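/- **Setting.** Let $r_0,H,\Omega,g,\theta_0>0$ and $R_0>1$ be constants. Put $\mathcal D=[0,\frac1{2r_0^2})\times[0,H]$ with points $p=(s,z)$, $\mathbb R^2_+=[0,\infty)^2$ with points $q=(\Upsilon,Z)$, $e(s)=r_0^4/(1-2sr_0^2)^2$. For $R>0$ let $\mathcal P_{[R]}$ be the set of Borel probability measures on $\mathbb R^2$ with support in $[0,R]^2$. Let $W_1$ be the 1-Wasserstein distance and $\Gamma(\mu,\nu)$ the set of couplings of $\mu,\nu$. Let $\mathcal H_0$ be the set of Borel functions $\rho:[0,H]\to[0,\frac1{2r_0^2})$ and $D_\rho=\{(s,z):0\le z\le H,\ 0\le s\le\rho(z)\}$. For $\sigma\in\mathcal P_{[R_0]}$ write $\Delta=\mathrm{spt}(\sigma)$. *The profile $\mathcal H(\sigma)$.* $\rho=\mathcal H(\sigma)$ is the nondecreasing function which, with some $\gamma$, minimizes $$I(\rho,\gamma)=\int_{D_\rho\times\Delta}\Big(-\langle p,q\rangle+\frac{\Upsilon}{2r_0^2}-\Omega\sqrt\Upsilon+\frac{r_0^2\Omega^2}{2(1-2r_0^2s)}\Big)\,\gamma(dp,dq)$$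 over all pairs with $\rho\in\mathcal H_0$, $\int_{D_\rho}e(s)\,ds\,dz=1$ and $\gamma\in\Gamma(e(s)\chi_{D_\rho}\mathcal L^2,\sigma)$. *The potentials $\bar{\mathcal H}(\sigma)$.* Let $\mathcal U$ be the set of pairs $(P,\Psi)\in C(\overline{\mathcal D})\times C(\mathbb R^2_+)$ with $P(p)+\Psi(q)\ge\langle p,q\rangle$ on $\mathcal D\times\mathbb R^2_+$, and $\mathcal U_0\subset\mathcal U$ the set of those pairs with $P(p)=\sup_{q\in\Delta}(\langle p,q\rangle-\Psi(q))$ for $p\in\mathcal D$ and $\Psi(q)=\sup_{p\in\mathcal D}(\langle p,q\rangle-P(p))$ for $q\in\mathbb R^2_+$. Then $(P,\Psi)=\bar{\mathcal H}(\sigma)$ is an element of $\mathcal U_0$ that maximizes over $\mathcal U$ $$J[\sigma](\Psi,P)=\int\Big(\frac{\Upsilon}{2r_0^2}-\Omega\sqrt\Upsilon-\Psi\Big)d\sigma+\inf_{\rho\in\mathcal H_0}\int_0^H\!\int_0^{\rho(z)}\Big(\frac{\Omega^2r_0^2}{2(1-2sr_0^2)}-P(s,z)\Big)e(s)\,ds\,dz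 .$$ *Forcing.* Let $F,S:[0,\infty)\times\mathbb R^2\to\mathbb R$ be continuous, bounded and nonnegative. Put $\mathbf d(s,z)=\big(\frac{r_0}{\sqrt{1-2r_0^2s}},z\big)$ and $\mathbb F_t=(F_t\circ\mathbf d,\frac g{\theta_0}S_t\circ\mathbf d)$, and let $C_0$ be a constant with $\sqrt{R_0}\,\|\mathbb F_t\|_\infty\le C_0$ for all $t\ge0$, where $\|\mathbb F_t\|_\infty=\sup_{\mathcal D}|\mathbb F_t|$. With $\mathcal A[G](\Upsilon,Z)=(\sqrt\Upsilon\,G_1,G_2)$, $\rho=\mathcal H(\sigma)$ and $(P,\Psi)=\bar{\mathcal H}(\sigma)$, set $$L_t[\sigma](G)=\int\langle\mathcal A[G]\circ\nabla P,\mathbb F_t\rangle\,e(s)\chi_{D_\rho}(s,z)\,ds\,dz .$$ **Theorem.** Let $0<L_0<R_0$, $\bar\sigma_0\in\mathcal P_{[L_0]}$ and $T>0$ with $L_0+C_0T<R_0$. Then there is a curve $t\in[0,T]\mapsto\sigma_t\in(\mathcal P(\mathbb R^2),W_1)$ which is $C_0$-Lipschitz, with $\mathrm{spt}(\sigma_t)\subset[0,R_0]^2$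 and $\sigma_0=\bar\sigma_0$, and which satisfies the evolution equation in the weak dual sense: $\sigma$ is an absolutely continuous path in $\mathcal P_{[R_0]}$, $\rho_t=\mathcal H(\sigma_t)$ and $(P_t,\Psi_t)=\bar{\mathcal H}(\sigma_t)$ exist for every $t\in(0,T)$, and, whichever representatives are taken, $$\int_0^T\!\!\int\frac{\partial\varphi}{\partial t}(t,\nabla P_t)\,e(s)\chi_{D_{\rho_t}}\,ds\,dz\,dt+\int_0^TL_t[\sigma_t](\nabla\varphi_t)\,dt=0\qquad\text{for all }\varphi\in C^1_c((0,T)\times\mathbb R^2).$$ Moreover, for every $t\in(0,T)$ there is a velocity $V_t[\sigma_t]\in L^\infty(\sigma_t;\mathbb R^2)$ with $|V_t[\sigma_t]|\le C_0$ $\sigma_t$-a.e. which represents $L_t[\sigma_t]$, that is, $L_t[\sigma_t](G)=\int\langle V_t[\sigma_t],G\rangle\,d\sigma_t$ for all $G\in L^1(\sigma_t;\mathbb R^2)$, and $\partial_t\sigma_t+\mathrm{div}(\sigma_tV_t[\sigma_t])=0$ holds in $(0,T)\times\mathbb R^2$ in the sense of distributions. -/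

import Mathlib

open Set MeasureTheory
open scoped ENNReal Gradient InnerProductSpace

noncomputable section

namespace AxisymmetricFlow

/-- The Euclidean plane. Physical points are `p = (s, z)`, dual points are `q = (Υ, Z)`. -/
abbrev Plane : Type := EuclideanSpace ℝ (Fin 2)

/-- The closed quadrant `ℝ²₊`. -/
def quadrant : Set Plane := {q | 0 ≤ q 0 ∧ 0 ≤ q 1}

/-- The square `[0, R]²`. -/
def box (R : ℝ) : Set Plane := {q | q 0 ∈ Icc 0 R ∧ q 1 ∈ Icc 0 R}

/-- The set `𝒫_[R]` of Borel probability measures on the plane with support in `[0, R]²`. -/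
def probBox (R : ℝ) : Set (Measure Plane) :=
  {σ | IsProbabilityMeasure σ ∧ σ.support ⊆ box R}

/-- Measures on `X × X` with marginals `μ` and `ν`. -/
def couplings (μ ν : Measure Plane) : Set (Measure (Plane × Plane)) :=
  {γ | γ.map Prod.fst = μ ∧ γ.map Prod.snd = ν}

/-- The 1-Wasserstein distance, for the Euclidean distance of the plane. -/
def W1 (μ ν : Measure Plane) : ℝ≥0∞ :=
  ⨅ γ ∈ couplings μ ν, ∫⁻ x, edist x.1 x.2 ∂γ

/-- A 1-absolutely continuous curve on the interval `(a, b)` for the distance `W1`. -/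
def AbsContCurve (a b : ℝ) (σ : ℝ → Measure Plane) : Prop :=
  ∃ m : ℝ → ℝ, IntegrableOn m (Ioo a b) ∧
    ∀ s ∈ Ioo a b, ∀ t ∈ Ioo a b, s ≤ t → W1 (σ s) (σ t) ≤ ENNReal.ofReal (∫ r in s..t, m r)

/-- The domain `𝒟 = [0, 1/(2 r₀²)) × [0, H]`. -/
def domD (r₀ H : ℝ) : Set Plane := {p | p 0 ∈ Ico 0 (1 / (2 * r₀ ^ 2)) ∧ p 1 ∈ Icc 0 H}

/-- The weight `e(s) = r₀⁴ / (1 - 2 s r₀²)²`. -/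
def weight (r₀ s : ℝ) : ℝ := r₀ ^ 4 / (1 - 2 * s * r₀ ^ 2) ^ 2

/-- The set `ℋ₀` of Borel functions `[0, H] → [0, 1/(2 r₀²))`; values outside `[0, H]` are
never used. -/
def profiles (r₀ H : ℝ) : Set (ℝ → ℝ) :=
  {ρ | Measurable ((Icc 0 H).domRestrict ρ) ∧ ∀ z ∈ Icc 0 H, ρ z ∈ Ico 0 (1 / (2 * r₀ ^ 2))}

/-- The set `D_ρ = {(s, z) : 0 ≤ s ≤ ρ(z), 0 ≤ z ≤ H}`. -/
def region (H : ℝ) (ρ : ℝ → ℝ) : Set Plane := {p | p 1 ∈ Icc 0 H ∧ p 0 ∈ Icc 0 (ρ (p 1))}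

/-- The measure `e(s) χ_{D_ρ}(s, z) ds dz`. -/
def regionMeasure (r₀ H : ℝ) (ρ : ℝ → ℝ) : Measure Plane :=
  (volume.restrict (region H ρ)).withDensity fun p => ENNReal.ofReal (weight r₀ (p 0))

/-- The integrand of the energy:
`-⟨p, q⟩ + Υ/(2 r₀²) - Ω √Υ + r₀² Ω² / (2 (1 - 2 r₀² s))`. -/
def cost (r₀ Ω : ℝ) (p q : Plane) : ℝ :=
  -⟪p, q⟫_ℝ + q 0 / (2 * r₀ ^ 2) - Ω * √(q 0)
    + r₀ ^ 2 * Ω ^ 2 / (2 * (1 - 2 * r₀ ^ 2 * p 0))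

/-- The energy `I(ρ, γ)`, the integral of the cost over `D_ρ × Δ` with `Δ = spt σ`. -/
def energy (r₀ H Ω : ℝ) (σ : Measure Plane) (ρ : ℝ → ℝ) (γ : Measure (Plane × Plane)) : ℝ :=
  ∫ x in region H ρ ×ˢ σ.support, cost r₀ Ω x.1 x.2 ∂γ

/-- The admissible pairs `(ρ, γ)` of finite energy: `ρ ∈ ℋ₀`, the measure `e χ_{D_ρ}` has mass
one, and `γ` couples it with `σ`. The cost is bounded below on `𝒟 × spt σ`, so that the
pairs excluded by the integrability condition are those of energy `+∞`. -/
def admissible (r₀ H Ω : ℝ) (σ : Measure Plane) : Set ((ℝ → ℝ) × Measure (Plane × Plane)) :=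
  {x | x.1 ∈ profiles r₀ H ∧ regionMeasure r₀ H x.1 univ = 1 ∧
    x.2 ∈ couplings (regionMeasure r₀ H x.1) σ ∧
    IntegrableOn (fun y : Plane × Plane => cost r₀ Ω y.1 y.2) (region H x.1 ×ˢ σ.support) x.2}

/-- `ρ = 𝓗(σ)`: the nondecreasing minimizer of the primal problem (it is unique up to null
sets). -/
def IsPrimalMinimizer (r₀ H Ω : ℝ) (σ : Measure Plane) (ρ : ℝ → ℝ) : Prop :=
  MonotoneOn ρ (Icc 0 H) ∧
  ∃ γ, (ρ, γ) ∈ admissible r₀ H Ω σ ∧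
    ∀ x ∈ admissible r₀ H Ω σ, energy r₀ H Ω σ ρ γ ≤ energy r₀ H Ω σ x.1 x.2

/-- `Π_P(ρ, z) = ∫₀^ρ (Ω² r₀² / (2 (1 - 2 s r₀²)) - P(s, z)) e(s) ds`. -/
def potentialPi (r₀ Ω : ℝ) (P : Plane → ℝ) (ρ z : ℝ) : ℝ :=
  ∫ s in (0 : ℝ)..ρ,
    (Ω ^ 2 * r₀ ^ 2 / (2 * (1 - 2 * s * r₀ ^ 2)) - P !₂[s, z]) * weight r₀ s

/-- `j(P)`, the infimum over `ρ ∈ ℋ₀` of `∫₀^H Π_P(ρ(z), z) dz`. For `P` continuous on the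
closure of `𝒟`, `Π_P` is bounded below, so that the profiles excluded by the integrability
condition are those of value `+∞`. -/
def jFun (r₀ H Ω : ℝ) (P : Plane → ℝ) : ℝ :=
  sInf {x | ∃ ρ ∈ profiles r₀ H,
    IntegrableOn (fun z => potentialPi r₀ Ω P (ρ z) z) (Icc 0 H) ∧
    x = ∫ z in Icc 0 H, potentialPi r₀ Ω P (ρ z) z}

/-- The dual functional `J[σ](Ψ, P)`. -/
def dualJ (r₀ H Ω : ℝ) (σ : Measure Plane) (P Ψ : Plane → ℝ) : ℝ :=
  (∫ q, (q 0 / (2 * r₀ ^ 2) - Ω * √(q 0) - Ψ q) ∂σ) + jFun r₀ H Ω P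

/-- The set `𝒰` of dual competitors. -/
def dualPairs (r₀ H : ℝ) : Set ((Plane → ℝ) × (Plane → ℝ)) :=
  {x | ContinuousOn x.1 (closure (domD r₀ H)) ∧ ContinuousOn x.2 quadrant ∧
    ∀ p ∈ domD r₀ H, ∀ q ∈ quadrant, ⟪p, q⟫_ℝ ≤ x.1 p + x.2 q}

/-- The subset `𝒰₀` of pairs of mutual Legendre transforms, with `Δ = spt σ`:
`P(p) = sup_{q ∈ Δ} (⟨p, q⟩ - Ψ(q))` on `𝒟` and `Ψ(q) = sup_{p ∈ 𝒟} (⟨p, q⟩ - P(p))` on the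
quadrant. -/
def legendrePairs (r₀ H : ℝ) (σ : Measure Plane) : Set ((Plane → ℝ) × (Plane → ℝ)) :=
  {x | x ∈ dualPairs r₀ H ∧
    (∀ p ∈ domD r₀ H, IsLUB ((fun q => ⟪p, q⟫_ℝ - x.2 q) '' σ.support) (x.1 p)) ∧
    (∀ q ∈ quadrant, IsLUB ((fun p => ⟪p, q⟫_ℝ - x.1 p) '' domD r₀ H) (x.2 q))}

/-- `(P, Ψ) = 𝓗̄(σ)`: the pair belongs to `𝒰₀` and maximizes `J[σ]` over `𝒰`. -/
def IsDualMaximizer (r₀ H Ω : ℝ) (σ : Measure Plane) (P Ψ : Plane → ℝ) : Prop :=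
  (P, Ψ) ∈ legendrePairs r₀ H σ ∧
    ∀ x ∈ dualPairs r₀ H, dualJ r₀ H Ω σ x.1 x.2 ≤ dualJ r₀ H Ω σ P Ψ

/-- The map `𝐝(s, z) = (r₀ / √(1 - 2 r₀² s), z)`. -/
def physCoord (r₀ : ℝ) (p : Plane) : Plane := !₂[r₀ / √(1 - 2 * r₀ ^ 2 * p 0), p 1]

/-- `𝔽_t = (F_t ∘ 𝐝, (g/θ₀) S_t ∘ 𝐝)`. -/
def forcing (r₀ g θ₀ : ℝ) (F S : ℝ → Plane → ℝ) (t : ℝ) (p : Plane) : Plane :=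
  !₂[F t (physCoord r₀ p), g / θ₀ * S t (physCoord r₀ p)]

/-- `𝒜[G](Υ, Z) = (√Υ G₁(Υ, Z), G₂(Υ, Z))`. -/
def opA (G : Plane → Plane) (q : Plane) : Plane := !₂[√(q 0) * G q 0, G q 1]

/-- The functional `G ↦ ∫ ⟨𝒜[G] ∘ ∇P, 𝔽⟩ e(s) χ_{D_ρ} ds dz`; it is `L_t[σ]` when
`ρ = 𝓗(σ)`, `(P, Ψ) = 𝓗̄(σ)` and `𝔽 = 𝔽_t`. -/
def functionalL (r₀ H : ℝ) (ρ : ℝ → ℝ) (P : Plane → ℝ) (𝔽 : Plane → Plane)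
    (G : Plane → Plane) : ℝ :=
  ∫ p, ⟪opA G (∇ P p), 𝔽 p⟫_ℝ ∂(regionMeasure r₀ H ρ)

/-- Compactly supported `C¹` functions on `(0, T) × ℝ²`. -/
def IsTestFunction (T : ℝ) (φ : ℝ → Plane → ℝ) : Prop :=
  ContDiff ℝ 1 (fun x : ℝ × Plane => φ x.1 x.2) ∧
  HasCompactSupport (fun x : ℝ × Plane => φ x.1 x.2) ∧
  tsupport (fun x : ℝ × Plane => φ x.1 x.2) ⊆ Ioo 0 T ×ˢ univ

/-- The evolution equation `σ̇_t = χ(σ_t)` on `(0, T)` in the weak dual sense: `σ` is an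
absolutely continuous path in `𝒫_[R₀]`, the profile `ρ_t = 𝓗(σ_t)` and the pair
`(P_t, Ψ_t) = 𝓗̄(σ_t)` exist, and, however their representatives are chosen,
`∫₀ᵀ ∫ ∂_tφ ∘ ∇P_t e χ_{D_{ρ_t}} ds dz dt + ∫₀ᵀ L_t[σ_t](∇φ_t) dt = 0`
for every test function, both time integrals being convergent. -/
def IsWeakDualSolution (r₀ H Ω g θ₀ R₀ T : ℝ) (F S : ℝ → Plane → ℝ)
    (σ : ℝ → Measure Plane) : Prop :=
  (∀ t ∈ Ioo 0 T, σ t ∈ probBox R₀) ∧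
  AbsContCurve 0 T σ ∧
  (∀ t ∈ Ioo 0 T, ∃ ρ, IsPrimalMinimizer r₀ H Ω (σ t) ρ) ∧
  (∀ t ∈ Ioo 0 T, ∃ P Ψ, IsDualMaximizer r₀ H Ω (σ t) P Ψ) ∧
  ∀ (ρ : ℝ → ℝ → ℝ) (P Ψ : ℝ → Plane → ℝ),
    (∀ t ∈ Ioo 0 T, IsPrimalMinimizer r₀ H Ω (σ t) (ρ t)) →
    (∀ t ∈ Ioo 0 T, IsDualMaximizer r₀ H Ω (σ t) (P t) (Ψ t)) →
    ∀ φ : ℝ → Plane → ℝ, IsTestFunction T φ →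
      IntervalIntegrable (fun t => ∫ p, deriv (fun τ => φ τ (∇ (P t) p)) t
        ∂(regionMeasure r₀ H (ρ t))) volume 0 T ∧
      IntervalIntegrable (fun t => functionalL r₀ H (ρ t) (P t) (forcing r₀ g θ₀ F S t)
        (∇ (φ t))) volume 0 T ∧
      (∫ t in (0 : ℝ)..T, ∫ p, deriv (fun τ => φ τ (∇ (P t) p)) t
          ∂(regionMeasure r₀ H (ρ t)))
        + (∫ t in (0 : ℝ)..T, functionalL r₀ H (ρ t) (P t) (forcing r₀ g θ₀ F S t)
            (∇ (φ t))) = 0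

/-- `V` is the velocity `V_t[σ] ∈ L^∞(σ; ℝ²)` with bound `C₀` that represents the functional
`L_t[σ]` on `L¹(σ; ℝ²)`. -/
def IsRieszVelocity (r₀ H Ω g θ₀ C₀ : ℝ) (F S : ℝ → Plane → ℝ) (t : ℝ)
    (σ : Measure Plane) (V : Plane → Plane) : Prop :=
  Measurable V ∧ (∀ᵐ q ∂σ, ‖V q‖ ≤ C₀) ∧
  ∀ (ρ : ℝ → ℝ) (P Ψ : Plane → ℝ),
    IsPrimalMinimizer r₀ H Ω σ ρ → IsDualMaximizer r₀ H Ω σ P Ψ →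
    ∀ G : Plane → Plane, Integrable G σ →
      functionalL r₀ H ρ P (forcing r₀ g θ₀ F S t) G = ∫ q, ⟪V q, G q⟫_ℝ ∂σ

/-- The continuity equation `∂_t σ + div(σ V_t) = 0` on `(0, T) × ℝ²`, in the sense of
distributions. -/
def SolvesContinuityEquation (T : ℝ) (σ : ℝ → Measure Plane) (V : ℝ → Plane → Plane) : Prop :=
  ∀ φ : ℝ → Plane → ℝ, IsTestFunction T φ →
    IntervalIntegrable
      (fun t => ∫ q, (deriv (fun τ => φ τ q) t + ⟪∇ (φ t) q, V t q⟫_ℝ) ∂(σ t)) volume 0 T ∧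
    ∫ t in (0 : ℝ)..T, ∫ q, (deriv (fun τ => φ τ q) t + ⟪∇ (φ t) q, V t q⟫_ℝ) ∂(σ t) = 0

end AxisymmetricFlow

end

/-!
The curve is a limit of explicit Euler schemes for the flow of the velocity field `V_t[σ]`. What
has to be shown is that the momentum `σ V_t[σ]`, that is, the functional `L_t[σ]`, depends
continuously on `(t, σ)`; this rests on the existence, uniqueness and compactness of the optimal
pairs `(ρ, P)`.

**Optimal triples.** Both variational problems are encoded in the notion `IsTriple` of a convex
potential `P` on the plane with subgradients in `[0, R]²` and a nondecreasing profile `ρ` such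
that `ρ z` minimizes `Π_P(·, z)` for almost every `z` and `∇P` pushes the measure of the region
`D_ρ` forward to `σ`. Such triples exist (`exists_isTriple`): for `σ` with second coordinates
bounded away from zero a maximizer of the dual energy is found by compactness, the profile is then
unique, and the first variation of the energy gives the push-forward; the general case follows by
a vertical shift. Limits of triples are triples (`exists_subseq_isTriple`), by compactness of
equi-Lipschitz potentials and of monotone profiles. By duality, triples consist of the minimizer
of `I` and, on `𝒟`, an optimal potential, and every primal minimizer forms a triple with every
dual maximizer (`IsTriple.isPrimalMinimizer`, `IsTriple.exists_isDualMaximizer`,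
`exists_isTriple_of_optimal`).

**Uniqueness.** The measure of the region and the map `∇P` on it are determined by `σ`
(`IsTriple.unique`). By duality two profiles `ρ₁`, `ρ₂` of the same `σ` are optimal for the same
potential (`IsTriple.cross`), and between them `∇P` is horizontal and depends on `s` only, since
the potential is nondecreasing in `z`. Let `Q(s)` be the difference of the masses of the two
regions to the right of `s`. Then `Q` vanishes at the end points of every interval of affinity of
`P(·, 0)`, and in between it can change its slope (in the variable `∫ e ds`) only at zeros `m` of
the density at which the cumulated density is nonnegative. If `Q` were nonzero somewhere, it would
be nonzero in a cell, an interval of affinity with slope `c` with one such `m` in it; the adjacent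
cell on the right exists, and the optimality of both profiles compares the two: `c Q(m)²` grows at
least by the factor three (`exists_next_cell`). Since this quantity is bounded, `Q = 0` and the
profiles agree.

**The evolution.** Averaging the forcing over the fibres of `∇P` gives the velocity
(`exists_isVelocity`), and compactness with uniqueness gives the continuity
(`tendsto_functionalL`). As the forcing and the components of `V` are nonnegative and bounded by
`C₀`, the Euler scheme stays in `[0, L₀ + C₀ t]²` and is nearly `C₀`-Lipschitz, through couplings
which move no mass farther than `C₀` times the elapsed time, up to the step size. A diagonal
argument yields a limit curve (`exists_subseq_curve`). For a test function, the increments of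
`∫ φ dσ` along the scheme telescope to zero, and a first-order expansion turns them into a Riemann sum
for the continuity equation, which passes to the limit by dominated convergence
(`IsContinuousVelocity.exists_curve`).
-/

noncomputable section

namespace AxisymmetricFlow

open Filter Topology

/-! ### Coordinates, the weight and iterated integrals -/

/-- The right end point `1 / (2 r₀²)` of the range of the variable `s`. -/
def sEnd (r₀ : ℝ) : ℝ := 1 / (2 * r₀ ^ 2)

lemma sEnd_pos {r₀ : ℝ} (hr₀ : 0 < r₀) : 0 < sEnd r₀ := by unfold sEnd; positivity

lemma one_sub_pos {r₀ s : ℝ} (hr₀ : 0 < r₀) (hs : s < sEnd r₀) : 0 < 1 - 2 * s * r₀ ^ 2 := by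
  unfold sEnd at hs
  rw [lt_div_iff₀ (by positivity)] at hs
  linarith

lemma weight_nonneg (r₀ s : ℝ) : 0 ≤ weight r₀ s := by unfold weight; positivity

lemma weight_pos {r₀ s : ℝ} (hr₀ : 0 < r₀) (hs : s < sEnd r₀) : 0 < weight r₀ s := by
  have := one_sub_pos hr₀ hs
  unfold weight; positivity

lemma measurable_weight (r₀ : ℝ) : Measurable (weight r₀) := by
  unfold weight; fun_prop

lemma continuousOn_weight {r₀ : ℝ} (hr₀ : 0 < r₀) : ContinuousOn (weight r₀) (Iio (sEnd r₀)) := by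
  unfold weight
  refine ContinuousOn.div (by fun_prop) (by fun_prop) fun s hs => ?_
  have := one_sub_pos hr₀ hs
  positivity

/-- The kinetic part `Ω² r₀² / (2 (1 - 2 s r₀²))` of the energy density. -/
def kin (r₀ Ω s : ℝ) : ℝ := Ω ^ 2 * r₀ ^ 2 / (2 * (1 - 2 * s * r₀ ^ 2))

lemma continuousOn_kin {r₀ : ℝ} (hr₀ : 0 < r₀) (Ω : ℝ) :
    ContinuousOn (kin r₀ Ω) (Iio (sEnd r₀)) := by
  unfold kin
  refine ContinuousOn.div (by fun_prop) (by fun_prop) fun s hs => ?_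
  have := one_sub_pos hr₀ hs
  positivity

lemma measurable_kin (r₀ Ω : ℝ) : Measurable (kin r₀ Ω) := by
  unfold kin; fun_prop

lemma kin_nonneg {r₀ s : ℝ} (hr₀ : 0 < r₀) (Ω : ℝ) (hs : s < sEnd r₀) : 0 ≤ kin r₀ Ω s := by
  have := one_sub_pos hr₀ hs
  unfold kin; positivity

lemma kin_le_kin {r₀ Ω s t : ℝ} (hr₀ : 0 < r₀) (ht : t < sEnd r₀) (hst : s ≤ t) :
    kin r₀ Ω s ≤ kin r₀ Ω t := by
  have h1 := one_sub_pos hr₀ ht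
  unfold kin
  gcongr

lemma kin_lt_kin {r₀ Ω s t : ℝ} (hr₀ : 0 < r₀) (hΩ : 0 < Ω) (ht : t < sEnd r₀) (hst : s < t) :
    kin r₀ Ω s < kin r₀ Ω t := by
  have h1 := one_sub_pos hr₀ ht
  unfold kin
  gcongr

/-- The primitive `∫₀ˢ e` of the weight. -/
def cumWeight (r₀ s : ℝ) : ℝ := r₀ ^ 2 / 2 * (1 / (1 - 2 * s * r₀ ^ 2) - 1)

lemma hasDerivAt_cumWeight {r₀ s : ℝ} (hr₀ : 0 < r₀) (hs : s < sEnd r₀) :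
    HasDerivAt (cumWeight r₀) (weight r₀ s) s := by
  have h := one_sub_pos hr₀ hs
  have h1 : HasDerivAt (fun s : ℝ => 1 - 2 * s * r₀ ^ 2) (-(2 * r₀ ^ 2)) s := by
    have := (((hasDerivAt_id s).const_mul 2).mul_const (r₀ ^ 2)).const_sub 1
    simpa using this
  have h2 := ((h1.inv h.ne').sub_const 1).const_mul (r₀ ^ 2 / 2)
  have h3 : cumWeight r₀ = fun s => r₀ ^ 2 / 2 * ((1 - 2 * s * r₀ ^ 2)⁻¹ - 1) := by
    funext s; simp [cumWeight]
  rw [h3]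
  refine h2.congr_deriv ?_
  unfold weight
  field_simp

lemma intervalIntegrable_weight {r₀ s t : ℝ} (hr₀ : 0 < r₀) (hs : s < sEnd r₀)
    (ht : t < sEnd r₀) : IntervalIntegrable (weight r₀) volume s t := by
  apply ((continuousOn_weight hr₀).mono _).intervalIntegrable
  intro x hx
  rcases le_total s t with h | h
  · rw [uIcc_of_le h] at hx; exact hx.2.trans_lt ht
  · rw [uIcc_of_ge h] at hx; exact hx.2.trans_lt hs

lemma integral_weight {r₀ s t : ℝ} (hr₀ : 0 < r₀) (hs : s < sEnd r₀) (ht : t < sEnd r₀) :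
    ∫ x in s..t, weight r₀ x = cumWeight r₀ t - cumWeight r₀ s := by
  refine intervalIntegral.integral_eq_sub_of_hasDerivAt (fun x hx => hasDerivAt_cumWeight hr₀ ?_)
    (intervalIntegrable_weight hr₀ hs ht)
  rcases le_total s t with h | h
  · rw [uIcc_of_le h] at hx; exact hx.2.trans_lt ht
  · rw [uIcc_of_ge h] at hx; exact hx.2.trans_lt hs

@[simp] lemma cumWeight_zero (r₀ : ℝ) : cumWeight r₀ 0 = 0 := by simp [cumWeight]

lemma cumWeight_lt_cumWeight {r₀ s t : ℝ} (hr₀ : 0 < r₀) (ht : t < sEnd r₀) (hst : s < t) :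
    cumWeight r₀ s < cumWeight r₀ t := by
  have h1 := one_sub_pos hr₀ ht
  unfold cumWeight
  gcongr

lemma cumWeight_le_cumWeight {r₀ s t : ℝ} (hr₀ : 0 < r₀) (ht : t < sEnd r₀) (hst : s ≤ t) :
    cumWeight r₀ s ≤ cumWeight r₀ t := by
  have h1 := one_sub_pos hr₀ ht
  unfold cumWeight
  gcongr

/-- A point of `[0, sEnd)` at which `1 / (1 - 2 s r₀²)` takes a prescribed value `1 + c`. -/
lemma exists_inv_eq {r₀ : ℝ} (hr₀ : 0 < r₀) {c : ℝ} (hc : 0 ≤ c) :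
    ∃ s ∈ Ico 0 (sEnd r₀), 1 / (1 - 2 * s * r₀ ^ 2) = 1 + c := by
  have hc1 : (1 + c) ≠ 0 := by positivity
  refine ⟨sEnd r₀ * (c / (1 + c)), ⟨by have := sEnd_pos hr₀; positivity, ?_⟩, ?_⟩
  · have := sEnd_pos hr₀
    have h : c / (1 + c) < 1 := by rw [div_lt_one (by positivity)]; linarith
    nlinarith
  · unfold sEnd
    field_simp
    ring

lemma exists_cumWeight_eq {r₀ : ℝ} (hr₀ : 0 < r₀) {c : ℝ} (hc : 0 ≤ c) :
    ∃ s ∈ Ico 0 (sEnd r₀), cumWeight r₀ s = c := by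
  obtain ⟨s, hs, h⟩ := exists_inv_eq hr₀ (c := 2 * c / r₀ ^ 2) (by positivity)
  refine ⟨s, hs, ?_⟩
  rw [cumWeight, h]; field_simp; ring

lemma exists_le_kin {r₀ Ω : ℝ} (hr₀ : 0 < r₀) (hΩ : 0 < Ω) (C : ℝ) :
    ∃ s ∈ Ico 0 (sEnd r₀), C ≤ kin r₀ Ω s := by
  obtain ⟨s, hs, h⟩ := exists_inv_eq hr₀ (c := 2 * |C| / (Ω ^ 2 * r₀ ^ 2)) (by positivity)
  refine ⟨s, hs, ?_⟩
  have : kin r₀ Ω s = Ω ^ 2 * r₀ ^ 2 / 2 * (1 / (1 - 2 * s * r₀ ^ 2)) := by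
    unfold kin; have := one_sub_pos hr₀ hs.2; field_simp
  rw [this, h]
  have h2 : Ω ^ 2 * r₀ ^ 2 / 2 * (1 + 2 * |C| / (Ω ^ 2 * r₀ ^ 2)) = Ω ^ 2 * r₀ ^ 2 / 2 + |C| := by
    field_simp
  rw [h2]
  have := le_abs_self C
  have : 0 < Ω ^ 2 * r₀ ^ 2 / 2 := by positivity
  linarith

lemma inner_plane (p q : Plane) : ⟪p, q⟫_ℝ = p 0 * q 0 + p 1 * q 1 := by
  simp [PiLp.inner_apply, Fin.sum_univ_two, mul_comm]

lemma continuous_coord (i : Fin 2) : Continuous fun p : Plane => p i := by fun_prop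

lemma measurable_coord (i : Fin 2) : Measurable fun p : Plane => p i :=
  (continuous_coord i).measurable

lemma continuous_mk₂ : Continuous fun x : ℝ × ℝ => (!₂[x.1, x.2] : Plane) := by
  refine (PiLp.continuous_toLp 2 _).comp ?_
  refine continuous_pi fun i => ?_
  fin_cases i
  · exact continuous_fst
  · exact continuous_snd

lemma mk₂_eta (p : Plane) : (!₂[p 0, p 1] : Plane) = p := by
  ext i; fin_cases i <;> rfl

/-- The plane as a product of two lines. -/
def planeEquiv : Plane ≃ᵐ ℝ × ℝ :=
  (MeasurableEquiv.toLp 2 (Fin 2 → ℝ)).symm.trans MeasurableEquiv.finTwoArrow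

@[simp] lemma planeEquiv_symm_apply (x : ℝ × ℝ) : planeEquiv.symm x = !₂[x.1, x.2] := by
  apply planeEquiv.injective
  rw [MeasurableEquiv.apply_symm_apply]
  rfl

lemma measurePreserving_planeEquiv : MeasurePreserving planeEquiv := by
  exact (EuclideanSpace.volume_preserving_symm_measurableEquiv_toLp (Fin 2)).trans
    (volume_preserving_finTwoArrow ℝ)

lemma measurePreserving_planeEquiv_symm : MeasurePreserving planeEquiv.symm :=
  measurePreserving_planeEquiv.symm

lemma lintegral_plane {f : Plane → ℝ≥0∞} (hf : Measurable f) :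
    ∫⁻ p, f p = ∫⁻ z : ℝ, ∫⁻ s : ℝ, f !₂[s, z] := by
  rw [← measurePreserving_planeEquiv_symm.lintegral_comp hf, Measure.volume_eq_prod,
    lintegral_prod_symm' (fun x => f (planeEquiv.symm x)) (hf.comp planeEquiv.symm.measurable)]
  simp

lemma integrable_plane_iff {f : Plane → ℝ} :
    Integrable f ↔ Integrable (fun x : ℝ × ℝ => f !₂[x.1, x.2]) (volume.prod volume) := by
  rw [← Measure.volume_eq_prod]
  have := measurePreserving_planeEquiv_symm.integrable_comp_emb planeEquiv.symm.measurableEmbedding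
    (g := f)
  rw [← this]
  simp [Function.comp_def]

lemma integral_plane {f : Plane → ℝ} (hf : Integrable f) :
    ∫ p, f p = ∫ z : ℝ, ∫ s : ℝ, f !₂[s, z] := by
  rw [← measurePreserving_planeEquiv_symm.integral_comp planeEquiv.symm.measurableEmbedding,
    Measure.volume_eq_prod, integral_prod_symm]
  · simp
  · simpa using integrable_plane_iff.1 hf

/-- To check a property of almost every point of the plane it suffices to check it on almost every
horizontal line. -/
lemma ae_plane_of_ae_ae {p : Plane → Prop} (hp : MeasurableSet {x | p x})
    (h : ∀ᵐ z : ℝ, ∀ᵐ s : ℝ, p !₂[s, z]) : ∀ᵐ x : Plane, p x := by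
  rw [ae_iff]
  have hm : MeasurableSet {x | ¬ p x} := hp.compl
  rw [← lintegral_indicator_one hm, lintegral_plane (measurable_one.indicator hm)]
  rw [lintegral_eq_zero_iff' ]
  · filter_upwards [h] with z hz
    rw [Pi.zero_apply, lintegral_eq_zero_iff']
    · filter_upwards [hz] with s hs
      simp [hs]
    · exact ((measurable_one.indicator hm).comp
        (continuous_mk₂.measurable.comp (measurable_id.prodMk measurable_const))).aemeasurable
  · refine (Measurable.lintegral_prod_left' (f := fun x : ℝ × ℝ =>
      ({x | ¬ p x}.indicator 1 !₂[x.1, x.2] : ℝ≥0∞)) ?_).aemeasurable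
    exact (measurable_one.indicator hm).comp continuous_mk₂.measurable

/-! ### The regions `D_ρ` -/

lemma measurable_indicator_profile {r₀ H : ℝ} {ρ : ℝ → ℝ} (hρ : ρ ∈ profiles r₀ H) :
    Measurable ((Icc (0 : ℝ) H).indicator ρ) := by
  classical
  have h := hρ.1
  have : (Icc (0 : ℝ) H).indicator ρ = fun z => if h : z ∈ Icc 0 H then
    (Icc 0 H).domRestrict ρ ⟨z, h⟩ else 0 := by
    funext z; by_cases hz : z ∈ Icc 0 H <;> simp [hz, indicator, domRestrict]
  rw [this]
  exact Measurable.dite h measurable_const measurableSet_Icc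

lemma measurableSet_region {r₀ H : ℝ} {ρ : ℝ → ℝ} (hρ : ρ ∈ profiles r₀ H) :
    MeasurableSet (region H ρ) := by
  have h1 := measurable_indicator_profile hρ
  have h2 : region H ρ = {p : Plane | p 1 ∈ Icc 0 H} ∩
      {p : Plane | 0 ≤ p 0 ∧ p 0 ≤ (Icc (0 : ℝ) H).indicator ρ (p 1)} := by
    ext p
    simp only [region, mem_ofPred_eq, mem_inter_iff]
    refine and_congr_right fun h => ?_
    rw [indicator_of_mem h]; rfl
  rw [h2]
  refine (measurable_coord 1 measurableSet_Icc).inter ?_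
  exact (measurableSet_le measurable_const (measurable_coord 0)).inter
    (measurableSet_le (measurable_coord 0) (h1.comp (measurable_coord 1)))

lemma measurable_ofReal_weight (r₀ : ℝ) :
    Measurable fun p : Plane => ENNReal.ofReal (weight r₀ (p 0)) :=
  ENNReal.measurable_ofReal.comp ((measurable_weight r₀).comp (measurable_coord 0))

lemma region_subset_domD {r₀ H : ℝ} {ρ : ℝ → ℝ} (hρ : ∀ z ∈ Icc 0 H, ρ z ∈ Ico 0 (sEnd r₀)) :
    region H ρ ⊆ domD r₀ H := by
  intro p hp
  exact ⟨⟨hp.2.1, hp.2.2.trans_lt (hρ _ hp.1).2⟩, hp.1⟩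

lemma regionMeasure_ae {r₀ H : ℝ} {ρ : ℝ → ℝ} (hρ : ρ ∈ profiles r₀ H) :
    ∀ᵐ p ∂(regionMeasure r₀ H ρ), p ∈ region H ρ := by
  unfold regionMeasure
  exact (withDensity_absolutelyContinuous _ _).ae_le
    (ae_restrict_mem (measurableSet_region hρ))

lemma regionMeasure_absolutelyContinuous (r₀ H : ℝ) (ρ : ℝ → ℝ) :
    regionMeasure r₀ H ρ ≪ volume :=
  (withDensity_absolutelyContinuous _ _).trans Measure.restrict_le_self.absolutelyContinuous

lemma regionMeasure_ae_iff {r₀ H : ℝ} {ρ : ℝ → ℝ} (hr₀ : 0 < r₀) (hρ : ρ ∈ profiles r₀ H)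
    {q : Plane → Prop} :
    (∀ᵐ p ∂(regionMeasure r₀ H ρ), q p) ↔ ∀ᵐ p, p ∈ region H ρ → q p := by
  rw [← ae_restrict_iff' (measurableSet_region hρ), regionMeasure,
    ae_withDensity_iff (measurable_ofReal_weight r₀)]
  have hm : ∀ᵐ p ∂(volume.restrict (region H ρ)), p ∈ region H ρ :=
    ae_restrict_mem (measurableSet_region hρ)
  constructor
  · intro h
    filter_upwards [h, hm] with p hp hm
    refine hp ?_
    have := weight_pos hr₀ (region_subset_domD hρ.2 hm).1.2
    simpa using this
  · intro h
    filter_upwards [h] with p hp _ using hp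

lemma lintegral_regionMeasure {r₀ H : ℝ} {ρ : ℝ → ℝ} (hρ : ρ ∈ profiles r₀ H)
    {f : Plane → ℝ≥0∞} (hf : Measurable f) :
    ∫⁻ p, f p ∂(regionMeasure r₀ H ρ) = ∫⁻ z in Icc 0 H, ∫⁻ s in Icc 0 (ρ z),
      ENNReal.ofReal (weight r₀ s) * f !₂[s, z] := by
  rw [regionMeasure, lintegral_withDensity_eq_lintegral_mul _ (measurable_ofReal_weight r₀) hf,
    ← lintegral_indicator (measurableSet_region hρ),
    lintegral_plane ((((measurable_ofReal_weight r₀).mul hf)).indicator (measurableSet_region hρ)),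
    ← lintegral_indicator measurableSet_Icc]
  congr 1
  ext z
  by_cases hz : z ∈ Icc 0 H
  · rw [indicator_of_mem hz, ← lintegral_indicator measurableSet_Icc]
    congr 1
    ext s
    by_cases hs : s ∈ Icc 0 (ρ z)
    · rw [indicator_of_mem hs, indicator_of_mem (show !₂[s, z] ∈ region H ρ from ⟨hz, hs⟩)]
      rfl
    · rw [indicator_of_notMem hs, indicator_of_notMem
        (show !₂[s, z] ∉ region H ρ from fun h => hs h.2)]
  · rw [indicator_of_notMem hz]
    have : ∀ s : ℝ, !₂[s, z] ∉ region H ρ := fun s h => hz h.1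
    simp [this]

lemma integrable_regionMeasure_iff {r₀ H : ℝ} {ρ : ℝ → ℝ} (hρ : ρ ∈ profiles r₀ H)
    {g : Plane → ℝ} :
    Integrable g (regionMeasure r₀ H ρ) ↔
      Integrable ((region H ρ).indicator fun p => weight r₀ (p 0) * g p) := by
  rw [regionMeasure, integrable_withDensity_iff_integrable_smul' (measurable_ofReal_weight r₀)
    (by simp), integrable_indicator_iff (measurableSet_region hρ), IntegrableOn]
  simp [ENNReal.toReal_ofReal (weight_nonneg _ _)]

lemma integral_regionMeasure_eq {r₀ H : ℝ} {ρ : ℝ → ℝ} (hρ : ρ ∈ profiles r₀ H) (g : Plane → ℝ) :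
    ∫ p, g p ∂(regionMeasure r₀ H ρ) =
      ∫ p, (region H ρ).indicator (fun p => weight r₀ (p 0) * g p) p := by
  rw [regionMeasure, integral_withDensity_eq_integral_toReal_smul (measurable_ofReal_weight r₀)
    (by simp), integral_indicator (measurableSet_region hρ)]
  simp [ENNReal.toReal_ofReal (weight_nonneg _ _)]

lemma integral_indicator_region {H z : ℝ} {ρ : ℝ → ℝ} (hz : z ∈ Icc 0 H) (h0 : 0 ≤ ρ z)
    (g : Plane → ℝ) :
    ∫ s, (region H ρ).indicator g !₂[s, z] = ∫ s in (0 : ℝ)..ρ z, g !₂[s, z] := by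
  rw [intervalIntegral.integral_of_le h0, ← integral_Icc_eq_integral_Ioc,
    ← integral_indicator measurableSet_Icc]
  congr 1
  ext s
  by_cases hs : s ∈ Icc 0 (ρ z)
  · rw [indicator_of_mem hs, indicator_of_mem (show !₂[s, z] ∈ region H ρ from ⟨hz, hs⟩)]
  · rw [indicator_of_notMem hs, indicator_of_notMem
      (show !₂[s, z] ∉ region H ρ from fun h => hs h.2)]

/-- Iterated integration over a region `D_ρ`. -/
lemma integral_regionMeasure {r₀ H : ℝ} {ρ : ℝ → ℝ} (hρ : ρ ∈ profiles r₀ H)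
    {g : Plane → ℝ} (hg : Integrable g (regionMeasure r₀ H ρ)) :
    IntegrableOn (fun z => ∫ s in (0 : ℝ)..ρ z, weight r₀ s * g !₂[s, z]) (Icc 0 H) ∧
    ∫ p, g p ∂(regionMeasure r₀ H ρ) =
      ∫ z in Icc 0 H, ∫ s in (0 : ℝ)..ρ z, weight r₀ s * g !₂[s, z] := by
  have hi := (integrable_regionMeasure_iff hρ).1 hg
  have key : (fun z => ∫ s, (region H ρ).indicator (fun p => weight r₀ (p 0) * g p) !₂[s, z]) =
      (Icc 0 H).indicator fun z => ∫ s in (0 : ℝ)..ρ z, weight r₀ s * g !₂[s, z] := by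
    funext z
    by_cases hz : z ∈ Icc 0 H
    · rw [indicator_of_mem hz, integral_indicator_region hz (hρ.2 z hz).1]
      rfl
    · rw [indicator_of_notMem hz]
      have : ∀ s : ℝ, !₂[s, z] ∉ region H ρ := fun s h => hz h.1
      simp [this]
  constructor
  · rw [← integrable_indicator_iff measurableSet_Icc, ← key]
    exact (integrable_plane_iff.1 hi).integral_prod_right
  · rw [integral_regionMeasure_eq hρ, integral_plane hi, key, integral_indicator measurableSet_Icc]

lemma regionMeasure_univ {r₀ H : ℝ} {ρ : ℝ → ℝ} (hr₀ : 0 < r₀) (hρ : ρ ∈ profiles r₀ H) :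
    regionMeasure r₀ H ρ univ = ∫⁻ z in Icc 0 H, ENNReal.ofReal (cumWeight r₀ (ρ z)) := by
  rw [← lintegral_one, lintegral_regionMeasure hρ measurable_const]
  refine setLIntegral_congr_fun measurableSet_Icc fun z hz => ?_
  have h := hρ.2 z hz
  have ha : (0:ℝ) < sEnd r₀ := sEnd_pos hr₀
  simp only [mul_one]
  rw [← ofReal_integral_eq_lintegral_ofReal]
  · rw [integral_Icc_eq_integral_Ioc, ← intervalIntegral.integral_of_le h.1,
      integral_weight hr₀ ha h.2, cumWeight_zero, sub_zero]
  · rw [← IntegrableOn, integrableOn_Icc_iff_integrableOn_Ioc,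
      ← intervalIntegrable_iff_integrableOn_Ioc_of_le h.1]
    exact intervalIntegrable_weight hr₀ ha h.2
  · exact Eventually.of_forall fun s => weight_nonneg _ _

/-! ### Convex potentials with subgradients in a compact set -/

/-- `P` is a finite convex function on the plane which has at every point a subgradient in `B`. -/
def IsPot (B : Set Plane) (P : Plane → ℝ) : Prop :=
  ∀ p, ∃ q ∈ B, ∀ p', P p + ⟪p' - p, q⟫_ℝ ≤ P p'

/-- The Legendre transform `p ↦ sup_{q ∈ A} (⟨p, q⟩ - g(q))`. -/
def leg (A : Set Plane) (g : Plane → ℝ) (p : Plane) : ℝ :=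
  sSup ((fun q => ⟪p, q⟫_ℝ - g q) '' A)

lemma exists_leg_eq {A : Set Plane} {g : Plane → ℝ} (hA : IsCompact A) (hne : A.Nonempty)
    (hg : ContinuousOn g A) (p : Plane) :
    ∃ q ∈ A, leg A g p = ⟪p, q⟫_ℝ - g q ∧ ∀ q' ∈ A, ⟪p, q'⟫_ℝ - g q' ≤ leg A g p := by
  have hc : ContinuousOn (fun q => ⟪p, q⟫_ℝ - g q) A := by fun_prop
  obtain ⟨q, hq, h1, h2⟩ := hA.exists_sSup_image_eq_and_ge hne hc
  exact ⟨q, hq, h1, fun q' hq' => by rw [leg, h1]; exact h2 q' hq'⟩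

lemma le_leg {A : Set Plane} {g : Plane → ℝ} (hA : IsCompact A)
    (hg : ContinuousOn g A) (p : Plane) {q : Plane} (hq : q ∈ A) :
    ⟪p, q⟫_ℝ - g q ≤ leg A g p := by
  obtain ⟨_, _, _, h⟩ := exists_leg_eq hA ⟨q, hq⟩ hg p
  exact h q hq

lemma leg_le {A : Set Plane} {g : Plane → ℝ} (hne : A.Nonempty) {p : Plane} {c : ℝ}
    (h : ∀ q ∈ A, ⟪p, q⟫_ℝ - g q ≤ c) : leg A g p ≤ c := by
  refine csSup_le (hne.image _) ?_
  rintro _ ⟨q, hq, rfl⟩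
  exact h q hq

lemma isLUB_leg {A : Set Plane} {g : Plane → ℝ} (hA : IsCompact A) (hne : A.Nonempty)
    (hg : ContinuousOn g A) (p : Plane) :
    IsLUB ((fun q => ⟪p, q⟫_ℝ - g q) '' A) (leg A g p) := by
  refine isLUB_csSup (hne.image _) ⟨leg A g p, ?_⟩
  rintro _ ⟨q, hq, rfl⟩
  exact le_leg hA hg p hq

lemma isPot_leg {A : Set Plane} {g : Plane → ℝ} (hA : IsCompact A) (hne : A.Nonempty)
    (hg : ContinuousOn g A) : IsPot A (leg A g) := by
  intro p
  obtain ⟨q, hq, h1, -⟩ := exists_leg_eq hA hne hg p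
  refine ⟨q, hq, fun p' => ?_⟩
  have := le_leg hA hg p' hq
  rw [h1, inner_sub_left]
  linarith

lemma IsPot.mono {A B : Set Plane} {P : Plane → ℝ} (h : IsPot A P) (hAB : A ⊆ B) : IsPot B P :=
  fun p => let ⟨q, hq, h'⟩ := h p; ⟨q, hAB hq, h'⟩

lemma IsPot.lipschitzWith {B : Set Plane} {P : Plane → ℝ} (h : IsPot B P) {K : NNReal}
    (hK : ∀ q ∈ B, ‖q‖ ≤ K) : LipschitzWith K P := by
  refine LipschitzWith.of_le_add_mul K fun x y => ?_
  obtain ⟨q, hq, h'⟩ := h x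
  have h1 := h' y
  have h2 : |⟪y - x, q⟫_ℝ| ≤ ‖y - x‖ * ‖q‖ := abs_real_inner_le_norm _ _
  have h3 : ‖y - x‖ * ‖q‖ ≤ K * dist x y := by
    rw [dist_comm, dist_eq_norm, mul_comm]
    exact mul_le_mul_of_nonneg_right (hK q hq) (norm_nonneg _)
  have := neg_abs_le ⟪y - x, q⟫_ℝ
  linarith

lemma exists_norm_bound {B : Set Plane} (hB : IsCompact B) : ∃ K : NNReal, ∀ q ∈ B, ‖q‖ ≤ K := by
  obtain ⟨C, hC⟩ := hB.isBounded.exists_norm_le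
  exact ⟨C.toNNReal, fun q hq => (hC q hq).trans (Real.le_coe_toNNReal C)⟩

lemma IsPot.continuous {B : Set Plane} {P : Plane → ℝ} (h : IsPot B P) (hB : IsCompact B) :
    Continuous P := by
  obtain ⟨K, hK⟩ := exists_norm_bound hB
  exact (h.lipschitzWith hK).continuous

lemma IsPot.ae_differentiableAt {B : Set Plane} {P : Plane → ℝ} (h : IsPot B P)
    (hB : IsCompact B) : ∀ᵐ p, DifferentiableAt ℝ P p := by
  obtain ⟨K, hK⟩ := exists_norm_bound hB
  exact (h.lipschitzWith hK).ae_differentiableAt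

/-- At a point of differentiability the only local subgradient is the gradient. -/
lemma eq_gradient_of_subgradient {f : Plane → ℝ} {p q : Plane} (hf : DifferentiableAt ℝ f p)
    (hq : ∀ᶠ p' in 𝓝 p, f p + ⟪p' - p, q⟫_ℝ ≤ f p') : q = ∇ f p := by
  have h1 : HasFDerivAt f (InnerProductSpace.toDual ℝ Plane (∇ f p)) p :=
    hf.hasGradientAt.hasFDerivAt
  have h2 : HasFDerivAt (fun p' : Plane => ⟪q, p'⟫_ℝ) (InnerProductSpace.toDual ℝ Plane q) p :=
    (InnerProductSpace.toDual ℝ Plane q).hasFDerivAt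
  have h3 : IsLocalMin (fun p' => f p' - ⟪q, p'⟫_ℝ) p := by
    filter_upwards [hq] with p' hp'
    rw [inner_sub_left, real_inner_comm, real_inner_comm q p] at hp'
    linarith
  have h4 := h3.hasFDerivAt_eq_zero (h1.sub h2)
  rw [← map_sub, LinearIsometryEquiv.map_eq_zero_iff, sub_eq_zero] at h4
  exact h4.symm

lemma IsPot.gradient_mem {B : Set Plane} {P : Plane → ℝ} (h : IsPot B P) {p : Plane}
    (hp : DifferentiableAt ℝ P p) :
    ∇ P p ∈ B ∧ ∀ p', P p + ⟪p' - p, ∇ P p⟫_ℝ ≤ P p' := by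
  obtain ⟨q, hq, h'⟩ := h p
  have := eq_gradient_of_subgradient hp (Eventually.of_forall h')
  rw [← this]
  exact ⟨hq, h'⟩

lemma measurable_gradient (P : Plane → ℝ) : Measurable (∇ P) := by
  unfold gradient
  exact (InnerProductSpace.toDual ℝ Plane).symm.continuous.measurable.comp (measurable_fderiv ℝ P)

lemma isPot_of_tendsto {B : Set Plane} (hB : IsCompact B) {P : ℕ → Plane → ℝ} {P' : Plane → ℝ}
    (hP : ∀ n, IsPot B (P n)) (hlim : ∀ p, Tendsto (fun n => P n p) atTop (𝓝 (P' p))) :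
    IsPot B P' := by
  intro p
  choose q hq h using fun n => hP n p
  obtain ⟨q', hq', φ, hφ, hlq⟩ := hB.tendsto_subseq hq
  refine ⟨q', hq', fun p' => ?_⟩
  have h1 : Tendsto (fun n => P (φ n) p + ⟪p' - p, q (φ n)⟫_ℝ) atTop
      (𝓝 (P' p + ⟪p' - p, q'⟫_ℝ)) :=
    ((hlim p).comp hφ.tendsto_atTop).add (tendsto_const_nhds.inner hlq)
  exact le_of_tendsto_of_tendsto' h1 ((hlim p').comp hφ.tendsto_atTop) fun n => h (φ n) p'

/-- Gradients of pointwise convergent potentials converge at the points of differentiability. -/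
lemma tendsto_gradient {B : Set Plane} (hB : IsCompact B) {P : ℕ → Plane → ℝ} {P' : Plane → ℝ}
    (hP : ∀ n, IsPot B (P n)) (hlim : ∀ p, Tendsto (fun n => P n p) atTop (𝓝 (P' p)))
    {p : Plane} (hp : ∀ n, DifferentiableAt ℝ (P n) p) (hp' : DifferentiableAt ℝ P' p) :
    Tendsto (fun n => ∇ (P n) p) atTop (𝓝 (∇ P' p)) := by
  refine tendsto_of_subseq_tendsto fun ns hns => ?_
  obtain ⟨q', -, φ, hφ, hlq⟩ := hB.tendsto_subseq fun n => ((hP (ns n)).gradient_mem (hp (ns n))).1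
  refine ⟨φ, ?_⟩
  have hns' := hns.comp hφ.tendsto_atTop
  have : q' = ∇ P' p := by
    refine eq_gradient_of_subgradient hp' (Eventually.of_forall fun p' => ?_)
    have h1 : Tendsto (fun n => P (ns (φ n)) p + ⟪p' - p, ∇ (P (ns (φ n))) p⟫_ℝ) atTop
        (𝓝 (P' p + ⟪p' - p, q'⟫_ℝ)) :=
      ((hlim p).comp hns').add (tendsto_const_nhds.inner hlq)
    exact le_of_tendsto_of_tendsto' h1 ((hlim p').comp hns')
      fun n => ((hP _).gradient_mem (hp _)).2 p'
  rw [← this]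
  exact hlq

lemma ae_tendsto_gradient {B : Set Plane} (hB : IsCompact B) {P : ℕ → Plane → ℝ} {P' : Plane → ℝ}
    (hP : ∀ n, IsPot B (P n)) (hP' : IsPot B P')
    (hlim : ∀ p, Tendsto (fun n => P n p) atTop (𝓝 (P' p))) :
    ∀ᵐ p, Tendsto (fun n => ∇ (P n) p) atTop (𝓝 (∇ P' p)) := by
  filter_upwards [ae_all_iff.2 fun n => (hP n).ae_differentiableAt hB,
    hP'.ae_differentiableAt hB] with p h1 h2
  exact tendsto_gradient hB hP hlim h1 h2

/-! ### Compactness of equi-Lipschitz and of monotone sequences -/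

/-- A bounded sequence of equi-Lipschitz functions has a pointwise convergent subsequence. -/
lemma exists_subseq_lipschitz {K : NNReal} {C : ℝ} {P : ℕ → Plane → ℝ}
    (hP : ∀ n, LipschitzWith K (P n)) (h0 : ∀ n, |P n 0| ≤ C) :
    ∃ (φ : ℕ → ℕ) (P' : Plane → ℝ), StrictMono φ ∧
      ∀ p, Tendsto (fun n => P (φ n) p) atTop (𝓝 (P' p)) := by
  let d := TopologicalSpace.denseSeq Plane
  have hd := TopologicalSpace.denseRange_denseSeq Plane
  have hcomp : IsCompact (Set.univ.pi fun i : ℕ => Icc (-(C + K * dist (d i) 0))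
      (C + K * dist (d i) 0)) := isCompact_univ_pi fun i => isCompact_Icc
  have hmem : ∀ n, (fun i => P n (d i)) ∈ (Set.univ.pi fun i : ℕ => Icc (-(C + K * dist (d i) 0))
      (C + K * dist (d i) 0)) := by
    intro n i _
    have h1 := (hP n).dist_le_mul (d i) 0
    rw [Real.dist_eq] at h1
    have h2 := h0 n
    have h3 := abs_sub_abs_le_abs_sub (P n (d i)) (P n 0)
    exact abs_le.1 (by linarith)
  obtain ⟨x, -, φ, hφ, hx⟩ := hcomp.tendsto_subseq hmem
  rw [tendsto_pi_nhds] at hx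
  have hC : ∀ p, CauchySeq fun n => P (φ n) p := by
    intro p
    rw [Metric.cauchySeq_iff']
    intro ε hε
    obtain ⟨i, hi⟩ : ∃ i, dist p (d i) < ε / (4 * (K + 1)) :=
      hd.exists_dist_lt p (by positivity)
    have hKi : K * dist p (d i) ≤ ε / 4 := by
      have h1 : (K : ℝ) * dist p (d i) ≤ (K + 1) * (ε / (4 * (K + 1))) := by
        gcongr
        linarith
      have h2 : ((K : ℝ) + 1) * (ε / (4 * (K + 1))) = ε / 4 := by field_simp
      linarith
    obtain ⟨N, hN⟩ := Metric.cauchySeq_iff'.1 (hx i).cauchySeq (ε / 4) (by positivity)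
    refine ⟨N, fun n hn => ?_⟩
    have h1 := (hP (φ n)).dist_le_mul p (d i)
    have h2 := (hP (φ N)).dist_le_mul p (d i)
    have h3 := hN n hn
    have h4 := dist_triangle4 (P (φ n) p) (P (φ n) (d i)) (P (φ N) (d i)) (P (φ N) p)
    rw [dist_comm (P (φ N) (d i))] at h4
    simp only [Function.comp_def] at h3
    linarith
  choose P' hP' using fun p => cauchySeq_tendsto_of_complete (hC p)
  exact ⟨φ, P', hφ, hP'⟩

/-- **Helly's selection theorem**: a bounded sequence of monotone functions has a subsequence that
converges off a countable set. -/
lemma exists_subseq_monotone {C : ℝ} {f : ℕ → ℝ → ℝ} (hf : ∀ n, Monotone (f n))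
    (hC : ∀ n x, f n x ∈ Icc 0 C) :
    ∃ (φ : ℕ → ℕ) (g : ℝ → ℝ), StrictMono φ ∧ Monotone g ∧ (∀ x, g x ∈ Icc 0 C) ∧
      {x | ¬ Tendsto (fun n => f (φ n) x) atTop (𝓝 (g x))}.Countable := by
  have hcomp : IsCompact (Set.univ.pi fun _ : ℚ => Icc 0 C) :=
    isCompact_univ_pi fun i => isCompact_Icc
  obtain ⟨x, hxm, φ, hφ, hx⟩ := hcomp.tendsto_subseq (x := fun n (i : ℚ) => f n i)
    fun n i _ => hC n i
  rw [tendsto_pi_nhds] at hx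
  have hxm' : ∀ i, x i ∈ Icc 0 C := fun i => hxm i trivial
  let g : ℝ → ℝ := fun t => sSup (x '' {q : ℚ | (q : ℝ) < t})
  have hne : ∀ t : ℝ, (x '' {q : ℚ | (q : ℝ) < t}).Nonempty := fun t =>
    let ⟨q, hq⟩ := exists_rat_lt t; ⟨x q, q, hq, rfl⟩
  have hbdd : ∀ t : ℝ, BddAbove (x '' {q : ℚ | (q : ℝ) < t}) := by
    refine fun t => ⟨C, ?_⟩
    rintro _ ⟨q, -, rfl⟩
    exact (hxm' q).2
  have hxmono : Monotone x := fun i j hij =>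
    le_of_tendsto_of_tendsto' (hx i) (hx j) fun n => hf _ (by exact_mod_cast hij)
  have hg : Monotone g := fun s t hst =>
    csSup_le_csSup (hbdd t) (hne s) (image_mono fun q hq => lt_of_lt_of_le hq hst)
  have hle : ∀ {q : ℚ} {t : ℝ}, (q : ℝ) < t → x q ≤ g t := fun {q t} h =>
    le_csSup (hbdd t) ⟨q, h, rfl⟩
  refine ⟨φ, g, hφ, hg, fun t => ?_, ?_⟩
  · constructor
    · obtain ⟨q, hq⟩ := exists_rat_lt t
      exact (hxm' q).1.trans (hle hq)
    · refine csSup_le (hne t) ?_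
      rintro _ ⟨q, -, rfl⟩
      exact (hxm' q).2
  · refine hg.countable_not_continuousAt.mono fun t ht => ?_
    rw [mem_ofPred_eq] at ht ⊢
    refine fun hct => ht ?_
    rw [tendsto_order]
    constructor
    · intro b hb
      obtain ⟨_, ⟨q, hq, rfl⟩, hbq⟩ := exists_lt_of_lt_csSup (hne t) hb
      filter_upwards [(tendsto_order.1 (hx q)).1 b hbq] with n hn
      exact hn.trans_le (hf _ (le_of_lt hq))
    · intro b hb
      have h1 : ∀ᶠ t' in 𝓝 t, g t' < b := (tendsto_order.1 hct).2 b hb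
      have h2 : ∀ᶠ t' in 𝓝[>] t, g t' < b := h1.filter_mono nhdsWithin_le_nhds
      obtain ⟨t', ht', hlt⟩ := (h2.and self_mem_nhdsWithin).exists
      obtain ⟨q, hq1, hq2⟩ := exists_rat_btwn (show t < t' from hlt)
      filter_upwards [(tendsto_order.1 (hx q)).2 b ((hle hq2).trans_lt ht')] with n hn
      exact (hf _ hq1.le).trans_lt hn

/-! ### Potentials with nonnegative slopes on the physical domain -/

/-- The closure `[0, 1/(2 r₀²)] × [0, H]` of the domain `𝒟`. -/
def domC (r₀ H : ℝ) : Set Plane := {p | p 0 ∈ Icc 0 (sEnd r₀) ∧ p 1 ∈ Icc 0 H}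

lemma isCompact_rect (a b c d : ℝ) : IsCompact {p : Plane | p 0 ∈ Icc a b ∧ p 1 ∈ Icc c d} := by
  have : {p : Plane | p 0 ∈ Icc a b ∧ p 1 ∈ Icc c d} =
      (fun x : ℝ × ℝ => (!₂[x.1, x.2] : Plane)) '' (Icc a b ×ˢ Icc c d) := by
    ext p
    constructor
    · intro hp
      exact ⟨(p 0, p 1), ⟨hp.1, hp.2⟩, mk₂_eta p⟩
    · rintro ⟨x, hx, rfl⟩
      exact ⟨hx.1, hx.2⟩
  rw [this]
  exact (isCompact_Icc.prod isCompact_Icc).image continuous_mk₂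

lemma isCompact_domC (r₀ H : ℝ) : IsCompact (domC r₀ H) := isCompact_rect _ _ _ _

lemma isCompact_box (R : ℝ) : IsCompact (box R) := isCompact_rect _ _ _ _

lemma domD_subset_domC (r₀ H : ℝ) : domD r₀ H ⊆ domC r₀ H :=
  fun _ hp => ⟨Ico_subset_Icc_self hp.1, hp.2⟩

lemma closure_domD {r₀ : ℝ} (hr₀ : 0 < r₀) (H : ℝ) : closure (domD r₀ H) = domC r₀ H := by
  apply Subset.antisymm
  · exact closure_minimal (domD_subset_domC r₀ H) (isCompact_domC r₀ H).isClosed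
  · intro p hp
    have h0 : p 0 ∈ closure (Ico 0 (1 / (2 * r₀ ^ 2))) := by
      rw [closure_Ico (by have := sEnd_pos hr₀; exact this.ne)]; exact hp.1
    obtain ⟨x, hx, hlim⟩ := mem_closure_iff_seq_limit.1 h0
    refine mem_closure_iff_seq_limit.2 ⟨fun n => !₂[x n, p 1], fun n => ⟨hx n, hp.2⟩, ?_⟩
    have := (continuous_mk₂.tendsto (p 0, p 1)).comp (hlim.prodMk_nhds tendsto_const_nhds)
    rw [mk₂_eta] at this
    exact this

lemma IsPot.le_of_le {R : ℝ} {P : Plane → ℝ} (h : IsPot (box R) P) {s z s' z' : ℝ}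
    (hs : s ≤ s') (hz : z ≤ z') : P !₂[s, z] ≤ P !₂[s', z'] := by
  obtain ⟨q, hq, h'⟩ := h !₂[s, z]
  have h1 := h' !₂[s', z']
  rw [inner_plane] at h1
  simp only [PiLp.sub_apply, Matrix.cons_val_zero, Matrix.cons_val_one] at h1
  nlinarith [hq.1.1, hq.2.1]

lemma IsPot.le_add {R : ℝ} {P : Plane → ℝ} (h : IsPot (box R) P) {s z s' z' : ℝ}
    (hs : s ≤ s') (hz : z ≤ z') : P !₂[s', z'] ≤ P !₂[s, z] + R * ((s' - s) + (z' - z)) := by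
  obtain ⟨q, hq, h'⟩ := h !₂[s', z']
  have h1 := h' !₂[s, z]
  rw [inner_plane] at h1
  simp only [PiLp.sub_apply, Matrix.cons_val_zero, Matrix.cons_val_one] at h1
  nlinarith [hq.1.2, hq.2.2]

lemma IsPot.continuous_section {B : Set Plane} (hB : IsCompact B) {P : Plane → ℝ} (h : IsPot B P)
    (z : ℝ) : Continuous fun s : ℝ => P !₂[s, z] :=
  (h.continuous hB).comp (continuous_mk₂.comp (continuous_id.prodMk continuous_const))

/-- The bounds of a potential on the physical domain in terms of its value at the origin. -/
lemma IsPot.bounds {r₀ H R : ℝ} {P : Plane → ℝ} (h : IsPot (box R) P) {p : Plane}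
    (hR : 0 ≤ R) (hp : p ∈ domC r₀ H) :
    P 0 ≤ P p ∧ P p ≤ P 0 + R * (sEnd r₀ + H) := by
  have h0 : (!₂[(0:ℝ), 0] : Plane) = 0 := by ext i; fin_cases i <;> rfl
  have h1 := h.le_of_le hp.1.1 hp.2.1
  have h2 := h.le_add hp.1.1 hp.2.1
  rw [mk₂_eta, h0] at h1 h2
  refine ⟨h1, h2.trans ?_⟩
  have := hp.1.2
  have := hp.2.2
  gcongr <;> linarith

/-! ### Minimizers of the profile energy on vertical sections -/

/-- The integrand of `potentialPi`. -/
def dens (r₀ Ω : ℝ) (P : Plane → ℝ) (z s : ℝ) : ℝ := (kin r₀ Ω s - P !₂[s, z]) * weight r₀ s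

lemma potentialPi_eq (r₀ Ω : ℝ) (P : Plane → ℝ) (r z : ℝ) :
    potentialPi r₀ Ω P r z = ∫ s in (0 : ℝ)..r, dens r₀ Ω P z s := rfl

@[simp] lemma potentialPi_zero (r₀ Ω : ℝ) (P : Plane → ℝ) (z : ℝ) :
    potentialPi r₀ Ω P 0 z = 0 := by simp [potentialPi_eq]

lemma continuousOn_dens {r₀ : ℝ} (hr₀ : 0 < r₀) (Ω : ℝ) {P : Plane → ℝ} {z : ℝ}
    (hP : ContinuousOn (fun s : ℝ => P !₂[s, z]) (Icc 0 (sEnd r₀))) :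
    ContinuousOn (dens r₀ Ω P z) (Ico 0 (sEnd r₀)) := by
  have hsub : Ico 0 (sEnd r₀) ⊆ Iio (sEnd r₀) := fun s hs => hs.2
  exact (((continuousOn_kin hr₀ Ω).mono hsub).sub (hP.mono Ico_subset_Icc_self)).mul
    ((continuousOn_weight hr₀).mono hsub)

lemma uIcc_subset_Ico {a b c : ℝ} (hb : b ∈ Ico 0 a) (hc : c ∈ Ico 0 a) : uIcc b c ⊆ Ico 0 a :=
  fun _ hx => ⟨(le_inf hb.1 hc.1).trans hx.1, hx.2.trans_lt (sup_lt_iff.2 ⟨hb.2, hc.2⟩)⟩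

lemma intervalIntegrable_dens {r₀ : ℝ} (hr₀ : 0 < r₀) (Ω : ℝ) {P : Plane → ℝ} {z r r' : ℝ}
    (hP : ContinuousOn (fun s : ℝ => P !₂[s, z]) (Icc 0 (sEnd r₀))) (hr : r ∈ Ico 0 (sEnd r₀))
    (hr' : r' ∈ Ico 0 (sEnd r₀)) : IntervalIntegrable (dens r₀ Ω P z) volume r r' :=
  ((continuousOn_dens hr₀ Ω hP).mono (uIcc_subset_Ico hr hr')).intervalIntegrable

lemma potentialPi_sub {r₀ : ℝ} (hr₀ : 0 < r₀) (Ω : ℝ) {P : Plane → ℝ} {z r r' : ℝ}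
    (hP : ContinuousOn (fun s : ℝ => P !₂[s, z]) (Icc 0 (sEnd r₀))) (hr : r ∈ Ico 0 (sEnd r₀))
    (hr' : r' ∈ Ico 0 (sEnd r₀)) :
    potentialPi r₀ Ω P r' z - potentialPi r₀ Ω P r z = ∫ s in r..r', dens r₀ Ω P z s := by
  have h0 : (0 : ℝ) ∈ Ico 0 (sEnd r₀) := ⟨le_rfl, sEnd_pos hr₀⟩
  rw [potentialPi_eq, potentialPi_eq]
  exact intervalIntegral.integral_interval_sub_left (intervalIntegrable_dens hr₀ Ω hP h0 hr')
    (intervalIntegrable_dens hr₀ Ω hP h0 hr)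

lemma continuousOn_potentialPi {r₀ : ℝ} (hr₀ : 0 < r₀) (Ω : ℝ) {P : Plane → ℝ} {z r : ℝ}
    (hP : ContinuousOn (fun s : ℝ => P !₂[s, z]) (Icc 0 (sEnd r₀))) (hr : r ∈ Ico 0 (sEnd r₀)) :
    ContinuousOn (fun r => potentialPi r₀ Ω P r z) (Icc 0 r) := by
  have h0 : (0 : ℝ) ∈ Ico 0 (sEnd r₀) := ⟨le_rfl, sEnd_pos hr₀⟩
  have := intervalIntegral.continuousOn_primitive_interval'
    (intervalIntegrable_dens hr₀ Ω hP h0 hr) (left_mem_uIcc)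
  rw [uIcc_of_le hr.1] at this
  exact this

/-- `r` minimizes `Π_P(·, z)` over `[0, 1/(2 r₀²))`. -/
def IsArgmin (r₀ Ω : ℝ) (P : Plane → ℝ) (z r : ℝ) : Prop :=
  r ∈ Ico 0 (sEnd r₀) ∧ ∀ r' ∈ Ico 0 (sEnd r₀), potentialPi r₀ Ω P r z ≤ potentialPi r₀ Ω P r' z

lemma IsArgmin.integral_nonneg {r₀ Ω : ℝ} (hr₀ : 0 < r₀) {P : Plane → ℝ} {z r r' : ℝ}
    (hP : ContinuousOn (fun s : ℝ => P !₂[s, z]) (Icc 0 (sEnd r₀))) (h : IsArgmin r₀ Ω P z r)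
    (hr' : r' ∈ Ico 0 (sEnd r₀)) : 0 ≤ ∫ s in r..r', dens r₀ Ω P z s := by
  rw [← potentialPi_sub hr₀ Ω hP h.1 hr']
  linarith [h.2 r' hr']

/-- The density is positive where the kinetic term exceeds the potential, hence minimizers lie to
the left of such points. -/
lemma IsArgmin.le_of_bound {r₀ Ω C S : ℝ} (hr₀ : 0 < r₀) (hΩ : 0 < Ω) {P : Plane → ℝ} {z r : ℝ}
    (hP : ContinuousOn (fun s : ℝ => P !₂[s, z]) (Icc 0 (sEnd r₀)))
    (hC : ∀ s ∈ Icc 0 (sEnd r₀), P !₂[s, z] ≤ C) (hS : S ∈ Ico 0 (sEnd r₀))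
    (hCS : C ≤ kin r₀ Ω S) (h : IsArgmin r₀ Ω P z r) : r ≤ S := by
  by_contra! hlt
  have h1 := h.integral_nonneg hr₀ hP hS
  rw [intervalIntegral.integral_symm] at h1
  have h2 : 0 < ∫ s in S..r, dens r₀ Ω P z s := by
    refine intervalIntegral.intervalIntegral_pos_of_pos_on
      (intervalIntegrable_dens hr₀ Ω hP hS h.1) (fun s hs => ?_) hlt
    have hs' : s < sEnd r₀ := hs.2.trans h.1.2
    have h3 := kin_lt_kin hr₀ hΩ hs' hs.1
    have h4 := hC s ⟨hS.1.trans hs.1.le, hs'.le⟩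
    exact mul_pos (by linarith) (weight_pos hr₀ hs')
  linarith

/-- The argmin set is nonempty and has a largest element. -/
lemma exists_largest_argmin {r₀ Ω C : ℝ} (hr₀ : 0 < r₀) (hΩ : 0 < Ω) {P : Plane → ℝ} {z : ℝ}
    (hP : ContinuousOn (fun s : ℝ => P !₂[s, z]) (Icc 0 (sEnd r₀)))
    (hC : ∀ s ∈ Icc 0 (sEnd r₀), P !₂[s, z] ≤ C) :
    ∃ r, IsArgmin r₀ Ω P z r ∧ ∀ r', IsArgmin r₀ Ω P z r' → r' ≤ r := by
  obtain ⟨S, hS, hCS⟩ := exists_le_kin hr₀ hΩ C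
  have hcont := continuousOn_potentialPi hr₀ Ω hP hS
  obtain ⟨r, hr, hmin⟩ := isCompact_Icc.exists_isMinOn ⟨0, left_mem_Icc.2 hS.1⟩ hcont
  have hsub : ∀ {x}, x ∈ Icc 0 S → x ∈ Ico 0 (sEnd r₀) := fun hx => ⟨hx.1, hx.2.trans_lt hS.2⟩
  have hmin' : ∀ r' ∈ Ico 0 (sEnd r₀), potentialPi r₀ Ω P r z ≤ potentialPi r₀ Ω P r' z := by
    intro r' hr'
    rcases le_total r' S with h | h
    · exact hmin ⟨hr'.1, h⟩
    · refine (hmin (right_mem_Icc.2 hS.1)).trans ?_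
      rw [← sub_nonneg, potentialPi_sub hr₀ Ω hP hS hr']
      refine intervalIntegral.integral_nonneg h fun s hs => ?_
      have hs' : s < sEnd r₀ := hs.2.trans_lt hr'.2
      have h3 := kin_le_kin (Ω := Ω) hr₀ hs' hs.1
      have h4 := hC s ⟨hS.1.trans hs.1, hs'.le⟩
      exact mul_nonneg (by linarith) (weight_nonneg _ _)
  let A := Icc 0 S ∩ {x | potentialPi r₀ Ω P x z = potentialPi r₀ Ω P r z}
  have hA : IsCompact A := by
    have h1 : IsClosed A := hcont.preimage_isClosed_of_isClosed isClosed_Icc isClosed_singleton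
    exact isCompact_Icc.of_isClosed_subset h1 inter_subset_left
  obtain ⟨r1, hr1, hr1'⟩ := hA.exists_isGreatest ⟨r, hr, rfl⟩
  refine ⟨r1, ⟨hsub hr1.1, fun r' hr' => by rw [hr1.2]; exact hmin' r' hr'⟩, fun r' h' => ?_⟩
  refine hr1' ⟨⟨h'.1.1, h'.le_of_bound hr₀ hΩ hP hC hS hCS⟩, ?_⟩
  exact le_antisymm (h'.2 r (hsub hr)) (hmin' r' h'.1)

/-- Minimizers at a higher level that lie strictly below a minimizer at a lower level are possible
only if the potential does not depend on the level in between. -/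
lemma IsArgmin.eq_of_crossing {r₀ Ω R : ℝ} (hr₀ : 0 < r₀) {P : Plane → ℝ}
    (hP : IsPot (box R) P) {z z' r r' : ℝ} (hz : z ≤ z') (h : IsArgmin r₀ Ω P z r)
    (h' : IsArgmin r₀ Ω P z' r') (hr : r' < r) :
    (∀ s ∈ Icc r' r, P !₂[s, z] = P !₂[s, z']) ∧ IsArgmin r₀ Ω P z' r ∧
      IsArgmin r₀ Ω P z r' := by
  have hc := fun z => (hP.continuous_section (isCompact_box R) z).continuousOn
    (s := Icc 0 (sEnd r₀))
  have h1 := h.integral_nonneg hr₀ (hc z) h'.1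
  rw [intervalIntegral.integral_symm] at h1
  have h2 := h'.integral_nonneg hr₀ (hc z') h.1
  have hi := intervalIntegrable_dens hr₀ Ω (hc z) h'.1 h.1
  have hi' := intervalIntegrable_dens hr₀ Ω (hc z') h'.1 h.1
  have hle : ∀ s ∈ Icc r' r, dens r₀ Ω P z' s ≤ dens r₀ Ω P z s := fun s hs =>
    mul_le_mul_of_nonneg_right (by linarith [hP.le_of_le (le_refl s) hz]) (weight_nonneg _ _)
  have h3 := intervalIntegral.integral_mono_on hr.le hi' hi hle
  -- the density decreases with the level, so that both minimality inequalities are equalities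
  have e1 : ∫ s in r'..r, dens r₀ Ω P z s = 0 := by linarith
  have e2 : ∫ s in r'..r, dens r₀ Ω P z' s = 0 := by linarith
  have hsub : Icc r' r ⊆ Ico 0 (sEnd r₀) := by
    have := uIcc_subset_Ico h'.1 h.1
    rwa [uIcc_of_le hr.le] at this
  refine ⟨?_, ⟨h.1, fun x hx => ?_⟩, ⟨h'.1, fun x hx => ?_⟩⟩
  · by_contra! hcon
    obtain ⟨s, hs, hne⟩ := hcon
    have hlt : dens r₀ Ω P z' s < dens r₀ Ω P z s := by
      refine mul_lt_mul_of_pos_right ?_ (weight_pos hr₀ (hsub hs).2)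
      have := lt_of_le_of_ne (hP.le_of_le (le_refl s) hz) hne
      linarith
    have := intervalIntegral.integral_lt_integral_of_continuousOn_of_le_of_exists_lt hr
      ((continuousOn_dens hr₀ Ω (hc z')).mono hsub) ((continuousOn_dens hr₀ Ω (hc z)).mono hsub)
      (fun s hs => hle s (Ioc_subset_Icc_self hs)) ⟨s, hs, hlt⟩
    linarith
  · have := potentialPi_sub hr₀ Ω (hc z') h'.1 h.1
    linarith [h'.2 x hx]
  · have := potentialPi_sub hr₀ Ω (hc z) h'.1 h.1
    linarith [h.2 x hx]

/-- An interior minimizer is a zero of the density. -/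
lemma IsArgmin.kin_eq {r₀ Ω R : ℝ} (hr₀ : 0 < r₀) {P : Plane → ℝ}
    (hP : IsPot (box R) P) {z r : ℝ} (h : IsArgmin r₀ Ω P z r) (hr : 0 < r) :
    kin r₀ Ω r = P !₂[r, z] := by
  have hs := hP.continuous_section (isCompact_box R) z
  have hc := hs.continuousOn (s := Icc 0 (sEnd r₀))
  have h0 : (0 : ℝ) ∈ Ico 0 (sEnd r₀) := ⟨le_rfl, sEnd_pos hr₀⟩
  have hcont : ContinuousOn (dens r₀ Ω P z) (Iio (sEnd r₀)) :=
    ((continuousOn_kin hr₀ Ω).sub hs.continuousOn).mul (continuousOn_weight hr₀)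
  have hd : HasDerivAt (fun r => potentialPi r₀ Ω P r z) (dens r₀ Ω P z r) r :=
    intervalIntegral.integral_hasDerivAt_right (intervalIntegrable_dens hr₀ Ω hc h0 h.1)
      (hcont.stronglyMeasurableAtFilter isOpen_Iio r h.1.2)
      (hcont.continuousAt (isOpen_Iio.mem_nhds h.1.2))
  have hmin : IsLocalMin (fun r => potentialPi r₀ Ω P r z) r := by
    filter_upwards [Ioo_mem_nhds hr h.1.2] with x hx
    exact h.2 x ⟨hx.1.le, hx.2⟩
  have := hmin.hasDerivAt_eq_zero hd
  rcases mul_eq_zero.1 this with h1 | h1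
  · linarith
  · exact absurd h1 (weight_pos hr₀ h.1.2).ne'

/-- A nondecreasing profile that minimizes `Π_P(·, z)` for almost every `z`. -/
structure IsPair (r₀ H Ω : ℝ) (ρ : ℝ → ℝ) (P : Plane → ℝ) : Prop where
  mono : MonotoneOn ρ (Icc 0 H)
  range : ∀ z ∈ Icc 0 H, ρ z ∈ Ico 0 (sEnd r₀)
  argmin : ∀ᵐ z : ℝ, z ∈ Icc 0 H → IsArgmin r₀ Ω P z (ρ z)

lemma mem_profiles_of_monotoneOn {r₀ H : ℝ} {ρ : ℝ → ℝ} (hm : MonotoneOn ρ (Icc 0 H))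
    (hρ : ∀ z ∈ Icc 0 H, ρ z ∈ Ico 0 (sEnd r₀)) : ρ ∈ profiles r₀ H := by
  refine ⟨?_, hρ⟩
  have : Monotone ((Icc 0 H).domRestrict ρ) := fun x y hxy => hm x.2 y.2 hxy
  exact this.measurable

lemma IsPair.mem_profiles {r₀ H Ω : ℝ} {ρ : ℝ → ℝ} {P : Plane → ℝ} (h : IsPair r₀ H Ω ρ P) :
    ρ ∈ profiles r₀ H := mem_profiles_of_monotoneOn h.mono h.range

/-- The largest minimizers form a nondecreasing profile. -/
lemma exists_isPair {r₀ H Ω R : ℝ} (hr₀ : 0 < r₀) (hΩ : 0 < Ω) {P : Plane → ℝ}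
    (hP : IsPot (box R) P) : ∃ ρ, IsPair r₀ H Ω ρ P := by
  have hex : ∀ z : ℝ, ∃ r, IsArgmin r₀ Ω P z r ∧ ∀ r', IsArgmin r₀ Ω P z r' → r' ≤ r := by
    intro z
    have hs := hP.continuous_section (isCompact_box R) z
    refine exists_largest_argmin hr₀ hΩ (C := P !₂[sEnd r₀, z]) hs.continuousOn fun s hs => ?_
    exact hP.le_of_le hs.2 le_rfl
  choose ρ h1 h2 using hex
  refine ⟨ρ, ⟨fun z _ z' _ hz => ?_, fun z _ => (h1 z).1, ae_of_all _ fun z _ => h1 z⟩⟩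
  by_contra! hlt
  have := ((h1 z).eq_of_crossing hr₀ hP hz (h1 z') hlt).2.1
  exact absurd (h2 z' _ this) (not_le.2 hlt)

/-! ### Convergence of potentials and of profiles -/

lemma weight_le_weight {r₀ s S : ℝ} (hr₀ : 0 < r₀) (hS : S < sEnd r₀) (hs : s ≤ S) :
    weight r₀ s ≤ weight r₀ S := by
  have h1 := one_sub_pos hr₀ hS
  unfold weight
  gcongr

lemma abs_dens_le {r₀ Ω C z s S : ℝ} (hr₀ : 0 < r₀) {P : Plane → ℝ}
    (hS : S < sEnd r₀) (hs : s ≤ S) (hC : |P !₂[s, z]| ≤ C) :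
    |dens r₀ Ω P z s| ≤ (kin r₀ Ω S + C) * weight r₀ S := by
  have h1 := kin_nonneg hr₀ Ω (hs.trans_lt hS)
  have h2 := kin_le_kin (Ω := Ω) hr₀ hS hs
  have h3 := weight_le_weight hr₀ hS hs
  rw [dens, abs_mul, abs_of_nonneg (weight_nonneg _ _)]
  refine mul_le_mul ?_ h3 (weight_nonneg _ _) (by linarith [abs_nonneg (P !₂[s, z])])
  have h4 := abs_sub (kin r₀ Ω s) (P !₂[s, z])
  rw [abs_of_nonneg h1] at h4
  linarith

/-- Continuity of `Π_P(r, z)` in `P` and `r` jointly. -/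
lemma tendsto_potentialPi {r₀ Ω C S z : ℝ} (hr₀ : 0 < r₀) {P : ℕ → Plane → ℝ}
    {P' : Plane → ℝ} (hP : ∀ n, ContinuousOn (fun s : ℝ => P n !₂[s, z]) (Icc 0 (sEnd r₀)))
    (hC : ∀ n, ∀ s ∈ Icc 0 S, |P n !₂[s, z]| ≤ C) (hS : S < sEnd r₀)
    (hlim : ∀ s : ℝ, Tendsto (fun n => P n !₂[s, z]) atTop (𝓝 (P' !₂[s, z])))
    {r : ℕ → ℝ} {r' : ℝ} (hr : ∀ n, r n ∈ Icc 0 S) (hr' : Tendsto r atTop (𝓝 r')) :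
    Tendsto (fun n => potentialPi r₀ Ω (P n) (r n) z) atTop (𝓝 (potentialPi r₀ Ω P' r' z)) := by
  have hr'S : r' ∈ Icc 0 S := isClosed_Icc.mem_of_tendsto hr' (Eventually.of_forall hr)
  have hI : ∀ {x}, x ∈ Icc 0 S → x ∈ Ico 0 (sEnd r₀) := fun hx => ⟨hx.1, hx.2.trans_lt hS⟩
  set B := (kin r₀ Ω S + C) * weight r₀ S with hB
  have h1 : Tendsto (fun n => potentialPi r₀ Ω (P n) r' z) atTop
      (𝓝 (potentialPi r₀ Ω P' r' z)) := by
    refine intervalIntegral.tendsto_integral_filter_of_dominated_convergence (fun _ => B)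
      (Eventually.of_forall fun n => ?_) (Eventually.of_forall fun n => ae_of_all _ fun s hs => ?_)
      (by simp) (ae_of_all _ fun s hs => ?_)
    · exact (intervalIntegrable_dens hr₀ Ω (hP n) ⟨le_rfl, sEnd_pos hr₀⟩ (hI hr'S)).def'.1
    · rw [uIoc_of_le hr'S.1] at hs
      exact abs_dens_le hr₀ hS (hs.2.trans hr'S.2) (hC n s ⟨hs.1.le, hs.2.trans hr'S.2⟩)
    · exact ((tendsto_const_nhds.sub (hlim s))).mul_const _
  have h2 : Tendsto (fun n => potentialPi r₀ Ω (P n) (r n) z - potentialPi r₀ Ω (P n) r' z) atTop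
      (𝓝 0) := by
    have h3 : Tendsto (fun n => B * |r n - r'|) atTop (𝓝 0) := by
      have := ((hr'.sub_const r').abs).const_mul B
      simpa using this
    refine squeeze_zero_norm (fun n => ?_) h3
    rw [potentialPi_sub hr₀ Ω (hP n) (hI hr'S) (hI (hr n))]
    refine intervalIntegral.norm_integral_le_of_norm_le_const fun s hs => ?_
    have hs' : s ∈ Icc 0 S := by
      have h5 := uIoc_subset_uIcc hs
      exact ⟨(le_inf hr'S.1 (hr n).1).trans h5.1, h5.2.trans (sup_le hr'S.2 (hr n).2)⟩
    exact abs_dens_le hr₀ hS hs'.2 (hC n s hs')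
  simpa using h2.add h1

lemma ae_coord_one {p : ℝ → Prop} (h : ∀ᵐ z : ℝ, p z) : ∀ᵐ x : Plane, p (x 1) := by
  have h1 : Measure.QuasiMeasurePreserving (fun x : Plane => x 1) volume volume := by
    have h2 : Measure.QuasiMeasurePreserving (Prod.snd : ℝ × ℝ → ℝ) (volume.prod volume) volume :=
      Measure.quasiMeasurePreserving_snd
    exact h2.comp measurePreserving_planeEquiv.quasiMeasurePreserving
  exact h1.ae h

lemma ae_not_graph {r₀ H : ℝ} {ρ : ℝ → ℝ} (hρ : ρ ∈ profiles r₀ H) :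
    ∀ᵐ x : Plane, x 1 ∈ Icc 0 H → x 0 ≠ ρ (x 1) := by
  have hm := measurable_indicator_profile hρ
  have h : ∀ᵐ x : Plane, x 0 ≠ (Icc (0:ℝ) H).indicator ρ (x 1) := by
    refine ae_plane_of_ae_ae ?_ (ae_of_all _ fun z => ?_)
    · exact (measurableSet_eq_fun (measurable_coord 0)
        (hm.comp (measurable_coord 1))).compl
    · have : ({(Icc (0:ℝ) H).indicator ρ z}ᶜ : Set ℝ) ∈ ae (volume : Measure ℝ) :=
        compl_mem_ae_iff.2 (by simp)
      filter_upwards [this] with s hs using hs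
  filter_upwards [h] with x hx h1
  rwa [indicator_of_mem h1] at hx

lemma integrable_bound_region {r₀ S : ℝ} (H C : ℝ) :
    Integrable ({p : Plane | p 0 ∈ Icc 0 S ∧ p 1 ∈ Icc 0 H}.indicator
      fun _ => weight r₀ S * C) := by
  have hc := isCompact_rect 0 S 0 H
  rw [integrable_indicator_iff hc.measurableSet]
  exact integrableOn_const hc.measure_lt_top.ne

lemma region_subset_rect {H S : ℝ} {ρ : ℝ → ℝ} (hS : ∀ z ∈ Icc 0 H, ρ z ≤ S) :
    region H ρ ⊆ {p : Plane | p 0 ∈ Icc 0 S ∧ p 1 ∈ Icc 0 H} :=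
  fun _ hp => ⟨⟨hp.2.1, hp.2.2.trans (hS _ hp.1)⟩, hp.1⟩

lemma norm_indicator_region_le {r₀ H S C : ℝ} (hr₀ : 0 < r₀) {ρ : ℝ → ℝ} (hS' : S < sEnd r₀)
    (hS : ∀ z ∈ Icc 0 H, ρ z ≤ S) {g : Plane → ℝ} {p : Plane} (hg : |g p| ≤ C) :
    ‖(region H ρ).indicator (fun p => weight r₀ (p 0) * g p) p‖ ≤
      {p : Plane | p 0 ∈ Icc 0 S ∧ p 1 ∈ Icc 0 H}.indicator (fun _ => weight r₀ S * C) p := by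
  by_cases hp : p ∈ region H ρ
  · have hp' := region_subset_rect hS hp
    rw [indicator_of_mem hp, indicator_of_mem hp', norm_mul, Real.norm_eq_abs, Real.norm_eq_abs,
      abs_of_nonneg (weight_nonneg _ _)]
    have := weight_nonneg r₀ S
    exact mul_le_mul (weight_le_weight hr₀ hS' hp'.1.2) hg (abs_nonneg _) this
  · rw [indicator_of_notMem hp, norm_zero]
    refine indicator_nonneg (fun _ _ => ?_) _
    exact mul_nonneg (weight_nonneg _ _) ((abs_nonneg _).trans hg)

lemma isFiniteMeasure_regionMeasure {r₀ H S : ℝ} {ρ : ℝ → ℝ} (hr₀ : 0 < r₀)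
    (hρ : ρ ∈ profiles r₀ H) (hS' : S < sEnd r₀) (hS : ∀ z ∈ Icc 0 H, ρ z ≤ S) :
    IsFiniteMeasure (regionMeasure r₀ H ρ) := by
  rw [← integrable_const_iff_isFiniteMeasure (c := (1:ℝ)) one_ne_zero,
    integrable_regionMeasure_iff hρ]
  refine (integrable_bound_region (r₀ := r₀) (S := S) H 1).mono' ?_
    (ae_of_all _ fun p => norm_indicator_region_le hr₀ hS' hS (by simp))
  refine (Measurable.indicator ?_ (measurableSet_region hρ)).aestronglyMeasurable
  exact ((measurable_weight r₀).comp (measurable_coord 0)).mul measurable_const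

/-- Dominated convergence over converging regions. -/
lemma tendsto_integral_regionMeasure {r₀ H S C : ℝ} (hr₀ : 0 < r₀) {ρ : ℕ → ℝ → ℝ} {ρ' : ℝ → ℝ}
    (hρ : ∀ n, ρ n ∈ profiles r₀ H) (hρ' : ρ' ∈ profiles r₀ H) (hS' : S < sEnd r₀)
    (hS : ∀ n, ∀ z ∈ Icc 0 H, ρ n z ≤ S)
    (hlim : ∀ᵐ z : ℝ, z ∈ Icc 0 H → Tendsto (fun n => ρ n z) atTop (𝓝 (ρ' z)))
    {g : ℕ → Plane → ℝ} {g' : Plane → ℝ} (hg : ∀ n, AEStronglyMeasurable (g n) volume)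
    (hC : ∀ n, ∀ᵐ p : Plane, p ∈ region H (ρ n) → |g n p| ≤ C)
    (hglim : ∀ᵐ p : Plane, p ∈ domD r₀ H → Tendsto (fun n => g n p) atTop (𝓝 (g' p))) :
    Tendsto (fun n => ∫ p, g n p ∂(regionMeasure r₀ H (ρ n))) atTop
      (𝓝 (∫ p, g' p ∂(regionMeasure r₀ H ρ'))) := by
  simp_rw [fun n => integral_regionMeasure_eq (hρ n), integral_regionMeasure_eq hρ']
  refine tendsto_integral_of_dominated_convergence _ (fun n => ?_)
    (integrable_bound_region (r₀ := r₀) (S := S) H |C|) (fun n => ?_) ?_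
  · exact ((((measurable_weight r₀).comp (measurable_coord 0)).aestronglyMeasurable).mul
      (hg n)).indicator (measurableSet_region (hρ n))
  · filter_upwards [hC n] with p hp
    by_cases hpr : p ∈ region H (ρ n)
    · exact norm_indicator_region_le hr₀ hS' (hS n) ((hp hpr).trans (le_abs_self C))
    · rw [indicator_of_notMem hpr, norm_zero]
      exact indicator_nonneg (fun _ _ => mul_nonneg (weight_nonneg _ _) (abs_nonneg _)) _
  · filter_upwards [ae_coord_one hlim, ae_not_graph hρ', hglim] with p h1 h2 h3
    by_cases hz : p 1 ∈ Icc 0 H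
    swap
    · have : ∀ r : ℝ → ℝ, p ∉ region H r := fun r h => hz h.1
      simp [this]
    by_cases h0 : 0 ≤ p 0
    swap
    · have : ∀ r : ℝ → ℝ, p ∉ region H r := fun r h => h0 h.2.1
      simp [this]
    rcases lt_or_gt_of_ne (h2 hz) with h | h
    · have hp' : p ∈ region H ρ' := ⟨hz, h0, h.le⟩
      have hev : ∀ᶠ n in atTop, p 0 < ρ n (p 1) := (tendsto_order.1 (h1 hz)).1 _ h
      have hD := region_subset_domD hρ'.2 hp'
      rw [indicator_of_mem hp']
      refine ((h3 hD).const_mul _).congr' ?_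
      filter_upwards [hev] with n hn
      rw [indicator_of_mem (show p ∈ region H (ρ n) from ⟨hz, h0, hn.le⟩)]
    · have hp' : p ∉ region H ρ' := fun hp => absurd hp.2.2 (not_le.2 h)
      have hev : ∀ᶠ n in atTop, ρ n (p 1) < p 0 := (tendsto_order.1 (h1 hz)).2 _ h
      rw [indicator_of_notMem hp']
      refine tendsto_const_nhds.congr' ?_
      filter_upwards [hev] with n hn
      rw [indicator_of_notMem (fun hp => absurd hp.2.2 (not_le.2 hn))]

/-! ### Optimal triples and their limits -/

lemma regionMeasure_congr {r₀ H : ℝ} {ρ ρ' : ℝ → ℝ}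
    (h : ∀ᵐ z : ℝ, z ∈ Icc 0 H → ρ z = ρ' z) : regionMeasure r₀ H ρ = regionMeasure r₀ H ρ' := by
  unfold regionMeasure
  congr 1
  refine Measure.restrict_congr_set ?_
  filter_upwards [ae_coord_one h] with p hp
  refine propext (and_congr_right fun hz => ?_)
  change p 0 ∈ Icc 0 (ρ (p 1)) ↔ p 0 ∈ Icc 0 (ρ' (p 1))
  rw [hp hz]

lemma IsPair.ae_le {r₀ H Ω R S : ℝ} (hr₀ : 0 < r₀) (hΩ : 0 < Ω) (hR : 0 ≤ R) {ρ : ℝ → ℝ}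
    {P : Plane → ℝ} (hP : IsPot (box R) P) (h : IsPair r₀ H Ω ρ P) (hS : S ∈ Ico 0 (sEnd r₀))
    (hPS : P 0 + R * (sEnd r₀ + H) ≤ kin r₀ Ω S) : ∀ᵐ z : ℝ, z ∈ Icc 0 H → ρ z ≤ S := by
  filter_upwards [h.argmin] with z hz hzH
  have hs := hP.continuous_section (isCompact_box R) z
  exact (hz hzH).le_of_bound hr₀ hΩ hs.continuousOn
    (fun s hs => (hP.bounds hR (p := !₂[s, z]) ⟨hs, hzH⟩).2) hS hPS

lemma IsPair.isFiniteMeasure {r₀ H Ω R : ℝ} (hr₀ : 0 < r₀) (hΩ : 0 < Ω) (hR : 0 ≤ R) {ρ : ℝ → ℝ}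
    {P : Plane → ℝ} (hP : IsPot (box R) P) (h : IsPair r₀ H Ω ρ P) :
    IsFiniteMeasure (regionMeasure r₀ H ρ) := by
  obtain ⟨S, hS, hPS⟩ := exists_le_kin hr₀ hΩ (P 0 + R * (sEnd r₀ + H))
  have h1 := h.ae_le hr₀ hΩ hR hP hS hPS
  have h2 : regionMeasure r₀ H ρ = regionMeasure r₀ H (fun z => min (ρ z) S) := by
    refine regionMeasure_congr ?_
    filter_upwards [h1] with z hz hzH
    exact (min_eq_left (hz hzH)).symm
  rw [h2]
  refine isFiniteMeasure_regionMeasure hr₀ ?_ hS.2 fun z _ => min_le_right _ _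
  exact mem_profiles_of_monotoneOn (fun x hx y hy hxy => min_le_min_right _ (h.mono hx hy hxy))
    fun z hz => ⟨le_min (h.range z hz).1 hS.1, min_lt_of_left_lt (h.range z hz).2⟩

/-- Convergence of potentials together with convergence of bounded integrals over the regions. -/
def PairConv (r₀ H : ℝ) (ρ : ℕ → ℝ → ℝ) (P : ℕ → Plane → ℝ) (ρ' : ℝ → ℝ) (P' : Plane → ℝ) :
    Prop :=
  (∀ p, Tendsto (fun n => P n p) atTop (𝓝 (P' p))) ∧
  ∀ (g : ℕ → Plane → ℝ) (g' : Plane → ℝ) (C : ℝ), (∀ n, AEStronglyMeasurable (g n) volume) →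
    (∀ n, ∀ᵐ p : Plane, p ∈ domD r₀ H → |g n p| ≤ C) →
    (∀ᵐ p : Plane, p ∈ domD r₀ H → Tendsto (fun n => g n p) atTop (𝓝 (g' p))) →
    Tendsto (fun n => ∫ p, g n p ∂(regionMeasure r₀ H (ρ n))) atTop
      (𝓝 (∫ p, g' p ∂(regionMeasure r₀ H ρ')))

/-- Sequential compactness of pairs of a potential and a minimizing profile. -/
lemma exists_subseq_isPair {r₀ H Ω R C : ℝ} (hr₀ : 0 < r₀) (hH : 0 < H) (hΩ : 0 < Ω) (hR : 0 ≤ R)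
    {ρ : ℕ → ℝ → ℝ} {P : ℕ → Plane → ℝ} (hP : ∀ n, IsPot (box R) (P n))
    (h : ∀ n, IsPair r₀ H Ω (ρ n) (P n)) (hC : ∀ n, |P n 0| ≤ C) :
    ∃ (φ : ℕ → ℕ) (ρ' : ℝ → ℝ) (P' : Plane → ℝ), StrictMono φ ∧ IsPot (box R) P' ∧
      IsPair r₀ H Ω ρ' P' ∧ PairConv r₀ H (fun n => ρ (φ n)) (fun n => P (φ n)) ρ' P' := by
  obtain ⟨S, hS, hPS⟩ := exists_le_kin hr₀ hΩ (C + R * (sEnd r₀ + H))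
  have ha := sEnd_pos hr₀
  have hle : ∀ n, ∀ᵐ z : ℝ, z ∈ Icc 0 H → ρ n z ≤ S := fun n =>
    (h n).ae_le hr₀ hΩ hR (hP n) hS (by linarith [(abs_le.1 (hC n)).2])
  obtain ⟨K, hK⟩ := exists_norm_bound (isCompact_box R)
  obtain ⟨φ, P', hφ, hP'⟩ := exists_subseq_lipschitz (fun n => (hP n).lipschitzWith hK) hC
  let f : ℕ → ℝ → ℝ := fun n z => min (ρ (φ n) (max 0 (min z H))) S
  have hcl : ∀ z : ℝ, max 0 (min z H) ∈ Icc 0 H :=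
    fun z => ⟨le_max_left _ _, max_le hH.le (min_le_right _ _)⟩
  have hcl' : ∀ z ∈ Icc 0 H, max 0 (min z H) = z := fun z hz => by
    rw [min_eq_left hz.2, max_eq_right hz.1]
  have hfm : ∀ n, Monotone (f n) := fun n x y hxy =>
    min_le_min_right _ ((h _).mono (hcl x) (hcl y) (max_le_max_left _ (min_le_min_right _ hxy)))
  have hfr : ∀ n z, f n z ∈ Icc 0 S := fun n z =>
    ⟨le_min ((h _).range _ (hcl z)).1 hS.1, min_le_right _ _⟩
  obtain ⟨ψ, ρ', hψ, hρ'm, hρ'r, hcount⟩ := exists_subseq_monotone hfm hfr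
  have hlim : ∀ᵐ z : ℝ, Tendsto (fun n => f (ψ n) z) atTop (𝓝 (ρ' z)) := by
    have := hcount.measure_zero (volume : Measure ℝ)
    exact measure_eq_zero_iff_ae_notMem.1 this |>.mono fun z hz => by simpa using hz
  have hPlim : ∀ p, Tendsto (fun n => P (φ (ψ n)) p) atTop (𝓝 (P' p)) :=
    fun p => (hP' p).comp hψ.tendsto_atTop
  have hpot : IsPot (box R) P' := isPot_of_tendsto (isCompact_box R) (fun n => hP _) hPlim
  have hrange : ∀ z ∈ Icc 0 H, ρ' z ∈ Ico 0 (sEnd r₀) :=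
    fun z _ => ⟨(hρ'r z).1, (hρ'r z).2.trans_lt hS.2⟩
  have heq : ∀ n, ∀ᵐ z : ℝ, z ∈ Icc 0 H → ρ (φ n) z = f n z := by
    intro n
    filter_upwards [hle (φ n)] with z hz hzH
    simp only [f, hcl' z hzH]
    exact (min_eq_left (hz hzH)).symm
  have hsec : ∀ {Q : Plane → ℝ}, IsPot (box R) Q → ∀ z : ℝ,
      ContinuousOn (fun s : ℝ => Q !₂[s, z]) (Icc 0 (sEnd r₀)) :=
    fun hQ z => (hQ.continuous_section (isCompact_box R) z).continuousOn
  refine ⟨φ ∘ ψ, ρ', P', hφ.comp hψ, hpot, ⟨hρ'm.monotoneOn _, hrange, ?_⟩, hPlim, ?_⟩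
  · filter_upwards [hlim, ae_all_iff.2 fun n => (h n).argmin, ae_all_iff.2 heq]
      with z h1 h2 h3 hz
    have hb : ∀ n, ∀ s ∈ Icc 0 (sEnd r₀),
        |P (φ (ψ n)) !₂[s, z]| ≤ C + R * (sEnd r₀ + H) := by
      intro n s hs
      have h4 := (hP (φ (ψ n))).bounds (H := H) (r₀ := r₀) hR (p := !₂[s, z]) ⟨hs, hz⟩
      have h5 := abs_le.1 (hC (φ (ψ n)))
      have h6 : 0 ≤ R * (sEnd r₀ + H) := by positivity
      rw [abs_le]
      constructor <;> linarith
    have key : ∀ (r : ℕ → ℝ) (r' : ℝ) (S' : ℝ), S' < sEnd r₀ → (∀ n, r n ∈ Icc 0 S') →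
        Tendsto r atTop (𝓝 r') → Tendsto (fun n => potentialPi r₀ Ω (P (φ (ψ n))) (r n) z) atTop
        (𝓝 (potentialPi r₀ Ω P' r' z)) := by
      intro r r' S' hS' hr hr'
      exact tendsto_potentialPi hr₀ (fun n => hsec (hP _) z)
        (fun n s hs => hb n s ⟨hs.1, hs.2.trans hS'.le⟩) hS' (fun s => hPlim _) hr hr'
    refine ⟨hrange z hz, fun r hr => ?_⟩
    refine le_of_tendsto_of_tendsto' (key _ _ S hS.2 (fun n => hfr (ψ n) z) h1)
      (key (fun _ => r) r r hr.2 (fun _ => right_mem_Icc.2 hr.1) tendsto_const_nhds) fun n => ?_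
    rw [← h3 (ψ n) hz]
    exact (h2 (φ (ψ n)) hz).2 r hr
  · intro g g' C' hg hgC hgl
    have hfp : ∀ n, f n ∈ profiles r₀ H := fun n =>
      mem_profiles_of_monotoneOn ((hfm n).monotoneOn _)
        fun z _ => ⟨(hfr n z).1, (hfr n z).2.trans_lt hS.2⟩
    have hm : ∀ n, regionMeasure r₀ H (ρ ((φ ∘ ψ) n)) = regionMeasure r₀ H (f (ψ n)) :=
      fun n => regionMeasure_congr (heq (ψ n))
    simp_rw [hm]
    refine tendsto_integral_regionMeasure hr₀ (fun n => hfp _)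
      (mem_profiles_of_monotoneOn (hρ'm.monotoneOn _) hrange) hS.2 (fun n z _ => (hfr _ z).2)
      (hlim.mono fun z hz _ => hz) hg (C := C') (fun n => ?_) hgl
    filter_upwards [hgC n] with p hp hpr
    exact hp (region_subset_domD (hfp _).2 hpr)

/-- The mass constraint bounds the additive constant of the potential. -/
lemma exists_bound_of_mass {r₀ H Ω R : ℝ} (hr₀ : 0 < r₀) (hH : 0 < H) (hR : 0 ≤ R) :
    ∃ C, ∀ (ρ : ℝ → ℝ) (P : Plane → ℝ), IsPot (box R) P → IsPair r₀ H Ω ρ P →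
      regionMeasure r₀ H ρ univ = 1 → |P 0| ≤ C := by
  -- the rectangle `[0, s₁] × [0, H]` has mass two
  obtain ⟨s₁, hs₁, hm⟩ := exists_cumWeight_eq hr₀ (c := 2 / H) (by positivity)
  have ha := sEnd_pos hr₀
  refine ⟨max (R * (sEnd r₀ + H)) (kin r₀ Ω s₁), fun ρ P hP h h1 => ?_⟩
  rw [regionMeasure_univ hr₀ h.mem_profiles] at h1
  rw [abs_le]
  constructor
  · -- a negative potential makes the optimal profile vanish
    by_contra! hlt
    have hlt' : P 0 + R * (sEnd r₀ + H) < 0 := by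
      have := le_max_left (R * (sEnd r₀ + H)) (kin r₀ Ω s₁)
      linarith
    have h0 : ∫⁻ z in Icc 0 H, ENNReal.ofReal (cumWeight r₀ (ρ z)) = 0 := by
      rw [setLIntegral_congr_fun_ae (g := fun _ => 0) measurableSet_Icc]
      · simp
      · filter_upwards [h.argmin] with z hz hzH
        have hρ0 : ρ z = 0 := by
          by_contra hne
          have hpos : 0 < ρ z := lt_of_le_of_ne (h.range z hzH).1 (Ne.symm hne)
          have h2 := (hz hzH).kin_eq hr₀ hP hpos
          have h3 := kin_nonneg hr₀ Ω (h.range z hzH).2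
          have h4 := (hP.bounds hR (r₀ := r₀) (H := H) (p := !₂[ρ z, z])
            ⟨Ico_subset_Icc_self (h.range z hzH), hzH⟩).2
          linarith
        simp [hρ0]
    rw [h0] at h1
    exact zero_ne_one h1
  · -- a potential above the kinetic term on `[0, s₁]` makes the mass at least two
    by_contra! hlt
    have hlt' : kin r₀ Ω s₁ < P 0 := (le_max_right _ _).trans_lt hlt
    have h0 : ∫⁻ z in Icc 0 H, ENNReal.ofReal (2 / H) ≤
        ∫⁻ z in Icc 0 H, ENNReal.ofReal (cumWeight r₀ (ρ z)) := by
      refine setLIntegral_mono_ae' measurableSet_Icc ?_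
      filter_upwards [h.argmin] with z hz hzH
      refine ENNReal.ofReal_le_ofReal ?_
      rw [← hm]
      refine cumWeight_le_cumWeight hr₀ (h.range z hzH).2 ?_
      by_contra! hc
      have hs := (hP.continuous_section (isCompact_box R) z).continuousOn (s := Icc 0 (sEnd r₀))
      have h2 := (hz hzH).integral_nonneg hr₀ hs hs₁
      have h3 : 0 < ∫ s in ρ z..s₁, -dens r₀ Ω P z s := by
        refine intervalIntegral.intervalIntegral_pos_of_pos_on
          (intervalIntegrable_dens hr₀ Ω hs (h.range z hzH) hs₁).neg (fun s hs => ?_) hc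
        have h4 := kin_le_kin (Ω := Ω) hr₀ hs₁.2 hs.2.le
        have h5 : (0:ℝ) ≤ s := (h.range z hzH).1.trans hs.1.le
        have h6 := (hP.bounds hR (r₀ := r₀) (H := H) (p := !₂[s, z])
          ⟨⟨h5, (hs.2.trans hs₁.2).le⟩, hzH⟩).1
        have h7 := weight_pos hr₀ (hs.2.trans hs₁.2)
        rw [dens, ← neg_mul]
        exact mul_pos (by linarith) h7
      rw [intervalIntegral.integral_neg] at h3
      linarith
    rw [h1, setLIntegral_const, Real.volume_Icc, ← ENNReal.ofReal_mul (by positivity)] at h0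
    have : 2 / H * (H - 0) = 2 := by field_simp; ring
    rw [this] at h0
    norm_num at h0

/-- An optimal triple: a potential `P`, a profile `ρ` minimizing `Π_P(·, z)` for almost all `z`,
such that the gradient of `P` transports the measure of the region `D_ρ` to `σ`. -/
structure IsTriple (r₀ H Ω R : ℝ) (σ : Measure Plane) (ρ : ℝ → ℝ) (P : Plane → ℝ) : Prop where
  pot : IsPot (box R) P
  pair : IsPair r₀ H Ω ρ P
  push : (regionMeasure r₀ H ρ).map (∇ P) = σ

lemma IsTriple.mass {r₀ H Ω R : ℝ} {σ : Measure Plane} [IsProbabilityMeasure σ] {ρ : ℝ → ℝ}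
    {P : Plane → ℝ} (h : IsTriple r₀ H Ω R σ ρ P) : regionMeasure r₀ H ρ univ = 1 := by
  have : (regionMeasure r₀ H ρ).map (∇ P) univ = 1 := by rw [h.push]; exact measure_univ
  rwa [Measure.map_apply (measurable_gradient P) MeasurableSet.univ, preimage_univ] at this

lemma IsTriple.integral_comp {r₀ H Ω R : ℝ} {σ : Measure Plane} {ρ : ℝ → ℝ}
    {P : Plane → ℝ} (h : IsTriple r₀ H Ω R σ ρ P) {f : Plane → ℝ}
    (hf : AEStronglyMeasurable f σ) :
    ∫ p, f (∇ P p) ∂(regionMeasure r₀ H ρ) = ∫ q, f q ∂σ := by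
  rw [← h.push] at hf ⊢
  exact (integral_map (measurable_gradient P).aemeasurable hf).symm

open BoundedContinuousFunction in
/-- Optimal triples are stable under weak convergence of the target measures, up to
subsequences. -/
lemma exists_subseq_isTriple {r₀ H Ω R : ℝ} (hr₀ : 0 < r₀) (hH : 0 < H) (hΩ : 0 < Ω) (hR : 0 ≤ R)
    {σ : ℕ → Measure Plane} {σ' : Measure Plane} [∀ n, IsProbabilityMeasure (σ n)]
    [IsProbabilityMeasure σ'] {ρ : ℕ → ℝ → ℝ} {P : ℕ → Plane → ℝ}
    (h : ∀ n, IsTriple r₀ H Ω R (σ n) (ρ n) (P n))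
    (hlim : ∀ f : Plane →ᵇ ℝ, Tendsto (fun n => ∫ q, f q ∂(σ n)) atTop (𝓝 (∫ q, f q ∂σ'))) :
    ∃ (φ : ℕ → ℕ) (ρ' : ℝ → ℝ) (P' : Plane → ℝ), StrictMono φ ∧
      IsTriple r₀ H Ω R σ' ρ' P' ∧ PairConv r₀ H (fun n => ρ (φ n)) (fun n => P (φ n)) ρ' P' := by
  obtain ⟨C, hC⟩ := exists_bound_of_mass (Ω := Ω) hr₀ hH hR
  obtain ⟨φ, ρ', P', hφ, hpot, hpair, hconv⟩ := exists_subseq_isPair hr₀ hH hΩ hR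
    (fun n => (h n).pot) (fun n => (h n).pair) (fun n => hC _ _ (h n).pot (h n).pair (h n).mass)
  refine ⟨φ, ρ', P', hφ, ⟨hpot, hpair, ?_⟩, hconv⟩
  have := hpair.isFiniteMeasure hr₀ hΩ hR hpot
  refine ext_of_forall_integral_eq_of_IsFiniteMeasure fun f => ?_
  rw [integral_map (measurable_gradient P').aemeasurable f.continuous.aestronglyMeasurable]
  have h1 := hconv.2 (fun n p => f (∇ (P (φ n)) p)) (fun p => f (∇ P' p)) ‖f‖
    (fun n => (f.continuous.measurable.comp (measurable_gradient _)).aestronglyMeasurable)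
    (fun n => ae_of_all _ fun p _ => f.norm_coe_le_norm _) (by
      filter_upwards [ae_tendsto_gradient (isCompact_box R) (fun n => (h (φ n)).pot) hpot hconv.1]
        with p hp _
      exact (f.continuous.tendsto _).comp hp)
  refine tendsto_nhds_unique h1 ?_
  have h2 := (hlim f).comp hφ.tendsto_atTop
  refine h2.congr fun n => ?_
  exact ((h (φ n)).integral_comp f.continuous.aestronglyMeasurable).symm

/-! ### Existence of optimal triples -/

lemma exists_mem_Ioo_of_ae {p : ℝ → Prop} (h : ∀ᵐ z : ℝ, p z) {a b : ℝ} (hab : a < b) :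
    ∃ z ∈ Ioo a b, p z := by
  have h1 : volume (Ioo a b) ≠ 0 := by simp [hab]
  obtain ⟨z, hz, hz'⟩ := nonempty_of_measure_ne_zero
    (by rwa [measure_inter_conull (t := {z | p z}) (show volume {z | p z}ᶜ = 0 from ae_iff.1 h)] :
      volume (Ioo a b ∩ {z | p z}) ≠ 0)
  exact ⟨z, hz, hz'⟩

/-- The energy `∫ (c₀ - P) e χ_{D_ρ}` of a profile in the potential `P`, where `c₀` is the kinetic
term `kin`. -/
def profileEnergy (r₀ H Ω : ℝ) (ρ : ℝ → ℝ) (P : Plane → ℝ) : ℝ :=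
  ∫ p, (kin r₀ Ω (p 0) - P p) ∂(regionMeasure r₀ H ρ)

lemma profileEnergy_eq {r₀ H Ω : ℝ} {ρ : ℝ → ℝ} {P : Plane → ℝ} (hρ : ρ ∈ profiles r₀ H)
    (hi : Integrable (fun p => kin r₀ Ω (p 0) - P p) (regionMeasure r₀ H ρ)) :
    IntegrableOn (fun z => potentialPi r₀ Ω P (ρ z) z) (Icc 0 H) ∧
      profileEnergy r₀ H Ω ρ P = ∫ z in Icc 0 H, potentialPi r₀ Ω P (ρ z) z := by
  have h := integral_regionMeasure hρ hi
  have e : ∀ z, ∫ s in (0 : ℝ)..ρ z, weight r₀ s * (kin r₀ Ω ((!₂[s, z] : Plane) 0) - P !₂[s, z]) =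
      potentialPi r₀ Ω P (ρ z) z := by
    intro z
    rw [potentialPi_eq]
    refine intervalIntegral.integral_congr fun s _ => ?_
    simp [dens, mul_comm]
  simp_rw [e] at h
  exact h

lemma IsPair.ae_mem_rect {r₀ H Ω R : ℝ} (hr₀ : 0 < r₀) (hΩ : 0 < Ω) (hR : 0 ≤ R) {ρ : ℝ → ℝ}
    {P : Plane → ℝ} (hP : IsPot (box R) P) (h : IsPair r₀ H Ω ρ P) :
    ∃ S ∈ Ico 0 (sEnd r₀), ∀ᵐ p ∂(regionMeasure r₀ H ρ), p 0 ∈ Icc 0 S ∧ p 1 ∈ Icc 0 H := by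
  obtain ⟨S, hS, hPS⟩ := exists_le_kin hr₀ hΩ (P 0 + R * (sEnd r₀ + H))
  refine ⟨S, hS, ?_⟩
  rw [regionMeasure_ae_iff hr₀ h.mem_profiles]
  filter_upwards [ae_coord_one (h.ae_le hr₀ hΩ hR hP hS hPS)] with p hp hpr
  exact ⟨⟨hpr.2.1, hpr.2.2.trans (hp hpr.1)⟩, hpr.1⟩

lemma exists_abs_bound {K : Set Plane} (hK : IsCompact K) {f : Plane → ℝ} (hf : ContinuousOn f K) :
    ∃ C, ∀ p ∈ K, |f p| ≤ C := by
  obtain ⟨C, hC⟩ := hK.exists_bound_of_continuousOn hf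
  exact ⟨C, hC⟩

lemma IsPair.integrable_kin {r₀ H Ω R : ℝ} (hr₀ : 0 < r₀) (hΩ : 0 < Ω) (hR : 0 ≤ R) {ρ : ℝ → ℝ}
    {P : Plane → ℝ} (hP : IsPot (box R) P) (h : IsPair r₀ H Ω ρ P) :
    Integrable (fun p => kin r₀ Ω (p 0)) (regionMeasure r₀ H ρ) := by
  obtain ⟨S, hS, hS'⟩ := h.ae_mem_rect hr₀ hΩ hR hP
  have := h.isFiniteMeasure hr₀ hΩ hR hP
  refine Integrable.of_bound
    ((measurable_kin r₀ Ω).comp (measurable_coord 0)).aestronglyMeasurable (kin r₀ Ω S) ?_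
  filter_upwards [hS'] with p hp
  rw [Real.norm_eq_abs,
    abs_of_nonneg (kin_nonneg hr₀ Ω (hp.1.2.trans_lt hS.2))]
  exact kin_le_kin hr₀ hS.2 hp.1.2

lemma IsPair.integrable_of_continuous {r₀ H Ω R : ℝ} (hr₀ : 0 < r₀) (hΩ : 0 < Ω) (hR : 0 ≤ R)
    {ρ : ℝ → ℝ} {P : Plane → ℝ} (hP : IsPot (box R) P) (h : IsPair r₀ H Ω ρ P) {f : Plane → ℝ}
    (hf : Continuous f) : Integrable f (regionMeasure r₀ H ρ) := by
  have := h.isFiniteMeasure hr₀ hΩ hR hP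
  obtain ⟨C, hC⟩ := exists_abs_bound (isCompact_domC r₀ H) hf.continuousOn
  refine Integrable.of_bound hf.aestronglyMeasurable C ?_
  filter_upwards [regionMeasure_ae h.mem_profiles] with p hp
  exact hC p (domD_subset_domC _ _ (region_subset_domD h.range hp))

/-- A minimizing profile has the least energy among all profiles. -/
lemma IsPair.profileEnergy_le {r₀ H Ω R : ℝ} (hr₀ : 0 < r₀) (hΩ : 0 < Ω) (hR : 0 ≤ R)
    {ρ r : ℝ → ℝ} {P : Plane → ℝ} (hP : IsPot (box R) P) (h : IsPair r₀ H Ω ρ P)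
    (hr : r ∈ profiles r₀ H)
    (hi : Integrable (fun p => kin r₀ Ω (p 0) - P p) (regionMeasure r₀ H r)) :
    profileEnergy r₀ H Ω ρ P ≤ profileEnergy r₀ H Ω r P := by
  have h1 := profileEnergy_eq h.mem_profiles ((h.integrable_kin hr₀ hΩ hR hP).sub
    (h.integrable_of_continuous hr₀ hΩ hR hP (hP.continuous (isCompact_box R))))
  have h2 := profileEnergy_eq hr hi
  rw [h1.2, h2.2]
  refine setIntegral_mono_ae_restrict h1.1 h2.1 ?_
  rw [EventuallyLE, ae_restrict_iff' measurableSet_Icc]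
  filter_upwards [h.argmin] with z hz hzH
  exact (hz hzH).2 _ (hr.2 z hzH)

/-- The rectangle `[0, R] × [δ, R]` of dual points. -/
def boxFrom (δ R : ℝ) : Set Plane := {q | q 0 ∈ Icc 0 R ∧ q 1 ∈ Icc δ R}

lemma isCompact_boxFrom (δ R : ℝ) : IsCompact (boxFrom δ R) := isCompact_rect _ _ _ _

lemma boxFrom_subset_box {δ R : ℝ} (hδ : 0 ≤ δ) : boxFrom δ R ⊆ box R :=
  fun _ hq => ⟨hq.1, hδ.trans hq.2.1, hq.2.2⟩

lemma boxFrom_nonempty {δ R : ℝ} (hR : 0 ≤ R) (hδR : δ ≤ R) : (boxFrom δ R).Nonempty :=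
  ⟨!₂[0, R], ⟨le_rfl, hR⟩, hδR, le_rfl⟩

/-- If the potential is strictly increasing in the second variable, minimizing profiles are unique
almost everywhere. -/
lemma IsPair.ae_eq_of_boxFrom {r₀ H Ω R δ : ℝ} (hr₀ : 0 < r₀) (hδ : 0 < δ)
    {ρ ρ' : ℝ → ℝ} {P : Plane → ℝ} (hP : IsPot (boxFrom δ R) P) (h : IsPair r₀ H Ω ρ P)
    (h' : IsPair r₀ H Ω ρ' P) : ∀ᵐ z : ℝ, z ∈ Icc 0 H → ρ z = ρ' z := by
  have hP' := hP.mono (boxFrom_subset_box hδ.le)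
  have cross : ∀ {z z' r r' : ℝ}, z < z' → IsArgmin r₀ Ω P z r → IsArgmin r₀ Ω P z' r' →
      r ≤ r' := by
    intro z z' r r' hz hr hr'
    by_contra! hlt
    have h1 := (hr.eq_of_crossing hr₀ hP' hz.le hr' hlt).1 r ⟨hlt.le, le_rfl⟩
    obtain ⟨q, hq, hq'⟩ := hP !₂[r, z]
    have h2 := hq' !₂[r, z']
    rw [inner_plane] at h2
    simp only [PiLp.sub_apply, Matrix.cons_val_zero, Matrix.cons_val_one] at h2
    have : 0 < (z' - z) * q 1 := mul_pos (by linarith) (hδ.trans_le hq.2.1)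
    linarith
  have main : ∀ {ρ₁ ρ₂ : ℝ → ℝ}, IsPair r₀ H Ω ρ₁ P → IsPair r₀ H Ω ρ₂ P →
      ∀ᵐ z : ℝ, z ∈ Icc 0 H → ρ₂ z ≤ ρ₁ z := by
    intro ρ₁ ρ₂ h₁ h₂
    have hc : ∀ᵐ z : ℝ, z ∉ {z | z ∈ Icc 0 H ∧ ¬ ContinuousWithinAt ρ₁ (Icc 0 H) z} :=
      measure_eq_zero_iff_ae_notMem.1
        ((h₁.mono.countable_not_continuousWithinAt).measure_zero volume)
    have hne : ∀ᵐ z : ℝ, z ≠ H := by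
      have : ({H}ᶜ : Set ℝ) ∈ ae (volume : Measure ℝ) := compl_mem_ae_iff.2 (by simp)
      filter_upwards [this] with z hz using hz
    filter_upwards [hc, hne, h₂.argmin] with z hz hzne hza hzH
    by_contra! hlt
    have hcont : ContinuousWithinAt ρ₁ (Icc 0 H) z := by
      by_contra hcon; exact hz ⟨hzH, hcon⟩
    have h3 : ∀ᶠ z' in 𝓝[Icc 0 H] z, ρ₁ z' < ρ₂ z := (tendsto_order.1 hcont).2 _ hlt
    obtain ⟨ε, hε, hball⟩ := Metric.mem_nhdsWithin_iff.1 h3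
    have hzH' : z < H := lt_of_le_of_ne hzH.2 hzne
    obtain ⟨z', hz', hz'a⟩ := exists_mem_Ioo_of_ae h₁.argmin
      (show z < min (z + ε) H from lt_min (by linarith) hzH')
    have hz'H : z' ∈ Icc 0 H := ⟨hzH.1.trans hz'.1.le, (hz'.2.trans_le (min_le_right _ _)).le⟩
    have h4 : ρ₁ z' < ρ₂ z := hball ⟨by
      rw [Metric.mem_ball, Real.dist_eq, abs_of_pos (by linarith [hz'.1])]
      linarith [hz'.2.trans_le (min_le_left (z + ε) H)], hz'H⟩
    have h5 := cross hz'.1 (hza hzH) (hz'a hz'H)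
    linarith
  filter_upwards [main h h', main h' h] with z h1 h2 hz
  exact le_antisymm (h2 hz) (h1 hz)

/-- The Legendre transform over the closure of the physical domain. -/
def star (r₀ H : ℝ) (P : Plane → ℝ) : Plane → ℝ := leg (domC r₀ H) P

lemma zero_mem_domC {r₀ H : ℝ} (hr₀ : 0 < r₀) (hH : 0 < H) : (0 : Plane) ∈ domC r₀ H :=
  ⟨⟨le_rfl, (sEnd_pos hr₀).le⟩, le_rfl, hH.le⟩

lemma isPot_star {r₀ H : ℝ} (hr₀ : 0 < r₀) (hH : 0 < H) {P : Plane → ℝ}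
    (hP : ContinuousOn P (domC r₀ H)) : IsPot (domC r₀ H) (star r₀ H P) :=
  isPot_leg (isCompact_domC r₀ H) ⟨0, zero_mem_domC hr₀ hH⟩ hP

lemma continuous_star {r₀ H : ℝ} (hr₀ : 0 < r₀) (hH : 0 < H) {P : Plane → ℝ}
    (hP : ContinuousOn P (domC r₀ H)) : Continuous (star r₀ H P) :=
  (isPot_star hr₀ hH hP).continuous (isCompact_domC r₀ H)

/-- Equality in the Young inequality along subgradients. -/
lemma IsPot.add_star_eq {r₀ H : ℝ} {B : Set Plane} (hB : IsCompact B)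
    {P : Plane → ℝ} (hP : IsPot B P) {p q : Plane} (hp : p ∈ domC r₀ H)
    (hq : ∀ p', P p + ⟪p' - p, q⟫_ℝ ≤ P p') : P p + star r₀ H P q = ⟪p, q⟫_ℝ := by
  have h1 := le_leg (isCompact_domC r₀ H) (hP.continuous hB).continuousOn q hp
  have h2 : star r₀ H P q ≤ ⟪p, q⟫_ℝ - P p := by
    refine leg_le ⟨p, hp⟩ fun p' _ => ?_
    have h3 := hq p'
    rw [inner_sub_left] at h3
    rw [real_inner_comm]
    linarith
  rw [real_inner_comm] at h1
  unfold star at *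
  linarith

lemma young_star {r₀ H : ℝ} {P : Plane → ℝ} (hP : ContinuousOn P (domC r₀ H)) {p : Plane}
    (hp : p ∈ domC r₀ H) (q : Plane) : ⟪p, q⟫_ℝ ≤ P p + star r₀ H P q := by
  have h1 := le_leg (isCompact_domC r₀ H) hP q hp
  rw [real_inner_comm] at h1
  unfold star
  linarith

lemma star_zero {r₀ H R : ℝ} (hr₀ : 0 < r₀) (hH : 0 < H) (hR : 0 ≤ R) {P : Plane → ℝ}
    (hP : IsPot (box R) P) : star r₀ H P 0 = - P 0 := by
  have h0 := zero_mem_domC hr₀ hH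
  apply le_antisymm
  · refine leg_le ⟨0, h0⟩ fun p hp => ?_
    have := (hP.bounds hR hp).1
    simpa using this
  · have := le_leg (isCompact_domC r₀ H) (hP.continuous (isCompact_box R)).continuousOn 0 h0
    simpa [star] using this

lemma integrable_of_ae_mem {σ : Measure Plane} [IsFiniteMeasure σ] {K : Set Plane}
    (hK : IsCompact K) (hσ : ∀ᵐ q ∂σ, q ∈ K) {f : Plane → ℝ} (hf : Continuous f) :
    Integrable f σ := by
  obtain ⟨C, hC⟩ := exists_abs_bound hK hf.continuousOn
  exact Integrable.of_bound hf.aestronglyMeasurable C (hσ.mono fun q hq => hC q hq)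

/-- The dual energy, up to a term that depends only on `σ`. -/
def dualEnergy (r₀ H Ω : ℝ) (σ : Measure Plane) (ρ : ℝ → ℝ) (P : Plane → ℝ) : ℝ :=
  -(∫ q, star r₀ H P q ∂σ) + profileEnergy r₀ H Ω ρ P

/-- The dual energy is coercive in the additive constant of the potential. -/
lemma exists_dualEnergy_le {r₀ H Ω R : ℝ} (hr₀ : 0 < r₀) (hH : 0 < H) (hΩ : 0 < Ω) (hR : 0 ≤ R)
    {σ : Measure Plane} [IsProbabilityMeasure σ] (hσ : ∀ᵐ q ∂σ, q ∈ box R) :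
    ∃ C, ∀ (ρ : ℝ → ℝ) (P : Plane → ℝ), IsPot (box R) P → IsPair r₀ H Ω ρ P →
      dualEnergy r₀ H Ω σ ρ P ≤ C - |P 0| := by
  -- The zero profile has energy zero and the rectangle `[0, s₁] × [0, H]` of mass two has energy at
  -- most `2 (c₀(s₁) - P 0)`; the second bound gains `2 |P 0|` against the `P 0` of the transform.
  obtain ⟨s₁, hs₁, hm⟩ := exists_cumWeight_eq hr₀ (c := 2 / H) (by positivity)
  have ha := sEnd_pos hr₀
  have hk := kin_nonneg hr₀ Ω hs₁.2
  refine ⟨2 * kin r₀ Ω s₁, fun ρ P hP h => ?_⟩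
  have hPc := hP.continuous (isCompact_box R)
  have h1 : -(∫ q, star r₀ H P q ∂σ) ≤ P 0 := by
    have hi := integrable_of_ae_mem (isCompact_box R) hσ
      (continuous_star hr₀ hH (hPc.continuousOn (s := domC r₀ H)))
    have : ∫ _, -P 0 ∂σ ≤ ∫ q, star r₀ H P q ∂σ := by
      refine integral_mono (integrable_const _) hi fun q => ?_
      have := young_star (hPc.continuousOn (s := domC r₀ H)) (zero_mem_domC hr₀ hH) q
      rw [inner_zero_left] at this
      simp only
      linarith
    simp only [integral_const, probReal_univ, one_smul] at this
    linarith
  have prof : ∀ c ∈ Ico 0 (sEnd r₀), (fun _ : ℝ => c) ∈ profiles r₀ H := fun c hc =>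
    mem_profiles_of_monotoneOn monotoneOn_const fun z _ => hc
  have cint : ∀ c ∈ Ico 0 (sEnd r₀), Integrable (fun p => kin r₀ Ω (p 0) - P p)
      (regionMeasure r₀ H fun _ => c) := by
    intro c hc
    have := isFiniteMeasure_regionMeasure hr₀ (prof c hc) hc.2 (fun _ _ => le_rfl)
    obtain ⟨C, hC⟩ := exists_abs_bound (isCompact_domC r₀ H) hPc.continuousOn
    refine Integrable.of_bound (((measurable_kin r₀ Ω).comp
      (measurable_coord 0)).sub hPc.measurable).aestronglyMeasurable (kin r₀ Ω c + C) ?_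
    filter_upwards [regionMeasure_ae (prof c hc)] with p hp
    have h1 := hC p (domD_subset_domC _ _ (region_subset_domD (prof c hc).2 hp))
    have h2 := kin_nonneg hr₀ Ω (hp.2.2.trans_lt hc.2)
    have h3 := kin_le_kin (Ω := Ω) hr₀ hc.2 hp.2.2
    refine (norm_sub_le _ _).trans ?_
    rw [Real.norm_eq_abs, Real.norm_eq_abs, abs_of_nonneg h2]
    exact add_le_add h3 h1
  have h2 : profileEnergy r₀ H Ω ρ P ≤ 0 := by
    have h0 : (0 : ℝ) ∈ Ico 0 (sEnd r₀) := ⟨le_rfl, ha⟩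
    refine (h.profileEnergy_le hr₀ hΩ hR hP (prof 0 h0) (cint 0 h0)).trans ?_
    rw [(profileEnergy_eq (prof 0 h0) (cint 0 h0)).2]
    simp
  have h3 : profileEnergy r₀ H Ω ρ P ≤ 2 * kin r₀ Ω s₁ - 2 * P 0 := by
    refine (h.profileEnergy_le hr₀ hΩ hR hP (prof s₁ hs₁) (cint s₁ hs₁)).trans ?_
    have hE := profileEnergy_eq (prof s₁ hs₁) (cint s₁ hs₁)
    rw [hE.2]
    have h4 : ∀ z ∈ Icc 0 H, potentialPi r₀ Ω P s₁ z ≤ (kin r₀ Ω s₁ - P 0) * (2 / H) := by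
      intro z hz
      have hs := (hP.continuous_section (isCompact_box R) z).continuousOn (s := Icc 0 (sEnd r₀))
      rw [potentialPi_eq, ← hm]
      have h5 : (kin r₀ Ω s₁ - P 0) * cumWeight r₀ s₁ =
          ∫ s in (0:ℝ)..s₁, (kin r₀ Ω s₁ - P 0) * weight r₀ s := by
        rw [intervalIntegral.integral_const_mul, integral_weight hr₀ ha hs₁.2, cumWeight_zero,
          sub_zero]
      rw [h5]
      refine intervalIntegral.integral_mono_on hs₁.1
        (intervalIntegrable_dens hr₀ Ω hs ⟨le_rfl, ha⟩ hs₁)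
        ((intervalIntegrable_weight hr₀ ha hs₁.2).const_mul _) fun s hs => ?_
      have h6 := kin_le_kin (Ω := Ω) hr₀ hs₁.2 hs.2
      have h7 := (hP.bounds hR (r₀ := r₀) (H := H) (p := !₂[s, z])
        ⟨⟨hs.1, hs.2.trans hs₁.2.le⟩, hz⟩).1
      exact mul_le_mul_of_nonneg_right (by linarith) (weight_nonneg _ _)
    have h5 := setIntegral_mono_on hE.1 (integrableOn_const (by simp)) measurableSet_Icc h4
    refine h5.trans (le_of_eq ?_)
    rw [setIntegral_const, Real.volume_real_Icc, sub_zero, max_eq_left hH.le, smul_eq_mul]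
    field_simp
  unfold dualEnergy
  rcases abs_cases (P 0) with h4 | h4 <;> rw [h4.1] <;> linarith

/-- The dual energy attains its maximum among the potentials with subgradients in `B`. -/
lemma exists_maximizer {r₀ H Ω R : ℝ} (hr₀ : 0 < r₀) (hH : 0 < H) (hΩ : 0 < Ω) (hR : 0 ≤ R)
    {B : Set Plane} (hB : IsCompact B) (hBne : B.Nonempty) (hBR : B ⊆ box R)
    {σ : Measure Plane} [IsProbabilityMeasure σ] (hσ : ∀ᵐ q ∂σ, q ∈ B) :
    ∃ ρ P, IsPot B P ∧ IsPair r₀ H Ω ρ P ∧ ∀ ρ' P', IsPot B P' → IsPair r₀ H Ω ρ' P' →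
      dualEnergy r₀ H Ω σ ρ' P' ≤ dualEnergy r₀ H Ω σ ρ P := by
  obtain ⟨C, hC⟩ := exists_dualEnergy_le hr₀ hH hΩ hR (hσ.mono fun q hq => hBR hq)
  let A : Set ℝ := {x | ∃ ρ P, IsPot B P ∧ IsPair r₀ H Ω ρ P ∧ x = dualEnergy r₀ H Ω σ ρ P}
  have hAne : A.Nonempty := by
    have hp := isPot_leg hB hBne (continuousOn_const (c := (0:ℝ)))
    obtain ⟨ρ, hρ⟩ := exists_isPair (H := H) hr₀ hΩ (hp.mono hBR)
    exact ⟨_, ρ, _, hp, hρ, rfl⟩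
  have hAb : BddAbove A := by
    refine ⟨C, ?_⟩
    rintro _ ⟨ρ, P, hP, h, rfl⟩
    exact (hC ρ P (hP.mono hBR) h).trans (by linarith [abs_nonneg (P 0)])
  -- a maximizing sequence has bounded additive constants, hence a limit along a subsequence
  obtain ⟨u, -, hu, huA⟩ := exists_seq_tendsto_sSup hAne hAb
  choose ρ P hP h hval using huA
  obtain ⟨m, hm⟩ := hu.bddBelow_range
  have hP0 : ∀ n, |P n 0| ≤ C - m := fun n => by
    have h1 := hC _ _ ((hP n).mono hBR) (h n)
    rw [← hval n] at h1
    linarith [hm ⟨n, rfl⟩]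
  obtain ⟨φ, P', hφ, hlim⟩ := exists_subseq_lipschitz
    (fun n => (hP n).lipschitzWith (exists_norm_bound hB).choose_spec) hP0
  have hP' : IsPot B P' := isPot_of_tendsto hB (fun n => hP _) hlim
  have hcont : ∀ n, ContinuousOn (P n) (domC r₀ H) := fun n => ((hP n).continuous hB).continuousOn
  obtain ⟨K, hK⟩ := exists_norm_bound (isCompact_domC r₀ H)
  have hstarL : ∀ n, LipschitzWith K (star r₀ H (P n)) :=
    fun n => (isPot_star hr₀ hH (hcont n)).lipschitzWith hK
  have hstar0 : ∀ n, |star r₀ H (P n) 0| ≤ C - m := fun n => by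
    rw [star_zero hr₀ hH hR ((hP n).mono hBR), abs_neg]; exact hP0 n
  obtain ⟨ψ, Q, hψ, hQ⟩ := exists_subseq_lipschitz (fun n => hstarL (φ n)) fun n => hstar0 _
  have hθ : Tendsto (fun n => φ (ψ n)) atTop atTop := hφ.tendsto_atTop.comp hψ.tendsto_atTop
  have hlim' : ∀ p, Tendsto (fun n => P (φ (ψ n)) p) atTop (𝓝 (P' p)) :=
    fun p => (hlim p).comp hψ.tendsto_atTop
  have hQpot : IsPot (domC r₀ H) Q := isPot_of_tendsto (isCompact_domC r₀ H)
    (fun n => isPot_star hr₀ hH (hcont _)) hQ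
  have hQge : ∀ q, star r₀ H P' q ≤ Q q := by
    intro q
    refine leg_le ⟨0, zero_mem_domC hr₀ hH⟩ fun p hp => ?_
    refine le_of_tendsto_of_tendsto' (tendsto_const_nhds.sub (hlim' p)) (hQ q) fun n => ?_
    exact le_leg (isCompact_domC r₀ H) (hcont _) q hp
  -- The profile is fixed to be the optimal one of the limit: the energies along the sequence can
  -- only increase when their own profiles are replaced by it.
  obtain ⟨ρ', hρ'⟩ := exists_isPair (H := H) hr₀ hΩ (hP'.mono hBR)
  refine ⟨ρ', P', hP', hρ', fun ρ'' P'' hP'' hρ'' => ?_⟩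
  have hsup : dualEnergy r₀ H Ω σ ρ'' P'' ≤ sSup A := le_csSup hAb ⟨_, _, hP'', hρ'', rfl⟩
  refine hsup.trans ?_
  have hfin := hρ'.isFiniteMeasure hr₀ hΩ hR (hP'.mono hBR)
  have hint : ∀ {f : Plane → ℝ}, Continuous f → Integrable f (regionMeasure r₀ H ρ') :=
    fun hf => hρ'.integrable_of_continuous hr₀ hΩ hR (hP'.mono hBR) hf
  have hkin := hρ'.integrable_kin hr₀ hΩ hR (hP'.mono hBR)
  have t1 : Tendsto (fun n => ∫ q, star r₀ H (P (φ (ψ n))) q ∂σ) atTop (𝓝 (∫ q, Q q ∂σ)) := by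
    obtain ⟨L, hL⟩ := exists_norm_bound hB
    refine tendsto_integral_of_dominated_convergence (fun _ => C - m + K * L)
      (fun n => (hstarL _).continuous.aestronglyMeasurable) (integrable_const _)
      (fun n => ?_) (ae_of_all _ hQ)
    filter_upwards [hσ] with q hq
    have h1 := (hstarL (φ (ψ n))).dist_le_mul q 0
    rw [dist_zero_right, Real.dist_eq] at h1
    have h2 : (K : ℝ) * ‖q‖ ≤ K * L := mul_le_mul_of_nonneg_left (hL q hq) K.2
    have h3 := abs_sub_abs_le_abs_sub (star r₀ H (P (φ (ψ n))) q) (star r₀ H (P (φ (ψ n))) 0)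
    have h4 := hstar0 (φ (ψ n))
    rw [Real.norm_eq_abs]
    linarith
  have t2 : Tendsto (fun n => profileEnergy r₀ H Ω ρ' (P (φ (ψ n)))) atTop
      (𝓝 (profileEnergy r₀ H Ω ρ' P')) := by
    unfold profileEnergy
    simp_rw [fun n => integral_sub hkin (hint ((hP (φ (ψ n))).continuous hB)),
      integral_sub hkin (hint (hP'.continuous hB))]
    refine tendsto_const_nhds.sub ?_
    refine tendsto_integral_of_dominated_convergence (fun _ => C - m + R * (sEnd r₀ + H))
      (fun n => ((hP _).continuous hB).aestronglyMeasurable) (integrable_const _)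
      (fun n => ?_) (ae_of_all _ hlim')
    filter_upwards [regionMeasure_ae hρ'.mem_profiles] with p hp
    have h1 := ((hP (φ (ψ n))).mono hBR).bounds hR
      (domD_subset_domC _ _ (region_subset_domD hρ'.range hp))
    have h2 := abs_le.1 (hP0 (φ (ψ n)))
    have h3 : 0 ≤ R * (sEnd r₀ + H) := by have := sEnd_pos hr₀; positivity
    rw [Real.norm_eq_abs, abs_le]
    constructor <;> linarith
  have t3 : Tendsto (fun n => u (φ (ψ n))) atTop (𝓝 (sSup A)) := hu.comp hθ
  have h5 : sSup A ≤ -(∫ q, Q q ∂σ) + profileEnergy r₀ H Ω ρ' P' := by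
    refine le_of_tendsto_of_tendsto' t3 (t1.neg.add t2) fun n => ?_
    rw [hval]
    refine add_le_add_right ?_ _
    exact (h _).profileEnergy_le hr₀ hΩ hR ((hP _).mono hBR) hρ'.mem_profiles
      (hkin.sub (hint ((hP _).continuous hB)))
  refine h5.trans (add_le_add_left (neg_le_neg ?_) _)
  exact integral_mono (integrable_of_ae_mem hB hσ (continuous_star hr₀ hH
      (hP'.continuous hB).continuousOn)) (integrable_of_ae_mem hB hσ (hQpot.continuous
      (isCompact_domC r₀ H))) hQge

open BoundedContinuousFunction in
/-- Existence of optimal triples for targets with second coordinate bounded away from zero. The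
first variation of the dual energy in the direction of a test function `f` yields
`∫ f ∘ ∇P e χ_{D_ρ} ≤ ∫ f dσ`. -/
lemma exists_isTriple_of_boxFrom {r₀ H Ω R δ : ℝ} (hr₀ : 0 < r₀) (hH : 0 < H) (hΩ : 0 < Ω)
    (hR : 0 ≤ R) (hδ : 0 < δ) (hδR : δ ≤ R) {σ : Measure Plane} [IsProbabilityMeasure σ]
    (hσ : ∀ᵐ q ∂σ, q ∈ boxFrom δ R) : ∃ ρ P, IsTriple r₀ H Ω R σ ρ P := by
  have hB := isCompact_boxFrom δ R
  have hBne := boxFrom_nonempty hR hδR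
  have hBR := boxFrom_subset_box (R := R) hδ.le
  obtain ⟨ρm, Pm, hPm, hρm, hmax⟩ := exists_maximizer (Ω := Ω) hr₀ hH hΩ hR hB hBne hBR hσ
  have hPmc := hPm.continuous hB
  set Ψ := star r₀ H Pm with hΨ
  have hΨc : Continuous Ψ := continuous_star hr₀ hH hPmc.continuousOn
  -- The maximizer `Pm` is compared with the transforms `Pn` of `Ψ + ε f`, which converge to `P`.
  set P := leg (boxFrom δ R) Ψ with hPdef
  have hP : IsPot (boxFrom δ R) P := isPot_leg hB hBne hΨc.continuousOn
  obtain ⟨ρ, hρ⟩ := exists_isPair (H := H) hr₀ hΩ (hP.mono hBR)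
  have hfin := hρ.isFiniteMeasure hr₀ hΩ hR (hP.mono hBR)
  have key : ∀ f : Plane →ᵇ ℝ, ∫ p, f (∇ P p) ∂(regionMeasure r₀ H ρ) ≤ ∫ q, f q ∂σ := by
    intro f
    let ε : ℕ → ℝ := fun n => 1 / ((n : ℝ) + 1)
    have hε : ∀ n, 0 < ε n := fun n => by positivity
    have hεlim : Tendsto ε atTop (𝓝 0) := tendsto_one_div_add_atTop_nhds_zero_nat
    have hε1 : ∀ n, ε n ≤ 1 := fun n => by
      have : (0:ℝ) ≤ n := by positivity
      simp only [ε]; rw [div_le_one (by positivity)]; linarith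
    let g : ℕ → Plane → ℝ := fun n q => Ψ q + ε n * f q
    have hgc : ∀ n, Continuous (g n) := fun n => hΨc.add (f.continuous.const_mul _)
    let Pn : ℕ → Plane → ℝ := fun n => leg (boxFrom δ R) (g n)
    have hPn : ∀ n, IsPot (boxFrom δ R) (Pn n) := fun n => isPot_leg hB hBne (hgc n).continuousOn
    have hPnc : ∀ n, Continuous (Pn n) := fun n => (hPn n).continuous hB
    have hfb : ∀ q, |f q| ≤ ‖f‖ := fun q => f.norm_coe_le_norm q
    have hdiff : ∀ n p, |Pn n p - P p| ≤ ε n * ‖f‖ := by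
      intro n p
      have hf' : ∀ q, -(ε n * ‖f‖) ≤ ε n * f q ∧ ε n * f q ≤ ε n * ‖f‖ := fun q => by
        have := abs_le.1 (hfb q)
        have h0 := (hε n).le
        constructor <;> nlinarith
      rw [abs_le]
      constructor
      · have : P p ≤ Pn n p + ε n * ‖f‖ := leg_le hBne fun q hq => by
          have h1 := le_leg hB (hgc n).continuousOn p hq
          simp only [g] at h1
          have := (hf' q).2
          change ⟪p, q⟫_ℝ - Ψ q ≤ leg (boxFrom δ R) (g n) p + _
          linarith
        linarith
      · have : Pn n p ≤ P p + ε n * ‖f‖ := leg_le hBne fun q hq => by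
          have h1 := le_leg hB hΨc.continuousOn p hq
          have := (hf' q).1
          simp only [g]
          linarith
        linarith
    have hPlim : ∀ p, Tendsto (fun n => Pn n p) atTop (𝓝 (P p)) := by
      intro p
      rw [tendsto_iff_dist_tendsto_zero]
      refine squeeze_zero (fun _ => dist_nonneg) (fun n => hdiff n p) ?_
      simpa using hεlim.mul_const ‖f‖
    choose ρn hρn using fun n => exists_isPair (H := H) hr₀ hΩ ((hPn n).mono hBR)
    have hineq : ∀ n, ∫ p, f (∇ (Pn n) p) ∂(regionMeasure r₀ H (ρn n)) ≤ ∫ q, f q ∂σ := by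
      intro n
      have hpn := hPn n
      have hfin' := (hρn n).isFiniteMeasure hr₀ hΩ hR (hpn.mono hBR)
      have hint : ∀ {f : Plane → ℝ}, Continuous f → Integrable f (regionMeasure r₀ H (ρn n)) :=
        fun hf => (hρn n).integrable_of_continuous hr₀ hΩ hR (hpn.mono hBR) hf
      have hkin := (hρn n).integrable_kin hr₀ hΩ hR (hpn.mono hBR)
      have hσf : Integrable f σ := f.integrable σ
      have hσΨ : Integrable Ψ σ := integrable_of_ae_mem hB hσ hΨc
      have h1 := hmax _ _ hpn (hρn n)
      have h2 := hρm.profileEnergy_le hr₀ hΩ hR (hPm.mono hBR) (hρn n).mem_profiles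
        (hkin.sub (hint hPmc))
      have h3 : ∫ q, star r₀ H (Pn n) q ∂σ ≤ ∫ q, Ψ q ∂σ + ε n * ∫ q, f q ∂σ := by
        rw [← integral_const_mul, ← integral_add hσΨ (hσf.const_mul _)]
        refine integral_mono_ae (integrable_of_ae_mem hB hσ
          (continuous_star hr₀ hH (hPnc n).continuousOn)) (hσΨ.add (hσf.const_mul _)) ?_
        filter_upwards [hσ] with q hq
        refine leg_le ⟨0, zero_mem_domC hr₀ hH⟩ fun p _ => ?_
        have := le_leg hB (hgc n).continuousOn p hq
        rw [real_inner_comm]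
        simp only [g] at this
        change ⟪p, q⟫_ℝ - leg (boxFrom δ R) (g n) p ≤ _
        linarith
      have h4 : profileEnergy r₀ H Ω (ρn n) (Pn n) =
          profileEnergy r₀ H Ω (ρn n) Pm + ∫ p, (Pm p - Pn n p) ∂(regionMeasure r₀ H (ρn n)) := by
        unfold profileEnergy
        rw [integral_sub hkin (hint hPmc), integral_sub hkin (hint (hPnc n)),
          integral_sub (hint hPmc) (hint (hPnc n))]
        ring
      have h5 : ε n * ∫ p, f (∇ (Pn n) p) ∂(regionMeasure r₀ H (ρn n)) ≤
          ∫ p, (Pm p - Pn n p) ∂(regionMeasure r₀ H (ρn n)) := by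
        rw [← integral_const_mul]
        have hfi : Integrable (fun p => f (∇ (Pn n) p)) (regionMeasure r₀ H (ρn n)) :=
          Integrable.of_bound (f.continuous.measurable.comp
            (measurable_gradient _)).aestronglyMeasurable ‖f‖ (ae_of_all _ fun p => hfb _)
        refine integral_mono_ae (hfi.const_mul _) ((hint hPmc).sub (hint (hPnc n))) ?_
        filter_upwards [regionMeasure_ae (hρn n).mem_profiles,
          (regionMeasure_absolutelyContinuous r₀ H (ρn n)).ae_le
            (hpn.ae_differentiableAt hB)] with p hp hd
        obtain ⟨q, hq, hq1, hq2⟩ := exists_leg_eq hB hBne (hgc n).continuousOn p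
        have hgrad : q = ∇ (Pn n) p := by
          refine eq_gradient_of_subgradient hd (Eventually.of_forall fun p' => ?_)
          have := le_leg hB (hgc n).continuousOn p' hq
          rw [inner_sub_left]
          change leg (boxFrom δ R) (g n) p + _ ≤ leg (boxFrom δ R) (g n) p'
          linarith
        have hpD := domD_subset_domC _ _ (region_subset_domD (hρn n).range hp)
        have h6 := young_star (hPmc.continuousOn (s := domC r₀ H)) hpD q
        rw [← hΨ] at h6
        rw [← hgrad]
        simp only [g] at hq1
        change leg (boxFrom δ R) (g n) p = _ at hq1
        change ε n * f q ≤ Pm p - leg (boxFrom δ R) (g n) p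
        linarith
      unfold dualEnergy at h1
      have h6 : ε n * ∫ p, f (∇ (Pn n) p) ∂(regionMeasure r₀ H (ρn n)) ≤ ε n * ∫ q, f q ∂σ := by
        linarith
      exact le_of_mul_le_mul_left h6 (hε n)
    have hb : ∀ n, |Pn n 0| ≤ |P 0| + ‖f‖ := by
      intro n
      have h1 := hdiff n 0
      have h2 := abs_sub_abs_le_abs_sub (Pn n 0) (P 0)
      have h3 : ε n * ‖f‖ ≤ 1 * ‖f‖ := mul_le_mul_of_nonneg_right (hε1 n) (norm_nonneg _)
      linarith
    obtain ⟨φ, ρ', P', hφ, -, hpair, hconv⟩ := exists_subseq_isPair hr₀ hH hΩ hR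
      (fun n => (hPn n).mono hBR) hρn hb
    have hP'eq : P' = P := by
      funext p
      exact tendsto_nhds_unique (hconv.1 p) ((hPlim p).comp hφ.tendsto_atTop)
    rw [hP'eq] at hpair hconv
    -- the limit profile does not depend on `f`, as the optimal profile of `P` is unique
    have hm : regionMeasure r₀ H ρ' = regionMeasure r₀ H ρ :=
      regionMeasure_congr (hpair.ae_eq_of_boxFrom hr₀ hδ hP hρ)
    have h1 := hconv.2 (fun n p => f (∇ (Pn (φ n)) p)) (fun p => f (∇ P p)) ‖f‖
      (fun n => (f.continuous.measurable.comp (measurable_gradient _)).aestronglyMeasurable)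
      (fun n => ae_of_all _ fun p _ => hfb _) (by
        filter_upwards [ae_tendsto_gradient hB (fun n => hPn (φ n)) hP hconv.1] with p hp _
        exact (f.continuous.tendsto _).comp hp)
    rw [hm] at h1
    exact le_of_tendsto' h1 fun n => hineq (φ n)
  refine ⟨ρ, P, hP.mono hBR, hρ, ?_⟩
  refine ext_of_forall_integral_eq_of_IsFiniteMeasure fun f => ?_
  rw [integral_map (measurable_gradient P).aemeasurable f.continuous.aestronglyMeasurable]
  refine le_antisymm (key f) ?_
  have := key (-f)
  simp only [BoundedContinuousFunction.coe_neg, Pi.neg_apply, integral_neg] at this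
  linarith

/-- Existence of optimal triples. The target measure is shifted upwards and the shift is then
sent to zero; this costs an enlargement of the box of the dual variables. -/
lemma exists_isTriple {r₀ H Ω R : ℝ} (hr₀ : 0 < r₀) (hH : 0 < H) (hΩ : 0 < Ω)
    (hR : 0 ≤ R) {σ : Measure Plane} [IsProbabilityMeasure σ]
    (hσ : ∀ᵐ q ∂σ, q ∈ box R) : ∃ ρ P, IsTriple r₀ H Ω (R + 1) σ ρ P := by
  let ε : ℕ → ℝ := fun n => 1 / ((n : ℝ) + 1)
  have hε : ∀ n, 0 < ε n := fun n => by positivity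
  have hεlim : Tendsto ε atTop (𝓝 0) := tendsto_one_div_add_atTop_nhds_zero_nat
  have hε1 : ∀ n, ε n ≤ 1 := fun n => by
    have : (0:ℝ) ≤ n := by positivity
    simp only [ε]; rw [div_le_one (by positivity)]; linarith
  let sh : ℕ → Plane → Plane := fun n q => q + !₂[0, ε n]
  have hshc : ∀ n, Continuous (sh n) := fun n => continuous_id.add continuous_const
  have hprob : ∀ n, IsProbabilityMeasure (σ.map (sh n)) := fun n =>
    Measure.isProbabilityMeasure_map (hshc n).aemeasurable
  have hmem : ∀ n, ∀ᵐ q ∂(σ.map (sh n)), q ∈ boxFrom (ε n) (R + 1) := by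
    intro n
    refine (ae_map_iff (hshc n).aemeasurable (isCompact_boxFrom _ _).measurableSet).2 ?_
    filter_upwards [hσ] with q hq
    have h0 : (sh n q) 0 = q 0 := by simp [sh]
    have h1 : (sh n q) 1 = q 1 + ε n := by simp [sh]
    have := hε1 n
    refine ⟨?_, ?_⟩
    · rw [h0]; exact ⟨hq.1.1, hq.1.2.trans (by linarith)⟩
    · rw [h1]; exact ⟨by linarith [hq.2.1], by linarith [hq.2.2]⟩
  choose ρ P h using fun n => exists_isTriple_of_boxFrom (Ω := Ω) hr₀ hH hΩ (by linarith) (hε n)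
    (by linarith [hε1 n]) (hmem n)
  obtain ⟨φ, ρ', P', -, ht, -⟩ := exists_subseq_isTriple hr₀ hH hΩ (by linarith) h (σ' := σ) (by
    intro f
    simp_rw [fun n => integral_map (μ := σ) (hshc n).aemeasurable
      (f.continuous.aestronglyMeasurable (μ := σ.map (sh n)))]
    refine tendsto_integral_of_dominated_convergence (fun _ => ‖f‖)
      (fun n => (f.continuous.comp (hshc n)).aestronglyMeasurable) (integrable_const _)
      (fun n => ae_of_all _ fun q => f.norm_coe_le_norm _) (ae_of_all _ fun q => ?_)
    refine (f.continuous.tendsto _).comp ?_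
    have h1 : Tendsto (fun n => (!₂[(0:ℝ), ε n] : Plane)) atTop (𝓝 0) := by
      have := (continuous_mk₂.tendsto (0, 0)).comp ((tendsto_const_nhds (x := (0:ℝ))).prodMk_nhds
        hεlim)
      have h0 : (!₂[(0:ℝ), 0] : Plane) = 0 := by ext i; fin_cases i <;> rfl
      rw [h0] at this
      exact this
    simpa using h1.const_add q)
  exact ⟨ρ', P', ht⟩

/-! ### Optimal profiles and potentials of the same target are interchangeable -/

/-- The open rectangle inside the physical domain. -/
def domO (r₀ H : ℝ) : Set Plane := {p | p 0 ∈ Ioo 0 (sEnd r₀) ∧ p 1 ∈ Ioo 0 H}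

lemma isOpen_domO (r₀ H : ℝ) : IsOpen (domO r₀ H) :=
  (isOpen_Ioo.preimage (continuous_coord 0)).inter (isOpen_Ioo.preimage (continuous_coord 1))

lemma domO_subset_domC (r₀ H : ℝ) : domO r₀ H ⊆ domC r₀ H :=
  fun _ hp => ⟨Ioo_subset_Icc_self hp.1, Ioo_subset_Icc_self hp.2⟩

lemma domO_subset_domD (r₀ H : ℝ) : domO r₀ H ⊆ domD r₀ H :=
  fun _ hp => ⟨Ioo_subset_Ico_self hp.1, Ioo_subset_Icc_self hp.2⟩

lemma ae_ne_const (c : ℝ) : ∀ᵐ z : ℝ, z ≠ c := by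
  have : ({c}ᶜ : Set ℝ) ∈ ae (volume : Measure ℝ) := compl_mem_ae_iff.2 (by simp)
  filter_upwards [this] with z hz using hz

lemma ae_coord_zero_ne : ∀ᵐ p : Plane, p 0 ≠ 0 := by
  refine ae_plane_of_ae_ae ((measurable_coord 0) (measurableSet_singleton 0)).compl
    (ae_of_all _ fun z => ?_)
  simpa using ae_ne_const 0

lemma ae_mem_domO (r₀ H : ℝ) : ∀ᵐ p : Plane, p ∈ domD r₀ H → p ∈ domO r₀ H := by
  filter_upwards [ae_coord_zero_ne, ae_coord_one (ae_ne_const 0), ae_coord_one (ae_ne_const H)]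
    with p h0 h1 h2 hp
  exact ⟨⟨lt_of_le_of_ne hp.1.1 (Ne.symm h0), hp.1.2⟩, lt_of_le_of_ne hp.2.1 (Ne.symm h1),
    lt_of_le_of_ne hp.2.2 h2⟩

lemma regionMeasure_ae_domO {r₀ H : ℝ} {ρ : ℝ → ℝ} (hρ : ρ ∈ profiles r₀ H) :
    ∀ᵐ p ∂(regionMeasure r₀ H ρ), p ∈ domO r₀ H := by
  filter_upwards [regionMeasure_ae hρ,
    (regionMeasure_absolutelyContinuous r₀ H ρ).ae_le (ae_mem_domO r₀ H)] with p h1 h2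
  exact h2 (region_subset_domD hρ.2 h1)

/-- If the Young inequality is an equality at an interior point of differentiability, then the dual
point is the gradient. -/
lemma eq_gradient_of_young {r₀ H : ℝ} {P Ψ : Plane → ℝ} {p q : Plane} (hp : p ∈ domO r₀ H)
    (hd : DifferentiableAt ℝ P p) (hy : ∀ p' ∈ domO r₀ H, ⟪p', q⟫_ℝ ≤ P p' + Ψ q)
    (he : P p + Ψ q = ⟪p, q⟫_ℝ) : q = ∇ P p := by
  refine eq_gradient_of_subgradient hd ?_
  filter_upwards [(isOpen_domO r₀ H).mem_nhds hp] with p' hp'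
  have := hy p' hp'
  rw [inner_sub_left]
  linarith

section Cross

variable {r₀ H Ω R R' : ℝ} {σ : Measure Plane} {ρ ρ' : ℝ → ℝ}
  {P P' : Plane → ℝ}

lemma IsTriple.ae_mem_box (h : IsTriple r₀ H Ω R σ ρ P) : ∀ᵐ q ∂σ, q ∈ box R := by
  rw [← h.push]
  refine (ae_map_iff (measurable_gradient P).aemeasurable (isCompact_box R).measurableSet).2 ?_
  filter_upwards [(regionMeasure_absolutelyContinuous r₀ H ρ).ae_le
    (h.pot.ae_differentiableAt (isCompact_box R))] with p hp
  exact (h.pot.gradient_mem hp).1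

lemma IsTriple.integrable_inner (hr₀ : 0 < r₀) (hΩ : 0 < Ω) (hR : 0 ≤ R)
    (h : IsTriple r₀ H Ω R σ ρ P) :
    Integrable (fun p => ⟪p, ∇ P p⟫_ℝ) (regionMeasure r₀ H ρ) := by
  have := h.pair.isFiniteMeasure hr₀ hΩ hR h.pot
  obtain ⟨K, hK⟩ := exists_norm_bound (isCompact_box R)
  obtain ⟨L, hL⟩ := exists_norm_bound (isCompact_domC r₀ H)
  refine Integrable.of_bound (measurable_id.inner (measurable_gradient P)).aestronglyMeasurable
    (L * K) ?_
  filter_upwards [regionMeasure_ae h.pair.mem_profiles,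
    (regionMeasure_absolutelyContinuous r₀ H ρ).ae_le
    (h.pot.ae_differentiableAt (isCompact_box R))] with p hp hd
  refine (norm_inner_le_norm _ _).trans ?_
  exact mul_le_mul (hL p (domD_subset_domC _ _ (region_subset_domD h.pair.range hp)))
    (hK _ (h.pot.gradient_mem hd).1) (norm_nonneg _) L.2

variable [IsProbabilityMeasure σ]

/-- The primal energy `∫ (c₀ - ⟨p, ∇P⟩) e χ_{D_ρ}` of a triple, up to a term that depends only on
`σ`. -/
def primalEnergy (r₀ H Ω : ℝ) (ρ : ℝ → ℝ) (P : Plane → ℝ) : ℝ :=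
  ∫ p, (kin r₀ Ω (p 0) - ⟪p, ∇ P p⟫_ℝ) ∂(regionMeasure r₀ H ρ)

lemma IsTriple.integrable_star_comp (hr₀ : 0 < r₀) (hH : 0 < H)
    (hPc : ContinuousOn P' (domC r₀ H)) (h : IsTriple r₀ H Ω R σ ρ P) :
    Integrable (fun p => star r₀ H P' (∇ P p)) (regionMeasure r₀ H ρ) := by
  have hc := continuous_star hr₀ hH hPc
  have h1 := integrable_of_ae_mem (isCompact_box R) h.ae_mem_box hc
  rw [← h.push] at h1
  exact (integrable_map_measure hc.aestronglyMeasurable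
    (measurable_gradient P).aemeasurable).1 h1

/-- Weak duality for the profile of one triple and the potential of another one. -/
lemma IsTriple.primal_sub_dual (hr₀ : 0 < r₀) (hH : 0 < H) (hΩ : 0 < Ω) (hR : 0 ≤ R)
    (h : IsTriple r₀ H Ω R σ ρ P) (hP' : Continuous P') :
    primalEnergy r₀ H Ω ρ P - dualEnergy r₀ H Ω σ ρ P' =
      ∫ p, (P' p + star r₀ H P' (∇ P p) - ⟪p, ∇ P p⟫_ℝ) ∂(regionMeasure r₀ H ρ) := by
  have hk := h.pair.integrable_kin hr₀ hΩ hR h.pot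
  have hi := h.integrable_inner hr₀ hΩ hR
  have hp := h.pair.integrable_of_continuous hr₀ hΩ hR h.pot hP'
  have hs := h.integrable_star_comp hr₀ hH hP'.continuousOn
  have hps : Integrable (fun p => P' p + star r₀ H P' (∇ P p)) (regionMeasure r₀ H ρ) := hp.add hs
  unfold primalEnergy dualEnergy profileEnergy
  rw [← h.integral_comp (continuous_star hr₀ hH hP'.continuousOn).aestronglyMeasurable,
    integral_sub hk hi, integral_sub hk hp, integral_sub hps hi, integral_add hp hs]
  ring

/-- The duality gap of a triple vanishes, by equality in Young's inequality along the gradient. -/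
lemma IsTriple.primal_eq_dual (hr₀ : 0 < r₀) (hH : 0 < H) (hΩ : 0 < Ω) (hR : 0 ≤ R)
    (h : IsTriple r₀ H Ω R σ ρ P) :
    primalEnergy r₀ H Ω ρ P = dualEnergy r₀ H Ω σ ρ P := by
  rw [← sub_eq_zero, h.primal_sub_dual hr₀ hH hΩ hR (h.pot.continuous (isCompact_box R))]
  refine integral_eq_zero_of_ae ?_
  filter_upwards [regionMeasure_ae h.pair.mem_profiles,
    (regionMeasure_absolutelyContinuous r₀ H ρ).ae_le
    (h.pot.ae_differentiableAt (isCompact_box R))] with p hp hd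
  have := h.pot.add_star_eq (isCompact_box R)
    (domD_subset_domC _ _ (region_subset_domD h.pair.range hp)) (h.pot.gradient_mem hd).2
  simp [this]

/-- The profile of an optimal triple and the potential of another optimal triple for the same target
form again an optimal triple, and the gradients of the potentials agree on the region. -/
lemma IsTriple.cross (hr₀ : 0 < r₀) (hH : 0 < H) (hΩ : 0 < Ω) (hR : 0 ≤ R) (hR' : 0 ≤ R')
    (h : IsTriple r₀ H Ω R σ ρ P) (h' : IsTriple r₀ H Ω R' σ ρ' P') :
    IsTriple r₀ H Ω R' σ ρ P' ∧ ∀ᵐ p ∂(regionMeasure r₀ H ρ), ∇ P p = ∇ P' p := by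
  -- Both triples have dual energy equal to primal energy; the two cross inequalities below then
  -- form a closed chain, in which all members are equal.
  have aux : ∀ {R₁ R₂ : ℝ} {ρ₁ ρ₂ : ℝ → ℝ} {P₁ P₂ : Plane → ℝ}, 0 ≤ R₁ → 0 ≤ R₂ →
      IsTriple r₀ H Ω R₁ σ ρ₁ P₁ → IsTriple r₀ H Ω R₂ σ ρ₂ P₂ →
      (0 ≤ᵐ[regionMeasure r₀ H ρ₁] fun p => P₂ p + star r₀ H P₂ (∇ P₁ p) - ⟪p, ∇ P₁ p⟫_ℝ) ∧
      dualEnergy r₀ H Ω σ ρ₂ P₂ ≤ dualEnergy r₀ H Ω σ ρ₁ P₂ ∧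
      dualEnergy r₀ H Ω σ ρ₁ P₂ ≤ primalEnergy r₀ H Ω ρ₁ P₁ := by
    intro R₁ R₂ ρ₁ ρ₂ P₁ P₂ hR₁ hR₂ h₁ h₂
    have hc := h₂.pot.continuous (isCompact_box R₂)
    have hnn : 0 ≤ᵐ[regionMeasure r₀ H ρ₁]
        fun p => P₂ p + star r₀ H P₂ (∇ P₁ p) - ⟪p, ∇ P₁ p⟫_ℝ := by
      filter_upwards [regionMeasure_ae h₁.pair.mem_profiles] with p hp
      have := young_star (hc.continuousOn (s := domC r₀ H))
        (domD_subset_domC _ _ (region_subset_domD h₁.pair.range hp)) (∇ P₁ p)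
      simp only [Pi.zero_apply]
      linarith
    refine ⟨hnn, ?_, ?_⟩
    · refine add_le_add_right ?_ _
      exact h₂.pair.profileEnergy_le hr₀ hΩ hR₂ h₂.pot h₁.pair.mem_profiles
        ((h₁.pair.integrable_kin hr₀ hΩ hR₁ h₁.pot).sub
          (h₁.pair.integrable_of_continuous hr₀ hΩ hR₁ h₁.pot hc))
    · rw [← sub_nonneg, h₁.primal_sub_dual hr₀ hH hΩ hR₁ hc]
      exact integral_nonneg_of_ae hnn
  obtain ⟨hnn, a1, a2⟩ := aux hR hR' h h'
  obtain ⟨-, b1, b2⟩ := aux hR' hR h' h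
  have e1 := h.primal_eq_dual hr₀ hH hΩ hR
  have e2 := h'.primal_eq_dual hr₀ hH hΩ hR'
  have hc := h'.pot.continuous (isCompact_box R')
  have hi1 := h.pair.integrable_kin hr₀ hΩ hR h.pot
  have hi2 := h.pair.integrable_of_continuous hr₀ hΩ hR h.pot hc
  have hgap : ∫ p, (P' p + star r₀ H P' (∇ P p) - ⟪p, ∇ P p⟫_ℝ) ∂(regionMeasure r₀ H ρ) = 0 := by
    rw [← h.primal_sub_dual hr₀ hH hΩ hR hc]
    linarith
  have hyoung := (integral_eq_zero_iff_of_nonneg_ae hnn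
    ((hi2.add (h.integrable_star_comp hr₀ hH hc.continuousOn)).sub
      (h.integrable_inner hr₀ hΩ hR))).1 hgap
  have hgrad : ∀ᵐ p ∂(regionMeasure r₀ H ρ), ∇ P p = ∇ P' p := by
    filter_upwards [hyoung, regionMeasure_ae_domO h.pair.mem_profiles,
      (regionMeasure_absolutelyContinuous r₀ H ρ).ae_le
      (h'.pot.ae_differentiableAt (isCompact_box R'))] with p h1 h2 h3
    refine eq_gradient_of_young h2 h3 (fun p' hp' => young_star hc.continuousOn
      (domO_subset_domC _ _ hp') _) ?_
    simp only [Pi.zero_apply] at h1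
    linarith
  refine ⟨⟨h'.pot, ⟨h.pair.mono, h.pair.range, ?_⟩, ?_⟩, hgrad⟩
  · have E1 := profileEnergy_eq h.pair.mem_profiles (hi1.sub hi2)
    have E2 := profileEnergy_eq h'.pair.mem_profiles
      ((h'.pair.integrable_kin hr₀ hΩ hR' h'.pot).sub
        (h'.pair.integrable_of_continuous hr₀ hΩ hR' h'.pot hc))
    have E3 : profileEnergy r₀ H Ω ρ' P' = profileEnergy r₀ H Ω ρ P' := by
      unfold dualEnergy at *
      linarith
    rw [E1.2, E2.2] at E3
    have hle : (fun z => potentialPi r₀ Ω P' (ρ' z) z) ≤ᵐ[volume.restrict (Icc 0 H)]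
        fun z => potentialPi r₀ Ω P' (ρ z) z := by
      rw [EventuallyLE, ae_restrict_iff' measurableSet_Icc]
      filter_upwards [h'.pair.argmin] with z hz hzH
      exact (hz hzH).2 _ (h.pair.range z hzH)
    have heq := (integral_eq_iff_of_ae_le E2.1 E1.1 hle).1 E3
    rw [EventuallyEq, ae_restrict_iff' measurableSet_Icc] at heq
    filter_upwards [heq, h'.pair.argmin] with z h1 h2 hz
    refine ⟨h.pair.range z hz, fun r hr => ?_⟩
    rw [← h1 hz]
    exact (h2 hz).2 r hr
  · rw [← Measure.map_congr hgrad]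
    exact h.push

end Cross

/-! ### Two nondecreasing optimal profiles of the same potential -/

lemma ae_ae_of_ae_plane {q : Plane → Prop} (h : ∀ᵐ p : Plane, q p) :
    ∀ᵐ z : ℝ, ∀ᵐ s : ℝ, q !₂[s, z] := by
  have h1 : MeasurePreserving (Prod.swap : ℝ × ℝ → ℝ × ℝ) (volume.prod volume)
    (volume.prod volume) := Measure.measurePreserving_swap
  have h2 : MeasurePreserving (fun x : ℝ × ℝ => planeEquiv.symm x.swap) (volume.prod volume)
      volume := measurePreserving_planeEquiv_symm.comp h1
  have h3 := h2.quasiMeasurePreserving.ae h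
  have h4 := Measure.ae_ae_of_ae_prod h3
  simpa using h4

/-- Two nondecreasing profiles which are both minimizing for the potential `P` and have the same
image measure under `∇P`; `S₀` is an upper bound for them and `S` a larger number. -/
structure TwoProfiles (r₀ H Ω R S₀ S : ℝ) (P : Plane → ℝ) (ρ₁ ρ₂ : ℝ → ℝ) : Prop where
  hr₀ : 0 < r₀
  hH : 0 < H
  hΩ : 0 < Ω
  hR : 0 ≤ R
  hS₀ : 0 ≤ S₀
  hS : S₀ < S
  hSe : S < sEnd r₀
  pot : IsPot (box R) P
  pair₁ : IsPair r₀ H Ω ρ₁ P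
  pair₂ : IsPair r₀ H Ω ρ₂ P
  le₁ : ∀ᵐ z : ℝ, z ∈ Icc 0 H → ρ₁ z ≤ S₀
  le₂ : ∀ᵐ z : ℝ, z ∈ Icc 0 H → ρ₂ z ≤ S₀
  push : (regionMeasure r₀ H ρ₁).map (∇ P) = (regionMeasure r₀ H ρ₂).map (∇ P)

/-- The zeros of the density at the level `z = 0` that are minima of `Π_P(·, 0)` from the right. -/
def critSet (r₀ Ω : ℝ) (P : Plane → ℝ) : Set ℝ :=
  {s | s ∈ Ioo 0 (sEnd r₀) ∧ kin r₀ Ω s = P !₂[s, 0] ∧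
    ∀ s' ∈ Ico s (sEnd r₀), 0 ≤ ∫ x in s..s', dens r₀ Ω P 0 x}

/-- The properties of two minimizers `r₁`, `r₂` at the level `z` that hold at almost every level:
strictly between them the potential does not depend on the second variable up to a level strictly
above `z`. -/
structure GoodLevel (r₀ Ω S₀ : ℝ) (P : Plane → ℝ) (z r₁ r₂ : ℝ) : Prop where
  nonneg : 0 ≤ z
  arg₁ : IsArgmin r₀ Ω P z r₁
  arg₂ : IsArgmin r₀ Ω P z r₂
  le₁ : r₁ ≤ S₀
  le₂ : r₂ ≤ S₀
  const₁ : ∀ s, r₂ < s → s < r₁ → ∃ z' > z, ∀ x ∈ Icc 0 z', P !₂[s, x] = P !₂[s, 0]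
  const₂ : ∀ s, r₁ < s → s < r₂ → ∃ z' > z, ∀ x ∈ Icc 0 z', P !₂[s, x] = P !₂[s, 0]

lemma GoodLevel.symm {r₀ Ω S₀ : ℝ} {P : Plane → ℝ} {z r₁ r₂ : ℝ}
    (h : GoodLevel r₀ Ω S₀ P z r₁ r₂) : GoodLevel r₀ Ω S₀ P z r₂ r₁ :=
  ⟨h.nonneg, h.arg₂, h.arg₁, h.le₂, h.le₁, h.const₂, h.const₁⟩

/-- A positive minimizer at a level `z ≥ 0` at which `P` has the same value as at the level zero is
critical: the potential is nondecreasing in the level, so that minimality passes downwards. -/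
lemma IsArgmin.mem_critSet {r₀ Ω R : ℝ} (hr₀ : 0 < r₀) {P : Plane → ℝ} (hP : IsPot (box R) P)
    {z r : ℝ} (hz : 0 ≤ z) (h : IsArgmin r₀ Ω P z r) (hr : 0 < r)
    (he : P !₂[r, z] = P !₂[r, 0]) : r ∈ critSet r₀ Ω P := by
  refine ⟨⟨hr, h.1.2⟩, by rw [h.kin_eq hr₀ hP hr, he], fun s' hs' => ?_⟩
  have hc := fun z => (hP.continuous_section (isCompact_box R) z).continuousOn
    (s := Icc 0 (sEnd r₀))
  have hs'' : s' ∈ Ico 0 (sEnd r₀) := ⟨h.1.1.trans hs'.1, hs'.2⟩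
  refine (h.integral_nonneg hr₀ (hc z) hs'').trans ?_
  refine intervalIntegral.integral_mono_on hs'.1 (intervalIntegrable_dens hr₀ Ω (hc z) h.1 hs'')
    (intervalIntegrable_dens hr₀ Ω (hc 0) h.1 hs'') fun s _ => ?_
  exact mul_le_mul_of_nonneg_right (by linarith [hP.le_of_le (le_refl s) hz]) (weight_nonneg _ _)

lemma GoodLevel.eq_on {r₀ Ω S₀ R : ℝ} {P : Plane → ℝ} (hP : IsPot (box R) P) {z r₁ r₂ : ℝ}
    (h : GoodLevel r₀ Ω S₀ P z r₁ r₂) (hlt : r₂ < r₁) :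
    ∀ s ∈ Icc r₂ r₁, P !₂[s, z] = P !₂[s, 0] := by
  have hc := fun z => hP.continuous_section (isCompact_box R) z
  have hcl : IsClosed {s : ℝ | P !₂[s, z] = P !₂[s, 0]} := isClosed_eq (hc z) (hc 0)
  have hsub : Ioo r₂ r₁ ⊆ {s : ℝ | P !₂[s, z] = P !₂[s, 0]} := by
    intro s hs
    obtain ⟨z', hz', hx⟩ := h.const₁ s hs.1 hs.2
    exact hx z ⟨h.nonneg, le_of_lt hz'⟩
  have := closure_minimal hsub hcl
  rw [closure_Ioo hlt.ne] at this
  exact this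

lemma GoodLevel.mem_critSet {r₀ Ω S₀ R : ℝ} (hr₀ : 0 < r₀) {P : Plane → ℝ}
    (hP : IsPot (box R) P) {z r₁ r₂ : ℝ}
    (h : GoodLevel r₀ Ω S₀ P z r₁ r₂) (hlt : r₂ < r₁) :
    r₁ ∈ critSet r₀ Ω P ∧ (r₂ = 0 ∨ r₂ ∈ critSet r₀ Ω P) := by
  have he := h.eq_on hP hlt
  refine ⟨h.arg₁.mem_critSet hr₀ hP h.nonneg (h.arg₂.1.1.trans_lt hlt) (he _ ⟨hlt.le, le_rfl⟩), ?_⟩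
  rcases h.arg₂.1.1.eq_or_lt with h0 | h0
  · exact Or.inl h0.symm
  · exact Or.inr (h.arg₂.mem_critSet hr₀ hP h.nonneg h0 (he _ ⟨le_rfl, hlt.le⟩))

/-- Minimizers at good levels either coincide or avoid intervals without critical points. -/
lemma GoodLevel.notMem_Ico {r₀ Ω S₀ R : ℝ} (hr₀ : 0 < r₀) {P : Plane → ℝ}
    (hP : IsPot (box R) P) {z r₁ r₂ c d : ℝ} (h : GoodLevel r₀ Ω S₀ P z r₁ r₂) (hne : r₁ ≠ r₂)
    (hc : 0 < c) (hK : ∀ s ∈ Ico c d, s ∉ critSet r₀ Ω P) : r₁ ∉ Ico c d ∧ r₂ ∉ Ico c d := by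
  have aux : ∀ {r₁ r₂ : ℝ}, GoodLevel r₀ Ω S₀ P z r₁ r₂ → r₂ < r₁ →
      r₁ ∉ Ico c d ∧ r₂ ∉ Ico c d := by
    intro r₁ r₂ h hlt
    obtain ⟨h1, h2⟩ := h.mem_critSet hr₀ hP hlt
    refine ⟨fun hm => hK _ hm h1, fun hm => ?_⟩
    rcases h2 with h2 | h2
    · exact absurd hm.1 (by rw [h2]; exact not_le.2 hc)
    · exact hK _ hm h2
  rcases lt_or_gt_of_ne hne with hlt | hlt
  · exact (aux h.symm hlt).symm
  · exact aux h hlt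

/-- The cumulative discrepancy of two profiles above `s`: the difference of the masses of the two
regions to the right of `s`. -/
def gapFun (r₀ H : ℝ) (ρ₁ ρ₂ : ℝ → ℝ) (s : ℝ) : ℝ :=
  ∫ z in Icc 0 H, (cumWeight r₀ (max (ρ₁ z) s) - cumWeight r₀ (max (ρ₂ z) s))

/-- The length of the set of levels at which the profile is below `s`. -/
def levelLen (H : ℝ) (ρ : ℝ → ℝ) (s : ℝ) : ℝ := volume.real {z | z ∈ Icc 0 H ∧ ρ z < s}

section LevelLen

variable {H : ℝ} {ρ : ℝ → ℝ}

lemma measurableSet_level (hρ : MonotoneOn ρ (Icc 0 H)) (s : ℝ) :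
    MeasurableSet {z | z ∈ Icc 0 H ∧ ρ z < s} := by
  refine Set.OrdConnected.measurableSet ⟨fun x hx y hy z hz => ?_⟩
  have hzH : z ∈ Icc 0 H := ⟨hx.1.1.trans hz.1, hz.2.trans hy.1.2⟩
  exact ⟨hzH, (hρ hzH hy.1 hz.2).trans_lt hy.2⟩

lemma level_lt_top (s : ℝ) : volume {z | z ∈ Icc 0 H ∧ ρ z < s} ≠ ⊤ := by
  have h : {z | z ∈ Icc 0 H ∧ ρ z < s} ⊆ Icc 0 H := fun z hz => hz.1
  refine measure_ne_top_of_subset h ?_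
  rw [Real.volume_Icc]
  exact ENNReal.ofReal_ne_top

lemma le_levelLen (hρ : MonotoneOn ρ (Icc 0 H)) {z s : ℝ} (hz : z ∈ Icc 0 H) (h : ρ z < s) :
    z ≤ levelLen H ρ s := by
  have h1 : Icc 0 z ⊆ {z | z ∈ Icc 0 H ∧ ρ z < s} := fun x hx =>
    ⟨⟨hx.1, hx.2.trans hz.2⟩, (hρ ⟨hx.1, hx.2.trans hz.2⟩ hz hx.2).trans_lt h⟩
  have h2 := measureReal_mono h1 (level_lt_top s)
  rwa [Real.volume_real_Icc, sub_zero, max_eq_left hz.1] at h2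

lemma levelLen_le (hρ : MonotoneOn ρ (Icc 0 H)) {z s : ℝ} (hz : z ∈ Icc 0 H) (h : s ≤ ρ z) :
    levelLen H ρ s ≤ z := by
  have h1 : {z | z ∈ Icc 0 H ∧ ρ z < s} ⊆ Icc 0 z := fun x hx => by
    refine ⟨hx.1.1, ?_⟩
    by_contra! hlt
    exact absurd (h.trans (hρ hz hx.1 hlt.le)) (not_le.2 hx.2)
  have h2 := measureReal_mono h1 (measure_Icc_lt_top (μ := volume) (a := 0) (b := z)).ne
  rwa [Real.volume_real_Icc, sub_zero, max_eq_left hz.1] at h2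

lemma levelLen_mono {s t : ℝ} (hst : s ≤ t) : levelLen H ρ s ≤ levelLen H ρ t :=
  measureReal_mono (fun _ hz => ⟨hz.1, hz.2.trans_le hst⟩) (level_lt_top t)

lemma levelLen_mem (hH : 0 ≤ H) (s : ℝ) : levelLen H ρ s ∈ Icc 0 H := by
  refine ⟨measureReal_nonneg, ?_⟩
  have h2 := measureReal_mono (μ := volume) (s₁ := {z | z ∈ Icc 0 H ∧ ρ z < s}) (s₂ := Icc 0 H)
    (fun _ hz => hz.1) (measure_Icc_lt_top (μ := volume) (a := 0) (b := H)).ne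
  rwa [Real.volume_real_Icc, sub_zero, max_eq_left hH] at h2

end LevelLen

namespace TwoProfiles

variable {r₀ H Ω R S₀ S : ℝ} {P : Plane → ℝ} {ρ₁ ρ₂ : ℝ → ℝ}

lemma symm (T : TwoProfiles r₀ H Ω R S₀ S P ρ₁ ρ₂) : TwoProfiles r₀ H Ω R S₀ S P ρ₂ ρ₁ :=
  ⟨T.hr₀, T.hH, T.hΩ, T.hR, T.hS₀, T.hS, T.hSe, T.pot, T.pair₂, T.pair₁, T.le₂, T.le₁, T.push.symm⟩

/-- At almost every level, the potential does not depend on the second variable strictly between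
the two profiles. At a point of continuity of `ρ₂` the second profile is still below `s` at some
higher level, where the minimizers of the two levels cross. -/
lemma ae_const (T : TwoProfiles r₀ H Ω R S₀ S P ρ₁ ρ₂) :
    ∀ᵐ z : ℝ, z ∈ Icc 0 H → ∀ s, ρ₂ z < s → s < ρ₁ z →
      ∃ z' > z, ∀ x ∈ Icc 0 z', P !₂[s, x] = P !₂[s, 0] := by
  have hc : ∀ᵐ z : ℝ, z ∉ {z | z ∈ Icc 0 H ∧ ¬ ContinuousWithinAt ρ₂ (Icc 0 H) z} :=
    measure_eq_zero_iff_ae_notMem.1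
      ((T.pair₂.mono.countable_not_continuousWithinAt).measure_zero volume)
  filter_upwards [hc, ae_ne_const H, T.pair₁.argmin] with z hz hzne hza hzH s hs1 hs2
  have hcont : ContinuousWithinAt ρ₂ (Icc 0 H) z := by
    by_contra hcon; exact hz ⟨hzH, hcon⟩
  have h3 : ∀ᶠ z' in 𝓝[Icc 0 H] z, ρ₂ z' < s := (tendsto_order.1 hcont).2 _ hs1
  obtain ⟨ε, hε, hball⟩ := Metric.mem_nhdsWithin_iff.1 h3
  have hzH' : z < H := lt_of_le_of_ne hzH.2 hzne
  obtain ⟨z', hz', hz'a⟩ := exists_mem_Ioo_of_ae T.pair₂.argmin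
    (show z < min (z + ε) H from lt_min (by linarith) hzH')
  have hz'H : z' ∈ Icc 0 H := ⟨hzH.1.trans hz'.1.le, (hz'.2.trans_le (min_le_right _ _)).le⟩
  have h4 : ρ₂ z' < s := hball ⟨by
    rw [Metric.mem_ball, Real.dist_eq, abs_of_pos (by linarith [hz'.1])]
    linarith [hz'.2.trans_le (min_le_left (z + ε) H)], hz'H⟩
  have h5 := ((hza hzH).eq_of_crossing T.hr₀ T.pot hz'.1.le (hz'a hz'H) (h4.trans hs2)).1 s
    ⟨h4.le, hs2.le⟩
  -- a subgradient at the level `z` has second component zero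
  obtain ⟨q, hq, hq'⟩ := T.pot !₂[s, z]
  have h6 := hq' !₂[s, z']
  have h7 := hq' !₂[s, 0]
  rw [inner_plane] at h6 h7
  simp only [PiLp.sub_apply, Matrix.cons_val_zero, Matrix.cons_val_one] at h6 h7
  have hq1 : q 1 = 0 := by
    have : 0 ≤ q 1 := hq.2.1
    have h8 : 0 < z' - z := by linarith [hz'.1]
    nlinarith
  rw [hq1] at h7
  refine ⟨z', hz'.1, fun x hx => le_antisymm ?_ (T.pot.le_of_le le_rfl hx.1)⟩
  have := T.pot.le_of_le (le_refl s) hx.2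
  linarith

lemma ae_good (T : TwoProfiles r₀ H Ω R S₀ S P ρ₁ ρ₂) :
    ∀ᵐ z : ℝ, z ∈ Icc 0 H → GoodLevel r₀ Ω S₀ P z (ρ₁ z) (ρ₂ z) := by
  filter_upwards [T.ae_const, T.symm.ae_const, T.pair₁.argmin, T.pair₂.argmin, T.le₁, T.le₂]
    with z h1 h2 h3 h4 h5 h6 hz
  exact ⟨hz.1, h3 hz, h4 hz, h5 hz, h6 hz, h1 hz, h2 hz⟩

lemma integrableOn_cumWeight_max (hr₀ : 0 < r₀) {ρ : ℝ → ℝ} (h : IsPair r₀ H Ω ρ P) {s : ℝ}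
    (hs : s < sEnd r₀) : IntegrableOn (fun z => cumWeight r₀ (max (ρ z) s)) (Icc 0 H) := by
  refine MonotoneOn.integrableOn_isCompact isCompact_Icc fun x hx y hy hxy => ?_
  exact cumWeight_le_cumWeight hr₀ (max_lt (h.range y hy).2 hs)
    (max_le_max_right _ (h.mono hx hy hxy))

lemma gapFun_sub (T : TwoProfiles r₀ H Ω R S₀ S P ρ₁ ρ₂) {c s : ℝ} (hc : c < sEnd r₀)
    (hs : s < sEnd r₀) : gapFun r₀ H ρ₁ ρ₂ s - gapFun r₀ H ρ₁ ρ₂ c = ∫ z in Icc 0 H,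
      ((cumWeight r₀ (max (ρ₁ z) s) - cumWeight r₀ (max (ρ₁ z) c)) -
        (cumWeight r₀ (max (ρ₂ z) s) - cumWeight r₀ (max (ρ₂ z) c))) := by
  have i1 := fun {x : ℝ} (hx : x < sEnd r₀) => integrableOn_cumWeight_max T.hr₀ T.pair₁ hx
  have i2 := fun {x : ℝ} (hx : x < sEnd r₀) => integrableOn_cumWeight_max T.hr₀ T.pair₂ hx
  have j1 : IntegrableOn (fun z => cumWeight r₀ (max (ρ₁ z) s) - cumWeight r₀ (max (ρ₁ z) c))
    (Icc 0 H) := (i1 hs).sub (i1 hc)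
  have j2 : IntegrableOn (fun z => cumWeight r₀ (max (ρ₂ z) s) - cumWeight r₀ (max (ρ₂ z) c))
    (Icc 0 H) := (i2 hs).sub (i2 hc)
  rw [integral_sub j1 j2, integral_sub (i1 hs) (i1 hc), integral_sub (i2 hs) (i2 hc)]
  unfold gapFun
  rw [integral_sub (i1 hs) (i2 hs), integral_sub (i1 hc) (i2 hc)]
  ring

/-- On intervals without critical points the discrepancy is an affine function of the primitive of
the weight. -/
lemma gapFun_sub_eq (T : TwoProfiles r₀ H Ω R S₀ S P ρ₁ ρ₂) {c d s : ℝ} (hc : 0 < c)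
    (hs : s ∈ Icc c d) (hd : d < sEnd r₀) (hK : ∀ x ∈ Ico c d, x ∉ critSet r₀ Ω P) :
    gapFun r₀ H ρ₁ ρ₂ s - gapFun r₀ H ρ₁ ρ₂ c =
      (cumWeight r₀ s - cumWeight r₀ c) * (levelLen H ρ₁ c - levelLen H ρ₂ c) := by
  rw [T.gapFun_sub (hs.1.trans_lt (hs.2.trans_lt hd)) (hs.2.trans_lt hd)]
  have hN : ∀ {ρ : ℝ → ℝ}, MonotoneOn ρ (Icc 0 H) → IntegrableOn
      ({z | z ∈ Icc 0 H ∧ ρ z < c}.indicator (1 : ℝ → ℝ)) (Icc 0 H) ∧ levelLen H ρ c =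
      ∫ z in Icc 0 H, {z | z ∈ Icc 0 H ∧ ρ z < c}.indicator (1 : ℝ → ℝ) z := by
    intro ρ hρ
    have hm := measurableSet_level hρ c
    constructor
    · exact ((integrable_const (1:ℝ)).indicator hm : Integrable _ (volume.restrict (Icc 0 H)))
    · rw [integral_indicator_one hm, measureReal_restrict_apply hm, inter_eq_left.2 fun z hz => hz.1]
      rfl
  obtain ⟨j1, e1⟩ := hN T.pair₁.mono
  obtain ⟨j2, e2⟩ := hN T.pair₂.mono
  rw [e1, e2, ← integral_sub j1 j2, ← integral_const_mul]
  refine setIntegral_congr_ae measurableSet_Icc ?_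
  filter_upwards [T.ae_good] with z hz hzH
  have hg := hz hzH
  by_cases hne : ρ₁ z = ρ₂ z
  · have : ({z | z ∈ Icc 0 H ∧ ρ₁ z < c}.indicator (1 : ℝ → ℝ) z) =
        {z | z ∈ Icc 0 H ∧ ρ₂ z < c}.indicator (1 : ℝ → ℝ) z := by
      simp [indicator, hne]
    rw [this, hne]
    ring
  · have hnm := hg.notMem_Ico T.hr₀ T.pot hne hc hK
    have key : ∀ {ρ : ℝ → ℝ}, ρ z ∉ Ico c d → cumWeight r₀ (max (ρ z) s) -
        cumWeight r₀ (max (ρ z) c) = (cumWeight r₀ s - cumWeight r₀ c) *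
        {z | z ∈ Icc 0 H ∧ ρ z < c}.indicator (1 : ℝ → ℝ) z := by
      intro ρ hρ
      rcases lt_or_ge (ρ z) c with h | h
      · rw [indicator_of_mem (show z ∈ {z | z ∈ Icc 0 H ∧ ρ z < c} from ⟨hzH, h⟩),
          max_eq_right h.le, max_eq_right (h.le.trans hs.1)]
        simp
      · have hd' : d ≤ ρ z := by
          by_contra! hlt; exact hρ ⟨h, hlt⟩
        rw [indicator_of_notMem (fun hm => absurd hm.2 (not_lt.2 h)), max_eq_left h,
          max_eq_left (hs.2.trans hd')]
        simp
    rw [key hnm.1, key hnm.2]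
    ring

lemma abs_gapFun_sub_le (T : TwoProfiles r₀ H Ω R S₀ S P ρ₁ ρ₂) {c s : ℝ} (hcs : c ≤ s)
    (hs : s < sEnd r₀) : |gapFun r₀ H ρ₁ ρ₂ s - gapFun r₀ H ρ₁ ρ₂ c| ≤
      (cumWeight r₀ s - cumWeight r₀ c) * H := by
  rw [T.gapFun_sub (hcs.trans_lt hs) hs]
  have hb : ∀ r < sEnd r₀, cumWeight r₀ (max r s) - cumWeight r₀ (max r c) ∈
      Icc 0 (cumWeight r₀ s - cumWeight r₀ c) := by
    intro r hr
    have h1 := cumWeight_le_cumWeight T.hr₀ hs hcs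
    rcases le_total r c with h | h
    · rw [max_eq_right h, max_eq_right (h.trans hcs)]
      exact ⟨by linarith, le_rfl⟩
    · rw [max_eq_left h]
      rcases le_total r s with h' | h'
      · rw [max_eq_right h']
        have h2 := cumWeight_le_cumWeight T.hr₀ hs h'
        have h3 := cumWeight_le_cumWeight T.hr₀ hr h
        exact ⟨by linarith, by linarith⟩
      · rw [max_eq_left h']
        exact ⟨by linarith, by linarith⟩
  have := norm_setIntegral_le_of_norm_le_const (μ := volume) (s := Icc 0 H)
    (f := fun z => (cumWeight r₀ (max (ρ₁ z) s) - cumWeight r₀ (max (ρ₁ z) c)) -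
        (cumWeight r₀ (max (ρ₂ z) s) - cumWeight r₀ (max (ρ₂ z) c)))
    (C := cumWeight r₀ s - cumWeight r₀ c) (measure_Icc_lt_top) (fun z hz => by
      have h1 := hb _ (T.pair₁.range z hz).2
      have h2 := hb _ (T.pair₂.range z hz).2
      rw [Real.norm_eq_abs, abs_le]
      constructor <;> linarith [h1.1, h1.2, h2.1, h2.2])
  rwa [Real.volume_real_Icc, sub_zero, max_eq_left T.hH.le] at this

/-- The discrepancy interpolates linearly, as a function of the primitive of the weight, between the
end points of an interval without critical points inside. -/
lemma gapFun_interp (T : TwoProfiles r₀ H Ω R S₀ S P ρ₁ ρ₂) {c d x : ℝ} (hc : 0 ≤ c)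
    (hx : x ∈ Icc c d) (hd : d < sEnd r₀) (hK : ∀ x ∈ Ioo c d, x ∉ critSet r₀ Ω P) :
    (cumWeight r₀ d - cumWeight r₀ c) * (gapFun r₀ H ρ₁ ρ₂ x - gapFun r₀ H ρ₁ ρ₂ c) =
      (cumWeight r₀ x - cumWeight r₀ c) * (gapFun r₀ H ρ₁ ρ₂ d - gapFun r₀ H ρ₁ ρ₂ c) := by
  rcases hx.1.eq_or_lt with rfl | hcx
  · simp
  have hce : c < sEnd r₀ := hcx.trans_le hx.2 |>.trans hd
  have hM : Tendsto (cumWeight r₀) (𝓝[>] c) (𝓝 (cumWeight r₀ c)) :=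
    ((hasDerivAt_cumWeight T.hr₀ hce).continuousAt.tendsto).mono_left nhdsWithin_le_nhds
  have hev : ∀ᶠ y in 𝓝[>] c, y ∈ Ioo c x := Ioo_mem_nhdsGT hcx
  have hQ : Tendsto (gapFun r₀ H ρ₁ ρ₂) (𝓝[>] c) (𝓝 (gapFun r₀ H ρ₁ ρ₂ c)) := by
    rw [tendsto_iff_dist_tendsto_zero]
    have h0 : Tendsto (fun y => (cumWeight r₀ y - cumWeight r₀ c) * H) (𝓝[>] c) (𝓝 0) := by
      have := (hM.sub_const (cumWeight r₀ c)).mul_const H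
      simpa using this
    refine squeeze_zero' (Eventually.of_forall fun _ => dist_nonneg) ?_ h0
    filter_upwards [hev] with y hy
    rw [Real.dist_eq]
    exact T.abs_gapFun_sub_le hy.1.le (hy.2.trans_le hx.2 |>.trans hd)
  have hL := (tendsto_const_nhds (x := cumWeight r₀ d)).sub hM |>.mul
    ((tendsto_const_nhds (x := gapFun r₀ H ρ₁ ρ₂ x)).sub hQ)
  have hR := (tendsto_const_nhds (x := cumWeight r₀ x)).sub hM |>.mul
    ((tendsto_const_nhds (x := gapFun r₀ H ρ₁ ρ₂ d)).sub hQ)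
  refine tendsto_nhds_unique (hL.congr' ?_) hR
  filter_upwards [hev] with y hy
  have hK' : ∀ x ∈ Ico y d, x ∉ critSet r₀ Ω P := fun x hx => hK x ⟨hy.1.trans_le hx.1, hx.2⟩
  rw [T.gapFun_sub_eq (hc.trans_lt hy.1) ⟨hy.2.le, hx.2⟩ hd hK',
    T.gapFun_sub_eq (hc.trans_lt hy.1) ⟨hy.2.le.trans hx.2, le_rfl⟩ hd hK']
  ring

lemma gapFun_eq_zero_of_le (T : TwoProfiles r₀ H Ω R S₀ S P ρ₁ ρ₂) {s : ℝ} (hs : S₀ ≤ s) :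
    gapFun r₀ H ρ₁ ρ₂ s = 0 := by
  refine integral_eq_zero_of_ae ?_
  rw [EventuallyEq, ae_restrict_iff' measurableSet_Icc]
  filter_upwards [T.le₁, T.le₂] with z h1 h2 hz
  rw [max_eq_right ((h1 hz).trans hs), max_eq_right ((h2 hz).trans hs)]
  simp

lemma integral_weight_indicator (hr₀ : 0 < r₀) {b r : ℝ} (hb : b ∈ Ico 0 (sEnd r₀))
    (hr : r ∈ Ico 0 (sEnd r₀)) :
    ∫ s in (0 : ℝ)..r, weight r₀ s * (Ioi b).indicator 1 s =
      cumWeight r₀ (max r b) - cumWeight r₀ b := by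
  have h0 : (0:ℝ) < sEnd r₀ := sEnd_pos hr₀
  have hz : ∀ {x : ℝ}, 0 ≤ x → x ≤ b → ∫ s in (0 : ℝ)..x, weight r₀ s * (Ioi b).indicator 1 s = 0 := by
    intro x hx0 hxb
    rw [intervalIntegral.integral_congr (g := fun _ => 0)]
    · simp
    · intro s hs
      rw [uIcc_of_le hx0] at hs
      simp only
      rw [indicator_of_notMem (by simpa using hs.2.trans hxb), mul_zero]
  have hint : ∀ {x y : ℝ}, x < sEnd r₀ → y < sEnd r₀ →
      IntervalIntegrable (fun s => weight r₀ s * (Ioi b).indicator (1 : ℝ → ℝ) s) volume x y := by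
    intro x y hx hy
    refine (intervalIntegrable_weight hr₀ hx hy).mono_fun
      ((measurable_weight r₀).mul (measurable_one.indicator
        measurableSet_Ioi)).aestronglyMeasurable (ae_of_all _ fun s => ?_)
    simp only [norm_mul]
    refine mul_le_of_le_one_right (norm_nonneg _) ?_
    by_cases h : s ∈ Ioi b <;> simp [h]
  rcases le_total r b with h | h
  · rw [max_eq_right h, sub_self, hz hr.1 h]
  · rw [max_eq_left h, ← intervalIntegral.integral_add_adjacent_intervals (hint h0 hb.2)
      (hint hb.2 hr.2), hz hb.1 le_rfl, zero_add, ← integral_weight hr₀ hb.2 hr.2]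
    refine intervalIntegral.integral_congr_ae (ae_of_all _ fun s hs => ?_)
    rw [uIoc_of_le h] at hs
    rw [indicator_of_mem (show s ∈ Ioi b from hs.1)]
    simp

/-- If `∇P` belongs to a set `A` exactly above `b` wherever the two regions differ, the equality of
the image measures, tested on `A`, shows that the discrepancy vanishes at `b`. -/
lemma gapFun_eq_zero_of_push (T : TwoProfiles r₀ H Ω R S₀ S P ρ₁ ρ₂) {b : ℝ} (hb : b ∈ Icc 0 S)
    {A : Set Plane} (hA : MeasurableSet A)
    (h : ∀ s ∈ Ioo 0 S, s ≠ b → ∀ q : Plane,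
      (∀ s' : ℝ, P !₂[s, 0] + q 0 * (s' - s) ≤ P !₂[s', 0]) → (q ∈ A ↔ b < s)) :
    gapFun r₀ H ρ₁ ρ₂ b = 0 := by
  have hbe : b ∈ Ico 0 (sEnd r₀) := ⟨hb.1, hb.2.trans_lt T.hSe⟩
  have hA' : MeasurableSet (∇ P ⁻¹' A) := measurable_gradient P hA
  set g : Plane → ℝ := (∇ P ⁻¹' A).indicator 1 with hg
  have hgm : Measurable g := measurable_one.indicator hA'
  have hg1 : ∀ p, ‖g p‖ ≤ 1 := fun p => by
    by_cases hp : p ∈ ∇ P ⁻¹' A <;> simp [hg, hp]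
  have f1 := T.pair₁.isFiniteMeasure T.hr₀ T.hΩ T.hR T.pot
  have f2 := T.pair₂.isFiniteMeasure T.hr₀ T.hΩ T.hR T.pot
  have hgi : ∀ {μ : Measure Plane} [IsFiniteMeasure μ], Integrable g μ := fun {μ} _ =>
    Integrable.of_bound hgm.aestronglyMeasurable 1 (ae_of_all _ hg1)
  have heq : ∫ p, g p ∂(regionMeasure r₀ H ρ₁) = ∫ p, g p ∂(regionMeasure r₀ H ρ₂) := by
    rw [hg, integral_indicator_one hA', integral_indicator_one hA',
      ← map_measureReal_apply (measurable_gradient P) hA,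
      ← map_measureReal_apply (measurable_gradient P) hA, T.push]
  obtain ⟨i1, e1⟩ := integral_regionMeasure T.pair₁.mem_profiles (g := g) hgi
  obtain ⟨i2, e2⟩ := integral_regionMeasure T.pair₂.mem_profiles (g := g) hgi
  rw [e1, e2, ← sub_eq_zero, ← integral_sub i1 i2] at heq
  rw [← heq]
  refine setIntegral_congr_ae measurableSet_Icc ?_
  filter_upwards [T.ae_good, ae_ae_of_ae_plane (T.pot.ae_differentiableAt (isCompact_box R))]
    with z hz hd hzH
  have hgd := hz hzH
  have hint : ∀ {x : ℝ}, x ∈ Ico 0 (sEnd r₀) →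
      IntervalIntegrable (fun s => weight r₀ s * g !₂[s, z]) volume 0 x := by
    intro x hx
    refine (intervalIntegrable_weight T.hr₀ (sEnd_pos T.hr₀) hx.2).mono_fun
      ((measurable_weight r₀).mul (hgm.comp (continuous_mk₂.measurable.comp
        (measurable_id.prodMk measurable_const)))).aestronglyMeasurable (ae_of_all _ fun s => ?_)
    simp only [norm_mul]
    exact mul_le_of_le_one_right (norm_nonneg _) (hg1 _)
  have hint' : ∀ {x : ℝ}, x ∈ Ico 0 (sEnd r₀) →
      IntervalIntegrable (fun s => weight r₀ s * (Ioi b).indicator (1 : ℝ → ℝ) s) volume 0 x := by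
    intro x hx
    refine (intervalIntegrable_weight T.hr₀ (sEnd_pos T.hr₀) hx.2).mono_fun
      ((measurable_weight r₀).mul (measurable_one.indicator
        measurableSet_Ioi)).aestronglyMeasurable (ae_of_all _ fun s => ?_)
    simp only [norm_mul]
    refine mul_le_of_le_one_right (norm_nonneg _) ?_
    by_cases h : s ∈ Ioi b <;> simp [h]
  -- only the points between the two profiles contribute
  rw [intervalIntegral.integral_interval_sub_left (hint hgd.arg₁.1) (hint hgd.arg₂.1)]
  have e3 := integral_weight_indicator T.hr₀ hbe hgd.arg₁.1
  have e4 := integral_weight_indicator T.hr₀ hbe hgd.arg₂.1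
  have e5 := intervalIntegral.integral_interval_sub_left (hint' hgd.arg₁.1) (hint' hgd.arg₂.1)
  have e6 : ∫ s in (ρ₂ z)..(ρ₁ z), weight r₀ s * g !₂[s, z] =
      ∫ s in (ρ₂ z)..(ρ₁ z), weight r₀ s * (Ioi b).indicator (1 : ℝ → ℝ) s := by
    refine intervalIntegral.integral_congr_ae ?_
    filter_upwards [hd, ae_ne_const (ρ₁ z), ae_ne_const (ρ₂ z), ae_ne_const b]
      with s hs h1 h2 h3 hsm
    obtain ⟨hq, hq'⟩ := T.pot.gradient_mem hs
    have hconst : ∃ z' > z, ∀ x ∈ Icc 0 z', P !₂[s, x] = P !₂[s, 0] := by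
      rcases le_total (ρ₂ z) (ρ₁ z) with hle | hle
      · rw [uIoc_of_le hle] at hsm
        exact hgd.const₁ s hsm.1 (lt_of_le_of_ne hsm.2 h1)
      · rw [uIoc_of_ge hle] at hsm
        exact hgd.const₂ s hsm.1 (lt_of_le_of_ne hsm.2 h2)
    have hsI : s ∈ Ioo 0 S := by
      have hm := uIoc_subset_uIcc hsm
      have hpos : min (ρ₂ z) (ρ₁ z) < s := hsm.1
      exact ⟨(le_min hgd.arg₂.1.1 hgd.arg₁.1.1).trans_lt hpos,
        (hm.2.trans (max_le hgd.le₂ hgd.le₁)).trans_lt T.hS⟩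
    obtain ⟨z', hz', hx⟩ := hconst
    have hz0 := hzH.1
    have hPz := hx z ⟨hz0, le_of_lt hz'⟩
    have hPz' := hx z' ⟨hz0.trans (le_of_lt hz'), le_rfl⟩
    -- the potential is constant up to a higher level, hence the second slope vanishes
    have hq1 : (∇ P !₂[s, z]) 1 = 0 := by
      have h6 := hq' !₂[s, z']
      rw [inner_plane] at h6
      simp only [PiLp.sub_apply, Matrix.cons_val_zero, Matrix.cons_val_one] at h6
      have h7 : 0 ≤ (∇ P !₂[s, z]) 1 := hq.2.1
      have h8 : 0 < z' - z := by linarith [show z < z' from hz']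
      nlinarith
    have hiff := h s hsI h3 (∇ P !₂[s, z]) (fun s' => by
      have h6 := hq' !₂[s', 0]
      rw [inner_plane, hq1] at h6
      simp only [PiLp.sub_apply, Matrix.cons_val_zero, Matrix.cons_val_one] at h6
      rw [mul_comm]
      linarith)
    congr 1
    by_cases hbs : b < s
    · rw [indicator_of_mem (show s ∈ Ioi b from hbs), hg,
        indicator_of_mem (show !₂[s, z] ∈ ∇ P ⁻¹' A from hiff.2 hbs)]
      rfl
    · rw [indicator_of_notMem (show s ∉ Ioi b from hbs), hg,
        indicator_of_notMem (show !₂[s, z] ∉ ∇ P ⁻¹' A from fun h => hbs (hiff.1 h))]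
  rw [e6, ← e5, e3, e4]
  ring

end TwoProfiles

/-! ### Uniqueness of the optimal profile and of the optimal map -/

/-- The coordinate `τ = 1 / (1 - 2 s r₀²)`, in which the kinetic term is linear and the primitive
of the weight is affine. -/
def tau (r₀ s : ℝ) : ℝ := 1 / (1 - 2 * s * r₀ ^ 2)

section Tau

variable {r₀ : ℝ} (hr₀ : 0 < r₀)
include hr₀

lemma tau_pos {s : ℝ} (hs : s < sEnd r₀) : 0 < tau r₀ s := one_div_pos.2 (one_sub_pos hr₀ hs)

lemma tau_lt_tau {s t : ℝ} (ht : t < sEnd r₀) (hst : s < t) : tau r₀ s < tau r₀ t := by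
  refine one_div_lt_one_div_of_lt (one_sub_pos hr₀ ht) ?_
  have : 0 < r₀ ^ 2 := by positivity
  nlinarith

lemma tau_le_tau {s t : ℝ} (ht : t < sEnd r₀) (hst : s ≤ t) : tau r₀ s ≤ tau r₀ t := by
  rcases hst.eq_or_lt with rfl | h
  · exact le_rfl
  · exact (tau_lt_tau hr₀ ht h).le

lemma hasDerivAt_tau {s : ℝ} (hs : s < sEnd r₀) :
    HasDerivAt (tau r₀) (2 * r₀ ^ 2 * tau r₀ s ^ 2) s := by
  have h1 := one_sub_pos hr₀ hs
  have h2 : HasDerivAt (fun s : ℝ => 1 - 2 * s * r₀ ^ 2) (-(2 * r₀ ^ 2)) s := by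
    have := (((hasDerivAt_id s).const_mul 2).mul_const (r₀ ^ 2)).const_sub 1
    simpa using this
  have h3 := h2.inv h1.ne'
  have e : tau r₀ = fun s => (1 - 2 * s * r₀ ^ 2)⁻¹ := by ext s; simp [tau]
  rw [e]
  refine h3.congr_deriv ?_
  beta_reduce
  rw [neg_neg, inv_pow, div_eq_mul_inv]

omit hr₀ in
lemma weight_eq_tau (s : ℝ) : weight r₀ s = r₀ ^ 4 * tau r₀ s ^ 2 := by
  unfold weight tau
  rw [one_div, inv_pow, div_eq_mul_inv]

omit hr₀ in
lemma kin_eq_tau (Ω s : ℝ) : kin r₀ Ω s = Ω ^ 2 * r₀ ^ 2 / 2 * tau r₀ s := by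
  unfold kin tau
  rw [div_mul_div_comm, mul_one]

omit hr₀ in
lemma cumWeight_sub (s t : ℝ) :
    cumWeight r₀ t - cumWeight r₀ s = r₀ ^ 2 / 2 * (tau r₀ t - tau r₀ s) := by
  unfold cumWeight tau
  ring

lemma sub_eq_tau {s t : ℝ} (hs : s < sEnd r₀) (ht : t < sEnd r₀) :
    t - s = sEnd r₀ * (tau r₀ t - tau r₀ s) / (tau r₀ t * tau r₀ s) := by
  have h1 := (one_sub_pos hr₀ hs).ne'
  have h2 := (one_sub_pos hr₀ ht).ne'
  have e : t - s = sEnd r₀ * ((1 - 2 * s * r₀ ^ 2) - (1 - 2 * t * r₀ ^ 2)) := by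
    unfold sEnd
    field_simp
    ring
  rw [e]
  unfold tau
  generalize 1 - 2 * s * r₀ ^ 2 = x at h1
  generalize 1 - 2 * t * r₀ ^ 2 = y at h2
  field_simp

/-- The kinetic term minus an affine function that agrees with it at `m`. -/
lemma kin_sub_affine {Ω c s m : ℝ} (hs : s < sEnd r₀) (hm : m < sEnd r₀) :
    kin r₀ Ω s - (kin r₀ Ω m + c * (s - m)) = (tau r₀ s - tau r₀ m) *
      (Ω ^ 2 * r₀ ^ 2 / 2 - c * sEnd r₀ / (tau r₀ s * tau r₀ m)) := by
  rw [kin_eq_tau, kin_eq_tau, sub_eq_tau hr₀ hm hs]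
  ring

end Tau

/-- An upper bound for the density at the left end of an interval `[s, m']` on which the potential
is affine, when the density vanishes at `m'` and its integral is nonpositive. -/
lemma three_mul_dens_le {r₀ Ω : ℝ} (hr₀ : 0 < r₀) {P : Plane → ℝ}
    {c' s m' : ℝ} (hPc : ContinuousOn (fun s : ℝ => P !₂[s, 0]) (Icc 0 (sEnd r₀)))
    (hc' : 0 ≤ c') (hs : 0 ≤ s) (hsm : s < m') (hm' : m' < sEnd r₀)
    (h2 : ∀ x ∈ Icc s m', P !₂[x, 0] = kin r₀ Ω m' + c' * (x - m'))
    (hint : ∫ x in s..m', dens r₀ Ω P 0 x ≤ 0) :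
    3 * (kin r₀ Ω s - P !₂[s, 0]) ≤ c' * sEnd r₀ / (tau r₀ m' * tau r₀ s ^ 2) *
      (tau r₀ m' - tau r₀ s) ^ 2 := by
  have hse : s < sEnd r₀ := hsm.trans hm'
  have ha := sEnd_pos hr₀
  have ts := tau_pos hr₀ hse
  have t1 := tau_pos hr₀ hm'
  have ts1 := tau_lt_tau hr₀ hm' hsm
  set B := tau r₀ m' - tau r₀ s
  have hB : 0 < B := by simp only [B]; linarith
  set h := kin r₀ Ω s - P !₂[s, 0] with hh
  set k := c' * sEnd r₀ / (tau r₀ m' * tau r₀ s ^ 2) with hk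
  have hhB : h / B = c' * sEnd r₀ / (tau r₀ s * tau r₀ m') - Ω ^ 2 * r₀ ^ 2 / 2 := by
    rw [hh, h2 s ⟨le_rfl, hsm.le⟩, kin_sub_affine hr₀ hse hm', div_eq_iff hB.ne']
    simp only [B]
    ring
  -- `D` is a lower bound for the density, a quadratic polynomial in `τ` times the weight, and
  -- `F` is its primitive
  set D : ℝ → ℝ := fun x => (tau r₀ m' - tau r₀ x) * (h / B - k * (tau r₀ x - tau r₀ s)) *
    weight r₀ x with hD
  set F : ℝ → ℝ := fun x => r₀ ^ 2 / 2 * (h * (tau r₀ x - tau r₀ s)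
    - (h / B + k * B) / 2 * (tau r₀ x - tau r₀ s) ^ 2
      + k / 3 * (tau r₀ x - tau r₀ s) ^ 3) with hF
  have hFD : ∀ x ∈ uIcc s m', HasDerivAt F (D x) x := by
    intro x hx
    rw [uIcc_of_le hsm.le] at hx
    have h0 := (hasDerivAt_tau hr₀ (hx.2.trans_lt hm')).sub_const (tau r₀ s)
    have := (((h0.const_mul h).sub ((h0.pow 2).const_mul ((h / B + k * B) / 2))).add
      ((h0.pow 3).const_mul (k / 3))).const_mul (r₀ ^ 2 / 2)
    have hF' : HasDerivAt F _ x := this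
    refine hF'.congr_deriv ?_
    have hDx : D x = (tau r₀ m' - tau r₀ x) * (h / B - k * (tau r₀ x - tau r₀ s)) *
      weight r₀ x := rfl
    rw [hDx, weight_eq_tau]
    have e1 : tau r₀ m' - tau r₀ x = B - (tau r₀ x - tau r₀ s) := by simp only [B]; ring
    have e2 : h = h / B * B := by field_simp
    rw [e1]
    generalize tau r₀ x - tau r₀ s = y
    generalize h / B = w at e2 ⊢
    rw [e2]
    norm_num
    ring
  have hDi : IntervalIntegrable D volume s m' := by
    refine ContinuousOn.intervalIntegrable ?_
    rw [uIcc_of_le hsm.le]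
    have htc : ContinuousOn (tau r₀) (Icc s m') := fun x hx =>
      (hasDerivAt_tau hr₀ (hx.2.trans_lt hm')).continuousAt.continuousWithinAt
    have hwc : ContinuousOn (weight r₀) (Icc s m') :=
      (continuousOn_weight hr₀).mono fun x hx => hx.2.trans_lt hm'
    fun_prop
  have hFTC := intervalIntegral.integral_eq_sub_of_hasDerivAt hFD hDi
  have hDle : ∫ x in s..m', D x ≤ ∫ x in s..m', dens r₀ Ω P 0 x := by
    refine intervalIntegral.integral_mono_on hsm.le hDi
      (intervalIntegrable_dens hr₀ Ω hPc ⟨hs, hse⟩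
        ⟨hs.trans hsm.le, hm'⟩) fun x hx => ?_
    refine mul_le_mul_of_nonneg_right ?_ (weight_nonneg _ _)
    have hxe := hx.2.trans_lt hm'
    have tx := tau_pos hr₀ hxe
    have htx1 := tau_le_tau hr₀ hm' hx.2
    have htxs := tau_le_tau hr₀ hxe hx.1
    rw [h2 x hx, kin_sub_affine hr₀ hxe hm', hhB]
    have : (tau r₀ x - tau r₀ m') * (Ω ^ 2 * r₀ ^ 2 / 2 - c' * sEnd r₀ / (tau r₀ x * tau r₀ m')) =
      (tau r₀ m' - tau r₀ x) * (c' * sEnd r₀ / (tau r₀ x * tau r₀ m') - Ω ^ 2 * r₀ ^ 2 / 2) := by ring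
    rw [this]
    refine mul_le_mul_of_nonneg_left ?_ (by linarith)
    have e1 : c' * sEnd r₀ / (tau r₀ x * tau r₀ m') = c' * sEnd r₀ / (tau r₀ s * tau r₀ m') -
        c' * sEnd r₀ / (tau r₀ m' * (tau r₀ s * tau r₀ x)) * (tau r₀ x - tau r₀ s) := by
      field_simp
      ring
    have e2 : c' * sEnd r₀ / (tau r₀ m' * (tau r₀ s * tau r₀ x)) ≤ k := by
      rw [hk]
      refine div_le_div_of_nonneg_left (by positivity) (by positivity) ?_
      refine mul_le_mul_of_nonneg_left ?_ t1.le
      nlinarith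
    have e3 := mul_le_mul_of_nonneg_right e2 (show 0 ≤ tau r₀ x - tau r₀ s by linarith)
    linarith
  have hFm : F m' - F s = r₀ ^ 2 / 2 * (B * (3 * h - k * B ^ 2) / 6) := by
    simp only [hF, sub_self]
    change r₀ ^ 2 / 2 * (h * B - (h / B + k * B) / 2 * B ^ 2 + k / 3 * B ^ 3) - _ = _
    field_simp
    ring
  by_contra! hlt
  have : 0 < r₀ ^ 2 / 2 * (B * (3 * h - k * B ^ 2) / 6) := by
    have : 0 < 3 * h - k * B ^ 2 := by linarith
    positivity
  linarith

/-- If the density, for a potential which is affine with slopes `c` and `c'` on `[m, s]` and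
`[s, m']`, vanishes at `m` and `m'` and has a nonpositive integral over `[m, m']`, then the two
intervals are in a definite proportion. -/
lemma three_mul_le_of_integral_nonpos {r₀ Ω : ℝ} (hr₀ : 0 < r₀) {P : Plane → ℝ}
    {c c' m s m' : ℝ} (hPc : ContinuousOn (fun s : ℝ => P !₂[s, 0]) (Icc 0 (sEnd r₀)))
    (hc : 0 ≤ c) (hc' : 0 ≤ c') (hm : 0 ≤ m) (hms : m < s)
    (hsm : s < m') (hm' : m' < sEnd r₀)
    (h1 : ∀ x ∈ Icc m s, P !₂[x, 0] = kin r₀ Ω m + c * (x - m))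
    (h2 : ∀ x ∈ Icc s m', P !₂[x, 0] = kin r₀ Ω m' + c' * (x - m'))
    (hcurv : c * sEnd r₀ ≤ Ω ^ 2 * r₀ ^ 2 / 2 * tau r₀ m ^ 2)
    (hint : ∫ x in m..m', dens r₀ Ω P 0 x ≤ 0) :
    3 * (c * (cumWeight r₀ s - cumWeight r₀ m) ^ 2) ≤
      c' * (cumWeight r₀ m' - cumWeight r₀ s) ^ 2 := by
  have hse : s < sEnd r₀ := hsm.trans hm'
  have hme : m < sEnd r₀ := hms.trans hse
  have ha := sEnd_pos hr₀
  have tm := tau_pos hr₀ hme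
  have ts := tau_pos hr₀ hse
  have t1 := tau_pos hr₀ hm'
  have tms := tau_lt_tau hr₀ hse hms
  have ts1 := tau_lt_tau hr₀ hm' hsm
  -- the left interval
  have hl : ∀ x ∈ Icc m s, c * sEnd r₀ * (tau r₀ x - tau r₀ m) ^ 2 / (tau r₀ m ^ 2 * tau r₀ x) ≤
      kin r₀ Ω x - P !₂[x, 0] := by
    intro x hx
    have hxe := hx.2.trans_lt hse
    have tx := tau_pos hr₀ hxe
    have hmx := tau_le_tau hr₀ hxe hx.1
    rw [h1 x hx, kin_sub_affine hr₀ hxe hme]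
    have : c * sEnd r₀ * (tau r₀ x - tau r₀ m) ^ 2 / (tau r₀ m ^ 2 * tau r₀ x) =
        (tau r₀ x - tau r₀ m) * (c * sEnd r₀ / tau r₀ m ^ 2 - c * sEnd r₀ / (tau r₀ x * tau r₀ m)) := by
      field_simp
    rw [this]
    refine mul_le_mul_of_nonneg_left ?_ (by linarith)
    have : c * sEnd r₀ / tau r₀ m ^ 2 ≤ Ω ^ 2 * r₀ ^ 2 / 2 := by
      rw [div_le_iff₀ (by positivity)]
      exact hcurv
    linarith
  have hsplit := intervalIntegral.integral_add_adjacent_intervals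
    (intervalIntegrable_dens hr₀ Ω hPc ⟨hm, hme⟩ ⟨hm.trans hms.le, hse⟩)
    (intervalIntegrable_dens hr₀ Ω hPc ⟨hm.trans hms.le, hse⟩ ⟨hm.trans (hms.trans hsm).le, hm'⟩)
  have hleft : 0 ≤ ∫ x in m..s, dens r₀ Ω P 0 x := by
    refine intervalIntegral.integral_nonneg hms.le fun x hx => ?_
    refine mul_nonneg (le_trans ?_ (hl x hx)) (weight_nonneg _ _)
    have tx := tau_pos hr₀ (hx.2.trans_lt hse)
    positivity
  -- the right interval
  have hkB := three_mul_dens_le hr₀ hPc hc' (hm.trans hms.le) hsm hm' h2 (by linarith)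
  set B := tau r₀ m' - tau r₀ s
  have hA := hl s ⟨hms.le, le_rfl⟩
  set A := tau r₀ s - tau r₀ m
  have hAB : 3 * (c * A ^ 2) ≤ c' * B ^ 2 := by
    have e1 : 3 * (c * sEnd r₀ * A ^ 2 / (tau r₀ m ^ 2 * tau r₀ s)) ≤
        c' * sEnd r₀ / (tau r₀ m' * tau r₀ s ^ 2) * B ^ 2 := by linarith
    have e2 : c' * sEnd r₀ / (tau r₀ m' * tau r₀ s ^ 2) * B ^ 2 ≤
        c' * sEnd r₀ / (tau r₀ m ^ 2 * tau r₀ s) * B ^ 2 := by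
      refine mul_le_mul_of_nonneg_right ?_ (by positivity)
      refine div_le_div_of_nonneg_left (by positivity) (by positivity) ?_
      have h3 : tau r₀ m ^ 2 ≤ tau r₀ m' * tau r₀ s := by
        rw [sq]
        exact mul_le_mul (by linarith) tms.le tm.le t1.le
      have h4 := mul_le_mul_of_nonneg_right h3 ts.le
      linarith
    have e3 := e1.trans e2
    have e4 : 0 < sEnd r₀ / (tau r₀ m ^ 2 * tau r₀ s) := by positivity
    have e5 : sEnd r₀ / (tau r₀ m ^ 2 * tau r₀ s) * (3 * (c * A ^ 2)) ≤
        sEnd r₀ / (tau r₀ m ^ 2 * tau r₀ s) * (c' * B ^ 2) := by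
      calc _ = 3 * (c * sEnd r₀ * A ^ 2 / (tau r₀ m ^ 2 * tau r₀ s)) := by ring
        _ ≤ _ := e3
        _ = _ := by ring
    exact le_of_mul_le_mul_left e5 e4
  rw [cumWeight_sub, cumWeight_sub]
  change 3 * (c * (r₀ ^ 2 / 2 * A) ^ 2) ≤ c' * (r₀ ^ 2 / 2 * B) ^ 2
  have : 0 ≤ (r₀ ^ 2 / 2) ^ 2 := by positivity
  nlinarith [mul_le_mul_of_nonneg_left hAB this]

/-- An interval `[s₁, s₂]`, maximal to the right in `[0, S]`, on which `P(·, 0)` is affine with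
slope `c`, and its only interior critical point `m`. The discrepancy of the profiles vanishes at
the end points and not at `m`. The inequality `curv` says that the kinetic term is at `m` at least
as steep as the potential. -/
structure Cell (r₀ H Ω R S : ℝ) (P : Plane → ℝ) (ρ₁ ρ₂ : ℝ → ℝ) (c s₁ s₂ m : ℝ) : Prop where
  c_mem : c ∈ Icc 0 R
  nonneg : 0 ≤ s₁
  lt₁ : s₁ < m
  lt₂ : m < s₂
  le : s₂ ≤ S
  affine : ∀ s ∈ Icc s₁ s₂, P !₂[s, 0] = kin r₀ Ω m + c * (s - m)
  strict : ∀ s ∈ Ioc s₂ S, kin r₀ Ω m + c * (s - m) < P !₂[s, 0]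
  gap₁ : gapFun r₀ H ρ₁ ρ₂ s₁ = 0
  gap₂ : gapFun r₀ H ρ₁ ρ₂ s₂ = 0
  gap_ne : gapFun r₀ H ρ₁ ρ₂ m ≠ 0
  crit : m ∈ critSet r₀ Ω P
  uniq : ∀ x ∈ Ioo s₁ s₂, x ∈ critSet r₀ Ω P → x = m
  kin_gt : ∀ s ∈ Ioc m s₂, P !₂[s, 0] < kin r₀ Ω s
  curv : c * sEnd r₀ ≤ Ω ^ 2 * r₀ ^ 2 / 2 * tau r₀ m ^ 2

/-- At a critical point, the kinetic term is at least as steep as an affine piece of the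
potential. -/
lemma curv_of_mem_critSet {r₀ Ω c m s : ℝ} (hr₀ : 0 < r₀) {P : Plane → ℝ}
    (hm : m ∈ critSet r₀ Ω P) (hms : m < s) (hs : s < sEnd r₀)
    (haff : ∀ x ∈ Icc m s, P !₂[x, 0] = kin r₀ Ω m + c * (x - m)) :
    c * sEnd r₀ ≤ Ω ^ 2 * r₀ ^ 2 / 2 * tau r₀ m ^ 2 := by
  by_contra! hlt
  have tm := tau_pos hr₀ hm.1.2
  have hc : ContinuousWithinAt (fun x => c * sEnd r₀ - Ω ^ 2 * r₀ ^ 2 / 2 * (tau r₀ x * tau r₀ m))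
      (Ioi m) m := by
    have := (hasDerivAt_tau hr₀ hm.1.2).continuousAt
    exact (by fun_prop : ContinuousAt _ m).continuousWithinAt
  have hev : ∀ᶠ x in 𝓝[>] m, 0 < c * sEnd r₀ - Ω ^ 2 * r₀ ^ 2 / 2 * (tau r₀ x * tau r₀ m) :=
    hc.eventually (lt_mem_nhds (by beta_reduce; rw [← sq]; linarith))
  obtain ⟨b, hb, hb'⟩ := mem_nhdsGT_iff_exists_Ioo_subset.1 hev
  obtain ⟨x, hx⟩ := exists_between (show m < min b s from lt_min hb hms)
  have hxb := hx.2.trans_le (min_le_left _ _)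
  have hxs := hx.2.trans_le (min_le_right _ _)
  have hneg : ∫ y in m..x, dens r₀ Ω P 0 y < 0 := by
    have hcont : ContinuousOn (dens r₀ Ω P 0) (Icc m x) := by
      have : ContinuousOn (fun y => (kin r₀ Ω y - (kin r₀ Ω m + c * (y - m))) * weight r₀ y)
          (Icc m x) := by
        have h1 := (continuousOn_kin hr₀ Ω).mono
          fun y (hy : y ∈ Icc m x) => hy.2.trans_lt (hxs.trans hs)
        have h2 := (continuousOn_weight hr₀).mono
          fun y (hy : y ∈ Icc m x) => hy.2.trans_lt (hxs.trans hs)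
        fun_prop
      refine this.congr fun y hy => ?_
      rw [dens, haff y ⟨hy.1, hy.2.trans hxs.le⟩]
    have hlt0 : ∀ y ∈ Ioo m x, dens r₀ Ω P 0 y < 0 := by
      intro y hy
      have hye : y < sEnd r₀ := hy.2.trans (hxs.trans hs)
      have ty := tau_pos hr₀ hye
      rw [dens, haff y ⟨hy.1.le, (hy.2.trans hxs).le⟩, kin_sub_affine hr₀ hye hm.1.2]
      refine mul_neg_of_neg_of_pos (mul_neg_of_pos_of_neg ?_ ?_) (weight_pos hr₀ hye)
      · linarith [tau_lt_tau hr₀ hye hy.1]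
      · have h1 : 0 < c * sEnd r₀ - Ω ^ 2 * r₀ ^ 2 / 2 * (tau r₀ y * tau r₀ m) :=
          hb' ⟨hy.1, hy.2.trans hxb⟩
        rw [sub_neg, lt_div_iff₀ (by positivity)]
        linarith
    have h0 := intervalIntegral.integral_pos hx.1 hcont.neg
      (fun y hy => ?_) ⟨(m + x) / 2, ?_, ?_⟩
    · rw [Pi.neg_def, intervalIntegral.integral_neg] at h0
      linarith
    · rcases hy.2.eq_or_lt with rfl | hyx
      · have hye : y < sEnd r₀ := hxs.trans hs
        have ty := tau_pos hr₀ hye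
        rw [Pi.neg_apply, dens, haff y ⟨hy.1.le, hxs.le⟩, kin_sub_affine hr₀ hye hm.1.2]
        refine neg_nonneg.2 (mul_nonpos_of_nonpos_of_nonneg
          (mul_nonpos_of_nonneg_of_nonpos ?_ ?_) (weight_nonneg _ _))
        · linarith [tau_lt_tau hr₀ hye hy.1]
        · have h1 : 0 < c * sEnd r₀ - Ω ^ 2 * r₀ ^ 2 / 2 * (tau r₀ y * tau r₀ m) :=
            hb' ⟨hy.1, hxb⟩
          rw [sub_nonpos, le_div_iff₀ (by positivity)]
          linarith
      · exact neg_nonneg.2 (hlt0 y ⟨hy.1, hyx⟩).le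
    · constructor <;> linarith [hx.1]
    · exact neg_pos.2 (hlt0 _ (by constructor <;> linarith [hx.1]))
  have := hm.2.2 x ⟨hx.1.le, hxs.trans hs⟩
  linarith

/-- A strictly convex kinetic term that is at `m` at least as steep as an affine function stays
above it to the right of `m`. -/
lemma kin_gt_of_curv {r₀ Ω c m x : ℝ} (hr₀ : 0 < r₀) (hΩ : 0 < Ω) (hm : m < x)
    (hx : x < sEnd r₀) (hcurv : c * sEnd r₀ ≤ Ω ^ 2 * r₀ ^ 2 / 2 * tau r₀ m ^ 2) :
    kin r₀ Ω m + c * (x - m) < kin r₀ Ω x := by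
  have tm := tau_pos hr₀ (hm.trans hx)
  have tx := tau_pos hr₀ hx
  have hlt := tau_lt_tau hr₀ hx hm
  have h := kin_sub_affine (Ω := Ω) (c := c) hr₀ hx (hm.trans hx)
  have : 0 < (tau r₀ x - tau r₀ m) *
      (Ω ^ 2 * r₀ ^ 2 / 2 - c * sEnd r₀ / (tau r₀ x * tau r₀ m)) := by
    refine mul_pos (by linarith) ?_
    rw [sub_pos, div_lt_iff₀ (by positivity)]
    have : 0 < Ω ^ 2 * r₀ ^ 2 / 2 := by positivity
    have : tau r₀ m ^ 2 < tau r₀ x * tau r₀ m := by nlinarith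
    nlinarith
  linarith

namespace TwoProfiles

variable {r₀ H Ω R S₀ S : ℝ} {P : Plane → ℝ} {ρ₁ ρ₂ : ℝ → ℝ}

lemma gapFun_swap (H : ℝ) (ρ₁ ρ₂ : ℝ → ℝ) (s : ℝ) :
    gapFun r₀ H ρ₂ ρ₁ s = - gapFun r₀ H ρ₁ ρ₂ s := by
  unfold gapFun
  rw [← integral_neg]
  simp

/-- The discrepancy is nowhere zero on an interval without critical points with a zero in it and a
nonzero value at one end. -/
lemma gapFun_ne_zero (T : TwoProfiles r₀ H Ω R S₀ S P ρ₁ ρ₂) {m s d x : ℝ} (hm : 0 ≤ m)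
    (hms : m < s) (hd : d < sEnd r₀) (hK : ∀ x ∈ Ioo m d, x ∉ critSet r₀ Ω P)
    (hQm : gapFun r₀ H ρ₁ ρ₂ m ≠ 0) (hQs : gapFun r₀ H ρ₁ ρ₂ s = 0) (hx : x ∈ Ioc s d) :
    gapFun r₀ H ρ₁ ρ₂ x ≠ 0 := by
  intro h0
  have hxe := hx.2.trans_lt hd
  have h := T.gapFun_interp (d := x) hm ⟨hms.le, hx.1.le⟩ hxe
    fun y hy => hK y ⟨hy.1, hy.2.trans_le hx.2⟩
  rw [h0, hQs, zero_sub] at h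
  have h1 := cumWeight_lt_cumWeight T.hr₀ hxe hx.1
  have h2 : (cumWeight r₀ x - cumWeight r₀ s) * gapFun r₀ H ρ₁ ρ₂ m = 0 := by linarith
  rcases mul_eq_zero.1 h2 with h3 | h3
  · linarith
  · exact hQm h3

/-- The discrepancy vanishes on an interval without critical points inside if it vanishes at both
ends. -/
lemma gapFun_eq_zero (T : TwoProfiles r₀ H Ω R S₀ S P ρ₁ ρ₂) {c d x : ℝ} (hc : 0 ≤ c)
    (hd : d < sEnd r₀) (hK : ∀ x ∈ Ioo c d, x ∉ critSet r₀ Ω P)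
    (hQc : gapFun r₀ H ρ₁ ρ₂ c = 0) (hQd : gapFun r₀ H ρ₁ ρ₂ d = 0) (hx : x ∈ Icc c d) :
    gapFun r₀ H ρ₁ ρ₂ x = 0 := by
  rcases (hx.1.trans hx.2).eq_or_lt with h | h
  · have : x = c := le_antisymm (h ▸ hx.2) hx.1
    rw [this, hQc]
  · have h1 := T.gapFun_interp hc hx hd hK
    rw [hQc, hQd] at h1
    have h2 := cumWeight_lt_cumWeight T.hr₀ hd h
    rcases mul_eq_zero.1 (show (cumWeight r₀ d - cumWeight r₀ c) * gapFun r₀ H ρ₁ ρ₂ x = 0 by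
      linarith) with h3 | h3
    · linarith
    · exact h3

/-- A point with nonzero discrepancy lies in a cell: the contact interval of a supporting line of
`P(·, 0)` at this point. The image measures, tested on the half planes above and strictly above the
slope, show that the discrepancy vanishes at both ends. -/
lemma exists_cell (T : TwoProfiles r₀ H Ω R S₀ S P ρ₁ ρ₂) {x : ℝ} (hx : x ∈ Ioo 0 S)
    (hQ : gapFun r₀ H ρ₁ ρ₂ x ≠ 0) :
    ∃ c s₁ s₂ m, Cell r₀ H Ω R S P ρ₁ ρ₂ c s₁ s₂ m ∧ x ∈ Ioo s₁ s₂ := by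
  have hpc : Continuous fun s : ℝ => P !₂[s, 0] := T.pot.continuous_section (isCompact_box R) 0
  -- the supporting line at `x` and its contact set
  obtain ⟨q, hq, hq'⟩ := T.pot !₂[x, 0]
  obtain ⟨c, hc⟩ : ∃ c, c = q 0 := ⟨_, rfl⟩
  have hsup : ∀ s : ℝ, P !₂[x, 0] + c * (s - x) ≤ P !₂[s, 0] := fun s => by
    have := hq' !₂[s, 0]
    rw [inner_plane] at this
    simp only [PiLp.sub_apply, Matrix.cons_val_zero, Matrix.cons_val_one, sub_self, zero_mul,
      add_zero, ← hc] at this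
    linarith
  have hcR : c ∈ Icc 0 R := hc ▸ hq.1
  set Z : Set ℝ := {s | s ∈ Icc 0 S ∧ P !₂[s, 0] = P !₂[x, 0] + c * (s - x)} with hZ
  have hZc : IsCompact Z := by
    refine isCompact_Icc.of_isClosed_subset ?_ (fun s hs => hs.1)
    exact isClosed_Icc.inter (isClosed_eq hpc (by fun_prop))
  have hxZ : x ∈ Z := ⟨⟨hx.1.le, hx.2.le⟩, by simp⟩
  obtain ⟨s₁, hs₁, hmin⟩ := hZc.exists_isLeast ⟨x, hxZ⟩
  obtain ⟨s₂, hs₂, hmax⟩ := hZc.exists_isGreatest ⟨x, hxZ⟩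
  have h1x := hmin hxZ
  have h2x := hmax hxZ
  have haff : ∀ s ∈ Icc s₁ s₂, P !₂[s, 0] = P !₂[x, 0] + c * (s - x) := by
    intro s hs
    refine le_antisymm ?_ (hsup s)
    obtain ⟨q', -, hq2⟩ := T.pot !₂[s, 0]
    have e1 := hq2 !₂[s₁, 0]
    have e2 := hq2 !₂[s₂, 0]
    rw [inner_plane] at e1 e2
    simp only [PiLp.sub_apply, Matrix.cons_val_zero, Matrix.cons_val_one, sub_self, zero_mul,
      add_zero] at e1 e2
    rw [hs₁.2] at e1
    rw [hs₂.2] at e2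
    rcases le_total c (q' 0) with h | h
    · nlinarith [mul_le_mul_of_nonneg_right h (show 0 ≤ s₂ - s by linarith [hs.2])]
    · nlinarith [mul_le_mul_of_nonneg_right h (show 0 ≤ s - s₁ by linarith [hs.1])]
  have hstr : ∀ s ∈ Icc 0 S, s < s₁ ∨ s₂ < s → P !₂[x, 0] + c * (s - x) < P !₂[s, 0] := by
    intro s hs hor
    refine lt_of_le_of_ne (hsup s) fun h => ?_
    have hsZ : s ∈ Z := ⟨hs, h.symm⟩
    rcases hor with h' | h'
    · exact absurd (hmin hsZ) (not_le.2 h')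
    · exact absurd (hmax hsZ) (not_le.2 h')
  have hg2 : gapFun r₀ H ρ₁ ρ₂ s₂ = 0 := by
    refine T.gapFun_eq_zero_of_push hs₂.1 (A := {q | c < q 0})
      (measurableSet_lt measurable_const (measurable_coord 0)) fun s hs hne q hq => ?_
    change c < q 0 ↔ s₂ < s
    have e := hq s₂
    rw [hs₂.2] at e
    constructor
    · intro h
      by_contra! hle
      have hlt : 0 < s₂ - s := sub_pos.2 (lt_of_le_of_ne hle hne)
      have := mul_lt_mul_of_pos_right h hlt
      have := hsup s
      nlinarith
    · intro h
      have e2 := hstr s ⟨hs.1.le, hs.2.le⟩ (Or.inr h)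
      by_contra! hle
      have := mul_le_mul_of_nonneg_right hle (sub_pos.2 h).le
      nlinarith
  have hg1 : gapFun r₀ H ρ₁ ρ₂ s₁ = 0 := by
    refine T.gapFun_eq_zero_of_push hs₁.1 (A := {q | c ≤ q 0})
      (measurableSet_le measurable_const (measurable_coord 0)) fun s hs hne q hq => ?_
    change c ≤ q 0 ↔ s₁ < s
    have e := hq s₁
    rw [hs₁.2] at e
    constructor
    · intro h
      by_contra! hle
      have hlt := lt_of_le_of_ne hle hne
      have e2 := hstr s ⟨hs.1.le, hs.2.le⟩ (Or.inl hlt)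
      have := mul_le_mul_of_nonneg_right h (sub_pos.2 hlt).le
      nlinarith
    · intro h
      by_contra! hlt
      have := mul_lt_mul_of_pos_right hlt (sub_pos.2 h)
      have := hsup s
      nlinarith
  have hx1 : s₁ < x := lt_of_le_of_ne h1x fun h => hQ (h ▸ hg1)
  have hx2 : x < s₂ := lt_of_le_of_ne h2x fun h => hQ (h ▸ hg2)
  have hs2e : s₂ < sEnd r₀ := hs₂.1.2.trans_lt T.hSe
  -- the interval contains a critical point
  obtain ⟨m, hm, hmK⟩ : ∃ m ∈ Ioo s₁ s₂, m ∈ critSet r₀ Ω P := by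
    by_contra! hno
    exact hQ (T.gapFun_eq_zero hs₁.1.1 hs2e hno hg1 hg2 ⟨hx1.le, hx2.le⟩)
  have haffm : ∀ m ∈ Ioo s₁ s₂, m ∈ critSet r₀ Ω P → ∀ s ∈ Icc s₁ s₂,
      P !₂[s, 0] = kin r₀ Ω m + c * (s - m) := by
    intro m hm hmK s hs
    rw [hmK.2.1, haff s hs, haff m ⟨hm.1.le, hm.2.le⟩]
    ring
  have hcurv : ∀ m ∈ Ioo s₁ s₂, m ∈ critSet r₀ Ω P →
      c * sEnd r₀ ≤ Ω ^ 2 * r₀ ^ 2 / 2 * tau r₀ m ^ 2 := fun m hm hmK =>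
    curv_of_mem_critSet T.hr₀ hmK hm.2 hs2e fun y hy =>
      haffm m hm hmK y ⟨hm.1.le.trans hy.1, hy.2⟩
  have hkin : ∀ m ∈ Ioo s₁ s₂, m ∈ critSet r₀ Ω P → ∀ s ∈ Ioc m s₂,
      P !₂[s, 0] < kin r₀ Ω s := by
    intro m hm hmK s hs
    rw [haffm m hm hmK s ⟨(hm.1.trans hs.1).le, hs.2⟩]
    exact kin_gt_of_curv T.hr₀ T.hΩ hs.1 (hs.2.trans_lt hs2e) (hcurv m hm hmK)
  have huniq : ∀ y ∈ Ioo s₁ s₂, y ∈ critSet r₀ Ω P → y = m := by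
    intro y hy hyK
    rcases lt_trichotomy y m with h | h | h
    · exact absurd hmK.2.1 (hkin y hy hyK m ⟨h, hm.2.le⟩).ne'
    · exact h
    · exact absurd hyK.2.1 (hkin m hm hmK y ⟨h, hy.2.le⟩).ne'
  refine ⟨c, s₁, s₂, m, ⟨hcR, hs₁.1.1, hm.1, hm.2, hs₂.1.2, haffm m hm hmK, ?_, hg1, hg2, ?_, hmK,
    huniq, hkin m hm hmK, hcurv m hm hmK⟩, hx1, hx2⟩
  · intro s hs
    have := hstr s ⟨(hs₁.1.1.trans (hm.1.trans (hm.2.trans hs.1)).le), hs.2⟩ (Or.inr hs.1)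
    rw [hmK.2.1, haff m ⟨hm.1.le, hm.2.le⟩]
    linarith
  · intro h0
    refine hQ ?_
    rcases le_total x m with h | h
    · refine T.gapFun_eq_zero hs₁.1.1 (hm.2.trans hs2e) (fun y hy hyK => ?_) hg1 h0 ⟨hx1.le, h⟩
      exact hy.2.ne (huniq y ⟨hy.1, hy.2.trans hm.2⟩ hyK)
    · refine T.gapFun_eq_zero (hs₁.1.1.trans hm.1.le) hs2e (fun y hy hyK => ?_) h0 hg2 ⟨h, hx2.le⟩
      exact hy.1.ne' (huniq y ⟨hm.1.trans hy.1, hy.2⟩ hyK)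

/-- The sign of the discrepancy at `m'` provides levels at which `ρ₁ < s ≤ ρ₂`. There `ρ₂ = m'` and
`ρ₁ ≤ m`, since these are critical or zero, and the minimality of `ρ₂` is the assertion. -/
lemma integral_dens_nonpos (T : TwoProfiles r₀ H Ω R S₀ S P ρ₁ ρ₂) {m s m' e : ℝ} (hm : 0 < m)
    (hms : m < s) (hsm : s < m') (hme : m' < e) (heS : e ≤ S)
    (hK₁ : ∀ x ∈ Ioo m m', x ∉ critSet r₀ Ω P) (hK₂ : ∀ x ∈ Ioo m' e, x ∉ critSet r₀ Ω P)
    (hs : gapFun r₀ H ρ₁ ρ₂ s = 0) (he : gapFun r₀ H ρ₁ ρ₂ e = 0)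
    (hm' : 0 < gapFun r₀ H ρ₁ ρ₂ m') : ∫ x in m..m', dens r₀ Ω P 0 x ≤ 0 := by
  have hr₀ := T.hr₀
  have hs0 := hm.trans hms
  have hm0 := hs0.trans hsm
  have hee : e < sEnd r₀ := heS.trans_lt T.hSe
  have hN1 : levelLen H ρ₂ s < levelLen H ρ₁ s := by
    have h := T.gapFun_sub_eq (c := s) (d := m') (s := m') hs0 ⟨hsm.le, le_rfl⟩ (hme.trans hee)
      fun x hx => hK₁ x ⟨hms.trans_le hx.1, hx.2⟩
    have h1 := cumWeight_lt_cumWeight hr₀ (hme.trans hee) hsm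
    rw [hs, sub_zero] at h
    rw [h] at hm'
    have := (mul_pos_iff_of_pos_left (by linarith)).1 hm'
    linarith
  obtain ⟨d, hd⟩ := exists_between hme
  have hN2 : levelLen H ρ₁ d < levelLen H ρ₂ d := by
    have h := T.gapFun_sub_eq (c := d) (d := e) (s := e) (hm0.trans hd.1) ⟨hd.2.le, le_rfl⟩ hee
      fun x hx => hK₂ x ⟨hd.1.trans_le hx.1, hx.2⟩
    have h' := T.gapFun_interp (c := m') (d := e) (x := d) hm0.le ⟨hd.1.le, hd.2.le⟩ hee hK₂
    have h1 := cumWeight_lt_cumWeight hr₀ hee hd.2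
    have h2 := cumWeight_lt_cumWeight hr₀ (hd.2.trans hee) hd.1
    rw [he] at h h'
    have h3 : 0 < (cumWeight r₀ e - cumWeight r₀ m') * gapFun r₀ H ρ₁ ρ₂ d := by
      have := mul_pos (sub_pos.2 h1) hm'
      linarith
    have h4 := (mul_pos_iff_of_pos_left (by linarith)).1 h3
    have h5 : 0 < (cumWeight r₀ e - cumWeight r₀ d) * (levelLen H ρ₂ d - levelLen H ρ₁ d) := by
      linarith
    have := (mul_pos_iff_of_pos_left (by linarith)).1 h5
    linarith
  obtain ⟨z, hz, hgood⟩ := exists_mem_Ioo_of_ae T.ae_good hN1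
  have hzH : z ∈ Icc 0 H := ⟨(levelLen_mem T.hH.le s).1.trans hz.1.le,
    hz.2.le.trans (levelLen_mem T.hH.le s).2⟩
  have hg := (hgood hzH).symm
  have hz1 : ρ₁ z < s := by
    by_contra! h
    exact absurd (levelLen_le T.pair₁.mono hzH h) (not_le.2 hz.2)
  have hz2 : s ≤ ρ₂ z := by
    by_contra! h
    exact absurd (le_levelLen T.pair₂.mono hzH h) (not_le.2 hz.1)
  have hz3 : ρ₂ z < d := by
    by_contra! h
    have h1 := levelLen_le T.pair₂.mono hzH h
    have h2 := levelLen_mono (H := H) (ρ := ρ₁) (hsm.trans hd.1).le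
    linarith [hz.2]
  have hlt := hz1.trans_le hz2
  obtain ⟨hk2, hk1⟩ := hg.mem_critSet hr₀ T.pot hlt
  have hz2' : ρ₂ z = m' := by
    rcases lt_trichotomy (ρ₂ z) m' with h | h | h
    · exact absurd hk2 (hK₁ _ ⟨hms.trans_le hz2, h⟩)
    · exact h
    · exact absurd hk2 (hK₂ _ ⟨h, hz3.trans hd.2⟩)
  have hz1' : ρ₁ z ≤ m := by
    rcases hk1 with h | h
    · rw [h]; exact hm.le
    · by_contra! h'
      exact hK₁ _ ⟨h', hz1.trans hsm⟩ h
  have heq := hg.eq_on T.pot hlt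
  have hPc := fun z => (T.pot.continuous_section (isCompact_box R) z).continuousOn
    (s := Icc 0 (sEnd r₀))
  have h1 := hg.arg₁.integral_nonneg hr₀ (hPc z)
    (show m ∈ Ico 0 (sEnd r₀) from ⟨hm.le, hms.trans (hsm.trans (hme.trans hee))⟩)
  rw [hz2', intervalIntegral.integral_symm] at h1
  have h2 : ∫ x in m..m', dens r₀ Ω P 0 x = ∫ x in m..m', dens r₀ Ω P z x := by
    refine intervalIntegral.integral_congr fun x hx => ?_
    rw [uIcc_of_le (hms.trans hsm).le] at hx
    rw [dens, dens, heq x ⟨hz1'.trans hx.1, by rw [hz2']; exact hx.2⟩]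
  linarith

/-- Each cell has a right neighbour, in which the discrepancy is larger in a weighted sense. -/
lemma exists_next_cell (T : TwoProfiles r₀ H Ω R S₀ S P ρ₁ ρ₂) {c s₁ s₂ m : ℝ}
    (h : Cell r₀ H Ω R S P ρ₁ ρ₂ c s₁ s₂ m) :
    ∃ c' s₁' s₂' m', Cell r₀ H Ω R S P ρ₁ ρ₂ c' s₁' s₂' m' ∧ c < c' ∧
      3 * (c * gapFun r₀ H ρ₁ ρ₂ m ^ 2) ≤ c' * gapFun r₀ H ρ₁ ρ₂ m' ^ 2 := by
  have hr₀ := T.hr₀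
  have hm0 : 0 < m := h.nonneg.trans_lt h.lt₁
  have hs2e : s₂ < sEnd r₀ := h.le.trans_lt T.hSe
  have hPc : Continuous fun s : ℝ => P !₂[s, 0] := T.pot.continuous_section (isCompact_box R) 0
  -- there is no critical point in a right neighbourhood of `s₂`
  have hev : ∀ᶠ x in 𝓝[>] s₂, P !₂[x, 0] < kin r₀ Ω x := by
    have h1 : ContinuousAt (kin r₀ Ω) s₂ :=
      (continuousOn_kin hr₀ Ω).continuousAt (Iio_mem_nhds hs2e)
    exact ((hPc.continuousAt (x := s₂)).eventually_lt h1
      (h.kin_gt s₂ ⟨h.lt₂, le_rfl⟩)).filter_mono nhdsWithin_le_nhds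
  obtain ⟨b, hb, hb'⟩ := mem_nhdsGT_iff_exists_Ioo_subset.1 hev
  obtain ⟨d, hd⟩ := exists_between (show s₂ < min b (sEnd r₀) from lt_min hb hs2e)
  have hdb := hd.2.trans_le (min_le_left _ _)
  have hde := hd.2.trans_le (min_le_right _ _)
  have hK : ∀ x ∈ Ioo m d, x ∉ critSet r₀ Ω P := by
    intro x hx hxK
    rcases le_or_gt x s₂ with hle | hlt
    · exact (h.kin_gt x ⟨hx.1, hle⟩).ne' hxK.2.1
    · exact (show P !₂[x, 0] < kin r₀ Ω x from hb' ⟨hlt, hx.2.trans hdb⟩).ne' hxK.2.1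
  have hne : ∀ x ∈ Ioc s₂ d, gapFun r₀ H ρ₁ ρ₂ x ≠ 0 := fun x hx =>
    T.gapFun_ne_zero hm0.le h.lt₂ hde hK h.gap_ne h.gap₂ hx
  have hdS : d < S := by
    by_contra! hSd
    exact hne d ⟨hd.1, le_rfl⟩ (T.gapFun_eq_zero_of_le (T.hS.le.trans hSd))
  obtain ⟨c', s₁', s₂', m', h', hd1, hd2⟩ :=
    T.exists_cell ⟨hm0.trans (h.lt₂.trans hd.1), hdS⟩ (hne d ⟨hd.1, le_rfl⟩)
  have hdaff := h'.affine d ⟨hd1.le, hd2.le⟩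
  have hdstr := h.strict d ⟨hd.1, hdS.le⟩
  -- the two cells are adjacent
  have hs1 : s₁' = s₂ := by
    rcases lt_trichotomy s₁' s₂ with hlt | heq | hgt
    · exfalso
      set y := max s₁ s₁' with hy
      have hys : y < s₂ := max_lt (h.lt₁.trans h.lt₂) hlt
      have e1 := h.affine y ⟨le_max_left _ _, hys.le⟩
      have e2 := h.affine s₂ ⟨(h.lt₁.trans h.lt₂).le, le_rfl⟩
      have e3 := h'.affine y ⟨le_max_right _ _, (hys.trans (hd.1.trans hd2)).le⟩
      have e4 := h'.affine s₂ ⟨hlt.le, (hd.1.trans hd2).le⟩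
      have e5 : (c' - c) * (s₂ - y) = 0 := by linarith
      rcases mul_eq_zero.1 e5 with h0 | h0
      · have : c' = c := by linarith
        rw [this] at e4 hdaff
        linarith
      · linarith
    · exact heq
    · exact absurd h'.gap₁ (hne s₁' ⟨hgt, hd1.le⟩)
  subst hs1
  have e2 := h.affine s₁' ⟨(h.lt₁.trans h.lt₂).le, le_rfl⟩
  have e4 := h'.affine s₁' ⟨le_rfl, (hd1.trans hd2).le⟩
  have hcc : c < c' := by
    by_contra! hle
    have := mul_le_mul_of_nonneg_right hle (sub_pos.2 hd1).le
    nlinarith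
  refine ⟨c', s₁', s₂', m', h', hcc, ?_⟩
  have hs2e' : s₂' < sEnd r₀ := h'.le.trans_lt T.hSe
  have hK₁ : ∀ x ∈ Ioo m m', x ∉ critSet r₀ Ω P := by
    intro x hx hxK
    rcases le_or_gt x s₁' with hle | hlt
    · exact (h.kin_gt x ⟨hx.1, hle⟩).ne' hxK.2.1
    · exact hx.2.ne (h'.uniq x ⟨hlt, hx.2.trans h'.lt₂⟩ hxK)
  have hK₂ : ∀ x ∈ Ioo m' s₂', x ∉ critSet r₀ Ω P := fun x hx hxK =>
    hx.1.ne' (h'.uniq x ⟨h'.lt₁.trans hx.1, hx.2⟩ hxK)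
  have hint : ∫ x in m..m', dens r₀ Ω P 0 x ≤ 0 := by
    rcases lt_or_gt_of_ne h'.gap_ne with hneg | hpos
    · refine T.symm.integral_dens_nonpos hm0 h.lt₂ h'.lt₁ h'.lt₂ h'.le hK₁ hK₂ ?_ ?_ ?_
      · rw [gapFun_swap, h.gap₂, neg_zero]
      · rw [gapFun_swap, h'.gap₂, neg_zero]
      · rw [gapFun_swap]; linarith
    · exact T.integral_dens_nonpos hm0 h.lt₂ h'.lt₁ h'.lt₂ h'.le hK₁ hK₂ h.gap₂ h'.gap₂ hpos
  have hmain := three_mul_le_of_integral_nonpos hr₀ hPc.continuousOn h.c_mem.1 h'.c_mem.1 hm0.le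
    h.lt₂ h'.lt₁ (h'.lt₂.trans hs2e') (fun x hx => h.affine x ⟨h.lt₁.le.trans hx.1, hx.2⟩)
    (fun x hx => h'.affine x ⟨hx.1, hx.2.trans h'.lt₂.le⟩) h.curv hint
  have hrel := T.gapFun_interp (c := m) (d := m') (x := s₁') hm0.le ⟨h.lt₂.le, h'.lt₁.le⟩
    (h'.lt₂.trans hs2e') hK₁
  rw [h.gap₂] at hrel
  have hA := cumWeight_lt_cumWeight hr₀ hs2e h.lt₂
  obtain ⟨A, hAd⟩ : ∃ A, A = cumWeight r₀ s₁' - cumWeight r₀ m := ⟨_, rfl⟩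
  obtain ⟨B, hBd⟩ : ∃ B, B = cumWeight r₀ m' - cumWeight r₀ s₁' := ⟨_, rfl⟩
  rw [← hAd, ← hBd] at hmain
  have hA0 : 0 < A := by linarith
  have hrel' : A * gapFun r₀ H ρ₁ ρ₂ m' = -(B * gapFun r₀ H ρ₁ ρ₂ m) := by
    rw [hAd, hBd]; linarith
  generalize gapFun r₀ H ρ₁ ρ₂ m' = y' at hrel' ⊢
  generalize gapFun r₀ H ρ₁ ρ₂ m = y at hrel' ⊢
  have h1 : A ^ 2 * y' ^ 2 = B ^ 2 * y ^ 2 := by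
    rw [← mul_pow, hrel', neg_sq, mul_pow]
  have h2 := mul_le_mul_of_nonneg_right hmain (sq_nonneg y)
  refine le_of_mul_le_mul_left (a := A ^ 2) ?_ (by positivity)
  calc A ^ 2 * (3 * (c * y ^ 2)) = 3 * (c * A ^ 2) * y ^ 2 := by ring
    _ ≤ c' * B ^ 2 * y ^ 2 := h2
    _ = c' * (B ^ 2 * y ^ 2) := by ring
    _ = A ^ 2 * (c' * y' ^ 2) := by rw [← h1]; ring

/-- The discrepancy vanishes everywhere: otherwise the weighted discrepancy `c Q(m)²` would grow
by the factor three from each cell to the next, while it is bounded. -/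
lemma gapFun_eq_zero_of_mem (T : TwoProfiles r₀ H Ω R S₀ S P ρ₁ ρ₂) {x : ℝ} (hx : x ∈ Ioo 0 S) :
    gapFun r₀ H ρ₁ ρ₂ x = 0 := by
  by_contra hQ
  obtain ⟨c, s₁, s₂, m, h, -⟩ := T.exists_cell hx hQ
  obtain ⟨c', s₁', s₂', m', h', hcc, -⟩ := T.exists_next_cell h
  set y := c' * gapFun r₀ H ρ₁ ρ₂ m' ^ 2 with hy
  have hy0 : 0 < y := mul_pos (h.c_mem.1.trans_lt hcc) (by have := h'.gap_ne; positivity)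
  have hiter : ∀ n : ℕ, ∃ c s₁ s₂ m, Cell r₀ H Ω R S P ρ₁ ρ₂ c s₁ s₂ m ∧
      3 ^ n * y ≤ c * gapFun r₀ H ρ₁ ρ₂ m ^ 2 := by
    intro n
    induction n with
    | zero => exact ⟨c', s₁', s₂', m', h', by simp [hy]⟩
    | succ n ih =>
      obtain ⟨a, b, d, e, hc, hn⟩ := ih
      obtain ⟨a', b', d', e', hc', -, hn'⟩ := T.exists_next_cell hc
      refine ⟨a', b', d', e', hc', ?_⟩
      rw [pow_succ]
      linarith
  obtain ⟨n, hn⟩ := pow_unbounded_of_one_lt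
    (R * ((cumWeight r₀ S - cumWeight r₀ 0) * H) ^ 2 / y) (show (1:ℝ) < 3 by norm_num)
  obtain ⟨a, b, d, e, hc, hn'⟩ := hiter n
  rw [div_lt_iff₀ hy0] at hn
  have heS : e ≤ S := hc.lt₂.le.trans hc.le
  have he0 : 0 ≤ e := hc.nonneg.trans hc.lt₁.le
  have hb := T.abs_gapFun_sub_le heS T.hSe
  rw [T.gapFun_eq_zero_of_le T.hS.le, zero_sub, abs_neg] at hb
  have hb' : |gapFun r₀ H ρ₁ ρ₂ e| ≤ (cumWeight r₀ S - cumWeight r₀ 0) * H := by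
    refine hb.trans (mul_le_mul_of_nonneg_right ?_ T.hH.le)
    linarith [cumWeight_le_cumWeight T.hr₀ (heS.trans_lt T.hSe) he0]
  have h2 : gapFun r₀ H ρ₁ ρ₂ e ^ 2 ≤ ((cumWeight r₀ S - cumWeight r₀ 0) * H) ^ 2 := by
    rw [← sq_abs]
    exact pow_le_pow_left₀ (abs_nonneg _) hb' 2
  have h3 := mul_le_mul hc.c_mem.2 h2 (sq_nonneg _) T.hR
  linarith

/-- If the discrepancy vanishes, the profiles are ordered: at a point of continuity of `ρ₂` with
`ρ₂ z < ρ₁ z`, monotonicity keeps the profiles apart on all of a small interval `[z, z']` and keeps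
the order elsewhere, so that the discrepancy would change. -/
lemma ae_le (T : TwoProfiles r₀ H Ω R S₀ S P ρ₁ ρ₂) :
    ∀ᵐ z : ℝ, z ∈ Icc 0 H → ρ₁ z ≤ ρ₂ z := by
  have hr₀ := T.hr₀
  have hc : ∀ᵐ z : ℝ, z ∉ {z | z ∈ Icc 0 H ∧ ¬ ContinuousWithinAt ρ₂ (Icc 0 H) z} :=
    measure_eq_zero_iff_ae_notMem.1
      ((T.pair₂.mono.countable_not_continuousWithinAt).measure_zero volume)
  filter_upwards [hc, ae_ne_const H, T.le₁] with z hz hzne hle hzH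
  by_contra! hlt
  have hcont : ContinuousWithinAt ρ₂ (Icc 0 H) z := by
    by_contra hcon; exact hz ⟨hzH, hcon⟩
  obtain ⟨c', hc1, hc2⟩ := exists_between hlt
  obtain ⟨c, hc3, hc4⟩ := exists_between hc2
  obtain ⟨ε, hε, hball⟩ := Metric.mem_nhdsWithin_iff.1 ((tendsto_order.1 hcont).2 _ hc1)
  have hzH' : z < H := lt_of_le_of_ne hzH.2 hzne
  obtain ⟨z', hz'⟩ := exists_between (show z < min (z + ε) H from lt_min (by linarith) hzH')
  have hz'H : z' ∈ Icc 0 H := ⟨hzH.1.trans hz'.1.le, (hz'.2.trans_le (min_le_right _ _)).le⟩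
  have h4 : ρ₂ z' < c' := hball ⟨by
    rw [Metric.mem_ball, Real.dist_eq, abs_of_pos (by linarith [hz'.1])]
    linarith [hz'.2.trans_le (min_le_left (z + ε) H)], hz'H⟩
  have hc'0 : 0 < c' := (T.pair₂.range z hzH).1.trans_lt hc1
  have hcS : c < S := (hc4.trans_le (hle hzH)).trans T.hS
  have hce : c < sEnd r₀ := hcS.trans T.hSe
  have hsub := T.gapFun_sub (c := c') (s := c) (hc3.trans hce) hce
  rw [T.gapFun_eq_zero_of_mem ⟨hc'0, hc3.trans hcS⟩,
    T.gapFun_eq_zero_of_mem ⟨hc'0.trans hc3, hcS⟩, sub_self] at hsub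
  set δ := cumWeight r₀ c - cumWeight r₀ c' with hδ
  have hδ0 : 0 < δ := by linarith [cumWeight_lt_cumWeight hr₀ hce hc3]
  -- the increment of `r ↦ M(max r c) - M(max r c')` decreases from `δ` to `0`
  have hb : ∀ r < sEnd r₀, cumWeight r₀ (max r c) - cumWeight r₀ (max r c') ∈ Icc 0 δ ∧
      (r ≤ c' → cumWeight r₀ (max r c) - cumWeight r₀ (max r c') = δ) ∧
      (c ≤ r → cumWeight r₀ (max r c) - cumWeight r₀ (max r c') = 0) := by
    intro r hr
    have h1 : r ≤ c' → cumWeight r₀ (max r c) - cumWeight r₀ (max r c') = δ := fun h => by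
      rw [max_eq_right h, max_eq_right (h.trans hc3.le)]
    have h2 : c ≤ r → cumWeight r₀ (max r c) - cumWeight r₀ (max r c') = 0 := fun h => by
      rw [max_eq_left h, max_eq_left (hc3.le.trans h), sub_self]
    refine ⟨?_, h1, h2⟩
    rcases le_total r c' with h | h
    · rw [h1 h]; exact ⟨hδ0.le, le_rfl⟩
    · rcases le_total c r with h' | h'
      · rw [h2 h']; exact ⟨le_rfl, hδ0.le⟩
      · rw [max_eq_left h, max_eq_right h']
        have e1 := cumWeight_le_cumWeight hr₀ hce h'
        have e2 := cumWeight_le_cumWeight hr₀ hr h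
        constructor <;> linarith
  have i1 := fun {x : ℝ} (hx : x < sEnd r₀) => integrableOn_cumWeight_max hr₀ T.pair₁ hx
  have i2 := fun {x : ℝ} (hx : x < sEnd r₀) => integrableOn_cumWeight_max hr₀ T.pair₂ hx
  have hle' : ∫ y in Icc 0 H, ((cumWeight r₀ (max (ρ₁ y) c) - cumWeight r₀ (max (ρ₁ y) c')) -
        (cumWeight r₀ (max (ρ₂ y) c) - cumWeight r₀ (max (ρ₂ y) c'))) ≤
      ∫ y in Icc 0 H, (Icc z z').indicator (fun _ => -δ) y := by
    refine setIntegral_mono_on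
      (((i1 hce).sub (i1 (hc3.trans hce))).sub ((i2 hce).sub (i2 (hc3.trans hce))))
      ((integrable_const (-δ)).indicator measurableSet_Icc) measurableSet_Icc fun y hy => ?_
    have h1 := hb _ (T.pair₁.range y hy).2
    have h2 := hb _ (T.pair₂.range y hy).2
    have l1 : z ≤ y → cumWeight r₀ (max (ρ₁ y) c) - cumWeight r₀ (max (ρ₁ y) c') = 0 :=
      fun h => h1.2.2 (hc4.le.trans (T.pair₁.mono hzH hy h))
    have l2 : y ≤ z' → cumWeight r₀ (max (ρ₂ y) c) - cumWeight r₀ (max (ρ₂ y) c') = δ :=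
      fun h => h2.2.1 ((T.pair₂.mono hy hz'H h).trans h4.le)
    by_cases hyz : y ∈ Icc z z'
    · rw [indicator_of_mem hyz, l1 hyz.1, l2 hyz.2]
      linarith
    · rw [indicator_of_notMem hyz]
      rcases le_total z y with h | h
      · rw [l1 h]; linarith [h2.1.1]
      · rw [l2 (h.trans hz'.1.le)]; linarith [h1.1.2]
  rw [integral_indicator measurableSet_Icc, Measure.restrict_restrict measurableSet_Icc,
    inter_eq_left.2 (Icc_subset_Icc hzH.1 hz'H.2), setIntegral_const, Real.volume_real_Icc,
    max_eq_left (by linarith [hz'.1]), smul_eq_mul] at hle'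
  nlinarith [mul_pos (sub_pos.2 hz'.1) hδ0]

end TwoProfiles

variable {r₀ H Ω R R' : ℝ} {σ : Measure Plane} {ρ ρ' : ℝ → ℝ} {P P' : Plane → ℝ}

/-- The profile and the optimal map of a triple are determined by the measure. -/
theorem IsTriple.unique [IsProbabilityMeasure σ] (hr₀ : 0 < r₀) (hH : 0 < H) (hΩ : 0 < Ω)
    (hR : 0 ≤ R) (hR' : 0 ≤ R') (h : IsTriple r₀ H Ω R σ ρ P) (h' : IsTriple r₀ H Ω R' σ ρ' P') :
    regionMeasure r₀ H ρ = regionMeasure r₀ H ρ' ∧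
      ∀ᵐ p ∂(regionMeasure r₀ H ρ), ∇ P p = ∇ P' p := by
  obtain ⟨hc, hgrad⟩ := h.cross hr₀ hH hΩ hR hR' h'
  refine ⟨regionMeasure_congr ?_, hgrad⟩
  obtain ⟨S₀, hS₀, hle⟩ := exists_le_kin hr₀ hΩ (P' 0 + R' * (sEnd r₀ + H))
  obtain ⟨S, hS⟩ := exists_between hS₀.2
  have T : TwoProfiles r₀ H Ω R' S₀ S P' ρ ρ' := ⟨hr₀, hH, hΩ, hR', hS₀.1, hS.1, hS.2, h'.pot,
    hc.pair, h'.pair, hc.pair.ae_le hr₀ hΩ hR' h'.pot hS₀ hle,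
    h'.pair.ae_le hr₀ hΩ hR' h'.pot hS₀ hle, hc.push.trans h'.push.symm⟩
  filter_upwards [T.ae_le, T.symm.ae_le] with z h1 h2 hz
  exact le_antisymm (h1 hz) (h2 hz)

/-! ### Duality: optimal triples, primal minimizers and dual maximizers -/

lemma integrable_of_continuousOn {X : Type*} [TopologicalSpace X] [T2Space X]
    [SecondCountableTopology X]
    [MeasurableSpace X] [BorelSpace X] {μ : Measure X} [IsFiniteMeasure μ]
    {K : Set X} (hK : IsCompact K) (hμ : ∀ᵐ x ∂μ, x ∈ K) {f : X → ℝ} (hf : ContinuousOn f K) :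
    Integrable f μ := by
  have h := hf.integrableOn_compact' (μ := μ) hK hK.measurableSet
  rwa [IntegrableOn, Measure.restrict_eq_self_of_ae_mem hμ] at h

section Potential

variable {r₀ H Ω : ℝ} {P P' : Plane → ℝ} {z r : ℝ}

lemma continuousOn_section (hP : ContinuousOn P (domC r₀ H)) (hz : z ∈ Icc 0 H) :
    ContinuousOn (fun s : ℝ => P !₂[s, z]) (Icc 0 (sEnd r₀)) :=
  hP.comp (continuous_mk₂.comp (by fun_prop : Continuous fun s : ℝ => (s, z))).continuousOn
    fun _ hs => ⟨hs, hz⟩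

lemma potentialPi_anti (hr₀ : 0 < r₀)
    (hP : ContinuousOn (fun s : ℝ => P !₂[s, z]) (Icc 0 (sEnd r₀)))
    (hP' : ContinuousOn (fun s : ℝ => P' !₂[s, z]) (Icc 0 (sEnd r₀)))
    (hr : r ∈ Ico 0 (sEnd r₀)) (h : ∀ s ∈ Icc 0 r, P' !₂[s, z] ≤ P !₂[s, z]) :
    potentialPi r₀ Ω P r z ≤ potentialPi r₀ Ω P' r z := by
  have h0 : (0 : ℝ) ∈ Ico 0 (sEnd r₀) := ⟨le_rfl, sEnd_pos hr₀⟩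
  rw [potentialPi_eq, potentialPi_eq]
  refine intervalIntegral.integral_mono_on hr.1 (intervalIntegrable_dens hr₀ Ω hP h0 hr)
    (intervalIntegrable_dens hr₀ Ω hP' h0 hr) fun s hs => ?_
  exact mul_le_mul_of_nonneg_right (by linarith [h s hs]) (weight_nonneg _ _)

lemma potentialPi_congr (hr : 0 ≤ r) (h : ∀ s ∈ Icc 0 r, P' !₂[s, z] = P !₂[s, z]) :
    potentialPi r₀ Ω P' r z = potentialPi r₀ Ω P r z := by
  rw [potentialPi_eq, potentialPi_eq]
  refine intervalIntegral.integral_congr fun s hs => ?_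
  rw [uIcc_of_le hr] at hs
  simp only [dens, h s hs]

lemma exists_le_potentialPi (hr₀ : 0 < r₀) (hΩ : 0 < Ω) (hP : ContinuousOn P (domC r₀ H)) :
    ∃ C, ∀ z ∈ Icc 0 H, ∀ r ∈ Ico 0 (sEnd r₀), C ≤ potentialPi r₀ Ω P r z := by
  obtain ⟨C, hC⟩ := exists_abs_bound (isCompact_domC r₀ H) hP
  obtain ⟨r', hr', -⟩ := exists_largest_argmin hr₀ hΩ (P := fun _ => C) (z := 0) (C := C)
    continuousOn_const fun _ _ => le_rfl
  refine ⟨potentialPi r₀ Ω (fun _ => C) r' 0, fun z hz r hr => (hr'.2 r hr).trans ?_⟩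
  refine potentialPi_anti (P := fun _ => C) (z := z) hr₀ continuousOn_const
    (continuousOn_section hP hz) hr fun s hs => ?_
  exact (le_abs_self _).trans (hC _ ⟨⟨hs.1, hs.2.trans hr.2.le⟩, hz⟩)

lemma jFun_le (hr₀ : 0 < r₀) (hΩ : 0 < Ω) (hP : ContinuousOn P (domC r₀ H)) {ρ : ℝ → ℝ}
    (hρ : ρ ∈ profiles r₀ H)
    (hi : IntegrableOn (fun z => potentialPi r₀ Ω P (ρ z) z) (Icc 0 H)) :
    jFun r₀ H Ω P ≤ ∫ z in Icc 0 H, potentialPi r₀ Ω P (ρ z) z := by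
  obtain ⟨C, hC⟩ := exists_le_potentialPi hr₀ hΩ hP
  refine csInf_le ⟨∫ _ in Icc 0 H, C, ?_⟩ ⟨ρ, hρ, hi, rfl⟩
  rintro x ⟨ρ', hρ', hi', rfl⟩
  exact setIntegral_mono_on (integrable_const C) hi' measurableSet_Icc
    fun z hz => hC z hz _ (hρ'.2 z hz)

lemma le_jFun (hr₀ : 0 < r₀) {C : ℝ} (h : ∀ ρ ∈ profiles r₀ H,
    IntegrableOn (fun z => potentialPi r₀ Ω P (ρ z) z) (Icc 0 H) →
      C ≤ ∫ z in Icc 0 H, potentialPi r₀ Ω P (ρ z) z) : C ≤ jFun r₀ H Ω P := by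
  refine le_csInf ⟨_, fun _ => 0, ⟨measurable_const, fun z _ => ⟨le_rfl, sEnd_pos hr₀⟩⟩, ?_, rfl⟩ ?_
  · simp
  · rintro x ⟨ρ, hρ, hi, rfl⟩
    exact h ρ hρ hi

end Potential

/-- The part `Υ/(2 r₀²) - Ω √Υ` of the cost, which depends on the dual point only. -/
def dualCost (r₀ Ω : ℝ) (q : Plane) : ℝ := q 0 / (2 * r₀ ^ 2) - Ω * √(q 0)

lemma continuous_dualCost (r₀ Ω : ℝ) : Continuous (dualCost r₀ Ω) := by
  have := continuous_coord 0
  unfold dualCost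
  fun_prop

lemma cost_eq (r₀ Ω : ℝ) (p q : Plane) :
    cost r₀ Ω p q = kin r₀ Ω (p 0) - ⟪p, q⟫_ℝ + dualCost r₀ Ω q := by
  unfold cost kin dualCost
  rw [mul_comm (r₀ ^ 2) (Ω ^ 2), show 2 * r₀ ^ 2 * p 0 = 2 * p 0 * r₀ ^ 2 by ring]
  ring

section Duality

variable {r₀ H Ω R : ℝ} {σ : Measure Plane} {ρ : ℝ → ℝ} {P Ψ : Plane → ℝ}
  {γ : Measure (Plane × Plane)}

lemma ae_mem_box_of_mem_probBox (hσ : σ ∈ probBox R) : ∀ᵐ q ∂σ, q ∈ box R :=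
  mem_of_superset Measure.support_mem_ae hσ.2

lemma isCompact_support (hσ : σ ∈ probBox R) : IsCompact σ.support :=
  (isCompact_box R).of_isClosed_subset Measure.isClosed_support hσ.2

lemma support_nonempty (hσ : σ ∈ probBox R) : σ.support.Nonempty := by
  have := hσ.1
  exact Measure.nonempty_support (IsProbabilityMeasure.ne_zero σ)

lemma box_subset_quadrant (R : ℝ) : box R ⊆ quadrant := fun _ hq => ⟨hq.1.1, hq.2.1⟩

lemma couplings_ae_fst {μ ν : Measure Plane} (h : γ ∈ couplings μ ν) {f : Plane → Prop}
    (hf : ∀ᵐ p ∂μ, f p) : ∀ᵐ x ∂γ, f x.1 := by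
  rw [← h.1] at hf
  exact ae_of_ae_map measurable_fst.aemeasurable hf

lemma couplings_ae_snd {μ ν : Measure Plane} (h : γ ∈ couplings μ ν) {f : Plane → Prop}
    (hf : ∀ᵐ q ∂ν, f q) : ∀ᵐ x ∂γ, f x.2 := by
  rw [← h.2] at hf
  exact ae_of_ae_map measurable_snd.aemeasurable hf

lemma couplings_isProbabilityMeasure {μ ν : Measure Plane} [IsProbabilityMeasure ν]
    (h : γ ∈ couplings μ ν) : IsProbabilityMeasure γ := by
  constructor
  have : γ.map Prod.snd univ = 1 := by rw [h.2]; exact measure_univ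
  rwa [Measure.map_apply measurable_snd MeasurableSet.univ, preimage_univ] at this

lemma couplings_ae_mem (hρ : ρ ∈ profiles r₀ H) (h : γ ∈ couplings (regionMeasure r₀ H ρ) σ) :
    ∀ᵐ x ∂γ, x ∈ region H ρ ×ˢ σ.support := by
  filter_upwards [couplings_ae_fst h (regionMeasure_ae hρ),
    couplings_ae_snd h (f := fun q => q ∈ σ.support) Measure.support_mem_ae] with x h1 h2
  exact ⟨h1, h2⟩

lemma energy_eq (hρ : ρ ∈ profiles r₀ H) (h : γ ∈ couplings (regionMeasure r₀ H ρ) σ) :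
    energy r₀ H Ω σ ρ γ = ∫ x, cost r₀ Ω x.1 x.2 ∂γ := by
  rw [energy, Measure.restrict_eq_self_of_ae_mem (couplings_ae_mem hρ h)]

/-- Weak duality, with the two nonnegative terms of the duality gap. -/
lemma energy_sub_dualJ (hr₀ : 0 < r₀) (hΩ : 0 < Ω) (hσ : σ ∈ probBox R)
    (hadm : (ρ, γ) ∈ admissible r₀ H Ω σ) (hx : (P, Ψ) ∈ dualPairs r₀ H) :
    (energy r₀ H Ω σ ρ γ - dualJ r₀ H Ω σ P Ψ =
      ∫ x, (P x.1 + Ψ x.2 - ⟪x.1, x.2⟫_ℝ) ∂γ + (profileEnergy r₀ H Ω ρ P - jFun r₀ H Ω P)) ∧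
    Integrable (fun x => P x.1 + Ψ x.2 - ⟪x.1, x.2⟫_ℝ) γ ∧
    (0 ≤ᵐ[γ] fun x => P x.1 + Ψ x.2 - ⟪x.1, x.2⟫_ℝ) ∧
    jFun r₀ H Ω P ≤ profileEnergy r₀ H Ω ρ P ∧
    Integrable (fun p => kin r₀ Ω (p 0) - P p) (regionMeasure r₀ H ρ) := by
  obtain ⟨hρ, hmass, hγ, hi⟩ := hadm
  obtain ⟨hPc, hΨc, hy⟩ := hx
  simp only at hρ hmass hγ hi hPc hΨc hy
  rw [closure_domD hr₀] at hPc
  have := hσ.1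
  have hγp := couplings_isProbabilityMeasure hγ
  have hμ : IsFiniteMeasure (regionMeasure r₀ H ρ) := ⟨by rw [hmass]; exact ENNReal.one_lt_top⟩
  have hmem := couplings_ae_mem hρ hγ
  rw [IntegrableOn, Measure.restrict_eq_self_of_ae_mem hmem] at hi
  have hD := region_subset_domD hρ.2
  have hPi : Integrable P (regionMeasure r₀ H ρ) := by
    refine integrable_of_continuousOn (isCompact_domC r₀ H) ?_ hPc
    filter_upwards [regionMeasure_ae hρ] with p hp using domD_subset_domC _ _ (hD hp)
  have hΨi : Integrable Ψ σ := integrable_of_continuousOn (isCompact_box R)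
    (ae_mem_box_of_mem_probBox hσ) (hΨc.mono (box_subset_quadrant R))
  have hdi : Integrable (dualCost r₀ Ω) σ := integrable_of_continuousOn (isCompact_box R)
    (ae_mem_box_of_mem_probBox hσ) (continuous_dualCost r₀ Ω).continuousOn
  have hPγ : Integrable (fun x : Plane × Plane => P x.1) γ := by
    rw [← hγ.1] at hPi
    exact hPi.comp_measurable measurable_fst
  have hΨγ : Integrable (fun x : Plane × Plane => Ψ x.2) γ := by
    rw [← hγ.2] at hΨi
    exact hΨi.comp_measurable measurable_snd
  have hdγ : Integrable (fun x : Plane × Plane => dualCost r₀ Ω x.2) γ := by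
    rw [← hγ.2] at hdi
    exact hdi.comp_measurable measurable_snd
  have hinγ : Integrable (fun x : Plane × Plane => ⟪x.1, x.2⟫_ℝ) γ := by
    refine integrable_of_continuousOn ((isCompact_domC r₀ H).prod (isCompact_box R)) ?_
      (by fun_prop)
    filter_upwards [hmem] with x hx using ⟨domD_subset_domC _ _ (hD hx.1), hσ.2 hx.2⟩
  have hkγ : Integrable (fun x : Plane × Plane => kin r₀ Ω (x.1 0)) γ := by
    have := (hi.add hinγ).sub hdγ
    refine this.congr (ae_of_all _ fun x => ?_)
    simp only [Pi.add_apply, Pi.sub_apply, cost_eq]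
    ring
  have hki : Integrable (fun p : Plane => kin r₀ Ω (p 0)) (regionMeasure r₀ H ρ) := by
    rw [← hγ.1]
    exact (integrable_map_measure ((measurable_kin r₀ Ω).comp
      (measurable_coord 0)).aestronglyMeasurable measurable_fst.aemeasurable).2 hkγ
  have hPΨγ : Integrable (fun x : Plane × Plane => P x.1 + Ψ x.2) γ := hPγ.add hΨγ
  refine ⟨?_, hPΨγ.sub hinγ, ?_, ?_, hki.sub hPi⟩
  · rw [energy_eq hρ hγ]
    simp_rw [cost_eq]
    have hk' : Integrable (fun x : Plane × Plane => kin r₀ Ω (x.1 0) - ⟪x.1, x.2⟫_ℝ) γ :=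
      hkγ.sub hinγ
    have e1 : ∫ x, kin r₀ Ω (x.1 0) ∂γ = ∫ p, kin r₀ Ω (p 0) ∂(regionMeasure r₀ H ρ) := by
      have hm := hki.aestronglyMeasurable
      rw [← hγ.1] at hm ⊢
      rw [integral_map measurable_fst.aemeasurable hm]
    have e2 : ∫ x, P x.1 ∂γ = ∫ p, P p ∂(regionMeasure r₀ H ρ) := by
      have hm := hPi.aestronglyMeasurable
      rw [← hγ.1] at hm ⊢
      rw [integral_map measurable_fst.aemeasurable hm]
    have e3 : ∫ x, Ψ x.2 ∂γ = ∫ q, Ψ q ∂σ := by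
      have hm := hΨi.aestronglyMeasurable
      rw [← hγ.2] at hm
      conv_rhs => rw [← hγ.2]
      rw [integral_map measurable_snd.aemeasurable hm]
    have e4 : ∫ x, dualCost r₀ Ω x.2 ∂γ = ∫ q, dualCost r₀ Ω q ∂σ := by
      conv_rhs => rw [← hγ.2]
      rw [integral_map measurable_snd.aemeasurable
        (continuous_dualCost r₀ Ω).aestronglyMeasurable]
    have e5 : dualJ r₀ H Ω σ P Ψ =
        (∫ q, (dualCost r₀ Ω q - Ψ q) ∂σ) + jFun r₀ H Ω P := rfl
    rw [e5, integral_add hk' hdγ, integral_sub hkγ hinγ, integral_sub hPΨγ hinγ,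
      integral_add hPγ hΨγ, integral_sub hdi hΨi, profileEnergy, integral_sub hki hPi, e1, e2, e3,
      e4]
    ring
  · filter_upwards [hmem] with x hx
    have := hy x.1 (hD hx.1) x.2 (box_subset_quadrant R (hσ.2 hx.2))
    simp only [Pi.zero_apply]
    linarith
  · obtain ⟨h1, h2⟩ := profileEnergy_eq hρ (hki.sub hPi)
    rw [h2]
    exact jFun_le hr₀ hΩ hPc hρ h1

lemma dualJ_le_energy (hr₀ : 0 < r₀) (hΩ : 0 < Ω) (hσ : σ ∈ probBox R)
    (hadm : (ρ, γ) ∈ admissible r₀ H Ω σ) (hx : (P, Ψ) ∈ dualPairs r₀ H) :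
    dualJ r₀ H Ω σ P Ψ ≤ energy r₀ H Ω σ ρ γ := by
  obtain ⟨h1, -, h2, h3, -⟩ := energy_sub_dualJ hr₀ hΩ hσ hadm hx
  have := integral_nonneg_of_ae h2
  linarith

/-- Strong duality: an optimal triple yields an admissible pair and a pair of Legendre transforms
with equal energies. -/
lemma IsTriple.exists_energy_le_dualJ (hr₀ : 0 < r₀) (hH : 0 < H) (hΩ : 0 < Ω) {R' : ℝ}
    (hR' : 0 ≤ R') (hσ : σ ∈ probBox R) (h : IsTriple r₀ H Ω R' σ ρ P) :
    ∃ γ P' Ψ', (ρ, γ) ∈ admissible r₀ H Ω σ ∧ (P', Ψ') ∈ legendrePairs r₀ H σ ∧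
      energy r₀ H Ω σ ρ γ ≤ dualJ r₀ H Ω σ P' Ψ' := by
  have := hσ.1
  have hPc : Continuous P := h.pot.continuous (isCompact_box R')
  have hρ := h.pair.mem_profiles
  have hgm : Measurable fun p => (p, ∇ P p) := measurable_id.prodMk (measurable_gradient P)
  have hk := h.pair.integrable_kin hr₀ hΩ hR' h.pot
  have hin := h.integrable_inner hr₀ hΩ hR'
  have hsc := continuous_star hr₀ hH (hPc.continuousOn (s := domC r₀ H))
  have hdi : Integrable (dualCost r₀ Ω) σ := integrable_of_continuousOn (isCompact_box R)
    (ae_mem_box_of_mem_probBox hσ) (continuous_dualCost r₀ Ω).continuousOn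
  have hdμ : Integrable (fun p => dualCost r₀ Ω (∇ P p)) (regionMeasure r₀ H ρ) := by
    rw [← h.push] at hdi
    exact hdi.comp_measurable (measurable_gradient P)
  set γ := (regionMeasure r₀ H ρ).map fun p => (p, ∇ P p) with hγdef
  have hγ : γ ∈ couplings (regionMeasure r₀ H ρ) σ := by
    constructor
    · rw [hγdef, Measure.map_map measurable_fst hgm]
      exact Measure.map_id
    · rw [hγdef, Measure.map_map measurable_snd hgm]
      exact h.push
  have hcm : Measurable fun x : Plane × Plane => cost r₀ Ω x.1 x.2 := by
    simp_rw [cost_eq]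
    exact (((measurable_kin r₀ Ω).comp ((measurable_coord 0).comp measurable_fst)).sub
      (measurable_fst.inner measurable_snd)).add
        ((continuous_dualCost r₀ Ω).measurable.comp measurable_snd)
  have hkin : Integrable (fun p => kin r₀ Ω (p 0) - ⟪p, ∇ P p⟫_ℝ) (regionMeasure r₀ H ρ) :=
    hk.sub hin
  have hci : Integrable (fun x : Plane × Plane => cost r₀ Ω x.1 x.2) γ := by
    rw [hγdef, integrable_map_measure hcm.aestronglyMeasurable hgm.aemeasurable]
    refine (hkin.add hdμ).congr (ae_of_all _ fun p => ?_)
    simp [cost_eq]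
  have hadm : (ρ, γ) ∈ admissible r₀ H Ω σ := ⟨hρ, h.mass, hγ, hci.integrableOn⟩
  -- the energy of the triple
  have hen : energy r₀ H Ω σ ρ γ =
      ∫ q, (dualCost r₀ Ω q - star r₀ H P q) ∂σ + profileEnergy r₀ H Ω ρ P := by
    rw [energy_eq hρ hγ, hγdef, integral_map hgm.aemeasurable hcm.aestronglyMeasurable]
    simp_rw [cost_eq]
    rw [integral_add hkin hdμ, h.integral_comp (continuous_dualCost r₀ Ω).aestronglyMeasurable,
      integral_sub hdi (integrable_of_ae_mem (isCompact_box R)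
        (ae_mem_box_of_mem_probBox hσ) hsc)]
    have := h.primal_eq_dual hr₀ hH hΩ hR'
    rw [primalEnergy, dualEnergy] at this
    rw [this]
    ring
  -- restricting the Legendre transform to the support gives a pair of mutual transforms
  set P' := leg σ.support (star r₀ H P) with hP'
  set Ψ' := star r₀ H P' with hΨ'
  have hsup := isCompact_support hσ
  have hne := support_nonempty hσ
  have hP'c : Continuous P' := (isPot_leg hsup hne hsc.continuousOn).continuous hsup
  have hΨ'c : Continuous Ψ' := continuous_star hr₀ hH hP'c.continuousOn
  have hΨle : ∀ q ∈ σ.support, Ψ' q ≤ star r₀ H P q := fun q hq =>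
    leg_le ⟨0, zero_mem_domC hr₀ hH⟩ fun p hp => by
      have := le_leg hsup hsc.continuousOn p hq
      rw [real_inner_comm]
      linarith
  have hPle : ∀ p ∈ domC r₀ H, P' p ≤ P p := fun p hp => leg_le hne fun q _ => by
    linarith [young_star hPc.continuousOn hp q]
  have hyoung : ∀ p ∈ domC r₀ H, ∀ q, ⟪p, q⟫_ℝ ≤ P' p + Ψ' q := fun p hp q =>
    young_star hP'c.continuousOn hp q
  refine ⟨γ, P', Ψ', hadm, ⟨⟨hP'c.continuousOn, hΨ'c.continuousOn, fun p hp q _ =>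
    hyoung p (domD_subset_domC _ _ hp) q⟩, fun p hp => ?_, fun q _ => ?_⟩, ?_⟩
  · have hlub := isLUB_leg hsup hne (hΨ'c.continuousOn (s := σ.support)) p
    convert hlub using 1
    refine le_antisymm (leg_le hne fun q hq => ?_) (leg_le hne fun q hq => ?_)
    · linarith [le_leg hsup (hΨ'c.continuousOn (s := σ.support)) p hq, hΨle q hq]
    · simp only
      linarith [hyoung p (domD_subset_domC _ _ hp) q]
  · constructor
    · rintro _ ⟨p, hp, rfl⟩
      simp only
      linarith [hyoung p (domD_subset_domC _ _ hp) q]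
    · intro b hb
      have hcl : IsClosed {p : Plane | ⟪p, q⟫_ℝ - P' p ≤ b} :=
        isClosed_le (by fun_prop) continuous_const
      have hsub : closure (domD r₀ H) ⊆ {p : Plane | ⟪p, q⟫_ℝ - P' p ≤ b} :=
        closure_minimal (fun p hp => hb ⟨p, hp, rfl⟩) hcl
      rw [closure_domD hr₀] at hsub
      refine leg_le ⟨0, zero_mem_domC hr₀ hH⟩ fun p hp => ?_
      rw [real_inner_comm]
      exact hsub hp
  · rw [hen]
    refine add_le_add ?_ ?_
    · refine integral_mono_ae (hdi.sub (integrable_of_ae_mem (isCompact_box R)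
        (ae_mem_box_of_mem_probBox hσ) hsc)) (hdi.sub (integrable_of_ae_mem (isCompact_box R)
        (ae_mem_box_of_mem_probBox hσ) hΨ'c)) ?_
      filter_upwards [Measure.support_mem_ae (μ := σ)] with q hq
      change dualCost r₀ Ω q - star r₀ H P q ≤ dualCost r₀ Ω q - Ψ' q
      linarith [hΨle q hq]
    · obtain ⟨h1, h2⟩ := profileEnergy_eq hρ
        (hk.sub (h.pair.integrable_of_continuous hr₀ hΩ hR' h.pot hPc))
      rw [h2]
      refine le_jFun hr₀ fun r hr hi => ?_
      refine setIntegral_mono_ae_restrict h1 hi ?_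
      rw [EventuallyLE, ae_restrict_iff' measurableSet_Icc]
      filter_upwards [h.pair.argmin] with z hz hzH
      refine ((hz hzH).2 _ (hr.2 z hzH)).trans ?_
      exact potentialPi_anti hr₀ (continuousOn_section hPc.continuousOn hzH)
        (continuousOn_section hP'c.continuousOn hzH) (hr.2 z hzH)
        fun s hs => hPle _ ⟨⟨hs.1, hs.2.trans (hr.2 z hzH).2.le⟩, hzH⟩

lemma IsTriple.isPrimalMinimizer (hr₀ : 0 < r₀) (hH : 0 < H) (hΩ : 0 < Ω) {R' : ℝ}
    (hR' : 0 ≤ R') (hσ : σ ∈ probBox R) (h : IsTriple r₀ H Ω R' σ ρ P) :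
    IsPrimalMinimizer r₀ H Ω σ ρ := by
  obtain ⟨γ, P', Ψ', h1, h2, h3⟩ := h.exists_energy_le_dualJ hr₀ hH hΩ hR' hσ
  exact ⟨h.pair.mono, γ, h1, fun x hx => h3.trans (dualJ_le_energy hr₀ hΩ hσ hx h2.1)⟩

lemma IsTriple.exists_isDualMaximizer (hr₀ : 0 < r₀) (hH : 0 < H) (hΩ : 0 < Ω) {R' : ℝ}
    (hR' : 0 ≤ R') (hσ : σ ∈ probBox R) (h : IsTriple r₀ H Ω R' σ ρ P) :
    ∃ P' Ψ', IsDualMaximizer r₀ H Ω σ P' Ψ' := by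
  obtain ⟨γ, P', Ψ', h1, h2, h3⟩ := h.exists_energy_le_dualJ hr₀ hH hΩ hR' hσ
  exact ⟨P', Ψ', h2, fun x hx => (dualJ_le_energy hr₀ hΩ hσ h1 hx).trans h3⟩

/-- A primal minimizer and a dual maximizer form an optimal triple, up to an extension of the
potential from `𝒟` to the plane. -/
theorem exists_isTriple_of_optimal (hr₀ : 0 < r₀) (hH : 0 < H) (hΩ : 0 < Ω) (hR : 0 ≤ R)
    (hσ : σ ∈ probBox R) (hρ : IsPrimalMinimizer r₀ H Ω σ ρ)
    (hP : IsDualMaximizer r₀ H Ω σ P Ψ) :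
    ∃ P', IsTriple r₀ H Ω R σ ρ P' ∧ ∀ᵐ p ∂(regionMeasure r₀ H ρ), ∇ P p = ∇ P' p := by
  have := hσ.1
  obtain ⟨hmono, γ, hadm, hmin⟩ := hρ
  obtain ⟨⟨hdual, hleg, -⟩, hmax⟩ := hP
  obtain ⟨ρ₀, P₀, h₀⟩ := exists_isTriple hr₀ hH hΩ hR (ae_mem_box_of_mem_probBox hσ)
  obtain ⟨γ₀, P₁, Ψ₁, hadm₀, hleg₁, hle⟩ :=
    h₀.exists_energy_le_dualJ hr₀ hH hΩ (by linarith) hσ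
  -- no duality gap, by comparison with an optimal triple
  have hstrong : energy r₀ H Ω σ ρ γ ≤ dualJ r₀ H Ω σ P Ψ :=
    (hmin _ hadm₀).trans (hle.trans (hmax _ hleg₁.1))
  obtain ⟨hgap, hgi, hgnn, hj, hki⟩ := energy_sub_dualJ hr₀ hΩ hσ hadm hdual
  have hg0 := integral_nonneg_of_ae hgnn
  have hgap0 : ∫ x, (P x.1 + Ψ x.2 - ⟪x.1, x.2⟫_ℝ) ∂γ = 0 := by linarith
  have hj0 : profileEnergy r₀ H Ω ρ P = jFun r₀ H Ω P := by linarith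
  have hyoung := (integral_eq_zero_iff_of_nonneg_ae hgnn hgi).1 hgap0
  obtain ⟨hρ, hmass, hγ, -⟩ := hadm
  simp only at hρ hmass hγ
  have hsup := isCompact_support hσ
  have hne := support_nonempty hσ
  have hΨc : ContinuousOn Ψ σ.support :=
    hdual.2.1.mono (hσ.2.trans (box_subset_quadrant R))
  have hPc := hdual.1
  rw [closure_domD hr₀] at hPc
  set P' := leg σ.support Ψ with hP'
  have hpot : IsPot (box R) P' := (isPot_leg hsup hne hΨc).mono hσ.2
  have hP'c : Continuous P' := hpot.continuous (isCompact_box R)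
  have hPP : ∀ p ∈ domD r₀ H, P p = P' p := fun p hp =>
    (hleg p hp).unique (isLUB_leg hsup hne hΨc p)
  have hgradeq : ∀ p ∈ domO r₀ H, ∇ P p = ∇ P' p := by
    intro p hp
    have : P =ᶠ[𝓝 p] P' := by
      filter_upwards [(isOpen_domO r₀ H).mem_nhds hp] with p' hp'
      exact hPP p' (domO_subset_domD _ _ hp')
    unfold gradient
    rw [this.fderiv_eq]
  -- the profile is minimizing, as its energy is the infimum `j(P)`
  have hpi : ∀ z ∈ Icc 0 H, ∀ r ∈ Ico 0 (sEnd r₀),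
      potentialPi r₀ Ω P r z = potentialPi r₀ Ω P' r z := fun z hz r hr =>
    potentialPi_congr hr.1 fun s hs => hPP _ ⟨⟨hs.1, hs.2.trans_lt hr.2⟩, hz⟩
  obtain ⟨ρ', hρ'⟩ := exists_isPair (H := H) hr₀ hΩ hpot
  have hpair : IsPair r₀ H Ω ρ P' := by
    refine ⟨hmono, hρ.2, ?_⟩
    obtain ⟨i1, e1⟩ := profileEnergy_eq hρ hki
    obtain ⟨i2, -⟩ := profileEnergy_eq hρ'.mem_profiles
      ((hρ'.integrable_kin hr₀ hΩ hR hpot).sub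
        (hρ'.integrable_of_continuous hr₀ hΩ hR hpot hP'c))
    have i2' : IntegrableOn (fun z => potentialPi r₀ Ω P (ρ' z) z) (Icc 0 H) :=
      i2.congr_fun (fun z hz => (hpi z hz _ (hρ'.range z hz)).symm) measurableSet_Icc
    have hle' : (fun z => potentialPi r₀ Ω P (ρ' z) z) ≤ᵐ[volume.restrict (Icc 0 H)]
        fun z => potentialPi r₀ Ω P (ρ z) z := by
      rw [EventuallyLE, ae_restrict_iff' measurableSet_Icc]
      filter_upwards [hρ'.argmin] with z hz hzH
      rw [hpi z hzH _ (hρ'.range z hzH), hpi z hzH _ (hρ.2 z hzH)]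
      exact (hz hzH).2 _ (hρ.2 z hzH)
    have hle2 := jFun_le hr₀ hΩ hPc hρ'.mem_profiles i2'
    have heq := (integral_eq_iff_of_ae_le i2' i1 hle').1
      (le_antisymm (integral_mono_ae i2' i1 hle') (by rw [← e1, hj0]; exact hle2))
    rw [EventuallyEq, ae_restrict_iff' measurableSet_Icc] at heq
    filter_upwards [heq, hρ'.argmin] with z h1 h2 hz
    refine ⟨hρ.2 z hz, fun r hr => ?_⟩
    have h3 := h1 hz
    rw [hpi z hz _ (hρ'.range z hz), hpi z hz _ (hρ.2 z hz)] at h3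
    rw [← h3]
    exact (h2 hz).2 r hr
  refine ⟨P', ⟨hpot, hpair, ?_⟩, ?_⟩
  · -- the plan is concentrated on the graph of the gradient
    have hgraph : ∀ᵐ x ∂γ, x.2 = ∇ P' x.1 := by
      filter_upwards [hyoung, couplings_ae_mem hρ hγ,
        couplings_ae_fst hγ (regionMeasure_ae_domO hρ),
        couplings_ae_fst hγ ((regionMeasure_absolutelyContinuous r₀ H ρ).ae_le
          (hpot.ae_differentiableAt (isCompact_box R)))] with x h1 h2 h3 h4
      simp only [Pi.zero_apply] at h1
      refine eq_gradient_of_young (Ψ := Ψ) h3 h4 (fun p' hp' => ?_) ?_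
      · rw [← hPP p' (domO_subset_domD _ _ hp')]
        exact hdual.2.2 p' (domO_subset_domD _ _ hp') x.2
          (box_subset_quadrant R (hσ.2 h2.2))
      · rw [← hPP x.1 (domO_subset_domD _ _ h3)]
        linarith
    rw [← hγ.1, Measure.map_map (measurable_gradient P') measurable_fst, ← hγ.2]
    exact Measure.map_congr (hgraph.mono fun x hx => hx.symm)
  · filter_upwards [regionMeasure_ae_domO hρ] with p hp using hgradeq p hp

end Duality

/-! ### The functional and its velocity -/

/-- The properties of the forcing `𝔽` on which the construction of the curve depends. -/
structure IsForcing (r₀ H R C₀ : ℝ) (𝔽 : ℝ → Plane → Plane) : Prop where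
  meas : ∀ t, 0 ≤ t → Measurable (𝔽 t)
  bound : ∀ t, 0 ≤ t → ∀ p ∈ domD r₀ H, √R * ‖𝔽 t p‖ ≤ C₀
  nonneg : ∀ t, 0 ≤ t → ∀ p ∈ domD r₀ H, 0 ≤ 𝔽 t p 0 ∧ 0 ≤ 𝔽 t p 1
  cont : ∀ p ∈ domD r₀ H, ContinuousOn (fun t => 𝔽 t p) (Ici 0)

/-- `V` is a bounded velocity with nonnegative components which represents the functional of the
optimal triples with target `σ`, for the forcing term `f`. -/
structure IsVelocity (r₀ H Ω R C₀ : ℝ) (f : Plane → Plane) (σ : Measure Plane)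
    (V : Plane → Plane) : Prop where
  meas : Measurable V
  bound : ∀ᵐ q ∂σ, ‖V q‖ ≤ C₀
  nonneg : ∀ᵐ q ∂σ, 0 ≤ V q 0 ∧ 0 ≤ V q 1
  repr : ∀ ρ P, IsTriple r₀ H Ω R σ ρ P → ∀ G : Plane → Plane, Integrable G σ →
    functionalL r₀ H ρ P f G = ∫ q, ⟪V q, G q⟫_ℝ ∂σ

lemma measurableSet_domD (r₀ H : ℝ) : MeasurableSet (domD r₀ H) :=
  (measurableSet_Ico.preimage (measurable_coord 0)).inter
    (measurableSet_Icc.preimage (measurable_coord 1))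

lemma norm_opA_le {R : ℝ} (hR : 1 ≤ R) (G : Plane → Plane) {q : Plane} (hq : q ∈ box R) :
    ‖opA G q‖ ≤ √R * ‖G q‖ := by
  refine le_of_sq_le_sq ?_ (by positivity)
  rw [mul_pow, Real.sq_sqrt (by linarith), EuclideanSpace.norm_sq_eq, EuclideanSpace.norm_sq_eq,
    Fin.sum_univ_two, Fin.sum_univ_two]
  simp only [opA, Matrix.cons_val_zero, Matrix.cons_val_one, norm_mul, mul_pow, Real.norm_eq_abs,
    sq_abs, Real.sq_sqrt hq.1.1]
  nlinarith [mul_le_mul_of_nonneg_right hq.1.2 (sq_nonneg (G q 0)),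
    mul_le_mul_of_nonneg_right hR (sq_nonneg (G q 1))]

lemma continuous_opA : Continuous fun x : Plane × Plane => (!₂[√(x.1 0) * x.2 0, x.2 1] : Plane) :=
  continuous_mk₂.comp ((((Real.continuous_sqrt.comp ((continuous_coord 0).comp continuous_fst)).mul
    ((continuous_coord 0).comp continuous_snd))).prodMk ((continuous_coord 1).comp continuous_snd))

lemma measurable_opA {G : Plane → Plane} (hG : Measurable G) : Measurable (opA G) :=
  continuous_opA.measurable.comp (measurable_id.prodMk hG)

lemma aestronglyMeasurable_opA {σ : Measure Plane} {G : Plane → Plane}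
    (hG : AEStronglyMeasurable G σ) : AEStronglyMeasurable (opA G) σ :=
  continuous_opA.comp_aestronglyMeasurable (aestronglyMeasurable_id.prodMk hG)

section Velocity

variable {r₀ H Ω R C₀ : ℝ} {σ : Measure Plane} {ρ ρ' : ℝ → ℝ} {P P' : Plane → ℝ}
  {f : Plane → Plane}

lemma functionalL_congr (hμ : regionMeasure r₀ H ρ = regionMeasure r₀ H ρ')
    (hg : ∀ᵐ p ∂(regionMeasure r₀ H ρ), ∇ P p = ∇ P' p) (G : Plane → Plane) :
    functionalL r₀ H ρ P f G = functionalL r₀ H ρ' P' f G := by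
  unfold functionalL
  rw [← hμ]
  refine integral_congr_ae ?_
  filter_upwards [hg] with p hp
  rw [hp]

/-- The velocity at `q` is obtained by averaging the forcing over the fibre of the optimal map
above `q`. -/
lemma exists_isVelocity [IsProbabilityMeasure σ] (hr₀ : 0 < r₀) (hH : 0 < H) (hΩ : 0 < Ω)
    (hR : 1 ≤ R) (h : IsTriple r₀ H Ω R σ ρ P) (hf : Measurable f)
    (hb : ∀ p ∈ domD r₀ H, √R * ‖f p‖ ≤ C₀)
    (hnn : ∀ p ∈ domD r₀ H, 0 ≤ f p 0 ∧ 0 ≤ f p 1) :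
    ∃ V, IsVelocity r₀ H Ω R C₀ f σ V := by
  have hR0 : 0 ≤ R := by linarith
  have hsR : 0 < √R := Real.sqrt_pos.2 (by linarith)
  have hC₀ : 0 ≤ C₀ := le_trans (by positivity)
    (hb 0 ⟨⟨le_rfl, sEnd_pos hr₀⟩, le_rfl, hH.le⟩)
  have hρ := h.pair.mem_profiles
  have hfin := h.pair.isFiniteMeasure hr₀ hΩ hR0 h.pot
  have hgm := measurable_gradient P
  set μ := regionMeasure r₀ H ρ with hμ
  set f' := (domD r₀ H).indicator f with hf'
  have hf'm : Measurable f' := hf.indicator (measurableSet_domD r₀ H)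
  have hf'b : ∀ p, ‖f' p‖ ≤ C₀ / √R := by
    intro p
    rw [le_div_iff₀ hsR, mul_comm]
    by_cases hp : p ∈ domD r₀ H
    · rw [hf', indicator_of_mem hp]; exact hb p hp
    · rw [hf', indicator_of_notMem hp]; simpa using hC₀
  have hf'nn : ∀ p i, 0 ≤ f' p i := by
    intro p i
    by_cases hp : p ∈ domD r₀ H
    · rw [hf', indicator_of_mem hp]
      fin_cases i
      exacts [(hnn p hp).1, (hnn p hp).2]
    · rw [hf', indicator_of_notMem hp]; simp
  -- the conditional law of the position `p` given `∇P p`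
  set κ := ProbabilityTheory.condDistrib id (∇ P) μ with hκ
  have hf'i : ∀ q, Integrable f' (κ q) := fun q =>
    Integrable.of_bound hf'm.aestronglyMeasurable _ (ae_of_all _ hf'b)
  set w : Plane → Plane := fun q => ∫ p, f' p ∂(κ q) with hw
  have hwm : Measurable w := (StronglyMeasurable.integral_kernel hf'm.stronglyMeasurable).measurable
  have hwb : ∀ q, ‖w q‖ ≤ C₀ / √R := fun q => by
    have := norm_integral_le_of_norm_le_const (μ := κ q) (ae_of_all _ hf'b)
    simpa using this
  have hwnn : ∀ q i, 0 ≤ w q i := fun q i => by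
    have := (EuclideanSpace.proj i : Plane →L[ℝ] ℝ).integral_comp_comm (hf'i q)
    change _ = w q i at this
    rw [← this]
    exact integral_nonneg fun p => hf'nn p i
  have hbox := h.ae_mem_box
  refine ⟨opA w, measurable_opA hwm, ?_, ?_, ?_⟩
  · filter_upwards [hbox] with q hq
    refine (norm_opA_le hR w hq).trans ?_
    calc √R * ‖w q‖ ≤ √R * (C₀ / √R) := mul_le_mul_of_nonneg_left (hwb q) hsR.le
      _ = C₀ := by field_simp
  · refine ae_of_all _ fun q => ⟨?_, ?_⟩
    · simpa [opA] using mul_nonneg (Real.sqrt_nonneg _) (hwnn q 0)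
    · simpa [opA] using hwnn q 1
  · intro ρ' P' h' G hG
    obtain ⟨hμ', hg'⟩ := h.unique hr₀ hH hΩ hR0 hR0 h'
    rw [← functionalL_congr hμ' hg']
    set ν := μ.map fun p => (∇ P p, id p) with hν
    have hνm : Measurable fun p => (∇ P p, id p) := hgm.prodMk measurable_id
    have hν1 : ν.map Prod.fst = σ := by
      rw [hν, Measure.map_map measurable_fst hνm]
      exact h.push
    have hνc : ν = (μ.map (∇ P)).compProd κ :=
      (ProbabilityTheory.compProd_map_condDistrib aemeasurable_id).symm
    have hGm : AEStronglyMeasurable (fun x : Plane × Plane => opA G x.1) ν := by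
      have := aestronglyMeasurable_opA hG.aestronglyMeasurable
      rw [← hν1] at this
      exact this.comp_measurable measurable_fst
    have hum : AEStronglyMeasurable (fun x : Plane × Plane => ⟪opA G x.1, f' x.2⟫_ℝ) ν :=
      hGm.inner (hf'm.comp measurable_snd).aestronglyMeasurable
    have hui : Integrable (fun x : Plane × Plane => ⟪opA G x.1, f' x.2⟫_ℝ) ν := by
      have hG1 : Integrable (fun x : Plane × Plane => G x.1) ν := by
        rw [← hν1] at hG
        exact hG.comp_measurable measurable_fst
      refine Integrable.mono' ((hG1.norm.const_mul (√R)).mul_const (C₀ / √R)) hum ?_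
      rw [← hν1] at hbox
      filter_upwards [ae_of_ae_map measurable_fst.aemeasurable hbox] with x hx
      refine (norm_inner_le_norm _ _).trans ?_
      exact mul_le_mul (norm_opA_le hR G hx) (hf'b _) (norm_nonneg _) (by positivity)
    calc functionalL r₀ H ρ P f G = ∫ p, ⟪opA G (∇ P p), f' p⟫_ℝ ∂μ := by
          refine integral_congr_ae ?_
          filter_upwards [regionMeasure_ae hρ] with p hp
          rw [hf', indicator_of_mem (region_subset_domD hρ.2 hp)]
      _ = ∫ x, ⟪opA G x.1, f' x.2⟫_ℝ ∂ν := by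
          rw [hν, integral_map hνm.aemeasurable (by rw [← hν]; exact hum)]
          rfl
      _ = ∫ q, ∫ p, ⟪opA G q, f' p⟫_ℝ ∂(κ q) ∂(μ.map (∇ P)) := by
          rw [hνc] at hui ⊢
          exact Measure.integral_compProd hui
      _ = ∫ q, ⟪opA w q, G q⟫_ℝ ∂σ := by
          rw [h.push]
          congr 1
          ext q
          rw [integral_inner (hf'i q)]
          simp only [inner_plane, opA, Matrix.cons_val_zero, Matrix.cons_val_one]
          change √(q 0) * G q 0 * w q 0 + G q 1 * w q 1 = _
          ring

open BoundedContinuousFunction in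
/-- The functional depends continuously on the time, the measure and the vector field. -/
lemma tendsto_functionalL {𝔽 : ℝ → Plane → Plane} (hr₀ : 0 < r₀) (hH : 0 < H) (hΩ : 0 < Ω)
    (hR : 1 ≤ R) (hF : IsForcing r₀ H R C₀ 𝔽) {σ : ℕ → Measure Plane} {σ' : Measure Plane}
    [∀ n, IsProbabilityMeasure (σ n)] [IsProbabilityMeasure σ'] {ρ : ℕ → ℝ → ℝ}
    {P : ℕ → Plane → ℝ} (h : ∀ n, IsTriple r₀ H Ω R (σ n) (ρ n) (P n))
    (h' : IsTriple r₀ H Ω R σ' ρ' P')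
    (hlim : ∀ f : Plane →ᵇ ℝ, Tendsto (fun n => ∫ q, f q ∂(σ n)) atTop (𝓝 (∫ q, f q ∂σ')))
    {t : ℕ → ℝ} {t' : ℝ} (ht : ∀ n, 0 ≤ t n) (ht' : Tendsto t atTop (𝓝 t'))
    {G : ℕ → Plane → Plane} {G' : Plane → Plane} {K : ℝ} (hGm : ∀ n, Measurable (G n))
    (hGb : ∀ n q, ‖G n q‖ ≤ K)
    (hG : ∀ q, Tendsto (fun x : ℕ × Plane => G x.1 x.2) (atTop ×ˢ 𝓝 q) (𝓝 (G' q))) :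
    Tendsto (fun n => functionalL r₀ H (ρ n) (P n) (𝔽 (t n)) (G n)) atTop
      (𝓝 (functionalL r₀ H ρ' P' (𝔽 t') G')) := by
  have hR0 : 0 ≤ R := by linarith
  have ht0 : 0 ≤ t' := ge_of_tendsto' ht' ht
  -- every subsequence of triples converges to an optimal triple, which is unique
  refine tendsto_of_subseq_tendsto fun ns hns => ?_
  obtain ⟨φ, ρ'', P'', hφ, h'', hconv⟩ := exists_subseq_isTriple hr₀ hH hΩ hR0
    (fun n => h (ns n)) (fun f => (hlim f).comp hns)
  refine ⟨φ, ?_⟩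
  obtain ⟨hμ, hg⟩ := h'.unique hr₀ hH hΩ hR0 hR0 h''
  rw [functionalL_congr hμ hg]
  have hidx : Tendsto (fun n => ns (φ n)) atTop atTop := hns.comp hφ.tendsto_atTop
  refine hconv.2 (fun n p => ⟪opA (G (ns (φ n))) (∇ (P (ns (φ n))) p), 𝔽 (t (ns (φ n))) p⟫_ℝ)
    (fun p => ⟪opA G' (∇ P'' p), 𝔽 t' p⟫_ℝ) (K * C₀) (fun n => ?_) (fun n => ?_) ?_
  · exact (((measurable_opA (hGm _)).comp (measurable_gradient _)).inner
      (hF.meas _ (ht _))).aestronglyMeasurable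
  · filter_upwards [(h (ns (φ n))).pot.ae_differentiableAt (isCompact_box R)] with p hd hp
    refine (abs_real_inner_le_norm _ _).trans ?_
    have h1 := norm_opA_le hR (G (ns (φ n))) ((h (ns (φ n))).pot.gradient_mem hd).1
    have h2 := hF.bound _ (ht (ns (φ n))) p hp
    have h3 := hGb (ns (φ n)) (∇ (P (ns (φ n))) p)
    have hK : 0 ≤ K := (norm_nonneg _).trans h3
    calc _ ≤ √R * ‖G (ns (φ n)) (∇ (P (ns (φ n))) p)‖ * ‖𝔽 (t (ns (φ n))) p‖ :=
          mul_le_mul_of_nonneg_right h1 (norm_nonneg _)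
      _ = ‖G (ns (φ n)) (∇ (P (ns (φ n))) p)‖ * (√R * ‖𝔽 (t (ns (φ n))) p‖) := by ring
      _ ≤ K * C₀ := mul_le_mul h3 h2 (by positivity) hK
  · filter_upwards [ae_tendsto_gradient (isCompact_box R) (fun n => (h (ns (φ n))).pot) h''.pot
      hconv.1] with p hp hpD
    have h1 : Tendsto (fun n => G (ns (φ n)) (∇ (P (ns (φ n))) p)) atTop (𝓝 (G' (∇ P'' p))) :=
      (hG (∇ P'' p)).comp (hidx.prodMk hp)
    have h2 : Tendsto (fun n => opA (G (ns (φ n))) (∇ (P (ns (φ n))) p)) atTop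
        (𝓝 (opA G' (∇ P'' p))) :=
      (continuous_opA.tendsto (∇ P'' p, G' (∇ P'' p))).comp (hp.prodMk_nhds h1)
    have h3 : Tendsto (fun n => t (ns (φ n))) atTop (𝓝[Ici 0] t') :=
      tendsto_nhdsWithin_iff.2 ⟨ht'.comp hidx, Eventually.of_forall fun n => ht _⟩
    have h4 : Tendsto (fun n => 𝔽 (t (ns (φ n))) p) atTop (𝓝 (𝔽 t' p)) :=
      (hF.cont p hpD t' ht0).tendsto.comp h3
    exact h2.inner h4

end Velocity

/-! ### Compactness of curves of measures -/

lemma isCompact_concentrated {X : Type*} [TopologicalSpace X] [T2Space X] [MeasurableSpace X]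
    [BorelSpace X] {K : Set X} (hK : IsCompact K) :
    IsCompact {μ : ProbabilityMeasure X | ∀ᵐ x ∂(μ : Measure X), x ∈ K} := by
  have h := isCompact_setOfPred_probabilityMeasure_mass_eq_compl_isCompact_le
    (u := fun _ => 0) (K := fun _ => K) tendsto_const_nhds (fun _ => hK) (Or.inr monotone_const)
  convert h using 1
  ext μ
  have : (μ : Measure X) Kᶜ = 0 ↔ μ Kᶜ ≤ 0 := by
    rw [← ProbabilityMeasure.ennreal_coeFn_eq_coeFn_toMeasure]
    simp
  simp only [mem_ofPred_eq, forall_const]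
  rw [← this]
  rfl

/-- There is a coupling of `μ` and `ν` which moves no mass farther than `d`. -/
def CoupledWithin (d : ℝ) (μ ν : Measure Plane) : Prop :=
  ∃ γ ∈ couplings μ ν, ∀ᵐ x ∂γ, dist x.1 x.2 ≤ d

namespace CoupledWithin

variable {d d' : ℝ} {μ ν : Measure Plane}

lemma symm (h : CoupledWithin d μ ν) : CoupledWithin d ν μ := by
  obtain ⟨γ, hγ, hd⟩ := h
  refine ⟨γ.map Prod.swap, ⟨?_, ?_⟩, ?_⟩
  · rw [Measure.map_map measurable_fst measurable_swap]
    exact hγ.2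
  · rw [Measure.map_map measurable_snd measurable_swap]
    exact hγ.1
  · rw [ae_map_iff measurable_swap.aemeasurable
      (measurableSet_le (measurable_fst.dist measurable_snd) measurable_const)]
    filter_upwards [hd] with x hx
    rwa [Prod.fst_swap, Prod.snd_swap, dist_comm]

lemma mono (h : CoupledWithin d μ ν) (hd : d ≤ d') : CoupledWithin d' μ ν := by
  obtain ⟨γ, hγ, hx⟩ := h
  exact ⟨γ, hγ, hx.mono fun _ hx => hx.trans hd⟩

lemma of_map {Y : Plane → Plane} (hY : Measurable Y) (h : ∀ᵐ q ∂μ, ‖Y q - q‖ ≤ d) :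
    CoupledWithin d μ (μ.map Y) := by
  have hm : Measurable fun q => (q, Y q) := measurable_id.prodMk hY
  refine ⟨μ.map fun q => (q, Y q), ⟨?_, ?_⟩, ?_⟩
  · rw [Measure.map_map measurable_fst hm]
    exact Measure.map_id
  · rw [Measure.map_map measurable_snd hm]
    rfl
  · rw [ae_map_iff hm.aemeasurable
      (measurableSet_le (measurable_fst.dist measurable_snd) measurable_const)]
    filter_upwards [h] with q hq
    rwa [dist_comm, dist_eq_norm]

lemma W1_le [IsProbabilityMeasure ν] (h : CoupledWithin d μ ν) : W1 μ ν ≤ ENNReal.ofReal d := by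
  obtain ⟨γ, hγ, hd⟩ := h
  have := couplings_isProbabilityMeasure hγ
  refine (iInf₂_le γ hγ).trans ?_
  calc ∫⁻ x, edist x.1 x.2 ∂γ ≤ ∫⁻ _, ENNReal.ofReal d ∂γ := by
        refine lintegral_mono_ae ?_
        filter_upwards [hd] with x hx
        rw [edist_dist]
        exact ENNReal.ofReal_le_ofReal hx
    _ = ENNReal.ofReal d := by simp

lemma abs_integral_sub_le [IsProbabilityMeasure ν] (h : CoupledWithin d μ ν)
    {f : Plane → ℝ} {L : NNReal} {C : ℝ} (hf : LipschitzWith L f) (hC : ∀ q, |f q| ≤ C) :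
    |∫ q, f q ∂μ - ∫ q, f q ∂ν| ≤ L * d := by
  obtain ⟨γ, hγ, hd⟩ := h
  have := couplings_isProbabilityMeasure hγ
  have hfm := hf.continuous.aestronglyMeasurable (μ := γ.map Prod.fst)
  have hfm' := hf.continuous.aestronglyMeasurable (μ := γ.map Prod.snd)
  have i1 : Integrable (fun x : Plane × Plane => f x.1) γ := Integrable.of_bound
    (hf.continuous.comp continuous_fst).aestronglyMeasurable C (ae_of_all _ fun x => hC x.1)
  have i2 : Integrable (fun x : Plane × Plane => f x.2) γ := Integrable.of_bound
    (hf.continuous.comp continuous_snd).aestronglyMeasurable C (ae_of_all _ fun x => hC x.2)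
  rw [← hγ.1, ← hγ.2, integral_map measurable_fst.aemeasurable hfm,
    integral_map measurable_snd.aemeasurable hfm', ← integral_sub i1 i2]
  have := norm_integral_le_of_norm_le_const (μ := γ) (f := fun x => f x.1 - f x.2) (C := L * d) (by
    filter_upwards [hd] with x hx
    rw [← dist_eq_norm]
    exact (hf.dist_le_mul _ _).trans (mul_le_mul_of_nonneg_left hx L.2))
  simpa using this

open BoundedContinuousFunction in
/-- Bounds on couplings pass to weak limits. -/
lemma of_tendsto {R : ℝ} {μn νn : ℕ → ProbabilityMeasure Plane} {μ ν : ProbabilityMeasure Plane}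
    {dn : ℕ → ℝ} (h : ∀ n, CoupledWithin (dn n) (μn n) (νn n)) (hd : Tendsto dn atTop (𝓝 d))
    (hμ : Tendsto μn atTop (𝓝 μ)) (hν : Tendsto νn atTop (𝓝 ν))
    (hμR : ∀ n, ∀ᵐ q ∂(μn n : Measure Plane), q ∈ box R)
    (hνR : ∀ n, ∀ᵐ q ∂(νn n : Measure Plane), q ∈ box R) : CoupledWithin d μ ν := by
  choose γ hγ hγd using h
  have hp : ∀ n, IsProbabilityMeasure (γ n) := fun n => couplings_isProbabilityMeasure (hγ n)
  set γp : ℕ → ProbabilityMeasure (Plane × Plane) := fun n => ⟨γ n, hp n⟩ with hγp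
  have hmem : ∀ n, γp n ∈ {γ : ProbabilityMeasure (Plane × Plane) |
      ∀ᵐ x ∂(γ : Measure (Plane × Plane)), x ∈ box R ×ˢ box R} := by
    intro n
    filter_upwards [couplings_ae_fst (hγ n) (hμR n), couplings_ae_snd (hγ n) (hνR n)]
      with x h1 h2 using ⟨h1, h2⟩
  obtain ⟨γ', -, φ, hφ, hlim⟩ :=
    (isCompact_concentrated ((isCompact_box R).prod (isCompact_box R))).tendsto_subseq hmem
  rw [ProbabilityMeasure.tendsto_iff_forall_integral_tendsto] at hlim
  have marg : ∀ {π : Plane × Plane → Plane} {μn : ℕ → ProbabilityMeasure Plane}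
      {μ : ProbabilityMeasure Plane}, Continuous π → Tendsto μn atTop (𝓝 μ) →
      (∀ n, (γ n).map π = (μn n : Measure Plane)) →
      (γ' : Measure (Plane × Plane)).map π = (μ : Measure Plane) := by
    intro π μn μ hπ hμ hπn
    have := Measure.isProbabilityMeasure_map (μ := (γ' : Measure (Plane × Plane)))
      hπ.measurable.aemeasurable
    refine ext_of_forall_integral_eq_of_IsFiniteMeasure fun f => ?_
    rw [integral_map hπ.measurable.aemeasurable f.continuous.aestronglyMeasurable]
    rw [ProbabilityMeasure.tendsto_iff_forall_integral_tendsto] at hμ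
    refine tendsto_nhds_unique (hlim (f.compContinuous ⟨π, hπ⟩))
      (((hμ f).comp hφ.tendsto_atTop).congr fun n => ?_)
    simp only [Function.comp_apply]
    rw [← hπn, integral_map hπ.measurable.aemeasurable f.continuous.aestronglyMeasurable]
    rfl
  refine ⟨γ', ⟨marg continuous_fst hμ fun n => (hγ n).1, marg continuous_snd hν fun n => (hγ n).2⟩,
    ?_⟩
  -- the function `min (dist - d - ε)⁺ 1` has integral zero eventually, hence in the limit
  have key : ∀ k : ℕ, ∀ᵐ x ∂(γ' : Measure (Plane × Plane)), dist x.1 x.2 ≤ d + 1 / ((k : ℝ) + 1) := by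
    intro k
    have hε : 0 < 1 / ((k : ℝ) + 1) := Nat.one_div_pos_of_nat
    set ε := 1 / ((k : ℝ) + 1)
    set u : Plane × Plane → ℝ := fun x => min (max (dist x.1 x.2 - (d + ε)) 0) 1 with hu
    have huc : Continuous u := by fun_prop
    have hu0 : ∀ x, 0 ≤ u x := fun x => le_min (le_max_right _ _) zero_le_one
    have hu1 : ∀ x, ‖u x‖ ≤ 1 := fun x => by
      rw [Real.norm_of_nonneg (hu0 x)]; exact min_le_right _ _
    have h1 := hlim (BoundedContinuousFunction.ofNormedAddCommGroup u huc 1 hu1)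
    have h2 : ∫ x, u x ∂(γ' : Measure (Plane × Plane)) = 0 := by
      refine tendsto_nhds_unique h1 (tendsto_const_nhds.congr' ?_)
      have hev : ∀ᶠ n in atTop, dn (φ n) < d + ε :=
        (hd.comp hφ.tendsto_atTop).eventually_lt_const (by linarith)
      filter_upwards [hev] with n hn
      refine (integral_eq_zero_of_ae ?_).symm
      filter_upwards [hγd (φ n)] with x hx
      change min (max (dist x.1 x.2 - (d + ε)) 0) 1 = 0
      rw [max_eq_right (by linarith), min_eq_left zero_le_one]
    have h3 := (integral_eq_zero_iff_of_nonneg hu0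
      (Integrable.of_bound huc.aestronglyMeasurable 1 (ae_of_all _ hu1))).1 h2
    filter_upwards [h3] with x hx
    by_contra! hlt
    have : 0 < u x := lt_min (lt_max_of_lt_left (by linarith)) one_pos
    exact this.ne' hx
  filter_upwards [ae_all_iff.2 key] with x hx
  refine ge_of_tendsto' (x := atTop) ?_ hx
  have := (tendsto_one_div_add_atTop_nhds_zero_nat (𝕜 := ℝ)).const_add d
  simpa using this

end CoupledWithin

lemma mem_probBox_of_ae {R : ℝ} {σ : Measure Plane} [IsProbabilityMeasure σ]
    (h : ∀ᵐ q ∂σ, q ∈ box R) : σ ∈ probBox R :=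
  ⟨inferInstance, Measure.support_subset_of_isClosed (isCompact_box R).isClosed h⟩

/-- Curves in `𝒫_[R]` that are `C`-Lipschitz up to a vanishing error have subsequences that
converge at all times. -/
lemma exists_subseq_curve {R C T : ℝ} (hC : 0 ≤ C) (hT : 0 < T) {e : ℕ → ℝ}
    (he : Tendsto e atTop (𝓝 0)) {σn : ℕ → ℝ → Measure Plane}
    (hR : ∀ n, ∀ t ∈ Icc 0 T, σn n t ∈ probBox R)
    (hlip : ∀ n, ∀ s ∈ Icc 0 T, ∀ t ∈ Icc 0 T,
      CoupledWithin (C * |s - t| + e n) (σn n s) (σn n t)) :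
    ∃ (φ : ℕ → ℕ) (σ : ℝ → ProbabilityMeasure Plane), StrictMono φ ∧
      (∀ t ∈ Icc 0 T, (σ t : Measure Plane) ∈ probBox R) ∧
      (∀ s ∈ Icc 0 T, ∀ t ∈ Icc 0 T,
        CoupledWithin (C * |s - t|) (σ s : Measure Plane) (σ t)) ∧
      ∀ t ∈ Icc 0 T, ∀ f : BoundedContinuousFunction Plane ℝ,
        Tendsto (fun n => ∫ q, f q ∂(σn (φ n) t)) atTop (𝓝 (∫ q, f q ∂(σ t : Measure Plane))) := by
  set c : ℝ → ℝ := fun t => projIcc 0 T hT.le t with hc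
  have hcm : ∀ t, c t ∈ Icc 0 T := fun t => (projIcc 0 T hT.le t).2
  have hcid : ∀ t ∈ Icc 0 T, c t = t := fun t ht => by
    simp only [hc, projIcc_of_mem hT.le ht]
  set p : ℕ → ℝ → ProbabilityMeasure Plane := fun n t => ⟨σn n (c t), (hR n _ (hcm t)).1⟩ with hp
  have hpe : ∀ n t, (p n t : Measure Plane) = σn n (c t) := fun _ _ => rfl
  set K : Set (ProbabilityMeasure Plane) := {μ | ∀ᵐ x ∂(μ : Measure Plane), x ∈ box R} with hK
  have hKc : IsCompact K := isCompact_concentrated (isCompact_box R)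
  have hpK : ∀ n t, p n t ∈ K := fun n t => ae_mem_box_of_mem_probBox (hR n _ (hcm t))
  have hlip' : ∀ n s t, CoupledWithin (C * |s - t| + e n) (p n s : Measure Plane) (p n t) :=
    fun n s t => (hlip n _ (hcm s) _ (hcm t)).mono (by
      have : |c s - c t| ≤ |s - t| := abs_projIcc_sub_projIcc hT.le
      linarith [mul_le_mul_of_nonneg_left this hC])
  -- convergence at rational times
  obtain ⟨gr, -, φ, hφ, hgr⟩ := (isCompact_univ_pi fun _ : ℚ => hKc).tendsto_subseq
    (x := fun n (r : ℚ) => p n r) fun n r _ => hpK n r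
  have hgr' : ∀ r : ℚ, Tendsto (fun n => p (φ n) r) atTop (𝓝 (gr r)) := fun r =>
    tendsto_pi_nhds.1 hgr r
  have heφ : Tendsto (fun n => e (φ n)) atTop (𝓝 0) := he.comp hφ.tendsto_atTop
  -- convergence at all times
  have hall : ∀ t : ℝ, ∃ μ ∈ K, Tendsto (fun n => p (φ n) t) atTop (𝓝 μ) := by
    intro t
    obtain ⟨μ, hμK, ψ, hψ, hμ⟩ := hKc.tendsto_subseq fun n => hpK (φ n) t
    refine ⟨μ, hμK, tendsto_iff_forall_lipschitz_integral_tendsto.2 fun f hfb ⟨L, hL⟩ => ?_⟩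
    have hbd : ∃ B, ∀ q, |f q| ≤ B := by
      obtain ⟨B, hB⟩ := hfb
      refine ⟨|f 0| + B, fun q => ?_⟩
      have h1 := hB q 0
      rw [Real.dist_eq] at h1
      have h2 := abs_add_le (f q - f 0) (f 0)
      rw [sub_add_cancel] at h2
      linarith
    obtain ⟨B, hB⟩ := hbd
    have hcau : CauchySeq fun n => ∫ q, f q ∂(p (φ n) t : Measure Plane) := by
      rw [Metric.cauchySeq_iff]
      intro ε hε
      obtain ⟨δ, hδ, hδε⟩ : ∃ δ > 0, L * (C * δ + δ) ≤ ε / 4 := by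
        refine ⟨ε / 4 / (L * (C + 1) + 1), by positivity, ?_⟩
        have h0 : 0 ≤ L * (C + 1) := by positivity
        have : L * (C * (ε / 4 / (L * (C + 1) + 1)) + ε / 4 / (L * (C + 1) + 1)) =
            (L * (C + 1)) / (L * (C + 1) + 1) * (ε / 4) := by field_simp
        rw [this]
        refine mul_le_of_le_one_left (by positivity) ?_
        rw [div_le_one (by positivity)]
        linarith
      obtain ⟨r, hr1, hr2⟩ := exists_rat_btwn (show t < t + δ by linarith)
      have hbc : CauchySeq fun n => ∫ q, f q ∂(p (φ n) r : Measure Plane) :=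
        ((tendsto_iff_forall_lipschitz_integral_tendsto.1 (hgr' r)) f hfb ⟨L, hL⟩).cauchySeq
      obtain ⟨N, hN⟩ := Metric.cauchySeq_iff.1 hbc (ε / 4) (by positivity)
      obtain ⟨N', hN'⟩ := eventually_atTop.1 (heφ.eventually_lt_const hδ)
      have hclose : ∀ n ≥ N', dist (∫ q, f q ∂(p (φ n) t : Measure Plane))
          (∫ q, f q ∂(p (φ n) r : Measure Plane)) ≤ ε / 4 := by
        intro n hn
        rw [Real.dist_eq]
        refine ((hlip' (φ n) t r).abs_integral_sub_le hL hB).trans (le_trans ?_ hδε)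
        refine mul_le_mul_of_nonneg_left ?_ L.2
        have h1 := hN' n hn
        have h2 : |t - r| ≤ δ := by rw [abs_le]; constructor <;> linarith
        linarith [mul_le_mul_of_nonneg_left h2 hC]
      refine ⟨max N N', fun m hm n hn => ?_⟩
      have h1 := hclose m ((le_max_right _ _).trans hm)
      have h2 := hclose n ((le_max_right _ _).trans hn)
      have h3 := hN m ((le_max_left _ _).trans hm) n ((le_max_left _ _).trans hn)
      rw [dist_comm] at h2
      have h4 := dist_triangle4 (∫ q, f q ∂(p (φ m) t : Measure Plane))
        (∫ q, f q ∂(p (φ m) r : Measure Plane)) (∫ q, f q ∂(p (φ n) r : Measure Plane))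
        (∫ q, f q ∂(p (φ n) t : Measure Plane))
      linarith
    obtain ⟨ℓ, hℓ⟩ := cauchySeq_tendsto_of_complete hcau
    have h1 := (tendsto_iff_forall_lipschitz_integral_tendsto.1 hμ) f hfb ⟨L, hL⟩
    have h2 := hℓ.comp hψ.tendsto_atTop
    rw [tendsto_nhds_unique h1 h2]
    exact hℓ
  choose σ hσK hσ using hall
  refine ⟨φ, σ, hφ, fun t _ => mem_probBox_of_ae (hσK t), fun s _ t _ => ?_, fun t ht f => ?_⟩
  · refine CoupledWithin.of_tendsto (fun n => hlip' (φ n) s t) ?_ (hσ s) (hσ t)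
      (fun n => hpK _ _) (fun n => hpK _ _)
    simpa using heφ.const_add (C * |s - t|)
  · have := (ProbabilityMeasure.tendsto_iff_forall_integral_tendsto.1 (hσ t)) f
    simp only [hpe, hcid t ht] at this
    exact this

/-! ### Continuous velocity fields on the space of measures -/

open BoundedContinuousFunction in
/-- A velocity field `v t σ` that depends on the time and on the measure `σ ∈ 𝒫_[R]` which it
transports. The momentum `σ v t σ` depends continuously on `(t, σ)`, although `v` itself is only
defined up to null sets of `σ`; mass never moves down or to the left. -/
structure IsContinuousVelocity (R C : ℝ) (v : ℝ → Measure Plane → Plane → Plane) : Prop where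
  meas : ∀ t σ, Measurable (v t σ)
  bound : ∀ t, 0 ≤ t → ∀ σ ∈ probBox R, ∀ᵐ q ∂σ, ‖v t σ q‖ ≤ C
  nonneg : ∀ t, 0 ≤ t → ∀ σ ∈ probBox R, ∀ᵐ q ∂σ, 0 ≤ v t σ q 0 ∧ 0 ≤ v t σ q 1
  cont : ∀ (σ : ℕ → Measure Plane) (σ' : Measure Plane) (t : ℕ → ℝ) (t' : ℝ)
    (G : ℕ → Plane → Plane) (G' : Plane → Plane) (K : ℝ),
    (∀ n, σ n ∈ probBox R) → σ' ∈ probBox R →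
    (∀ f : Plane →ᵇ ℝ, Tendsto (fun n => ∫ q, f q ∂(σ n)) atTop (𝓝 (∫ q, f q ∂σ'))) →
    (∀ n, 0 ≤ t n) → Tendsto t atTop (𝓝 t') → (∀ n, Measurable (G n)) →
    (∀ n q, ‖G n q‖ ≤ K) →
    (∀ q, Tendsto (fun x : ℕ × Plane => G x.1 x.2) (atTop ×ˢ 𝓝 q) (𝓝 (G' q))) →
    Tendsto (fun n => ∫ q, ⟪v (t n) (σ n) q, G n q⟫_ℝ ∂(σ n)) atTop
      (𝓝 (∫ q, ⟪v t' σ' q, G' q⟫_ℝ ∂σ'))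

lemma exists_isTriple_of_mem_probBox {r₀ H Ω R : ℝ} (hr₀ : 0 < r₀) (hH : 0 < H) (hΩ : 0 < Ω)
    (hR : 0 ≤ R) {σ : Measure Plane} (hσ : σ ∈ probBox R) : ∃ ρ P, IsTriple r₀ H Ω R σ ρ P := by
  have := hσ.1
  obtain ⟨ρ, P, h⟩ := exists_isTriple (Ω := Ω) hr₀ hH hΩ hR (ae_mem_box_of_mem_probBox hσ)
  obtain ⟨P', Ψ', hP⟩ := h.exists_isDualMaximizer hr₀ hH hΩ (by linarith) hσ
  obtain ⟨P'', h'', -⟩ := exists_isTriple_of_optimal hr₀ hH hΩ hR hσ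
    (h.isPrimalMinimizer hr₀ hH hΩ (by linarith) hσ) hP
  exact ⟨ρ, P'', h''⟩

open Classical in
/-- A choice of the velocity that represents the functional of `σ` for the forcing term `f`. -/
def vel (r₀ H Ω R C₀ : ℝ) (f : Plane → Plane) (σ : Measure Plane) : Plane → Plane :=
  if h : ∃ V, IsVelocity r₀ H Ω R C₀ f σ V then h.choose else 0

lemma measurable_vel (r₀ H Ω R C₀ : ℝ) (f : Plane → Plane) (σ : Measure Plane) :
    Measurable (vel r₀ H Ω R C₀ f σ) := by
  unfold vel
  split_ifs with h
  exacts [h.choose_spec.meas, measurable_const]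

section

variable {r₀ H Ω R C₀ : ℝ} {𝔽 : ℝ → Plane → Plane}

lemma isVelocity_vel (hr₀ : 0 < r₀) (hH : 0 < H) (hΩ : 0 < Ω) (hR : 1 ≤ R)
    (hF : IsForcing r₀ H R C₀ 𝔽) {t : ℝ} (ht : 0 ≤ t) {σ : Measure Plane} (hσ : σ ∈ probBox R) :
    IsVelocity r₀ H Ω R C₀ (𝔽 t) σ (vel r₀ H Ω R C₀ (𝔽 t) σ) := by
  have := hσ.1
  obtain ⟨ρ, P, h⟩ := exists_isTriple_of_mem_probBox (Ω := Ω) hr₀ hH hΩ (by linarith) hσ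
  have hex := exists_isVelocity hr₀ hH hΩ hR h (hF.meas t ht) (hF.bound t ht) (hF.nonneg t ht)
  unfold vel
  rw [dif_pos hex]
  exact hex.choose_spec

/-- The chosen velocities depend continuously on the measure, although the choice is arbitrary:
their pairings with vector fields are values of the functional, and these are determined by the
measure. -/
lemma isContinuousVelocity_vel (hr₀ : 0 < r₀) (hH : 0 < H) (hΩ : 0 < Ω) (hR : 1 ≤ R)
    (hF : IsForcing r₀ H R C₀ 𝔽) :
    IsContinuousVelocity R C₀ fun t σ => vel r₀ H Ω R C₀ (𝔽 t) σ where
  meas t σ := measurable_vel ..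
  bound t ht σ hσ := (isVelocity_vel hr₀ hH hΩ hR hF ht hσ).bound
  nonneg t ht σ hσ := (isVelocity_vel hr₀ hH hΩ hR hF ht hσ).nonneg
  cont σ σ' t t' G G' K hσ hσ' hlim ht htt hGm hGb hG := by
    have hp : ∀ n, IsProbabilityMeasure (σ n) := fun n => (hσ n).1
    have hp' := hσ'.1
    have hR0 : 0 ≤ R := by linarith
    have ht0 : 0 ≤ t' := ge_of_tendsto' htt ht
    choose ρ P h using fun n => exists_isTriple_of_mem_probBox (Ω := Ω) hr₀ hH hΩ hR0 (hσ n)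
    obtain ⟨ρ', P', h'⟩ := exists_isTriple_of_mem_probBox (Ω := Ω) hr₀ hH hΩ hR0 hσ'
    have hpt : ∀ q, Tendsto (fun n => G n q) atTop (𝓝 (G' q)) := fun q =>
      (hG q).comp (tendsto_id.prodMk tendsto_const_nhds)
    have hGm' : Measurable G' := measurable_of_tendsto_metrizable hGm (tendsto_pi_nhds.2 hpt)
    have hGb' : ∀ q, ‖G' q‖ ≤ K := fun q => le_of_tendsto' (hpt q).norm fun n => hGb n q
    have h1 := tendsto_functionalL hr₀ hH hΩ hR hF h h' hlim ht htt hGm hGb hG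
    rw [(isVelocity_vel hr₀ hH hΩ hR hF ht0 hσ').repr ρ' P' h' G'
      (Integrable.of_bound hGm'.aestronglyMeasurable K (ae_of_all _ hGb'))] at h1
    refine h1.congr fun n => ?_
    exact (isVelocity_vel hr₀ hH hΩ hR hF (ht n) (hσ n)).repr _ _ (h n) _
      (Integrable.of_bound (hGm n).aestronglyMeasurable K (ae_of_all _ (hGb n)))

end

/-! ### The explicit Euler scheme -/

/-- The measures of the explicit Euler scheme of step `h`. -/
def euler (v : ℝ → Measure Plane → Plane → Plane) (h : ℝ) (σ₀ : Measure Plane) :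
    ℕ → Measure Plane
  | 0 => σ₀
  | k + 1 => (euler v h σ₀ k).map fun q => q + h • v (k * h) (euler v h σ₀ k) q

/-- The piecewise constant interpolation of the Euler scheme. -/
def eulerCurve (v : ℝ → Measure Plane → Plane → Plane) (h : ℝ) (σ₀ : Measure Plane) (t : ℝ) :
    Measure Plane :=
  euler v h σ₀ ⌊t / h⌋₊

lemma probBox_mono {R R' : ℝ} (h : R ≤ R') : probBox R ⊆ probBox R' := fun _ hσ =>
  ⟨hσ.1, hσ.2.trans fun _ hq => ⟨⟨hq.1.1, hq.1.2.trans h⟩, hq.2.1, hq.2.2.trans h⟩⟩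

section Euler

variable {R L C h : ℝ} {v : ℝ → Measure Plane → Plane → Plane} {σ₀ : Measure Plane}

lemma IsContinuousVelocity.measurable_step (hv : IsContinuousVelocity R C v) (h t : ℝ)
    (σ : Measure Plane) : Measurable fun q => q + h • v t σ q :=
  measurable_id.add ((hv.meas t σ).const_smul h)

lemma coord_le_norm (q : Plane) (i : Fin 2) : q i ≤ ‖q‖ :=
  (le_abs_self _).trans (PiLp.norm_apply_le q i)

lemma euler_mem_probBox_add (hv : IsContinuousVelocity R C v) (hC : 0 ≤ C) (hh : 0 ≤ h)
    (hσ₀ : σ₀ ∈ probBox L) (k : ℕ) (hk : L + C * (h * k) ≤ R) :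
    euler v h σ₀ k ∈ probBox (L + C * (h * k)) := by
  induction k with
  | zero => simpa [euler] using hσ₀
  | succ k ih =>
    push_cast at hk ⊢
    have hle : L + C * (h * k) ≤ L + C * (h * (k + 1)) := by nlinarith [mul_nonneg hC hh]
    have hmem := ih (hle.trans hk)
    have hmR := probBox_mono (hle.trans hk) hmem
    have := hmem.1
    have hm := hv.measurable_step h (k * h) (euler v h σ₀ k)
    have : IsProbabilityMeasure (euler v h σ₀ (k + 1)) :=
      Measure.isProbabilityMeasure_map hm.aemeasurable
    refine mem_probBox_of_ae ?_
    rw [euler]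
    refine (ae_map_iff hm.aemeasurable (isCompact_box _).isClosed.measurableSet).2 ?_
    filter_upwards [ae_mem_box_of_mem_probBox hmem, hv.bound (k * h) (by positivity) _ hmR,
      hv.nonneg (k * h) (by positivity) _ hmR] with q hq hb hn
    have hc : ∀ i, v (k * h) (euler v h σ₀ k) q i ≤ C := fun i => (coord_le_norm _ i).trans hb
    have h0 := mul_le_mul_of_nonneg_left (hc 0) hh
    have h1 := mul_le_mul_of_nonneg_left (hc 1) hh
    have h2 := mul_nonneg hh hn.1
    have h3 := mul_nonneg hh hn.2
    obtain ⟨⟨a1, a2⟩, b1, b2⟩ := hq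
    refine ⟨⟨?_, ?_⟩, ?_, ?_⟩ <;>
      simp only [PiLp.add_apply, PiLp.smul_apply, smul_eq_mul] <;> nlinarith

lemma euler_mem_probBox (hv : IsContinuousVelocity R C v) (hC : 0 ≤ C) (hh : 0 ≤ h)
    (hσ₀ : σ₀ ∈ probBox L) {k : ℕ} (hk : L + C * (h * k) ≤ R) : euler v h σ₀ k ∈ probBox R :=
  probBox_mono hk (euler_mem_probBox_add hv hC hh hσ₀ k hk)

/-- Later measures of the scheme are images of earlier ones under maps of controlled displacement.
-/
lemma exists_euler_map (hv : IsContinuousVelocity R C v) (hC : 0 ≤ C) (hh : 0 ≤ h)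
    (hσ₀ : σ₀ ∈ probBox L) (k j : ℕ) (hk : L + C * (h * (k + j : ℕ)) ≤ R) :
    ∃ Y : Plane → Plane, Measurable Y ∧ (euler v h σ₀ k).map Y = euler v h σ₀ (k + j) ∧
      ∀ᵐ q ∂(euler v h σ₀ k), ‖Y q - q‖ ≤ C * (h * j) := by
  induction j with
  | zero => exact ⟨id, measurable_id, Measure.map_id, by simp⟩
  | succ j ih =>
    have hle : L + C * (h * (k + j : ℕ)) ≤ R := by
      push_cast at hk ⊢
      nlinarith [mul_nonneg hC hh]
    obtain ⟨Y, hY, hmap, hb⟩ := ih hle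
    have hm := hv.measurable_step h ((k + j : ℕ) * h) (euler v h σ₀ (k + j))
    refine ⟨_, hm.comp hY, ?_, ?_⟩
    · rw [← Measure.map_map hm hY, hmap]
      rfl
    · have hvb := hv.bound ((k + j : ℕ) * h) (by positivity) _ (euler_mem_probBox hv hC hh hσ₀ hle)
      have hvb' : ∀ᵐ q ∂(euler v h σ₀ k).map Y,
          ‖v ((k + j : ℕ) * h) (euler v h σ₀ (k + j)) q‖ ≤ C := by rw [hmap]; exact hvb
      filter_upwards [hb, ae_of_ae_map hY.aemeasurable hvb'] with q h1 h2
      have h3 : ‖h • v ((k + j : ℕ) * h) (euler v h σ₀ (k + j)) (Y q)‖ ≤ h * C := by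
        rw [norm_smul, Real.norm_of_nonneg hh]
        exact mul_le_mul_of_nonneg_left h2 hh
      calc _ = ‖(Y q - q) + h • v ((k + j : ℕ) * h) (euler v h σ₀ (k + j)) (Y q)‖ := by
            congr 1
            simp only [Function.comp_apply]
            abel
        _ ≤ C * (h * j) + h * C := (norm_add_le _ _).trans (add_le_add h1 h3)
        _ = C * (h * (j + 1 : ℕ)) := by push_cast; ring

lemma mul_floor_div_le (hh : 0 < h) {t : ℝ} (ht : 0 ≤ t) : h * ⌊t / h⌋₊ ≤ t := by
  have := Nat.floor_le (div_nonneg ht hh.le)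
  rw [le_div_iff₀ hh] at this
  linarith

lemma lt_mul_floor_div_add (hh : 0 < h) (t : ℝ) : t < h * ⌊t / h⌋₊ + h := by
  have := Nat.lt_floor_add_one (t / h)
  rw [div_lt_iff₀ hh] at this
  linarith

/-- The hypothesis `L + C T ≤ R` keeps the scheme in the box in which the velocity is controlled. -/
lemma eulerCurve_mem_probBox (hv : IsContinuousVelocity R C v) (hC : 0 ≤ C) (hh : 0 < h)
    (hσ₀ : σ₀ ∈ probBox L) {T : ℝ} (hT : L + C * T ≤ R) {t : ℝ} (ht : t ∈ Icc 0 T) :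
    eulerCurve v h σ₀ t ∈ probBox R := by
  refine euler_mem_probBox hv hC hh.le hσ₀ (le_trans ?_ hT)
  have := mul_le_mul_of_nonneg_left ((mul_floor_div_le hh ht.1).trans ht.2) hC
  linarith

lemma coupledWithin_eulerCurve (hv : IsContinuousVelocity R C v) (hC : 0 ≤ C) (hh : 0 < h)
    (hσ₀ : σ₀ ∈ probBox L) {T : ℝ} (hT : L + C * T ≤ R) {s t : ℝ} (hs : s ∈ Icc 0 T)
    (ht : t ∈ Icc 0 T) :
    CoupledWithin (C * |s - t| + C * h) (eulerCurve v h σ₀ s) (eulerCurve v h σ₀ t) := by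
  wlog hst : s ≤ t generalizing s t
  · rw [abs_sub_comm]
    exact (this ht hs (le_of_not_ge hst)).symm
  obtain ⟨j, hj⟩ := Nat.exists_eq_add_of_le
    (Nat.floor_mono (div_le_div_of_nonneg_right hst hh.le) : ⌊s / h⌋₊ ≤ ⌊t / h⌋₊)
  have h1 := mul_floor_div_le hh ht.1
  have h2 := lt_mul_floor_div_add hh s
  obtain ⟨Y, hY, hmap, hb⟩ := exists_euler_map hv hC hh.le hσ₀ ⌊s / h⌋₊ j (by
    rw [← hj]
    have := mul_le_mul_of_nonneg_left (h1.trans ht.2) hC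
    linarith)
  rw [eulerCurve, eulerCurve, hj, ← hmap]
  refine (CoupledWithin.of_map hY hb).mono ?_
  rw [abs_of_nonpos (by linarith), ← mul_add]
  rw [hj] at h1
  push_cast at h1
  exact mul_le_mul_of_nonneg_left (by linarith) hC

end Euler

/-! ### Step functions -/

section Step

variable {h : ℝ}

lemma floor_div_eq (hh : 0 < h) {N : ℕ} {τ : ℝ} (hτ : τ ∈ Ico (N * h) ((N + 1) * h)) :
    ⌊τ / h⌋₊ = N := by
  rw [Nat.floor_eq_iff (div_nonneg ((by positivity : (0:ℝ) ≤ N * h).trans hτ.1) hh.le),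
    le_div_iff₀ hh, div_lt_iff₀ hh]
  exact hτ

lemma measurable_floor_div (a : ℕ → ℝ) (h : ℝ) : Measurable fun τ : ℝ => a ⌊τ / h⌋₊ :=
  measurable_from_nat.comp (Nat.measurable_floor.comp (measurable_id.div_const h))

/-- The integral of a step function. -/
lemma integral_step (hh : 0 < h) (a : ℕ → ℝ) (N : ℕ) :
    IntervalIntegrable (fun τ : ℝ => a ⌊τ / h⌋₊) volume 0 (N * h) ∧
      ∫ τ in (0 : ℝ)..N * h, a ⌊τ / h⌋₊ = ∑ k ∈ Finset.range N, h * a k := by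
  induction N with
  | zero => simp
  | succ N ih =>
    have hle : (N : ℝ) * h ≤ (N + 1) * h := by nlinarith
    have heq : EqOn (fun _ : ℝ => a N) (fun τ : ℝ => a ⌊τ / h⌋₊)
        (Ioo ((N : ℝ) * h) ((N + 1) * h)) := fun τ hτ => by
      simp only [floor_div_eq hh ⟨hτ.1.le, hτ.2⟩]
    have hi : IntervalIntegrable (fun τ : ℝ => a ⌊τ / h⌋₊) volume (N * h) ((N + 1) * h) := by
      refine (intervalIntegrable_const (c := a N)).congr_uIoo ?_
      rwa [uIoo_of_le hle]
    push_cast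
    refine ⟨ih.1.trans hi, ?_⟩
    rw [← intervalIntegral.integral_add_adjacent_intervals ih.1 hi, ih.2, Finset.sum_range_succ,
      ← intervalIntegral.integral_congr_Ioo_of_le hle heq, intervalIntegral.integral_const]
    simp only [smul_eq_mul]
    ring

end Step

/-! ### Test functions -/

namespace IsTestFunction

variable {T : ℝ} {φ : ℝ → Plane → ℝ}

lemma hasFDerivAt (hφ : IsTestFunction T φ) (x : ℝ × Plane) :
    HasFDerivAt (fun x : ℝ × Plane => φ x.1 x.2)
      (fderiv ℝ (fun x : ℝ × Plane => φ x.1 x.2) x) x :=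
  (hφ.1.differentiable one_ne_zero x).hasFDerivAt

lemma continuous_fderiv (hφ : IsTestFunction T φ) :
    Continuous (fderiv ℝ fun x : ℝ × Plane => φ x.1 x.2) :=
  hφ.1.continuous_fderiv one_ne_zero

lemma deriv_eq (hφ : IsTestFunction T φ) (t : ℝ) (q : Plane) :
    deriv (fun τ => φ τ q) t = fderiv ℝ (fun x : ℝ × Plane => φ x.1 x.2) (t, q) (1, 0) := by
  have h := (hφ.hasFDerivAt (t, q)).comp_hasDerivAt t ((hasDerivAt_id t).prodMk
    (hasDerivAt_const t q))
  exact h.deriv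

lemma inner_gradient_eq (hφ : IsTestFunction T φ) (t : ℝ) (q w : Plane) :
    ⟪∇ (φ t) q, w⟫_ℝ = fderiv ℝ (fun x : ℝ × Plane => φ x.1 x.2) (t, q) (0, w) := by
  have h : HasFDerivAt (φ t) _ q := (hφ.hasFDerivAt (t, q)).comp q
    ((hasFDerivAt_const t q).prodMk (hasFDerivAt_id q))
  rw [gradient, InnerProductSpace.toDual_symm_apply, h.fderiv]
  rfl

lemma gradient_eq (hφ : IsTestFunction T φ) (t : ℝ) (q : Plane) :
    ∇ (φ t) q = (InnerProductSpace.toDual ℝ Plane).symm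
      ((fderiv ℝ (fun x : ℝ × Plane => φ x.1 x.2) (t, q)).comp (.inr ℝ ℝ Plane)) := by
  refine ext_inner_right ℝ fun w => ?_
  rw [hφ.inner_gradient_eq, InnerProductSpace.toDual_symm_apply]
  rfl

lemma continuous_deriv (hφ : IsTestFunction T φ) :
    Continuous fun x : ℝ × Plane => deriv (fun τ => φ τ x.2) x.1 := by
  simp_rw [hφ.deriv_eq]
  exact hφ.continuous_fderiv.clm_apply continuous_const

lemma continuous_gradient (hφ : IsTestFunction T φ) :
    Continuous fun x : ℝ × Plane => ∇ (φ x.1) x.2 := by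
  simp_rw [hφ.gradient_eq]
  exact (LinearIsometryEquiv.continuous _).comp
    (hφ.continuous_fderiv.clm_comp continuous_const)

lemma exists_bound (hφ : IsTestFunction T φ) : ∃ K, 0 ≤ K ∧ (∀ t q, ‖∇ (φ t) q‖ ≤ K) ∧
    (∀ t q, |deriv (fun τ => φ τ q) t| ≤ K) ∧ ∀ t q, |φ t q| ≤ K := by
  obtain ⟨K, hK⟩ := (hφ.2.1.fderiv (𝕜 := ℝ)).exists_bound_of_continuous hφ.continuous_fderiv
  obtain ⟨K', hK'⟩ := hφ.2.1.exists_bound_of_continuous hφ.1.continuous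
  have hK0 : 0 ≤ K := (norm_nonneg _).trans (hK 0)
  refine ⟨max K K', hK0.trans (le_max_left _ _), fun t q => le_trans ?_ (le_max_left _ _),
    fun t q => le_trans ?_ (le_max_left _ _), fun t q => (hK' (t, q)).trans (le_max_right _ _)⟩
  · rw [hφ.gradient_eq, LinearIsometryEquiv.norm_map]
    refine (ContinuousLinearMap.opNorm_comp_le _ _).trans ?_
    exact (mul_le_of_le_one_right (norm_nonneg _) (ContinuousLinearMap.norm_inr_le_one ..)).trans
      (hK _)
  · rw [hφ.deriv_eq, ← Real.norm_eq_abs]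
    refine ((fderiv ℝ _ _).le_opNorm _).trans ?_
    simpa [Prod.norm_def] using hK (t, q)

lemma uniformContinuous_fderiv (hφ : IsTestFunction T φ) :
    UniformContinuous (fderiv ℝ fun x : ℝ × Plane => φ x.1 x.2) :=
  (hφ.2.1.fderiv (𝕜 := ℝ)).uniformContinuous_of_continuous hφ.continuous_fderiv

lemma eq_zero (hφ : IsTestFunction T φ) {t : ℝ} (ht : t ∉ Ioo 0 T) (q : Plane) : φ t q = 0 :=
  image_eq_zero_of_notMem_tsupport (f := fun x : ℝ × Plane => φ x.1 x.2) (x := (t, q))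
    fun h => ht (hφ.2.2 h).1

/-- Test functions are uniformly differentiable. -/
lemma abs_sub_sub_le (hφ : IsTestFunction T φ) {ε : ℝ} (hε : 0 < ε) : ∃ δ > 0,
    ∀ (t h : ℝ) (q w : Plane), |h| ≤ δ → ‖w‖ ≤ δ →
      |φ (t + h) (q + w) - φ t q - (h * deriv (fun τ => φ τ q) t + ⟪∇ (φ t) q, w⟫_ℝ)| ≤
        ε * max |h| ‖w‖ := by
  obtain ⟨δ, hδ, hunif⟩ := Metric.uniformContinuous_iff.1 hφ.uniformContinuous_fderiv ε hε
  refine ⟨δ / 2, by positivity, fun t h q w hh hw => ?_⟩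
  have hn : ‖((h, w) : ℝ × Plane)‖ = max |h| ‖w‖ := rfl
  have hlt : ‖((h, w) : ℝ × Plane)‖ < δ := by
    rw [hn]; exact max_lt (by linarith) (by linarith)
  have key := (convex_ball ((t, q) : ℝ × Plane) δ).norm_image_sub_le_of_norm_hasFDerivWithin_le'
    (f := fun x : ℝ × Plane => φ x.1 x.2) (C := ε)
    (φ := fderiv ℝ (fun x : ℝ × Plane => φ x.1 x.2) (t, q)) (x := (t, q)) (y := (t + h, q + w))
    (fun x _ => (hφ.hasFDerivAt x).hasFDerivWithinAt)
    (fun x hx => by rw [← dist_eq_norm]; exact (hunif hx).le)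
    (Metric.mem_ball_self hδ) (by
      rw [Metric.mem_ball, dist_eq_norm]
      simpa using hlt)
  have e1 : ((t + h, q + w) : ℝ × Plane) - (t, q) = (h, w) := by simp
  rw [e1, hn] at key
  have e2 : fderiv ℝ (fun x : ℝ × Plane => φ x.1 x.2) (t, q) (h, w) =
      h * deriv (fun τ => φ τ q) t + ⟪∇ (φ t) q, w⟫_ℝ := by
    rw [hφ.deriv_eq, hφ.inner_gradient_eq, ← smul_eq_mul, ← map_smul, ← map_add]
    simp
  rw [e2] at key
  exact key

end IsTestFunction

/-! ### Convergence of the Euler scheme -/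

section Convergence

variable {R L C T : ℝ} {v : ℝ → Measure Plane → Plane → Plane} {σ₀ : Measure Plane}
  {φ : ℝ → Plane → ℝ}

/-- The Euler scheme satisfies the continuity equation up to an error that vanishes with the
step: the increments of `∫ φ` telescope to zero, and each is computed by a first-order expansion
of `φ`. -/
lemma abs_sum_euler_le (hv : IsContinuousVelocity R C v) (hC : 0 ≤ C) (hT : 0 < T)
    (hσ₀ : σ₀ ∈ probBox L) (hLT : L + C * T ≤ R) (hφ : IsTestFunction T φ) {ε : ℝ} (hε : 0 < ε) :
    ∃ h₀ > 0, ∀ (h : ℝ) (N : ℕ), 0 < h → h ≤ h₀ → N * h = T →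
      |∑ k ∈ Finset.range N, h * (∫ q, deriv (fun τ => φ τ q) (k * h) ∂(euler v h σ₀ k) +
        ∫ q, ⟪v (k * h) (euler v h σ₀ k) q, ∇ (φ (k * h)) q⟫_ℝ ∂(euler v h σ₀ k))| ≤ ε := by
  obtain ⟨K, hK0, hK1, hK2, hK3⟩ := hφ.exists_bound
  obtain ⟨δ, hδ, hd⟩ := hφ.abs_sub_sub_le (ε := ε / ((1 + C) * T)) (by positivity)
  refine ⟨δ / (1 + C), by positivity, fun h N hh hh₀ hN => ?_⟩
  rw [le_div_iff₀ (by positivity)] at hh₀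
  set μ := euler v h σ₀ with hμ
  set I : ℕ → ℝ := fun k => ∫ q, φ (k * h) q ∂(μ k) with hI
  set A : ℕ → ℝ := fun k => ∫ q, deriv (fun τ => φ τ q) (k * h) ∂(μ k) +
        ∫ q, ⟪v (k * h) (μ k) q, ∇ (φ (k * h)) q⟫_ℝ ∂(μ k) with hA
  have htel : ∑ k ∈ Finset.range N, (I (k + 1) - I k) = 0 := by
    rw [Finset.sum_range_sub]
    have h1 : I N = 0 := by
      simp only [hI, hN, hφ.eq_zero (t := T) (by simp), integral_zero]
    have h2 : I 0 = 0 := by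
      simp only [hI, Nat.cast_zero, zero_mul, hφ.eq_zero (t := 0) (by simp), integral_zero]
    rw [h1, h2, sub_zero]
  have hstep : ∀ k ∈ Finset.range N,
      |(I (k + 1) - I k) - h * A k| ≤ ε / ((1 + C) * T) * (h * (1 + C)) := by
    intro k hk
    have hkN : ((k : ℝ) + 1) ≤ N := by exact_mod_cast Finset.mem_range.1 hk
    have hkT : h * (k : ℝ) ≤ T := by
      rw [← hN]; nlinarith
    have hmem : μ k ∈ probBox R := euler_mem_probBox hv hC hh.le hσ₀
      (le_trans (by linarith [mul_le_mul_of_nonneg_left hkT hC]) hLT)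
    have hprob := hmem.1
    have hvb := hv.bound (k * h) (by positivity) _ hmem
    have hm := hv.measurable_step h (k * h) (μ k)
    have hc : ∀ t, Continuous (φ t) := fun t =>
      hφ.1.continuous.comp (continuous_const.prodMk continuous_id)
    have hgc : ∀ t, Continuous (∇ (φ t)) := fun t =>
      hφ.continuous_gradient.comp (continuous_const.prodMk continuous_id)
    have hdc : ∀ t, Continuous fun q => deriv (fun τ => φ τ q) t := fun t =>
      hφ.continuous_deriv.comp (continuous_const.prodMk continuous_id)
    have i1 : Integrable (fun q => φ (k * h + h) (q + h • v (k * h) (μ k) q)) (μ k) :=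
      Integrable.of_bound (((hc _).measurable.comp hm).aestronglyMeasurable) K
        (ae_of_all _ fun q => hK3 _ _)
    have i2 : Integrable (φ (k * h)) (μ k) :=
      Integrable.of_bound (hc _).aestronglyMeasurable K (ae_of_all _ fun q => hK3 _ _)
    have i3 : Integrable (fun q => deriv (fun τ => φ τ q) (k * h)) (μ k) :=
      Integrable.of_bound (hdc _).aestronglyMeasurable K (ae_of_all _ fun q => hK2 _ _)
    have i4 : Integrable (fun q => ⟪v (k * h) (μ k) q, ∇ (φ (k * h)) q⟫_ℝ) (μ k) := by
      refine Integrable.of_bound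
        ((hv.meas _ _).inner (hgc _).measurable).aestronglyMeasurable (C * K) ?_
      filter_upwards [hvb] with q hq
      exact (norm_inner_le_norm _ _).trans (mul_le_mul hq (hK1 _ _) (norm_nonneg _) hC)
    have e1 : I (k + 1) = ∫ q, φ (k * h + h) (q + h • v (k * h) (μ k) q) ∂(μ k) := by
      simp only [hI]
      rw [show μ (k + 1) = (μ k).map fun q => q + h • v (k * h) (μ k) q from rfl,
        integral_map hm.aemeasurable (hc _).aestronglyMeasurable]
      push_cast
      rw [add_one_mul]
    have e2 : (I (k + 1) - I k) - h * A k = ∫ q, (φ (k * h + h) (q + h • v (k * h) (μ k) q) -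
        φ (k * h) q - (h * deriv (fun τ => φ τ q) (k * h) +
          h * ⟪v (k * h) (μ k) q, ∇ (φ (k * h)) q⟫_ℝ)) ∂(μ k) := by
      have s1 := integral_sub (i1.sub i2) ((i3.const_mul h).add (i4.const_mul h))
      simp only [Pi.sub_apply, Pi.add_apply] at s1
      rw [s1, integral_sub i1 i2, integral_add (i3.const_mul h) (i4.const_mul h),
        integral_const_mul, integral_const_mul, e1]
      simp only [hI, hA]
      ring
    rw [e2, ← Real.norm_eq_abs]
    have := norm_integral_le_of_norm_le_const (μ := μ k)
      (f := fun q => φ (k * h + h) (q + h • v (k * h) (μ k) q) -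
        φ (k * h) q - (h * deriv (fun τ => φ τ q) (k * h) +
          h * ⟪v (k * h) (μ k) q, ∇ (φ (k * h)) q⟫_ℝ))
      (C := ε / ((1 + C) * T) * (h * (1 + C))) (by
        filter_upwards [hvb] with q hq
        have hw : ‖h • v (k * h) (μ k) q‖ ≤ h * C := by
          rw [norm_smul, Real.norm_of_nonneg hh.le]
          exact mul_le_mul_of_nonneg_left hq hh.le
        have hhC : 0 ≤ h * C := by positivity
        have := hd (k * h) h q (h • v (k * h) (μ k) q) (by rw [abs_of_pos hh]; linarith)
          (by linarith)
        rw [inner_smul_right, real_inner_comm] at this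
        refine this.trans (mul_le_mul_of_nonneg_left ?_ (by positivity))
        rw [abs_of_pos hh]
        exact max_le (by linarith) (by linarith))
    simpa using this
  have hsum : ∑ k ∈ Finset.range N, h * A k =
      -∑ k ∈ Finset.range N, ((I (k + 1) - I k) - h * A k) := by
    rw [Finset.sum_sub_distrib, htel]
    ring
  rw [hsum, abs_neg]
  refine (Finset.abs_sum_le_sum_abs _ _).trans ((Finset.sum_le_sum hstep).trans ?_)
  rw [Finset.sum_const, Finset.card_range, nsmul_eq_mul, ← hN]
  have : 0 < (N : ℝ) := by
    rcases Nat.eq_zero_or_pos N with h0 | h0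
    · rw [h0] at hN; simp at hN; linarith
    · exact_mod_cast h0
  apply le_of_eq
  field_simp

open BoundedContinuousFunction in
/-- Integrals of jointly uniformly continuous functions are continuous in the time and the measure. -/
lemma tendsto_integral_of_uniformContinuous {σ : ℕ → Measure Plane} {σ' : Measure Plane}
    [∀ n, IsProbabilityMeasure (σ n)]
    (hlim : ∀ f : Plane →ᵇ ℝ, Tendsto (fun n => ∫ q, f q ∂(σ n)) atTop (𝓝 (∫ q, f q ∂σ')))
    {u : ℝ → Plane → ℝ} (hu : UniformContinuous fun x : ℝ × Plane => u x.1 x.2) {K : ℝ}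
    (hK : ∀ t q, |u t q| ≤ K) {t : ℕ → ℝ} {t' : ℝ} (ht : Tendsto t atTop (𝓝 t')) :
    Tendsto (fun n => ∫ q, u (t n) q ∂(σ n)) atTop (𝓝 (∫ q, u t' q ∂σ')) := by
  have hc : ∀ t, Continuous (u t) := fun t =>
    hu.continuous.comp (continuous_const.prodMk continuous_id)
  have h1 : Tendsto (fun n => ∫ q, u t' q ∂(σ n)) atTop (𝓝 (∫ q, u t' q ∂σ')) :=
    hlim (ofNormedAddCommGroup (u t') (hc t') K (hK t'))
  have h2 : Tendsto (fun n => ∫ q, u (t n) q ∂(σ n) - ∫ q, u t' q ∂(σ n)) atTop (𝓝 0) := by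
    rw [Metric.tendsto_atTop]
    intro ε hε
    obtain ⟨δ, hδ, hunif⟩ := Metric.uniformContinuous_iff.1 hu (ε / 2) (by positivity)
    obtain ⟨N, hN⟩ := Metric.tendsto_atTop.1 ht δ hδ
    refine ⟨N, fun n hn => ?_⟩
    have i : ∀ t, Integrable (u t) (σ n) := fun t =>
      Integrable.of_bound (hc t).aestronglyMeasurable K (ae_of_all _ (hK t))
    rw [dist_zero_right, ← integral_sub (i _) (i _)]
    have := norm_integral_le_of_norm_le_const (μ := σ n) (f := fun q => u (t n) q - u t' q)
      (C := ε / 2) (ae_of_all _ fun q => by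
        rw [← dist_eq_norm]
        refine (hunif (a := (t n, q)) (b := (t', q)) ?_).le
        simpa [Prod.dist_eq, hδ] using hN n hn)
    simp only [probReal_univ, mul_one] at this
    linarith
  simpa using h2.add h1

/-- A limit of Euler schemes transports `σ₀` along the velocity field `v`. -/
theorem IsContinuousVelocity.exists_curve (hv : IsContinuousVelocity R C v) (hC : 0 ≤ C)
    (hT : 0 < T) (hσ₀ : σ₀ ∈ probBox L) (hLT : L + C * T ≤ R) :
    ∃ σ : ℝ → Measure Plane, (∀ t ∈ Icc 0 T, σ t ∈ probBox R) ∧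
      (∀ s ∈ Icc 0 T, ∀ t ∈ Icc 0 T, CoupledWithin (C * |s - t|) (σ s) (σ t)) ∧
      σ 0 = σ₀ ∧
      ∀ φ, IsTestFunction T φ →
        IntervalIntegrable (fun t => ∫ q, deriv (fun τ => φ τ q) t ∂(σ t)) volume 0 T ∧
        IntervalIntegrable (fun t => ∫ q, ⟪v t (σ t) q, ∇ (φ t) q⟫_ℝ ∂(σ t)) volume 0 T ∧
        (∫ t in (0 : ℝ)..T, ∫ q, deriv (fun τ => φ τ q) t ∂(σ t)) +
          ∫ t in (0 : ℝ)..T, ∫ q, ⟪v t (σ t) q, ∇ (φ t) q⟫_ℝ ∂(σ t) = 0 := by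
  -- step sizes that divide the time interval evenly
  set h : ℕ → ℝ := fun n => T / ((n : ℝ) + 1) with hhdef
  have hh : ∀ n, 0 < h n := fun n => by positivity
  have hh0 : Tendsto h atTop (𝓝 0) := by
    have := (tendsto_one_div_add_atTop_nhds_zero_nat (𝕜 := ℝ)).const_mul T
    simpa [hhdef, div_eq_mul_inv] using this
  have hhT : ∀ n, ((n + 1 : ℕ) : ℝ) * h n = T := fun n => by
    simp only [hhdef]; push_cast; field_simp
  obtain ⟨ψ, σ, hψ, hmem, hlip, hconv⟩ := exists_subseq_curve (e := fun n => C * h n)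
    (σn := fun n => eulerCurve v (h n) σ₀) hC hT (by simpa using hh0.const_mul C)
    (fun n t ht => eulerCurve_mem_probBox hv hC (hh n) hσ₀ hLT ht)
    (fun n s hs t ht => coupledWithin_eulerCurve hv hC (hh n) hσ₀ hLT hs ht)
  have hψ' := hψ.tendsto_atTop
  refine ⟨fun t => σ t, hmem, hlip, ?_, fun φ hφ => ?_⟩
  · have := hσ₀.1
    refine ext_of_forall_integral_eq_of_IsFiniteMeasure fun f => ?_
    refine tendsto_nhds_unique (hconv 0 ⟨le_rfl, hT.le⟩ f) (tendsto_const_nhds.congr fun n => ?_)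
    simp [eulerCurve, euler]
  obtain ⟨K, hK0, hK1, hK2, -⟩ := hφ.exists_bound
  -- the last grid time before `τ`
  set tn : ℕ → ℝ → ℝ := fun n τ => ⌊τ / h n⌋₊ * h n with htn
  have htn0 : ∀ n τ, 0 ≤ tn n τ := fun n τ => by have := hh n; positivity
  have htnlim : ∀ τ, 0 ≤ τ → Tendsto (fun n => tn (ψ n) τ) atTop (𝓝 τ) := by
    intro τ hτ
    have hlow : Tendsto (fun n => τ - h (ψ n)) atTop (𝓝 τ) := by
      simpa using (hh0.comp hψ').const_sub τ
    refine tendsto_of_tendsto_of_tendsto_of_le_of_le hlow tendsto_const_nhds (fun n => ?_)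
      fun n => ?_
    · have := lt_mul_floor_div_add (hh (ψ n)) τ
      simp only [htn]; linarith
    · have := mul_floor_div_le (hh (ψ n)) hτ
      simp only [htn]; linarith
  set a : ℕ → ℕ → ℝ := fun n k => ∫ q, deriv (fun τ => φ τ q) (k * h n) ∂(euler v (h n) σ₀ k)
    with ha
  set b : ℕ → ℕ → ℝ := fun n k =>
    ∫ q, ⟪v (k * h n) (euler v (h n) σ₀ k) q, ∇ (φ (k * h n)) q⟫_ℝ ∂(euler v (h n) σ₀ k) with hb
  have hIoc : ∀ {τ}, τ ∈ Ioc 0 T → τ ∈ Icc 0 T := fun hτ => ⟨hτ.1.le, hτ.2⟩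
  have hprob : ∀ n τ, τ ∈ Ioc 0 T → eulerCurve v (h n) σ₀ τ ∈ probBox R := fun n τ hτ =>
    eulerCurve_mem_probBox hv hC (hh n) hσ₀ hLT (hIoc hτ)
  have hab : ∀ n, ∀ τ ∈ Ioc 0 T, ‖a n ⌊τ / h n⌋₊‖ ≤ K := fun n τ hτ => by
    have hp := (hprob n τ hτ).1
    have := norm_integral_le_of_norm_le_const (μ := eulerCurve v (h n) σ₀ τ)
      (f := fun q => deriv (fun τ => φ τ q) (tn n τ)) (ae_of_all _ fun q => hK2 _ _)
    rwa [probReal_univ, mul_one] at this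
  have hbb : ∀ n, ∀ τ ∈ Ioc 0 T, ‖b n ⌊τ / h n⌋₊‖ ≤ C * K := fun n τ hτ => by
    have hp := (hprob n τ hτ).1
    have := norm_integral_le_of_norm_le_const (μ := eulerCurve v (h n) σ₀ τ)
      (f := fun q => ⟪v (tn n τ) (eulerCurve v (h n) σ₀ τ) q, ∇ (φ (tn n τ)) q⟫_ℝ) (C := C * K) (by
        filter_upwards [hv.bound _ (htn0 n τ) _ (hprob n τ hτ)] with q hq
        exact (norm_inner_le_norm _ _).trans (mul_le_mul hq (hK1 _ _) (norm_nonneg _) hC))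
    rwa [probReal_univ, mul_one] at this
  have halim : ∀ τ ∈ Ioc 0 T, Tendsto (fun n => a (ψ n) ⌊τ / h (ψ n)⌋₊) atTop
      (𝓝 (∫ q, deriv (fun τ => φ τ q) τ ∂(σ τ : Measure Plane))) := fun τ hτ => by
    have hp : ∀ n, IsProbabilityMeasure (eulerCurve v (h (ψ n)) σ₀ τ) := fun n => (hprob _ τ hτ).1
    have huc : UniformContinuous fun x : ℝ × Plane => deriv (fun τ => φ τ x.2) x.1 := by
      simp_rw [hφ.deriv_eq]
      exact ((ContinuousLinearMap.apply ℝ ℝ ((1, 0) : ℝ × Plane)).uniformContinuous).comp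
        hφ.uniformContinuous_fderiv
    exact tendsto_integral_of_uniformContinuous (hconv τ (hIoc hτ))
      (u := fun t q => deriv (fun τ => φ τ q) t) huc hK2 (htnlim τ hτ.1.le)
  have hblim : ∀ τ ∈ Ioc 0 T, Tendsto (fun n => b (ψ n) ⌊τ / h (ψ n)⌋₊) atTop
      (𝓝 (∫ q, ⟪v τ (σ τ) q, ∇ (φ τ) q⟫_ℝ ∂(σ τ : Measure Plane))) := fun τ hτ => by
    refine hv.cont (fun n => eulerCurve v (h (ψ n)) σ₀ τ) (σ τ) (fun n => tn (ψ n) τ) τ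
      (fun n => ∇ (φ (tn (ψ n) τ))) (∇ (φ τ)) K (fun n => hprob _ τ hτ) (hmem τ (hIoc hτ))
      (hconv τ (hIoc hτ)) (fun n => htn0 _ _) (htnlim τ hτ.1.le) (fun n => ?_)
      (fun n q => hK1 _ _) fun q => ?_
    · exact (hφ.continuous_gradient.comp (continuous_const.prodMk continuous_id)).measurable
    · exact (hφ.continuous_gradient.tendsto (τ, q)).comp
        (((htnlim τ hτ.1.le).comp tendsto_fst).prodMk_nhds tendsto_snd)
  -- bounded step functions that converge pointwise converge in the mean to an integrable limit
  have hlimit : ∀ {c : ℕ → ℕ → ℝ} {c' : ℝ → ℝ} {B : ℝ},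
      (∀ n, ∀ τ ∈ Ioc 0 T, ‖c n ⌊τ / h n⌋₊‖ ≤ B) →
      (∀ τ ∈ Ioc 0 T, Tendsto (fun n => c (ψ n) ⌊τ / h (ψ n)⌋₊) atTop (𝓝 (c' τ))) →
      IntervalIntegrable c' volume 0 T ∧
        Tendsto (fun n => ∫ τ in (0 : ℝ)..T, c (ψ n) ⌊τ / h (ψ n)⌋₊) atTop
          (𝓝 (∫ τ in (0 : ℝ)..T, c' τ)) := by
    intro c c' B hcb hclim
    have hcm : ∀ n, AEStronglyMeasurable (fun τ : ℝ => c (ψ n) ⌊τ / h (ψ n)⌋₊)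
        (volume.restrict (Ioc 0 T)) := fun n => (measurable_floor_div _ _).aestronglyMeasurable
    have hcl : ∀ᵐ τ ∂(volume.restrict (Ioc 0 T)),
        Tendsto (fun n => c (ψ n) ⌊τ / h (ψ n)⌋₊) atTop (𝓝 (c' τ)) :=
      (ae_restrict_iff' measurableSet_Ioc).2 (ae_of_all _ hclim)
    refine ⟨?_, ?_⟩
    · rw [intervalIntegrable_iff_integrableOn_Ioc_of_le hT.le]
      refine Integrable.of_bound (aestronglyMeasurable_of_tendsto_ae atTop hcm hcl) B ?_
      exact (ae_restrict_iff' measurableSet_Ioc).2 (ae_of_all _ fun τ hτ =>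
        le_of_tendsto' (hclim τ hτ).norm fun n => hcb _ τ hτ)
    · simp only [intervalIntegral.integral_of_le hT.le]
      refine tendsto_integral_of_dominated_convergence (fun _ => B) hcm (integrable_const B)
        (fun n => (ae_restrict_iff' measurableSet_Ioc).2 (ae_of_all _ (hcb _))) hcl
  obtain ⟨ia, la⟩ := hlimit hab halim
  obtain ⟨ib, lb⟩ := hlimit hbb hblim
  refine ⟨ia, ib, tendsto_nhds_unique (la.add lb) ?_⟩
  rw [Metric.tendsto_atTop]
  intro ε hε
  obtain ⟨h₀, hh₀, hsum⟩ := abs_sum_euler_le hv hC hT hσ₀ hLT hφ (half_pos hε)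
  obtain ⟨N, hN⟩ := eventually_atTop.1 ((hh0.comp hψ').eventually_lt_const hh₀)
  refine ⟨N, fun n hn => ?_⟩
  have h1 := hsum (h (ψ n)) (ψ n + 1) (hh _) (hN n hn).le (hhT _)
  have sa := integral_step (hh (ψ n)) (a (ψ n)) (ψ n + 1)
  have sb := integral_step (hh (ψ n)) (b (ψ n)) (ψ n + 1)
  rw [hhT] at sa sb
  rw [dist_zero_right, Real.norm_eq_abs, sa.2, sb.2, ← Finset.sum_add_distrib]
  simp_rw [← mul_add]
  exact h1.trans_lt (half_lt_self hε)

end Convergence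

/-! ### The physical forcing -/

lemma measurable_physCoord (r₀ : ℝ) : Measurable (physCoord r₀) := by
  have h0 : Measurable fun p : Plane => r₀ / √(1 - 2 * r₀ ^ 2 * p 0) :=
    measurable_const.div (Real.continuous_sqrt.measurable.comp
      (measurable_const.sub ((measurable_coord 0).const_mul _)))
  exact continuous_mk₂.measurable.comp (h0.prodMk (measurable_coord 1))

lemma isForcing_forcing {r₀ H g θ₀ R C₀ : ℝ} (hg : 0 < g) (hθ₀ : 0 < θ₀) {F S : ℝ → Plane → ℝ}
    (hF : ContinuousOn (fun x : ℝ × Plane => F x.1 x.2) (Ici 0 ×ˢ univ))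
    (hS : ContinuousOn (fun x : ℝ × Plane => S x.1 x.2) (Ici 0 ×ˢ univ))
    (hF0 : ∀ t, 0 ≤ t → ∀ x, 0 ≤ F t x) (hS0 : ∀ t, 0 ≤ t → ∀ x, 0 ≤ S t x)
    (hC₀ : ∀ t, 0 ≤ t → ∀ p ∈ domD r₀ H, √R * ‖forcing r₀ g θ₀ F S t p‖ ≤ C₀) :
    IsForcing r₀ H R C₀ (forcing r₀ g θ₀ F S) where
  meas t ht := by
    have hsec : ∀ {f : ℝ → Plane → ℝ},
        ContinuousOn (fun x : ℝ × Plane => f x.1 x.2) (Ici 0 ×ˢ univ) →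
        Measurable fun p => f t (physCoord r₀ p) := fun hf =>
      (continuousOn_univ.1 (hf.comp (continuous_const.prodMk continuous_id).continuousOn
        fun x _ => ⟨ht, mem_univ _⟩)).measurable.comp (measurable_physCoord r₀)
    exact continuous_mk₂.measurable.comp ((hsec hF).prodMk ((hsec hS).const_mul _))
  bound := hC₀
  nonneg t ht p _ := ⟨hF0 t ht _, mul_nonneg (by positivity) (hS0 t ht _)⟩
  cont p _ := by
    have hsec : ∀ {f : ℝ → Plane → ℝ},
        ContinuousOn (fun x : ℝ × Plane => f x.1 x.2) (Ici 0 ×ˢ univ) →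
        ContinuousOn (fun t => f t (physCoord r₀ p)) (Ici 0) := fun hf =>
      hf.comp (continuous_id.prodMk continuous_const).continuousOn
        fun t ht => ⟨ht, mem_univ _⟩
    exact continuous_mk₂.comp_continuousOn ((hsec hF).prodMk (continuousOn_const.mul (hsec hS)))

section

variable {r₀ H Ω R C₀ : ℝ} {σ : Measure Plane} {ρ : ℝ → ℝ} {P Ψ : Plane → ℝ}

/-- A velocity for the optimal triples represents the functional of every choice of the primal
minimizer and the dual maximizer. -/
lemma IsVelocity.functionalL_eq {f : Plane → Plane} {V : Plane → Plane} (hr₀ : 0 < r₀)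
    (hH : 0 < H) (hΩ : 0 < Ω) (hR : 0 ≤ R) (hσ : σ ∈ probBox R)
    (hV : IsVelocity r₀ H Ω R C₀ f σ V) (hρ : IsPrimalMinimizer r₀ H Ω σ ρ)
    (hP : IsDualMaximizer r₀ H Ω σ P Ψ) {G : Plane → Plane} (hG : Integrable G σ) :
    functionalL r₀ H ρ P f G = ∫ q, ⟪V q, G q⟫_ℝ ∂σ := by
  obtain ⟨P', h', hg⟩ := exists_isTriple_of_optimal hr₀ hH hΩ hR hσ hρ hP
  rw [functionalL_congr rfl hg, hV.repr ρ P' h' G hG]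

/-- The gradient of the dual maximizer pushes the mass of the primal minimizer forward to `σ`. -/
lemma integral_gradient_eq (hr₀ : 0 < r₀) (hH : 0 < H) (hΩ : 0 < Ω) (hR : 0 ≤ R)
    (hσ : σ ∈ probBox R) (hρ : IsPrimalMinimizer r₀ H Ω σ ρ)
    (hP : IsDualMaximizer r₀ H Ω σ P Ψ) {f : Plane → ℝ} (hf : AEStronglyMeasurable f σ) :
    ∫ p, f (∇ P p) ∂(regionMeasure r₀ H ρ) = ∫ q, f q ∂σ := by
  obtain ⟨P', h', hg⟩ := exists_isTriple_of_optimal hr₀ hH hΩ hR hσ hρ hP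
  rw [← h'.integral_comp hf]
  refine integral_congr_ae ?_
  filter_upwards [hg] with p hp
  rw [hp]

end

end AxisymmetricFlow

end

theorem mainTheorem4
    (r₀ H Ω g θ₀ R₀ L₀ C₀ T : ℝ)
    (hr₀ : 0 < r₀) (hH : 0 < H) (hΩ : 0 < Ω) (hg : 0 < g) (hθ₀ : 0 < θ₀) (hR₀ : 1 < R₀)
    (F S : ℝ → AxisymmetricFlow.Plane → ℝ)
    (hFcont : ContinuousOn (fun x : ℝ × AxisymmetricFlow.Plane => F x.1 x.2) (Ici 0 ×ˢ univ))
    (hScont : ContinuousOn (fun x : ℝ × AxisymmetricFlow.Plane => S x.1 x.2) (Ici 0 ×ˢ univ))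
    (hFbdd : ∃ M : ℝ, ∀ t, 0 ≤ t → ∀ x, |F t x| ≤ M)
    (hSbdd : ∃ M : ℝ, ∀ t, 0 ≤ t → ∀ x, |S t x| ≤ M)
    (hFnonneg : ∀ t, 0 ≤ t → ∀ x, 0 ≤ F t x)
    (hSnonneg : ∀ t, 0 ≤ t → ∀ x, 0 ≤ S t x)
    (hC₀ : ∀ t, 0 ≤ t → ∀ p ∈ AxisymmetricFlow.domD r₀ H,
      √R₀ * ‖AxisymmetricFlow.forcing r₀ g θ₀ F S t p‖ ≤ C₀)
    (hL₀ : 0 < L₀) (hLR : L₀ < R₀)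
    (σ₀ : MeasureTheory.Measure AxisymmetricFlow.Plane)
    (hσ₀ : σ₀ ∈ AxisymmetricFlow.probBox L₀)
    (hT : 0 < T) (hLT : L₀ + C₀ * T < R₀) :
    ∃ σ : ℝ → MeasureTheory.Measure AxisymmetricFlow.Plane,
      (∀ t ∈ Icc 0 T, σ t ∈ AxisymmetricFlow.probBox R₀) ∧
      (∀ s ∈ Icc 0 T, ∀ t ∈ Icc 0 T,
        AxisymmetricFlow.W1 (σ s) (σ t) ≤ ENNReal.ofReal (C₀ * |s - t|)) ∧
      σ 0 = σ₀ ∧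
      AxisymmetricFlow.IsWeakDualSolution r₀ H Ω g θ₀ R₀ T F S σ ∧
      ∃ V : ℝ → AxisymmetricFlow.Plane → AxisymmetricFlow.Plane,
        (∀ t ∈ Ioo 0 T,
          AxisymmetricFlow.IsRieszVelocity r₀ H Ω g θ₀ C₀ F S t (σ t) (V t)) ∧
        AxisymmetricFlow.SolvesContinuityEquation T σ V := by
  have hR1 : 1 ≤ R₀ := hR₀.le
  have hR0 : 0 ≤ R₀ := by linarith
  have hC : 0 ≤ C₀ := le_trans (by positivity)
    (hC₀ 0 le_rfl 0 ⟨⟨le_rfl, AxisymmetricFlow.sEnd_pos hr₀⟩, le_rfl, hH.le⟩)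
  have hForcing := AxisymmetricFlow.isForcing_forcing (R := R₀) hg hθ₀ hFcont hScont hFnonneg
    hSnonneg hC₀
  obtain ⟨σ, hmem, hlip, h0, hφ⟩ := (AxisymmetricFlow.isContinuousVelocity_vel (Ω := Ω) hr₀ hH hΩ
    hR1 hForcing).exists_curve hC hT hσ₀ hLT.le
  have hIoo : ∀ {t}, t ∈ Ioo 0 T → t ∈ Icc 0 T := fun ht => ⟨ht.1.le, ht.2.le⟩
  have hvel := fun t (ht : t ∈ Ioo 0 T) =>
    AxisymmetricFlow.isVelocity_vel (Ω := Ω) hr₀ hH hΩ hR1 hForcing ht.1.le (hmem t (hIoo ht))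
  have hW : ∀ s ∈ Icc 0 T, ∀ t ∈ Icc 0 T,
      AxisymmetricFlow.W1 (σ s) (σ t) ≤ ENNReal.ofReal (C₀ * |s - t|) := fun s hs t ht => by
    have := (hmem t ht).1
    exact (hlip s hs t ht).W1_le
  -- the two integrands of the weak formulation, for any choice of the minimizers
  have hgrad : ∀ {φ : ℝ → AxisymmetricFlow.Plane → ℝ}, AxisymmetricFlow.IsTestFunction T φ →
      ∀ t ∈ Ioo 0 T, MeasureTheory.Integrable (∇ (φ t)) (σ t) := fun {φ} h t ht => by
    have := (hmem t (hIoo ht)).1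
    obtain ⟨K, -, hK, -⟩ := h.exists_bound
    exact Integrable.of_bound (h.continuous_gradient.comp
      (continuous_const.prodMk continuous_id)).aestronglyMeasurable K
        (MeasureTheory.ae_of_all _ (hK t))
  have hderiv : ∀ {φ : ℝ → AxisymmetricFlow.Plane → ℝ}, AxisymmetricFlow.IsTestFunction T φ →
      ∀ t, Continuous fun q => deriv (fun τ => φ τ q) t := fun h t =>
    h.continuous_deriv.comp (continuous_const.prodMk continuous_id)
  refine ⟨σ, hmem, hW, h0, ⟨fun t ht => hmem t (hIoo ht), ⟨fun _ => C₀, ?_, ?_⟩, ?_, ?_, ?_⟩,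
    fun t => AxisymmetricFlow.vel r₀ H Ω R₀ C₀ (AxisymmetricFlow.forcing r₀ g θ₀ F S t) (σ t),
    fun t ht => ⟨(hvel t ht).meas, (hvel t ht).bound, fun ρ P Ψ hρ hP G hG =>
      (hvel t ht).functionalL_eq hr₀ hH hΩ hR0 (hmem t (hIoo ht)) hρ hP hG⟩, ?_⟩
  · exact integrableOn_const (by simp)
  · intro s hs t ht hst
    refine (hW s (hIoo hs) t (hIoo ht)).trans (ENNReal.ofReal_le_ofReal (le_of_eq ?_))
    rw [intervalIntegral.integral_const, abs_sub_comm, abs_of_nonneg (by linarith), smul_eq_mul,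
      mul_comm]
  · intro t ht
    obtain ⟨ρ, P, h⟩ := AxisymmetricFlow.exists_isTriple_of_mem_probBox (Ω := Ω) hr₀ hH hΩ hR0
      (hmem t (hIoo ht))
    exact ⟨ρ, h.isPrimalMinimizer hr₀ hH hΩ hR0 (hmem t (hIoo ht))⟩
  · intro t ht
    obtain ⟨ρ, P, h⟩ := AxisymmetricFlow.exists_isTriple_of_mem_probBox (Ω := Ω) hr₀ hH hΩ hR0
      (hmem t (hIoo ht))
    exact h.exists_isDualMaximizer hr₀ hH hΩ hR0 (hmem t (hIoo ht))
  · intro ρ P Ψ hρ hP φ hφT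
    obtain ⟨i1, i2, hsum⟩ := hφ φ hφT
    have e1 : EqOn (fun t => ∫ q, deriv (fun τ => φ τ q) t ∂(σ t))
        (fun t => ∫ p, deriv (fun τ => φ τ (∇ (P t) p)) t
          ∂(AxisymmetricFlow.regionMeasure r₀ H (ρ t))) (Ioo 0 T) := fun t ht =>
      (AxisymmetricFlow.integral_gradient_eq hr₀ hH hΩ hR0 (hmem t (hIoo ht)) (hρ t ht) (hP t ht)
        (f := fun q => deriv (fun τ => φ τ q) t) (hderiv hφT t).aestronglyMeasurable).symm
    have e2 : EqOn (fun t => ∫ q, ⟪AxisymmetricFlow.vel r₀ H Ω R₀ C₀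
          (AxisymmetricFlow.forcing r₀ g θ₀ F S t) (σ t) q, ∇ (φ t) q⟫_ℝ ∂(σ t))
        (fun t => AxisymmetricFlow.functionalL r₀ H (ρ t) (P t)
          (AxisymmetricFlow.forcing r₀ g θ₀ F S t) (∇ (φ t))) (Ioo 0 T) := fun t ht =>
      ((hvel t ht).functionalL_eq hr₀ hH hΩ hR0 (hmem t (hIoo ht)) (hρ t ht) (hP t ht)
        (hgrad hφT t ht)).symm
    refine ⟨i1.congr_uIoo ?_, i2.congr_uIoo ?_, ?_⟩
    · rwa [uIoo_of_le hT.le]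
    · rwa [uIoo_of_le hT.le]
    · rw [← intervalIntegral.integral_congr_Ioo_of_le hT.le e1,
        ← intervalIntegral.integral_congr_Ioo_of_le hT.le e2]
      exact hsum
  · intro φ hφT
    obtain ⟨i1, i2, hsum⟩ := hφ φ hφT
    have e : EqOn (fun t => ∫ q, deriv (fun τ => φ τ q) t ∂(σ t) +
          ∫ q, ⟪AxisymmetricFlow.vel r₀ H Ω R₀ C₀
            (AxisymmetricFlow.forcing r₀ g θ₀ F S t) (σ t) q, ∇ (φ t) q⟫_ℝ ∂(σ t))
        (fun t => ∫ q, (deriv (fun τ => φ τ q) t + ⟪∇ (φ t) q, AxisymmetricFlow.vel r₀ H Ω R₀ C₀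
          (AxisymmetricFlow.forcing r₀ g θ₀ F S t) (σ t) q⟫_ℝ) ∂(σ t)) (Ioo 0 T) := fun t ht => by
      have := (hmem t (hIoo ht)).1
      obtain ⟨K, -, -, hK, -⟩ := hφT.exists_bound
      have j1 : Integrable (fun q => deriv (fun τ => φ τ q) t) (σ t) :=
        Integrable.of_bound (hderiv hφT t).aestronglyMeasurable K
          (MeasureTheory.ae_of_all _ (hK t))
      have j2 : Integrable (fun q => ⟪∇ (φ t) q, AxisymmetricFlow.vel r₀ H Ω R₀ C₀
          (AxisymmetricFlow.forcing r₀ g θ₀ F S t) (σ t) q⟫_ℝ) (σ t) := by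
        refine Integrable.mono' ((hgrad hφT t ht).norm.mul_const C₀)
          ((hgrad hφT t ht).aestronglyMeasurable.inner (hvel t ht).meas.aestronglyMeasurable) ?_
        filter_upwards [(hvel t ht).bound] with q hq
        exact (norm_inner_le_norm _ _).trans (mul_le_mul_of_nonneg_left hq (norm_nonneg _))
      simp only
      rw [integral_add j1 j2]
      simp_rw [real_inner_comm]
    refine ⟨(i1.add i2).congr_uIoo ?_, ?_⟩
    · rwa [uIoo_of_le hT.le]
    · rw [← intervalIntegral.integral_congr_Ioo_of_le hT.le e,
        intervalIntegral.integral_add i1 i2]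
      exact hsum
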